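/- Let $k\ge 3$ and $m\ge 2$ be integers and let $0<\alpha<2$. **Equations.** Put $c_\alpha=\frac{1}{2\pi}\frac{\Gamma(\alpha/2)}{2^{1-\alpha}\Gamma(1-\alpha/2)}$ and, for $2\pi$-periodic real functions $u,p,q$, $$T_1(u)(x)=c_\alpha\int_0^{2\pi}\frac{\cos(x-y)\,(u'(y)u(x)-u(y)u'(x))+\sin(x-y)\,(u(x)u(y)+u'(x)u'(y))}{(u(x)^2+u(y)^2-2u(x)u(y)\cos(x-y))^{\alpha/2}}\,dy,$$ $$T_2(p,q)(x)=c_\alpha\int_0^{2\pi}\frac{\cos(x-y)\,(p(y)q'(x)-p'(y)q(x))-\sin(x-y)\,(p(y)q(x)+p'(y)q'(x))}{(q(x)^2+p(y)^2-2q(x)p(y)\cos(x-y))^{\alpha/2}}\,dy.$$ A triple $(b,R,r)$ with $0<b+r(x)<1+R(x)$ for all $x$ is a *stationary doubly-connected patch* of the gSQG equation with parameter $\alpha$ (SQG if $\alpha=1$), with outer boundary $(1+R(x))(\cos x,\sin x)$ and inner boundary $(b+r(x))(\cos x,\sin x)$, if $$T_1(1+R)+T_2(b+r,1+R)=0,\qquad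 -T_2(1+R,b+r)-T_1(b+r)=0$$ identically in $x$ (with convergent integrals). **Spaces.** For $c>0$ and an integer $l\ge 1$, $X^{l,m}_c$ is the space of functions $f(z)=\sum_{j\ge1}a_{jm}\cos(jmz)$, with $a_{jm}\in\mathbb R$, analytic in the strip of half-width $c$ around the real axis, for which $$\|f\|_{X^l_c}^2=\sum_\pm\int_0^{2\pi}|f(x\pm ic)|^2dx+\sum_\pm\int_0^{2\pi}|\partial^l f(x\pm ic)|^2dx<\infty .$$ The space $X^{l+\beta,m}_c$ ($0<\beta<1$), respectively $X^{l+\log,m}_c$ (put $\beta=0$), consists of those $f\in X^{l,m}_c$ for which in addition $$\sum_\pm\Big\|\int_{-\pi}^{\pi}\frac{\partial^l f(x\pm ic-y)-\partial^l f(x\pm ic)}{|\sin(y/2)|^{1+\beta}}\,dy\Big\|_{L^2(x)}<\infty ,$$ and this quantity is added to the norm. (All values on the lines $\operatorname{Im} z=\pm c$ are boundary values from inside the strip.) Let $X$ denote $X^{k+1,m}_c$ if $\alpha<1$, $X^{k+1+\log,m}_c$ if $\alpha=1$, and $X^{k+\alpha,m}_c=X^{(k+1)+(\alpha-1),m}_c$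 if $\alpha>1$. **The radius $b_m^*$.** For $n\ge1$ and $0<b<1$ let $$\Lambda_n(b)=\frac{b^{n-1}}{2^{1-\alpha}\Gamma(1-\frac\alpha2)^2}\int_0^1x^{n-1+\frac\alpha2}(1-x)^{-\frac\alpha2}(1-b^2x)^{-\frac\alpha2}dx,\qquad \Theta_n=\lim_{b\to1^-}\big(\Lambda_1(b)-\Lambda_n(b)\big)=\frac{1}{2^{1-\alpha}\Gamma(1-\frac\alpha2)^2}\int_0^1\frac{x^{\frac\alpha2}-x^{n-1+\frac\alpha2}}{(1-x)^{\alpha}}dx,$$ $$\Delta_m(b)=\big(-\Theta_m+b^2\Lambda_1(b)\big)\big(b^{1-\alpha}\Theta_m-b\Lambda_1(b)\big)+b^3\Lambda_m(b)^2 .$$ **Theorem.** There is exactly one $b_m^*\in(0,1)$ with $\Delta_m(b_m^*)=0$. Moreover there are $c>0$, $\varepsilon>0$ and a family $(b(s),R_s,r_s)_{|s|<\varepsilon}$ in $(0,1)\times X\times X$, continuous in $s$ (with respect to the norm of $X$), such that 1. $(b(0),R_0,r_0)=(b_m^*,0,0)$, that is, the family bifurcates from the annulus with radii $1$ and $b_m^*$;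 2. for every $|s|<\varepsilon$, $(b(s),R_s,r_s)$ is an ($m$-fold symmetric) stationary doubly-connected patch; 3. for every $s\ne0$, $(R_s,r_s)\ne(0,0)$, so that the patch is not an annulus. -/

import Mathlib

open Set Filter Topology MeasureTheory
open scoped ENNReal

noncomputable section

namespace GSQG

/-! ### The stationary contour equations -/

/-- The normalizing constant `c_α` of the gSQG velocity. -/
def cAlpha (α : ℝ) : ℝ :=
  1 / (2 * Real.pi) *
    (Real.Gamma (α / 2) / ((2 : ℝ) ^ (1 - α) * Real.Gamma ((2 - α) / 2)))

/-- Integrand of the self-interaction `T₁(u)` at the point `x`. -/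
def t1Integrand (α : ℝ) (u : ℝ → ℝ) (x y : ℝ) : ℝ :=
  (Real.cos (x - y) * (deriv u y * u x - u y * deriv u x)
      + Real.sin (x - y) * (u x * u y + deriv u x * deriv u y))
    / (u x ^ 2 + u y ^ 2 - 2 * u x * u y * Real.cos (x - y)) ^ (α / 2)

/-- Integrand of the mutual interaction `T₂(p,q)` at the point `x`. -/
def t2Integrand (α : ℝ) (p q : ℝ → ℝ) (x y : ℝ) : ℝ :=
  (Real.cos (x - y) * (p y * deriv q x - deriv p y * q x)
      - Real.sin (x - y) * (p y * q x + deriv p y * deriv q x))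
    / (q x ^ 2 + p y ^ 2 - 2 * q x * p y * Real.cos (x - y)) ^ (α / 2)

/-- `T₁(u)(x)`. -/
def T1 (α : ℝ) (u : ℝ → ℝ) (x : ℝ) : ℝ :=
  cAlpha α * ∫ y in (0 : ℝ)..(2 * Real.pi), t1Integrand α u x y

/-- `T₂(p,q)(x)`. -/
def T2 (α : ℝ) (p q : ℝ → ℝ) (x : ℝ) : ℝ :=
  cAlpha α * ∫ y in (0 : ℝ)..(2 * Real.pi), t2Integrand α p q x y

/-- The polar radius `a + f(x)`, `x ∈ ℝ`, of a boundary curve. The perturbation `f` is given as a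
function on a complex strip which is real on the real line. -/
def radius (a : ℝ) (f : ℂ → ℂ) (x : ℝ) : ℝ := a + (f (x : ℂ)).re

/-- First component of the stationarity functional (normal velocity on the outer boundary). -/
def F1 (α b : ℝ) (R r : ℂ → ℂ) (x : ℝ) : ℝ :=
  T1 α (radius 1 R) x + T2 α (radius b r) (radius 1 R) x

/-- Second component of the stationarity functional (normal velocity on the inner boundary). -/
def F2 (α b : ℝ) (R r : ℂ → ℂ) (x : ℝ) : ℝ :=
  -T2 α (radius 1 R) (radius b r) x - T1 α (radius b r) x

/-- `(b, R, r)` is a stationary doubly-connected patch: the two polar curves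
`(1 + R(x))(cos x, sin x)` and `(b + r(x))(cos x, sin x)` bound an annular region around the
origin, all integrals in the functional converge, and both components vanish identically. -/
structure IsStationaryPatch (α b : ℝ) (R r : ℂ → ℂ) : Prop where
  inner_pos : ∀ x : ℝ, 0 < radius b r x
  inner_lt_outer : ∀ x : ℝ, radius b r x < radius 1 R x
  integrable_outer : ∀ x : ℝ,
    IntervalIntegrable (t1Integrand α (radius 1 R) x) volume 0 (2 * Real.pi) ∧
    IntervalIntegrable (t2Integrand α (radius b r) (radius 1 R) x) volume 0 (2 * Real.pi)
  integrable_inner : ∀ x : ℝ,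
    IntervalIntegrable (t2Integrand α (radius 1 R) (radius b r) x) volume 0 (2 * Real.pi) ∧
    IntervalIntegrable (t1Integrand α (radius b r) x) volume 0 (2 * Real.pi)
  outer_eq : ∀ x : ℝ, F1 α b R r x = 0
  inner_eq : ∀ x : ℝ, F2 α b R r x = 0

/-! ### Spaces of even, `m`-fold, analytic functions on a strip -/

/-- The strip `|Im z| < c`. -/
def strip (c : ℝ) : Set ℂ := {z | |z.im| < c}

/-- `L²` norm of `g` over one period of the horizontal line `Im z = s`. -/
def lineL2 (g : ℂ → ℂ) (s : ℝ) : ℝ≥0∞ :=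
  eLpNorm (fun x : ℝ => g ((x : ℂ) + (s : ℂ) * Complex.I)) 2
    (volume.restrict (Ioc 0 (2 * Real.pi)))

/-- The norm `(∑± ∫ |f(x ± ic)|² + ∑± ∫ |∂ᵏ f(x ± ic)|²)^(1/2)`. The integrals over the boundary
lines `Im z = ± c` are those of the boundary traces; for cosine series the integrals over
`Im z = ± s` increase with `s ∈ [0, c)`, so that the boundary value is their supremum. -/
def xNorm (c : ℝ) (k : ℕ) (f : ℂ → ℂ) : ℝ≥0∞ :=
  (⨆ s ∈ Ico 0 c,
    (lineL2 f s ^ 2 + lineL2 f (-s) ^ 2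
      + (lineL2 (iteratedDeriv k f) s ^ 2 + lineL2 (iteratedDeriv k f) (-s) ^ 2))) ^ (1 / 2 : ℝ)

/-- `z ↦ ∫_𝕋 (∂ᵏ f(z - y) - ∂ᵏ f(z)) / |sin (y/2)|^(1+β) dy`. -/
def singularOp (k : ℕ) (β : ℝ) (f : ℂ → ℂ) (z : ℂ) : ℂ :=
  ∫ y in (-Real.pi)..Real.pi,
    (iteratedDeriv k f (z - (y : ℂ)) - iteratedDeriv k f z)
      / ((|Real.sin (y / 2)| ^ (1 + β) : ℝ) : ℂ)

/-- The additional term in the norm of `X^{k+β}_c` for `0 < β < 1`, and of `X^{k+log}_c` for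
`β = 0`; the values on the boundary lines are again taken as suprema over the interior lines. -/
def singularNorm (c : ℝ) (k : ℕ) (β : ℝ) (f : ℂ → ℂ) : ℝ≥0∞ :=
  ⨆ s ∈ Ico 0 c, (lineL2 (singularOp k β f) s + lineL2 (singularOp k β f) (-s))

/-- `f` is analytic in the strip and `f(z) = ∑_{j ≥ 1} a_{jm} cos(jmz)` there, with real
coefficients. -/
def IsStripCosine (c : ℝ) (m : ℕ) (f : ℂ → ℂ) : Prop :=
  AnalyticOnNhd ℂ f (strip c) ∧
    ∃ a : ℕ → ℝ, ∀ z ∈ strip c,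
      HasSum (fun j : ℕ => (a (j + 1) : ℂ) * Complex.cos (((j + 1 : ℕ) : ℂ) * (m : ℂ) * z)) (f z)

/-- The norm of the perturbation space: that of `X^{k+1}_c` if `α < 1`, of `X^{k+1+log}_c` if
`α = 1`, and of `X^{k+α}_c = X^{(k+1)+(α-1)}_c` if `α > 1`. -/
def patchNorm (α c : ℝ) (k : ℕ) (f : ℂ → ℂ) : ℝ≥0∞ :=
  if α < 1 then xNorm c (k + 1) f
  else if α = 1 then xNorm c (k + 1) f + singularNorm c (k + 1) 0 f
  else xNorm c (k + 1) f + singularNorm c (k + 1) (α - 1) f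

/-- Membership in `X^{k+1,m}_c` if `α < 1`, in `X^{k+1+log,m}_c` if `α = 1`, and in
`X^{k+α,m}_c` if `α > 1`. -/
def MemPatchSpace (α c : ℝ) (k m : ℕ) (f : ℂ → ℂ) : Prop :=
  IsStripCosine c m f ∧ patchNorm α c k f < ⊤

/-! ### The linearization at the annulus and its determinant -/

/-- `Λ_n(b)`, for `n ≥ 1` and `0 < b < 1`. -/
def Lam (α : ℝ) (n : ℕ) (b : ℝ) : ℝ :=
  b ^ (n - 1) / ((2 : ℝ) ^ (1 - α) * Real.Gamma (1 - α / 2) ^ 2) *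
    ∫ x in (0 : ℝ)..1,
      x ^ ((n : ℝ) - 1 + α / 2) * (1 - x) ^ (-(α / 2)) * (1 - b ^ 2 * x) ^ (-(α / 2))

/-- `Θ_n = Λ_1(1) - Λ_n(1)`, for `n ≥ 1`. Both terms are infinite if `α ≥ 1`, so the difference is
taken under the integral sign, which gives `lim_{b → 1⁻} (Λ_1(b) - Λ_n(b))` for all
`0 < α < 2`. -/
def Theta (α : ℝ) (n : ℕ) : ℝ :=
  1 / ((2 : ℝ) ^ (1 - α) * Real.Gamma (1 - α / 2) ^ 2) *
    ∫ x in (0 : ℝ)..1, (x ^ (α / 2) - x ^ ((n : ℝ) - 1 + α / 2)) * (1 - x) ^ (-α)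

/-- The matrix `M_n^α(b)`: up to the factor `-n`, the linearization of `(F1, F2)` at the annulus
with radii `1` and `b`, on the `n`-th Fourier mode. -/
def M (α : ℝ) (n : ℕ) (b : ℝ) : Matrix (Fin 2) (Fin 2) ℝ :=
  !![-Theta α n + b ^ 2 * Lam α 1 b, -(b ^ 2 * Lam α n b);
     b * Lam α n b, b ^ (1 - α) * Theta α n - b * Lam α 1 b]

/-- `Δ_n^α(b) = det M_n^α(b)`. -/
def Delta (α : ℝ) (n : ℕ) (b : ℝ) : ℝ := (M α n b).det

end GSQG

end

/-!
Both contour equations are instances of one velocity integral: with `θ = x - y`, the normal velocity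
at the point of polar angle `x` of a curve with radius `f`, induced by a curve with radius `g`, is an
integral in `θ` of `velKer`, so that the unknown functional is a difference of a self-interaction and
a mutual interaction on each curve. The annuli are trivial zeros for every inner radius `b`, and a
nontrivial branch is obtained by bifurcation from a simple eigenvalue (Crandall–Rabinowitz,
`exists_bifurcation_branch`).

*Scalar part.* The numbers `b Λ_n(b)` are the Fourier coefficients of `|1 - b e^{iθ}|^(-α)`
(`mul_Lam_eq`), and letting `b → 1` shows that `Θ_n` is the difference of the first and the `n`-th
coefficient of the singular kernel `|2 sin (θ/2)|^(-α)` (`Theta_eq`). After symmetrization, `Δ_n(b) = 0`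
says that `Θ_n` is an eigenvalue of the `2 × 2` symmetric matrix with entries `outerShear`,
`innerShear` and `coupling`. Its smaller eigenvalue always stays below `Θ_n` (`quadForm_test_pos`, by a
test vector and the bound `rpow_mul_Lam_sub_le`), and its larger one increases with `b`. Thus there is
exactly one root, it is simple, and at this root the determinants of the modes `2m, 3m, …` are of the
size `Θ_n²`, because `Θ_n` increases with `n`, while the entries of the symmetric matrix do not.

*Function spaces.* The perturbations and the values of the functional are taken in weighted `ℓ¹` spaces
of cosine and sine coefficients, all of them realized as `ℓ¹` with normalized unit vectors. The
weight of the mode `n = m(k+1)` is `2^(k+1)` for the values, and in addition a multiple of `n Θ_n` for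
the perturbations: exactly the size of the linearization, so that the latter is an isomorphism between
the modes `k ≥ 1`. The weight `2^(k+1)` makes all functions analytic in a strip. The functional
`patchMap` is built from bounded multilinear operations and binomial powers in the Banach algebra `Four`
of Fourier series in `x` and `θ`, and is therefore smooth without any estimate of derivatives. The
singularity of the self-interaction is handled by writing the kernel as
`|2 sin (θ/2)|^(-α)` times a power of a divided difference, and by a cancellation in the numerator
(`numer_self`) that makes one factor of each product vanish at `θ = 0`; the integral of
`|e^{ilθ} - 1| |2 sin (θ/2)|^(-α)` is bounded by a multiple of `Θ_n` (`exists_expDiff_bound`), which is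
compensated by the weight.

*Conclusion.* The linearization at an annulus is block diagonal with blocks proportional to `M_n(b)`
(`fderiv_patchMap_coord`, by integration by parts), so that the scalar part gives the bordered
isomorphism (`borderedMap_injective`, `borderedMap_surjective`). Cauchy estimates on a strip of half
the width bound the norm of the perturbation space by the `ℓ¹` norm (`exists_patchNorm_le`).
-/

noncomputable section

namespace GSQG

/-! ### Absolutely summable sequences -/

/-- The real Banach space `ℓ¹(ι)`. -/
abbrev Ell (ι : Type*) : Type _ := lp (fun _ : ι => ℝ) 1

section Lift

variable {ι : Type*} {E G : Type*} [NormedAddCommGroup E] [NormedSpace ℝ E]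
  [NormedAddCommGroup G] [NormedSpace ℝ G]

theorem Ell.hasSum_norm (x : Ell ι) : HasSum (fun i => |x i|) ‖x‖ := by
  simpa using lp.hasSum_norm (p := 1) (by simp) x

/-- The `i`-th unit vector of `ℓ¹(ι)`. -/
def Ell.basis [DecidableEq ι] (i : ι) : Ell ι := lp.single 1 i (1 : ℝ)

theorem Ell.norm_basis [DecidableEq ι] (i : ι) : ‖(Ell.basis i : Ell ι)‖ = 1 := by
  simp [Ell.basis]

theorem Ell.hasSum_basis [DecidableEq ι] (x : Ell ι) :
    HasSum (fun i => x i • (Ell.basis i : Ell ι)) x := by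
  have := lp.hasSum_single (E := fun _ : ι => ℝ) (p := 1) (by simp) x
  convert this using 2 with i
  rw [Ell.basis, ← lp.single_smul]
  simp

theorem Ell.basis_apply [DecidableEq ι] (i j : ι) :
    (Ell.basis i : Ell ι) j = if j = i then 1 else 0 := by
  rw [Ell.basis, lp.single_apply]
  split_ifs with h
  · subst h; simp
  · simp [h]

variable [CompleteSpace E]

theorem Ell.summable_smul {v : ι → E} {C : ℝ} (hv : ∀ i, ‖v i‖ ≤ C) (x : Ell ι) :
    Summable (fun i => x i • v i) := by
  refine Summable.of_norm_bounded (g := fun i => |x i| * C) ((Ell.hasSum_norm x).summable.mul_right C) ?_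
  intro i
  rw [norm_smul, Real.norm_eq_abs]
  exact mul_le_mul_of_nonneg_left (hv i) (abs_nonneg _)

open Classical in
/-- The continuous linear map on `ℓ¹(ι)` with prescribed bounded values on the unit vectors
(and `0` if the prescribed values are unbounded). -/
def Ell.lift (v : ι → E) : Ell ι →L[ℝ] E :=
  if h : ∃ C, ∀ i, ‖v i‖ ≤ C then
    LinearMap.mkContinuous
      { toFun := fun x => ∑' i, x i • v i
        map_add' := fun x y => by
          obtain ⟨C, hC⟩ := h
          rw [← (Ell.summable_smul hC x).tsum_add (Ell.summable_smul hC y)]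
          refine tsum_congr fun i => ?_
          rw [lp.coeFn_add, Pi.add_apply, add_smul]
        map_smul' := fun c x => by
          obtain ⟨C, hC⟩ := h
          rw [RingHom.id_apply, ← (Ell.summable_smul hC x).tsum_const_smul c]
          refine tsum_congr fun i => ?_
          rw [lp.coeFn_smul, Pi.smul_apply, smul_assoc] }
      h.choose
      (fun x => by
        have hC := h.choose_spec
        set C := h.choose
        have h1 : Summable (fun i => |x i| * C) := (Ell.hasSum_norm x).summable.mul_right C
        refine (tsum_of_norm_bounded h1.hasSum fun i => ?_).trans (le_of_eq ?_)
        · rw [norm_smul, Real.norm_eq_abs]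
          exact mul_le_mul_of_nonneg_left (hC i) (abs_nonneg _)
        · rw [tsum_mul_right, (Ell.hasSum_norm x).tsum_eq, mul_comm])
  else 0

theorem Ell.lift_apply {v : ι → E} {C : ℝ} (hv : ∀ i, ‖v i‖ ≤ C) (x : Ell ι) :
    Ell.lift v x = ∑' i, x i • v i := by
  have h : ∃ C, ∀ i, ‖v i‖ ≤ C := ⟨C, hv⟩
  rw [Ell.lift, dif_pos h]
  rfl

theorem Ell.hasSum_lift {v : ι → E} {C : ℝ} (hv : ∀ i, ‖v i‖ ≤ C) (x : Ell ι) :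
    HasSum (fun i => x i • v i) (Ell.lift v x) := by
  rw [Ell.lift_apply hv]
  exact (Ell.summable_smul hv x).hasSum

theorem Ell.norm_lift_apply_le {v : ι → E} {C : ℝ} (hv : ∀ i, ‖v i‖ ≤ C) (x : Ell ι) :
    ‖Ell.lift v x‖ ≤ C * ‖x‖ := by
  rw [Ell.lift_apply hv]
  have h1 : Summable (fun i => |x i| * C) := (Ell.hasSum_norm x).summable.mul_right C
  refine (tsum_of_norm_bounded h1.hasSum fun i => ?_).trans (le_of_eq ?_)
  · rw [norm_smul, Real.norm_eq_abs]
    exact mul_le_mul_of_nonneg_left (hv i) (abs_nonneg _)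
  · rw [tsum_mul_right, (Ell.hasSum_norm x).tsum_eq, mul_comm]

theorem Ell.norm_lift_le {v : ι → E} {C : ℝ} (hC : 0 ≤ C) (hv : ∀ i, ‖v i‖ ≤ C) :
    ‖Ell.lift v‖ ≤ C :=
  ContinuousLinearMap.opNorm_le_bound _ hC (Ell.norm_lift_apply_le hv)

theorem Ell.lift_basis [DecidableEq ι] {v : ι → E} {C : ℝ} (hv : ∀ i, ‖v i‖ ≤ C) (i : ι) :
    Ell.lift v (Ell.basis i) = v i := by
  rw [Ell.lift_apply hv, tsum_eq_single i]
  · simp [Ell.basis_apply]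
  · intro j hj
    simp [Ell.basis_apply, hj]

omit [CompleteSpace E] in
/-- A continuous linear map on `ℓ¹(ι)` is determined by its values on the unit vectors. -/
theorem Ell.ext_basis [DecidableEq ι] {S T : Ell ι →L[ℝ] E}
    (h : ∀ i, S (Ell.basis i) = T (Ell.basis i)) : S = T := by
  ext x
  have h1 := (Ell.hasSum_basis x).mapL S
  have h2 := (Ell.hasSum_basis x).mapL T
  refine h1.unique ?_
  convert h2 using 2 with i
  simp [h]

/-- A sequence with absolutely summable terms, as an element of `ℓ¹(ι)`. -/
def Ell.mk (f : ι → ℝ) (hf : Summable fun i => |f i|) : Ell ι :=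
  ⟨f, by
    refine memℓp_gen ?_
    simpa using hf⟩

@[simp] theorem Ell.mk_apply (f : ι → ℝ) (hf : Summable fun i => |f i|) (i : ι) :
    Ell.mk f hf i = f i := rfl

end Lift

/-! ### The algebra of double Fourier series -/

/-- The weight `2^|n|`. -/
def wt (n : ℤ) : ℝ := 2 ^ n.natAbs

theorem wt_pos (n : ℤ) : 0 < wt n := by unfold wt; positivity

theorem one_le_wt (n : ℤ) : 1 ≤ wt n := one_le_pow₀ (by norm_num)

theorem wt_add_le (n k : ℤ) : wt (n + k) ≤ wt n * wt k := by
  unfold wt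
  rw [← pow_add]
  exact pow_le_pow_right₀ (by norm_num) (Int.natAbs_add_le n k)

/-- The Banach algebra of double Fourier series `∑ h_{n,j} e^{inξ} e^{ijθ}` with real coefficients
and norm `∑ |h_{n,j}| 2^|n|`. It is encoded as `ℓ¹(ℤ × ℤ)`: the unit vector with index `(n, j)`
stands for the normalized monomial `2^(-|n|) e^{inξ} e^{ijθ}`. -/
def Four : Type := Ell (ℤ × ℤ)

instance : NormedAddCommGroup Four := inferInstanceAs (NormedAddCommGroup (Ell (ℤ × ℤ)))
instance : NormedSpace ℝ Four := inferInstanceAs (NormedSpace ℝ (Ell (ℤ × ℤ)))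
instance : CompleteSpace Four := inferInstanceAs (CompleteSpace (Ell (ℤ × ℤ)))

namespace Four

/-- The normalized monomials. -/
def e (i : ℤ × ℤ) : Four := Ell.basis i

theorem norm_e (i : ℤ × ℤ) : ‖e i‖ = 1 := Ell.norm_basis i

/-- `Ell.lift` on the algebra of double Fourier series. -/
def lift {E : Type*} [NormedAddCommGroup E] [NormedSpace ℝ E] [CompleteSpace E]
    (v : ℤ × ℤ → E) : Four →L[ℝ] E := Ell.lift v

section
variable {E : Type*} [NormedAddCommGroup E] [NormedSpace ℝ E]

theorem ext_e {S T : Four →L[ℝ] E} (h : ∀ i, S (e i) = T (e i)) : S = T :=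
  Ell.ext_basis h

variable [CompleteSpace E]

theorem lift_e {v : ℤ × ℤ → E} {C : ℝ} (hv : ∀ i, ‖v i‖ ≤ C) (i : ℤ × ℤ) :
    lift v (e i) = v i := Ell.lift_basis hv i

theorem norm_lift_le {v : ℤ × ℤ → E} {C : ℝ} (hC : 0 ≤ C) (hv : ∀ i, ‖v i‖ ≤ C) :
    ‖lift v‖ ≤ C := Ell.norm_lift_le hC hv

end

/-- The factor in the product of two normalized monomials. -/
def twist (i j : ℤ × ℤ) : ℝ := wt (i.1 + j.1) / (wt i.1 * wt j.1)

theorem norm_twist_smul_e (i j : ℤ × ℤ) : ‖twist i j • e (i + j)‖ ≤ 1 := by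
  have h1 := wt_pos i.1
  have h2 := wt_pos j.1
  have h3 := wt_pos (i.1 + j.1)
  rw [norm_smul, norm_e, mul_one, twist, Real.norm_of_nonneg (by positivity),
    div_le_one (by positivity)]
  exact wt_add_le _ _

theorem norm_lift_twist (i : ℤ × ℤ) : ‖lift (fun j => twist i j • e (i + j))‖ ≤ 1 :=
  norm_lift_le zero_le_one (norm_twist_smul_e i)

/-- The product of double Fourier series as a continuous bilinear map. -/
def mulB : Four →L[ℝ] Four →L[ℝ] Four :=
  lift fun i => lift fun j => twist i j • e (i + j)

theorem mulB_e (i j : ℤ × ℤ) : mulB (e i) (e j) = twist i j • e (i + j) := by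
  rw [mulB, lift_e norm_lift_twist, lift_e (norm_twist_smul_e i)]

theorem norm_mulB_le : ‖mulB‖ ≤ 1 := norm_lift_le zero_le_one norm_lift_twist

theorem mulB_comm (f g : Four) : mulB f g = mulB g f := by
  have : mulB = mulB.flip := by
    refine ext_e fun i => ext_e fun j => ?_
    simp only [mulB_e, ContinuousLinearMap.flip_apply, twist, add_comm i j, add_comm i.1 j.1,
      mul_comm (wt i.1)]
  conv_lhs => rw [this]
  rfl

theorem mulB_assoc (f g h : Four) : mulB (mulB f g) h = mulB f (mulB g h) := by
  let S : Four →L[ℝ] Four →L[ℝ] Four →L[ℝ] Four :=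
    (ContinuousLinearMap.compL ℝ Four Four (Four →L[ℝ] Four) mulB).comp mulB
  let T : Four →L[ℝ] Four →L[ℝ] Four →L[ℝ] Four :=
    ((ContinuousLinearMap.compL ℝ Four (Four →L[ℝ] Four) (Four →L[ℝ] Four)).flip mulB).comp
      ((ContinuousLinearMap.compL ℝ Four Four Four).comp mulB)
  have hST : S = T := by
    refine ext_e fun i => ext_e fun j => ext_e fun k => ?_
    have h1 := wt_pos i.1
    have h2 := wt_pos j.1
    have h3 := wt_pos k.1
    have h4 := wt_pos (i.1 + j.1)
    have h5 := wt_pos (j.1 + k.1)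
    change mulB (mulB (e i) (e j)) (e k) = mulB (e i) (mulB (e j) (e k))
    rw [mulB_e, mulB_e, map_smul, map_smul, smul_apply, mulB_e, mulB_e,
      smul_smul, smul_smul, add_assoc]
    congr 1
    simp only [twist, Prod.fst_add, add_assoc]
    field_simp
  exact congrArg (fun X : Four →L[ℝ] Four →L[ℝ] Four →L[ℝ] Four => X f g h) hST

theorem mulB_e_zero (f : Four) : mulB (e 0) f = f := by
  have : mulB (e 0) = ContinuousLinearMap.id ℝ Four := by
    refine ext_e fun j => ?_
    have := (wt_pos j.1).ne'
    rw [mulB_e, zero_add]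
    simp [twist, wt]
  rw [this]; rfl

instance : NormedCommRing Four :=
  { (inferInstance : NormedAddCommGroup Four) with
    mul := fun f g => mulB f g
    one := e 0
    left_distrib := fun f g h => (mulB f).map_add g h
    right_distrib := fun f g h => by
      change mulB (f + g) h = mulB f h + mulB g h
      rw [map_add]; rfl
    zero_mul := fun f => by change mulB 0 f = 0; simp
    mul_zero := fun f => by change mulB f 0 = 0; simp
    mul_assoc := mulB_assoc
    one_mul := mulB_e_zero
    mul_one := fun f => (mulB_comm f (e 0)).trans (mulB_e_zero f)
    mul_comm := mulB_comm
    norm_mul_le := fun f g => by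
      refine (mulB.le_opNorm₂ f g).trans ?_
      gcongr
      exact mul_le_of_le_one_left (norm_nonneg _) norm_mulB_le }

theorem one_def : (1 : Four) = e 0 := rfl

instance : NormOneClass Four := ⟨norm_e 0⟩

instance : NormedAlgebra ℝ Four :=
  { Algebra.ofModule (R := ℝ) (A := Four)
      (fun r f g => by
        change mulB (r • f) g = r • mulB f g
        rw [map_smul]; rfl)
      (fun r f g => (mulB f).map_smul r g) with
    norm_smul_le := fun r f => norm_smul_le r f }

/-- The monomial `e^{ijθ}`. -/
def t (j : ℤ) : Four := e (0, j)

theorem norm_t (j : ℤ) : ‖t j‖ = 1 := norm_e _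

end Four

section Eval
open Four

/-- The value of the normalized monomial with index `(n, j)` at the point `(mx, θ)`. -/
def monoVal (m : ℕ) (x θ : ℝ) (i : ℤ × ℤ) : ℂ :=
  ((wt i.1)⁻¹ : ℝ) * Complex.exp (((i.1 * m * x + i.2 * θ : ℝ) : ℂ) * Complex.I)

theorem norm_monoVal (m : ℕ) (x θ : ℝ) (i : ℤ × ℤ) : ‖monoVal m x θ i‖ = (wt i.1)⁻¹ := by
  have := wt_pos i.1
  rw [monoVal, norm_mul, Complex.norm_exp_ofReal_mul_I, mul_one, Complex.norm_real,
    Real.norm_of_nonneg (by positivity)]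

theorem norm_monoVal_le (m : ℕ) (x θ : ℝ) (i : ℤ × ℤ) : ‖monoVal m x θ i‖ ≤ 1 := by
  rw [norm_monoVal]
  exact inv_le_one_of_one_le₀ (one_le_wt _)

/-- The value of a double Fourier series at `(mx, θ)`. -/
def eval (m : ℕ) (x θ : ℝ) : Four →L[ℝ] ℂ := Four.lift (monoVal m x θ)

theorem eval_e (m : ℕ) (x θ : ℝ) (i : ℤ × ℤ) : eval m x θ (e i) = monoVal m x θ i :=
  lift_e (norm_monoVal_le m x θ) i

theorem norm_eval_le (m : ℕ) (x θ : ℝ) (h : Four) : ‖eval m x θ h‖ ≤ ‖h‖ := by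
  have := Ell.norm_lift_apply_le (norm_monoVal_le m x θ) h
  rwa [one_mul] at this

theorem eval_mul (m : ℕ) (x θ : ℝ) (f g : Four) :
    eval m x θ (f * g) = eval m x θ f * eval m x θ g := by
  let S : Four →L[ℝ] Four →L[ℝ] ℂ := (ContinuousLinearMap.compL ℝ Four Four ℂ (eval m x θ)).comp mulB
  let T : Four →L[ℝ] Four →L[ℝ] ℂ :=
    ((ContinuousLinearMap.mul ℝ ℂ).bilinearComp (eval m x θ) (eval m x θ))
  have hST : S = T := by
    refine ext_e fun i => ext_e fun j => ?_
    change eval m x θ (mulB (e i) (e j)) = eval m x θ (e i) * eval m x θ (e j)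
    rw [mulB_e, map_smul, eval_e, eval_e, eval_e, monoVal, monoVal, monoVal]
    have h1 : (wt i.1 : ℂ) ≠ 0 := by exact_mod_cast (wt_pos i.1).ne'
    have h2 : (wt j.1 : ℂ) ≠ 0 := by exact_mod_cast (wt_pos j.1).ne'
    have h3 : (wt (i.1 + j.1) : ℂ) ≠ 0 := by exact_mod_cast (wt_pos (i.1 + j.1)).ne'
    rw [mul_mul_mul_comm, ← Complex.exp_add, Complex.real_smul, ← mul_assoc]
    congr 1
    · simp only [twist, Prod.fst_add]
      push_cast
      field_simp
    · congr 1
      simp only [Prod.fst_add, Prod.snd_add]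
      push_cast
      ring
  exact congrArg (fun X : Four →L[ℝ] Four →L[ℝ] ℂ => X f g) hST

theorem eval_t (m : ℕ) (x θ : ℝ) (j : ℤ) :
    eval m x θ (t j) = Complex.exp ((j * θ : ℝ) * Complex.I) := by
  rw [t, eval_e, monoVal]
  simp [wt]

theorem eval_one (m : ℕ) (x θ : ℝ) : eval m x θ 1 = 1 := by
  rw [one_def, eval_e, monoVal]
  simp [wt]

theorem eval_pow (m : ℕ) (x θ : ℝ) (f : Four) (n : ℕ) :
    eval m x θ (f ^ n) = eval m x θ f ^ n := by
  induction n with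
  | zero => simp [eval_one]
  | succ n ih => rw [pow_succ, pow_succ, eval_mul, ih]

theorem continuous_eval (m : ℕ) (x : ℝ) (h : Four) : Continuous fun θ => eval m x θ h := by
  have : (fun θ => eval m x θ h) = fun θ => ∑' i, (show Ell (ℤ × ℤ) from h) i • monoVal m x θ i := by
    funext θ
    exact Ell.lift_apply (norm_monoVal_le m x θ) h
  rw [this]
  refine continuous_tsum (u := fun i => |(show Ell (ℤ × ℤ) from h) i|) ?_ (Ell.hasSum_norm h).summable ?_
  · intro i
    simp only [monoVal]
    fun_prop
  · intro i θ
    rw [norm_smul, Real.norm_eq_abs]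
    exact mul_le_of_le_one_right (abs_nonneg _) (norm_monoVal_le m x θ i)

end Eval

/-! ### Binomial powers in the algebra -/

section Pw

/-- The power `(1 + z)^s` for `‖z‖ < 1`, defined by the binomial series. -/
def pw (s : ℝ) (z : Four) : Four := (binomialSeries Four s).sum z

theorem one_le_radius_binomialSeries (s : ℝ) : 1 ≤ (binomialSeries Four s).radius := by
  refine (binomialSeries_radius_ge_one (𝕂 := ℝ) (𝔸 := ℝ) (a := s)).trans ?_
  refine FormalMultilinearSeries.radius_le_of_le fun n => ?_
  rw [binomialSeries, binomialSeries, FormalMultilinearSeries.ofScalars_norm,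
    FormalMultilinearSeries.ofScalars_norm]

theorem hasFPowerSeriesOnBall_pw (s : ℝ) :
    HasFPowerSeriesOnBall (pw s) (binomialSeries Four s) 0 (binomialSeries Four s).radius :=
  (binomialSeries Four s).hasFPowerSeriesOnBall (zero_lt_one.trans_le (one_le_radius_binomialSeries s))

theorem mem_eball_of_norm_lt_one {s : ℝ} {z : Four} (hz : ‖z‖ < 1) :
    z ∈ Metric.eball (0 : Four) (binomialSeries Four s).radius := by
  refine Metric.eball_subset_eball (one_le_radius_binomialSeries s) ?_
  rw [← ENNReal.ofReal_one, Metric.eball_ofReal]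
  simpa using hz

theorem contDiffAt_pw (s : ℝ) {z : Four} (hz : ‖z‖ < 1) {n : WithTop ℕ∞} : ContDiffAt ℝ n (pw s) z :=
  ((hasFPowerSeriesOnBall_pw s).analyticAt_of_mem (mem_eball_of_norm_lt_one hz)).contDiffAt

theorem eval_pw (s : ℝ) {z : Four} (hz : ‖z‖ < 1) (m : ℕ) (x θ : ℝ) :
    eval m x θ (pw s z) = (1 + eval m x θ z) ^ (s : ℂ) := by
  have h1 := ((hasFPowerSeriesOnBall_pw s).hasSum (mem_eball_of_norm_lt_one hz)).mapL (eval m x θ)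
  have hz' : ‖eval m x θ z‖ < 1 := (norm_eval_le m x θ z).trans_lt hz
  have h2 := (Complex.one_add_cpow_hasFPowerSeriesOnBall_zero (a := (s : ℂ))).hasSum
    (y := eval m x θ z) (by
      rw [← ENNReal.ofReal_one, Metric.eball_ofReal]
      simpa using hz')
  rw [zero_add] at h1 h2
  have h3 : (fun n => eval m x θ (binomialSeries Four s n fun _ => z))
      = fun n => binomialSeries ℂ (s : ℂ) n fun _ => eval m x θ z := by
    funext n
    rw [binomialSeries_apply, binomialSeries_apply, map_smul, List.ofFn_const, List.prod_replicate,
      List.ofFn_const, List.prod_replicate, eval_pow, ← Complex.ofReal_choose, Complex.real_smul,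
      smul_eq_mul]
  rw [h3] at h1
  exact h1.unique h2

end Pw

/-! ### Bifurcation from a simple eigenvalue -/

section SimpleEigenvalue

variable {X Y : Type*} [NormedAddCommGroup X] [NormedSpace ℝ X]
  [NormedAddCommGroup Y] [NormedSpace ℝ Y]

/-- A family of uniformly contracting maps `z ↦ z - L⁻¹ (G s z)` has zeros of `G s` that depend
continuously on `s`. -/
theorem exists_continuous_zeros {Z W : Type*} [NormedAddCommGroup Z] [NormedSpace ℝ Z]
    [CompleteSpace Z] [NormedAddCommGroup W] [NormedSpace ℝ W] (G : ℝ → Z → W) (z₀ : Z)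
    (L : Z ≃L[ℝ] W) (h0 : G 0 z₀ = 0)
    (hL : ∀ η > 0, ∃ δ > 0, ∀ s, |s| < δ → ∀ z ∈ Metric.closedBall z₀ δ,
      ∀ z' ∈ Metric.closedBall z₀ δ, ‖G s z - G s z' - L (z - z')‖ ≤ η * ‖z - z'‖)
    (hc : ∃ δ > 0, ∀ s, |s| < δ → ∀ z ∈ Metric.closedBall z₀ δ,
      ContinuousAt (fun s => G s z) s) (ρ : ℝ) (hρ : 0 < ρ) :
    ∃ ε > 0, ∃ z : ℝ → Z, z 0 = z₀ ∧ ContinuousOn z (Ioo (-ε) ε) ∧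
      ∀ s ∈ Ioo (-ε) ε, ‖z s - z₀‖ ≤ ρ ∧ G s (z s) = 0 := by
  set T : W →L[ℝ] Z := (L.symm : W →L[ℝ] Z) with hT
  set K : ℝ := ‖T‖ + 1 with hK
  have hK0 : 0 < K := by positivity
  have hTK : ∀ w, ‖T w‖ ≤ K * ‖w‖ := fun w =>
    (T.le_opNorm w).trans (by gcongr; linarith)
  obtain ⟨δ₁, hδ₁, hL⟩ := hL (1 / (2 * K)) (by positivity)
  obtain ⟨δ₂, hδ₂, hc⟩ := hc
  set δ : ℝ := min ρ (min δ₁ δ₂) with hδ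
  have hδ0 : 0 < δ := by positivity
  have hδ1 : δ ≤ δ₁ := (min_le_right _ _).trans (min_le_left _ _)
  have hδ2 : δ ≤ δ₂ := (min_le_right _ _).trans (min_le_right _ _)
  have hδρ : δ ≤ ρ := min_le_left _ _
  set Φ : ℝ → Z → Z := fun s z => z - T (G s z) with hΦ
  have hcontr : ∀ s, |s| < δ → ∀ z ∈ Metric.closedBall z₀ δ, ∀ z' ∈ Metric.closedBall z₀ δ,
      ‖Φ s z - Φ s z'‖ ≤ 1 / 2 * ‖z - z'‖ := by
    intro s hs z hz z' hz'
    have h1 : Φ s z - Φ s z' = - T (G s z - G s z' - L (z - z')) := by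
      simp only [hΦ, hT, map_sub, ContinuousLinearEquiv.coe_coe,
        ContinuousLinearEquiv.symm_apply_apply]
      abel
    rw [h1, norm_neg]
    refine (hTK _).trans ?_
    have h2 := hL s (hs.trans_le hδ1) z (Metric.closedBall_subset_closedBall hδ1 hz) z'
      (Metric.closedBall_subset_closedBall hδ1 hz')
    calc K * ‖G s z - G s z' - L (z - z')‖ ≤ K * (1 / (2 * K) * ‖z - z'‖) := by gcongr
      _ = 1 / 2 * ‖z - z'‖ := by field_simp
  have hz₀ : z₀ ∈ Metric.closedBall z₀ δ := Metric.mem_closedBall_self hδ0.le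
  have hsmall : ∀ᶠ s in 𝓝 (0 : ℝ), ‖T (G s z₀)‖ < δ / 2 := by
    have h1 : ContinuousAt (fun s => ‖T (G s z₀)‖) 0 :=
      (T.continuous.continuousAt.comp (hc 0 (by simpa using hδ₂) z₀
        (Metric.mem_closedBall_self hδ₂.le))).norm
    refine h1.eventually_lt continuousAt_const ?_
    simp [h0, hδ0]
  obtain ⟨ε₁, hε₁, hsmall⟩ := Metric.eventually_nhds_iff.1 hsmall
  set ε : ℝ := min δ ε₁ with hε
  have hε0 : 0 < ε := by positivity
  have key : ∀ s ∈ Ioo (-ε) ε, ∃ z ∈ Metric.closedBall z₀ δ, Φ s z = z := by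
    intro s hs
    have hsε : |s| < ε := abs_lt.2 hs
    have hsδ : |s| < δ := hsε.trans_le (min_le_left _ _)
    have hmaps : MapsTo (Φ s) (Metric.closedBall z₀ δ) (Metric.closedBall z₀ δ) := by
      intro z hz
      rw [mem_closedBall_iff_norm] at hz ⊢
      have h1 := hcontr s hsδ z (mem_closedBall_iff_norm.2 hz) z₀ hz₀
      have h2 : ‖Φ s z₀ - z₀‖ < δ / 2 := by
        have := hsmall (y := s) (by
          rw [Real.dist_eq, sub_zero]; exact hsε.trans_le (min_le_right _ _))
        simpa [hΦ] using this
      calc ‖Φ s z - z₀‖ = ‖(Φ s z - Φ s z₀) + (Φ s z₀ - z₀)‖ := by congr 1; abel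
        _ ≤ ‖Φ s z - Φ s z₀‖ + ‖Φ s z₀ - z₀‖ := norm_add_le _ _
        _ ≤ 1 / 2 * δ + δ / 2 := by
            refine add_le_add (h1.trans ?_) h2.le
            gcongr
        _ = δ := by ring
    have hcw : ContractingWith (1 / 2) (hmaps.restrict (Φ s) _ _) := by
      refine ⟨by norm_num, LipschitzWith.of_dist_le_mul fun a b => ?_⟩
      have := hcontr s hsδ a a.2 b b.2
      simpa [Subtype.dist_eq, dist_eq_norm] using this
    obtain ⟨z, hz, hfix, -⟩ := hcw.exists_fixedPoint' (Metric.isClosed_closedBall.isComplete)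
      hmaps hz₀ (edist_ne_top _ _)
    exact ⟨z, hz, hfix⟩
  choose! z hz hfix using key
  have hG0 : ∀ s ∈ Ioo (-ε) ε, G s (z s) = 0 := by
    intro s hs
    have h1 := hfix s hs
    simp only [hΦ, sub_eq_self] at h1
    have h2 := congrArg L h1
    simpa [hT] using h2
  have hbound : ∀ s ∈ Ioo (-ε) ε, ∀ y ∈ Metric.closedBall z₀ δ,
      ‖z s - y‖ ≤ 2 * K * ‖G s y‖ := by
    intro s hs y hy
    have hsδ : |s| < δ := (abs_lt.2 hs).trans_le (min_le_left _ _)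
    have h1 := hcontr s hsδ (z s) (hz s hs) y hy
    have h2 : ‖z s - y‖ ≤ ‖Φ s (z s) - Φ s y‖ + ‖T (G s y)‖ := by
      have : z s - y = (Φ s (z s) - Φ s y) - T (G s y) := by
        rw [hfix s hs]; simp only [hΦ]; abel
      rw [this]
      exact norm_sub_le _ _
    have h3 := hTK (G s y)
    linarith
  have h0ε : (0 : ℝ) ∈ Ioo (-ε) ε := ⟨by linarith, hε0⟩
  refine ⟨ε, hε0, z, ?_, ?_, ?_⟩
  · have := hbound 0 h0ε z₀ hz₀
    rw [h0, norm_zero, mul_zero] at this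
    exact sub_eq_zero.1 (norm_le_zero_iff.1 this)
  · intro t ht
    refine ContinuousAt.continuousWithinAt ?_
    have htδ : |t| < δ₂ := ((abs_lt.2 ht).trans_le (min_le_left _ _)).trans_le hδ2
    have h1 : ContinuousAt (fun s => 2 * K * ‖G s (z t)‖) t :=
      ((hc t htδ (z t) (Metric.closedBall_subset_closedBall hδ2 (hz t ht))).norm).const_mul _
    rw [ContinuousAt, tendsto_iff_norm_sub_tendsto_zero]
    refine squeeze_zero' (Eventually.of_forall fun _ => norm_nonneg _)
      (Filter.mem_of_superset (Ioo_mem_nhds ht.1 ht.2) fun s hs => hbound s hs (z t) (hz t ht)) ?_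
    have h2 := h1.tendsto
    rwa [hG0 t ht, norm_zero, mul_zero] at h2
  · intro s hs
    exact ⟨(mem_closedBall_iff_norm.1 (hz s hs)).trans hδρ, hG0 s hs⟩

/-- The bifurcation equation rescaled by the amplitude `s`, together with the normalization `ℓ`. -/
def rescaled (F : ℝ × X → Y) (v : X) (ℓ : X →L[ℝ] ℝ) (s : ℝ) (z : ℝ × X) : Y × ℝ :=
  (if s = 0 then fderiv ℝ F (z.1, 0) (0, v + z.2) else s⁻¹ • F (z.1, s • (v + z.2)), ℓ z.2)

/-- For fixed `z`, the rescaled equation is continuous in the amplitude, also at `s = 0`, where it is the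
directional derivative. -/
theorem continuousAt_rescaled (F : ℝ × X → Y) (b₀ : ℝ) (v : X) (ℓ : X →L[ℝ] ℝ)
    (hF : ContDiffAt ℝ 2 F (b₀, 0)) (h0 : ∀ᶠ b in 𝓝 b₀, F (b, 0) = 0) :
    ∃ δ > 0, ∀ s, |s| < δ → ∀ z ∈ Metric.closedBall ((b₀, 0) : ℝ × X) δ,
      ContinuousAt (fun s => rescaled F v ℓ s z) s := by
  obtain ⟨δ₁, hδ₁, hd⟩ := Metric.eventually_nhds_iff.1
    ((hF.eventually (by norm_num)).mono fun p hp => hp.differentiableAt (by norm_num))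
  obtain ⟨δ₂, hδ₂, h0⟩ := Metric.eventually_nhds_iff.1 h0
  set M : ℝ := ‖v‖ + 1
  have hM : 0 < M := by positivity
  refine ⟨min 1 (min (δ₁ / (2 * M)) (min (δ₁ / 2) (δ₂ / 2))), by positivity, fun s hs z hz => ?_⟩
  have hs1 : |s| < δ₁ / (2 * M) := hs.trans_le ((min_le_right _ _).trans (min_le_left _ _))
  have hz' : ‖z - (b₀, 0)‖ ≤ min 1 (min (δ₁ / (2 * M)) (min (δ₁ / 2) (δ₂ / 2))) :=
    mem_closedBall_iff_norm.1 hz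
  have hz1 : ‖z.2‖ ≤ 1 := by
    have := (norm_snd_le (z - (b₀, 0))).trans (hz'.trans (min_le_left _ _))
    simpa using this
  have hzb : ‖z.1 - b₀‖ ≤ min 1 (min (δ₁ / (2 * M)) (min (δ₁ / 2) (δ₂ / 2))) :=
    (norm_fst_le (z - (b₀, 0))).trans hz'
  have hb1 : |z.1 - b₀| ≤ δ₁ / 2 :=
    hzb.trans ((min_le_right _ _).trans ((min_le_right _ _).trans (min_le_left _ _)))
  have hb2 : |z.1 - b₀| ≤ δ₂ / 2 :=
    hzb.trans ((min_le_right _ _).trans ((min_le_right _ _).trans (min_le_right _ _)))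
  have hg : ‖v + z.2‖ ≤ M := (norm_add_le _ _).trans (by simp only [M]; linarith)
  have hdiff : DifferentiableAt ℝ F (z.1, s • (v + z.2)) := by
    apply hd
    rw [dist_eq_norm, Prod.mk_sub_mk, sub_zero, Prod.norm_def, max_lt_iff]
    refine ⟨by rw [Real.norm_eq_abs]; linarith, ?_⟩
    rw [norm_smul, Real.norm_eq_abs]
    calc |s| * ‖v + z.2‖ ≤ δ₁ / (2 * M) * M := by gcongr
      _ = δ₁ / 2 := by field_simp
      _ < δ₁ := by linarith
  refine ContinuousAt.prodMk ?_ continuousAt_const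
  by_cases hs0 : s = 0
  · subst hs0
    rw [zero_smul] at hdiff
    have hz0 : F (z.1, 0) = 0 := h0 (by rw [Real.dist_eq]; linarith)
    have h1 : HasDerivAt (fun s : ℝ => F (z.1, s • (v + z.2)))
        (fderiv ℝ F (z.1, 0) (0, v + z.2)) 0 := by
      have hin : HasDerivAt (fun s : ℝ => ((z.1, s • (v + z.2)) : ℝ × X)) (0, v + z.2) 0 := by
        refine (hasDerivAt_const _ _).prodMk ?_
        simpa using (hasDerivAt_id (0 : ℝ)).smul_const (v + z.2)
      have hf : HasFDerivAt F (fderiv ℝ F (z.1, 0)) ((fun s : ℝ => ((z.1, s • (v + z.2)) : ℝ × X)) 0) := by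
        simpa using hdiff.hasFDerivAt
      exact hf.comp_hasDerivAt 0 hin
    rw [continuousAt_iff_punctured_nhds]
    simp only [if_true]
    have h2 := hasDerivAt_iff_tendsto_slope.1 h1
    refine h2.congr' ?_
    filter_upwards [self_mem_nhdsWithin] with t ht
    have ht' : t ≠ 0 := ht
    simp [slope, ht', hz0]
  · have h1 : ContinuousAt (fun s : ℝ => s⁻¹ • F (z.1, s • (v + z.2))) s := by
      refine (continuousAt_inv₀ hs0).smul ?_
      have hin : ContinuousAt (fun s : ℝ => ((z.1, s • (v + z.2)) : ℝ × X)) s := by fun_prop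
      exact ContinuousAt.comp (f := fun s : ℝ => ((z.1, s • (v + z.2)) : ℝ × X))
        hdiff.continuousAt hin
    refine h1.congr ?_
    filter_upwards [isOpen_ne.mem_nhds hs0] with t ht
    rw [if_neg ht]

/-- Near `(0, (b₀, 0))`, the rescaled equation is a small Lipschitz perturbation of the bordered
linearization `L`, uniformly in the amplitude. -/
theorem rescaled_approx (F : ℝ × X → Y) (b₀ : ℝ) (v : X) (ℓ : X →L[ℝ] ℝ) (τ : Y)
    (hF : ContDiffAt ℝ 2 F (b₀, 0)) (h0 : ∀ᶠ b in 𝓝 b₀, F (b, 0) = 0)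
    (hτ : HasDerivAt (fun b => fderiv ℝ F (b, 0) (0, v)) τ b₀)
    (L : (ℝ × X) →L[ℝ] (Y × ℝ))
    (hL : ∀ β w, L (β, w) = (β • τ + fderiv ℝ F (b₀, 0) (0, w), ℓ w)) :
    ∀ η > 0, ∃ δ > 0, ∀ s, |s| < δ → ∀ z ∈ Metric.closedBall ((b₀, 0) : ℝ × X) δ,
      ∀ z' ∈ Metric.closedBall ((b₀, 0) : ℝ × X) δ,
      ‖rescaled F v ℓ s z - rescaled F v ℓ s z' - L (z - z')‖ ≤ η * ‖z - z'‖ := by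
  intro η hη
  -- the derivative of `F` and the partial derivative in the parameter
  have hDF : ContDiffAt ℝ 1 (fderiv ℝ F) (b₀, 0) := hF.fderiv_right (by norm_num)
  set E : ℝ × X → Y := fun p => fderiv ℝ F p (1, 0) with hE
  have hDFd : HasFDerivAt (fderiv ℝ F) (fderiv ℝ (fderiv ℝ F) (b₀, 0)) (b₀, 0) :=
    (hDF.differentiableAt (by norm_num)).hasFDerivAt
  set E' : ℝ × X →L[ℝ] Y := (fderiv ℝ (fderiv ℝ F) (b₀, 0)).flip (1, 0) with hE'
  have hEs : HasStrictFDerivAt E E' (b₀, 0) := by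
    have h1 : HasStrictFDerivAt (fderiv ℝ F) (fderiv ℝ (fderiv ℝ F) (b₀, 0)) (b₀, 0) :=
      hDF.hasStrictFDerivAt (by norm_num)
    exact ((ContinuousLinearMap.apply ℝ Y ((1, 0) : ℝ × X)).hasStrictFDerivAt).comp _ h1
  have hE'v : E' (0, v) = τ := by
    have hsymm : IsSymmSndFDerivAt ℝ F (b₀, 0) := hF.isSymmSndFDerivAt (by simp)
    have h1 : E' (0, v) = fderiv ℝ (fderiv ℝ F) (b₀, 0) (1, 0) (0, v) := hsymm _ _
    rw [h1]
    have hin : HasDerivAt (fun b : ℝ => ((b, 0) : ℝ × X)) (1, 0) b₀ :=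
      (hasDerivAt_id b₀).prodMk (hasDerivAt_const _ _)
    have h2 := hDFd.comp_hasDerivAt b₀ hin
    have h3 := ((ContinuousLinearMap.apply ℝ Y ((0, v) : ℝ × X)).hasFDerivAt).comp_hasDerivAt b₀ h2
    exact h3.unique hτ
  set M : ℝ := ‖v‖ + 1 with hMdef
  have hM : 0 < M := by positivity
  -- the three smallness requirements
  have hnear1 : ∀ᶠ p in 𝓝 ((b₀, 0) : ℝ × X), ‖fderiv ℝ F p - fderiv ℝ F (b₀, 0)‖ < η / 4 := by
    refine ContinuousAt.eventually_lt (f := fun p => ‖fderiv ℝ F p - fderiv ℝ F (b₀, 0)‖)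
      (hDF.continuousAt.sub continuousAt_const).norm continuousAt_const ?_
    simpa using hη
  have hnear2 := hEs.isLittleO.def (c := η / (4 * M)) (by positivity)
  rw [nhds_prod_eq] at hnear2
  obtain ⟨U, hU, hnear2⟩ := Filter.eventually_prod_self_iff'.1 hnear2
  have hnear3 : ∀ᶠ p in 𝓝 ((b₀, 0) : ℝ × X), DifferentiableAt ℝ F p :=
    (hF.eventually (by norm_num)).mono fun p hp => hp.differentiableAt (by norm_num)
  have hE0 : ∀ᶠ b in 𝓝 b₀, E (b, 0) = 0 := by
    have hd : ∀ᶠ b in 𝓝 b₀, DifferentiableAt ℝ F (b, (0 : X)) := by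
      have hcont : Tendsto (fun b : ℝ => ((b, 0) : ℝ × X)) (𝓝 b₀) (𝓝 (b₀, 0)) :=
        (by fun_prop : Continuous (fun b : ℝ => ((b, 0) : ℝ × X))).continuousAt
      exact hcont.eventually hnear3
    filter_upwards [h0.eventually_nhds, hd] with b hb hdb
    have hin : HasDerivAt (fun b : ℝ => ((b, 0) : ℝ × X)) (1, 0) b :=
      (hasDerivAt_id b).prodMk (hasDerivAt_const _ _)
    have h1 := hdb.hasFDerivAt.comp_hasDerivAt b hin
    have h2 : HasDerivAt (F ∘ fun b : ℝ => ((b, 0) : ℝ × X)) 0 b := by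
      refine (hasDerivAt_const b (0 : Y)).congr_of_eventuallyEq ?_
      filter_upwards [hb] with b' hb'
      exact hb'
    exact h1.unique h2
  obtain ⟨δ₁, hδ₁, hn⟩ := Metric.eventually_nhds_iff.1
    (hnear1.and ((Filter.eventually_of_mem hU fun p hp => hp).and hnear3))
  obtain ⟨δ₂, hδ₂, hE0⟩ := Metric.eventually_nhds_iff.1 hE0
  set κ : ℝ := ‖E'‖ + 1 with hκ
  have hκ0 : 0 < κ := by positivity
  obtain ⟨δ₃, hδ₃, hcont⟩ := continuousAt_rescaled F b₀ v ℓ hF h0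
  set δ : ℝ := min (min 1 (δ₁ / (2 * M))) (min (min (δ₁ / 2) (δ₂ / 2)) (min (η / (4 * κ)) δ₃))
    with hδ
  have hδ0 : 0 < δ := by positivity
  have hd1 : δ ≤ 1 := (min_le_left _ _).trans (min_le_left _ _)
  have hd2 : δ ≤ δ₁ / (2 * M) := (min_le_left _ _).trans (min_le_right _ _)
  have hd3 : δ ≤ δ₁ / 2 := (min_le_right _ _).trans ((min_le_left _ _).trans (min_le_left _ _))
  have hd4 : δ ≤ δ₂ / 2 := (min_le_right _ _).trans ((min_le_left _ _).trans (min_le_right _ _))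
  have hd5 : δ ≤ η / (4 * κ) :=
    (min_le_right _ _).trans ((min_le_right _ _).trans (min_le_left _ _))
  have hd6 : δ ≤ δ₃ := (min_le_right _ _).trans ((min_le_right _ _).trans (min_le_right _ _))
  have main : ∀ s, |s| < δ → s ≠ 0 → ∀ z ∈ Metric.closedBall ((b₀, 0) : ℝ × X) δ,
      ∀ z' ∈ Metric.closedBall ((b₀, 0) : ℝ × X) δ,
      ‖rescaled F v ℓ s z - rescaled F v ℓ s z' - L (z - z')‖ ≤ η * ‖z - z'‖ := by
    intro s hs hs0 z hz z' hz'
    set H : ℝ × X → Y := fun z => s⁻¹ • F (z.1, s • (v + z.2)) with hH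
    set L₁ : (ℝ × X) →L[ℝ] Y := (ContinuousLinearMap.fst ℝ Y ℝ).comp L with hL₁
    have hL₁a : ∀ β w, L₁ (β, w) = β • τ + fderiv ℝ F (b₀, 0) (0, w) := by
      intro β w; simp [hL₁, hL]
    have hred : rescaled F v ℓ s z - rescaled F v ℓ s z' - L (z - z')
        = ((H z - L₁ z) - (H z' - L₁ z'), 0) := by
      have e1 : L (z - z') = (L₁ z - L₁ z', ℓ z.2 - ℓ z'.2) := by
        refine Prod.ext ?_ ?_
        · simp [hL₁]
        · have := hL (z - z').1 (z - z').2
          rw [Prod.mk.eta] at this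
          rw [this]; simp
      rw [e1]
      simp only [rescaled, if_neg hs0, hH, Prod.mk_sub_mk]
      refine Prod.ext ?_ ?_
      · simp only []; abel
      · simp
    rw [hred, Prod.norm_def]
    simp only [norm_zero]
    rw [max_eq_left (norm_nonneg _)]
    -- derivative of the rescaled map
    set inner : (ℝ × X) →L[ℝ] (ℝ × X) :=
      (ContinuousLinearMap.fst ℝ ℝ X).prod (s • ContinuousLinearMap.snd ℝ ℝ X) with hinner
    have hpt : ∀ y ∈ Metric.closedBall ((b₀, 0) : ℝ × X) δ,
        |y.1 - b₀| ≤ δ ∧ ‖y.2‖ ≤ δ ∧ ‖v + y.2‖ ≤ M ∧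
          dist ((y.1, s • (v + y.2)) : ℝ × X) (b₀, 0) < δ₁ ∧
          dist ((y.1, 0) : ℝ × X) (b₀, 0) < δ₁ := by
      intro y hy
      rw [mem_closedBall_iff_norm] at hy
      have h1 : |y.1 - b₀| ≤ δ := (norm_fst_le (y - (b₀, 0))).trans hy
      have h2 : ‖y.2‖ ≤ δ := by
        have := (norm_snd_le (y - (b₀, 0))).trans hy
        simpa using this
      have h3 : ‖v + y.2‖ ≤ M := (norm_add_le _ _).trans (by rw [hMdef]; linarith)
      refine ⟨h1, h2, h3, ?_, ?_⟩
      · rw [dist_eq_norm, Prod.mk_sub_mk, sub_zero, Prod.norm_def, max_lt_iff]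
        refine ⟨by rw [Real.norm_eq_abs]; linarith, ?_⟩
        rw [norm_smul, Real.norm_eq_abs]
        calc |s| * ‖v + y.2‖ ≤ δ₁ / (2 * M) * M := by gcongr; exact hs.le.trans hd2
          _ = δ₁ / 2 := by field_simp
          _ < δ₁ := by linarith
      · rw [dist_eq_norm, Prod.mk_sub_mk, sub_zero, Prod.norm_def, max_lt_iff]
        refine ⟨by rw [Real.norm_eq_abs]; linarith, by simpa using hδ₁⟩
    have hderiv : ∀ y ∈ Metric.closedBall ((b₀, 0) : ℝ × X) δ,
        HasFDerivWithinAt (fun z => H z - L₁ z)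
          (s⁻¹ • (fderiv ℝ F (y.1, s • (v + y.2))).comp inner - L₁)
          (Metric.closedBall ((b₀, 0) : ℝ × X) δ) y := by
      intro y hy
      obtain ⟨-, -, -, hd, -⟩ := hpt y hy
      have hFd : HasFDerivAt F (fderiv ℝ F (y.1, s • (v + y.2))) (y.1, s • (v + y.2)) :=
        (hn hd).2.2.hasFDerivAt
      have hin : HasFDerivAt (fun z : ℝ × X => ((z.1, s • (v + z.2)) : ℝ × X)) inner y := by
        refine hasFDerivAt_fst.prodMk ?_
        exact (hasFDerivAt_snd.const_add v).const_smul s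
      have h1 := HasFDerivAt.comp (f := fun z : ℝ × X => ((z.1, s • (v + z.2)) : ℝ × X)) y hFd hin
      exact ((h1.const_smul s⁻¹).sub L₁.hasFDerivAt).hasFDerivWithinAt
    refine Convex.norm_image_sub_le_of_norm_hasFDerivWithin_le (C := η) hderiv ?_
      (convex_closedBall _ _) hz' hz
    intro y hy
    obtain ⟨hb, hw, hg, hd, hd'⟩ := hpt y hy
    refine ContinuousLinearMap.opNorm_le_bound _ hη.le ?_
    rintro ⟨β, w⟩
    set p : ℝ × X := (y.1, s • (v + y.2)) with hp
    have hEp : ‖s⁻¹ • E p - τ‖ ≤ η / 2 := by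
      have h1 := hnear2 p (hn hd).2.1 (y.1, 0) (hn hd').2.1
      simp only [] at h1
      have hE0' : E (y.1, 0) = 0 := hE0 (by rw [Real.dist_eq]; linarith)
      have h2 : p - (y.1, 0) = s • ((0, v + y.2) : ℝ × X) := by
        rw [hp, Prod.mk_sub_mk]; simp
      rw [h2, hE0', sub_zero, map_smul, norm_smul] at h1
      have h3 : ‖s⁻¹ • E p - E' (0, v + y.2)‖ ≤ η / 4 := by
        have e : s⁻¹ • E p - E' (0, v + y.2) = s⁻¹ • (E p - s • E' (0, v + y.2)) := by
          rw [smul_sub, inv_smul_smul₀ hs0]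
        rw [e, norm_smul, norm_inv]
        have hsn : 0 < ‖s‖ := norm_pos_iff.2 hs0
        have hgn : ‖((0, v + y.2) : ℝ × X)‖ ≤ M := by
          rw [Prod.norm_def]; simpa using hg
        calc ‖s‖⁻¹ * ‖E p - s • E' (0, v + y.2)‖
            ≤ ‖s‖⁻¹ * (η / (4 * M) * (‖s‖ * ‖((0, v + y.2) : ℝ × X)‖)) := by gcongr
          _ = η / (4 * M) * ‖((0, v + y.2) : ℝ × X)‖ := by field_simp
          _ ≤ η / (4 * M) * M := by gcongr
          _ = η / 4 := by field_simp
      have h4 : ‖E' (0, v + y.2) - τ‖ ≤ η / 4 := by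
        have e : E' (0, v + y.2) - τ = E' (0, y.2) := by
          rw [← hE'v, ← map_sub, Prod.mk_sub_mk]; simp
        rw [e]
        calc ‖E' (0, y.2)‖ ≤ ‖E'‖ * ‖((0, y.2) : ℝ × X)‖ := E'.le_opNorm _
          _ ≤ κ * δ := by
              gcongr
              · rw [hκ]; linarith
              · rw [Prod.norm_def]; simpa using hw
          _ ≤ κ * (η / (4 * κ)) := by gcongr
          _ = η / 4 := by field_simp
      calc ‖s⁻¹ • E p - τ‖ = ‖(s⁻¹ • E p - E' (0, v + y.2)) + (E' (0, v + y.2) - τ)‖ := by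
            congr 1; abel
        _ ≤ η / 4 + η / 4 := (norm_add_le _ _).trans (add_le_add h3 h4)
        _ = η / 2 := by ring
    have hval : (s⁻¹ • (fderiv ℝ F p).comp inner - L₁) (β, w)
        = β • (s⁻¹ • E p - τ) + (fderiv ℝ F p - fderiv ℝ F (b₀, 0)) (0, w) := by
      have e1 : inner (β, w) = β • ((1, 0) : ℝ × X) + s • ((0, w) : ℝ × X) := by
        simp [hinner]
      rw [sub_apply, smul_apply, ContinuousLinearMap.comp_apply, e1, hL₁a, map_add, map_smul,
        map_smul, smul_add, inv_smul_smul₀ hs0, sub_apply, smul_sub, smul_comm s⁻¹ β]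
      simp only [hE]
      abel
    rw [hval]
    have hβ : |β| ≤ ‖((β, w) : ℝ × X)‖ := norm_fst_le ((β, w) : ℝ × X)
    have hw' : ‖((0, w) : ℝ × X)‖ ≤ ‖((β, w) : ℝ × X)‖ := by
      rw [Prod.norm_def, Prod.norm_def]
      simp
    calc ‖β • (s⁻¹ • E p - τ) + (fderiv ℝ F p - fderiv ℝ F (b₀, 0)) (0, w)‖
        ≤ |β| * ‖s⁻¹ • E p - τ‖ + ‖fderiv ℝ F p - fderiv ℝ F (b₀, 0)‖ * ‖((0, w) : ℝ × X)‖ := by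
          refine (norm_add_le _ _).trans (add_le_add ?_ ?_)
          · rw [norm_smul, Real.norm_eq_abs]
          · exact ContinuousLinearMap.le_opNorm _ _
      _ ≤ ‖((β, w) : ℝ × X)‖ * (η / 2) + η / 4 * ‖((β, w) : ℝ × X)‖ := by
          gcongr
          exact (hn hd).1.le
      _ ≤ η * ‖((β, w) : ℝ × X)‖ := by
          have := norm_nonneg ((β, w) : ℝ × X)
          nlinarith
  refine ⟨δ, hδ0, fun s hs z hz z' hz' => ?_⟩
  by_cases hs0 : s = 0
  · -- at `s = 0` the estimate is the limit of those for `s ≠ 0`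
    subst hs0
    have hsub : Metric.closedBall ((b₀, 0) : ℝ × X) δ ⊆ Metric.closedBall (b₀, 0) δ₃ :=
      Metric.closedBall_subset_closedBall hd6
    have hc : ContinuousAt
        (fun s => ‖rescaled F v ℓ s z - rescaled F v ℓ s z' - L (z - z')‖) 0 :=
      (((hcont 0 (by simpa using hδ₃) z (hsub hz)).sub
        (hcont 0 (by simpa using hδ₃) z' (hsub hz'))).sub continuousAt_const).norm
    refine le_of_tendsto (hc.tendsto.mono_left (nhdsWithin_le_nhds (s := {0}ᶜ))) ?_
    have hlt : ∀ᶠ t in 𝓝 (0 : ℝ), |t| < δ := by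
      have := Metric.ball_mem_nhds (0 : ℝ) hδ0
      filter_upwards [this] with t ht
      simpa using ht
    filter_upwards [self_mem_nhdsWithin, nhdsWithin_le_nhds hlt] with t ht htδ
    exact main t htδ ht z hz z' hz'
  · exact main s hs hs0 z hz z' hz'

/-- **Bifurcation from a simple eigenvalue** (Crandall–Rabinowitz): a kernel vector `v` of the
linearization at `(b₀, 0)` is continued to a branch of nontrivial zeros `s (v + w(s))`, provided
that the linearization of the rescaled equation together with the normalization `ℓ` is invertible. -/
theorem exists_bifurcation_branch [CompleteSpace X] (F : ℝ × X → Y) (b₀ : ℝ) (v : X)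
    (ℓ : X →L[ℝ] ℝ) (τ : Y)
    (hF : ContDiffAt ℝ 2 F (b₀, 0)) (h0 : ∀ᶠ b in 𝓝 b₀, F (b, 0) = 0)
    (hv : fderiv ℝ F (b₀, 0) (0, v) = 0)
    (hτ : HasDerivAt (fun b => fderiv ℝ F (b, 0) (0, v)) τ b₀)
    (L : (ℝ × X) ≃L[ℝ] (Y × ℝ))
    (hL : ∀ β w, L (β, w) = (β • τ + fderiv ℝ F (b₀, 0) (0, w), ℓ w)) (ρ : ℝ) (hρ : 0 < ρ) :
    ∃ ε > 0, ∃ z : ℝ → ℝ × X, z 0 = (b₀, 0) ∧ ContinuousOn z (Ioo (-ε) ε) ∧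
      ∀ s ∈ Ioo (-ε) ε, ‖z s - (b₀, 0)‖ ≤ ρ ∧ F ((z s).1, s • (v + (z s).2)) = 0 ∧
        ℓ (z s).2 = 0 := by
  obtain ⟨ε, hε, z, hz0, hzc, hz⟩ := exists_continuous_zeros (rescaled F v ℓ) (b₀, 0) L
    (by simp [rescaled, hv])
    (rescaled_approx F b₀ v ℓ τ hF h0 hτ (L : (ℝ × X) →L[ℝ] (Y × ℝ)) hL)
    (continuousAt_rescaled F b₀ v ℓ hF h0) ρ hρ
  refine ⟨ε, hε, z, hz0, hzc, fun s hs => ⟨(hz s hs).1, ?_, ?_⟩⟩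
  · have h1 := congrArg Prod.fst (hz s hs).2
    by_cases hs0 : s = 0
    · subst hs0
      rw [hz0, zero_smul]
      exact h0.self_of_nhds
    · simp only [rescaled, if_neg hs0, Prod.fst_zero, smul_eq_zero, inv_eq_zero] at h1
      exact h1.resolve_left hs0
  · exact congrArg Prod.snd (hz s hs).2

end SimpleEigenvalue

theorem hasSum_of_eq {ι M : Type*} [AddCommMonoid M] [TopologicalSpace M] {f g : ι → M} {a a' : M}
    (h : HasSum f a) (hf : ∀ i, g i = f i) (ha : a' = a) : HasSum g a' := by
  rw [ha, funext hf]; exact h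

/-! ### Fourier coefficients of the mutual interaction kernel -/

section Kernel

/-- The coefficients of `(1 - z)^(-s) = ∑ bc s j z^j`. -/
def bc (s : ℝ) (j : ℕ) : ℝ := Ring.choose (s + j - 1) j

theorem bc_eq (s : ℝ) (j : ℕ) : (j.factorial : ℝ) * bc s j = (ascPochhammer ℝ j).eval s := by
  have h := Ring.factorial_nsmul_multichoose_eq_ascPochhammer s j
  rw [Polynomial.ascPochhammer_smeval_eq_eval, Ring.multichoose_eq, nsmul_eq_mul] at h
  exact h

theorem bc_succ (s : ℝ) (j : ℕ) : ((j : ℝ) + 1) * bc s (j + 1) = (s + j) * bc s j := by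
  have h1 := bc_eq s j
  have h2 := bc_eq s (j + 1)
  rw [ascPochhammer_succ_right, Polynomial.eval_mul, ← h1, Nat.factorial_succ] at h2
  simp only [Polynomial.eval_add, Polynomial.eval_X, Polynomial.eval_natCast] at h2
  push_cast at h2
  have hj : (j.factorial : ℝ) ≠ 0 := by positivity
  apply mul_left_cancel₀ hj
  linarith

theorem bc_zero (s : ℝ) : bc s 0 = 1 := by
  have h1 := bc_eq s 0
  simpa using h1

theorem bc_nonneg {s : ℝ} (hs : 0 < s) (j : ℕ) : 0 ≤ bc s j := by
  induction j with
  | zero => rw [bc_zero]; exact zero_le_one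
  | succ j ih =>
    have := bc_succ s j
    have h1 : 0 ≤ ((j : ℝ) + 1) * bc s (j + 1) := by rw [this]; positivity
    exact nonneg_of_mul_nonneg_right h1 (by positivity)

theorem Gamma_add_nat {s : ℝ} (hs : 0 < s) (j : ℕ) :
    Real.Gamma (j + s) = Real.Gamma s * (bc s j * j.factorial) := by
  induction j with
  | zero => simp [bc_zero]
  | succ j ih =>
    have h := bc_succ s j
    push_cast
    rw [show (j : ℝ) + 1 + s = (j + s) + 1 by ring, Real.Gamma_add_one (by positivity), ih,
      Nat.factorial_succ]
    push_cast
    linear_combination (-(Real.Gamma s) * j.factorial) * h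

theorem hasSum_bc_complex (s : ℝ) {z : ℂ} (hz : ‖z‖ < 1) :
    HasSum (fun j : ℕ => (bc s j : ℂ) * z ^ j) ((1 - z) ^ (-s : ℂ)) := by
  have h := (Complex.one_div_one_sub_cpow_hasFPowerSeriesOnBall_zero (s : ℂ)).hasSum (y := z) (by
    rw [← ENNReal.ofReal_one, Metric.eball_ofReal]
    simpa using hz)
  rw [zero_add, one_div, ← Complex.cpow_neg] at h
  refine hasSum_of_eq h (fun j => ?_) rfl
  rw [FormalMultilinearSeries.ofScalars_apply_eq, bc, smul_eq_mul, Complex.ofReal_choose]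
  push_cast
  rfl

theorem hasSum_bc (s : ℝ) {z : ℝ} (hz : |z| < 1) :
    HasSum (fun j : ℕ => bc s j * z ^ j) ((1 - z) ^ (-s)) := by
  have h := hasSum_bc_complex s (z := (z : ℂ)) (by simpa using hz)
  have h1 : ((1 - (z : ℂ)) ^ (-s : ℂ)) = (((1 - z) ^ (-s) : ℝ) : ℂ) := by
    rw [Complex.ofReal_cpow (by have := abs_lt.1 hz; linarith)]
    push_cast; rfl
  rw [h1] at h
  exact_mod_cast h

theorem beta_integrable {u v : ℝ} (hu : 0 < u) (hv : 0 < v) :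
    IntervalIntegrable (fun x : ℝ => x ^ (u - 1) * (1 - x) ^ (v - 1)) volume 0 1 ∧
      ∫ x in (0 : ℝ)..1, x ^ (u - 1) * (1 - x) ^ (v - 1)
        = Real.Gamma u * Real.Gamma v / Real.Gamma (u + v) := by
  have h1 := Complex.betaIntegral_convergent (u := (u : ℂ)) (v := (v : ℂ)) (by simpa) (by simpa)
  have heq : ∀ x ∈ uIcc (0 : ℝ) 1, (x : ℂ) ^ ((u : ℂ) - 1) * (1 - (x : ℂ)) ^ ((v : ℂ) - 1)
      = ((x ^ (u - 1) * (1 - x) ^ (v - 1) : ℝ) : ℂ) := by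
    intro x hx
    rw [uIcc_of_le zero_le_one] at hx
    rw [Complex.ofReal_mul, Complex.ofReal_cpow hx.1, Complex.ofReal_cpow (by linarith [hx.2])]
    push_cast; rfl
  have h2 := Complex.betaIntegral_eq_Gamma_mul_div (u : ℂ) (v : ℂ) (by simpa) (by simpa)
  rw [Complex.betaIntegral, intervalIntegral.integral_congr heq, intervalIntegral.integral_ofReal,
    ← Complex.ofReal_add, Complex.Gamma_ofReal, Complex.Gamma_ofReal, Complex.Gamma_ofReal] at h2
  refine ⟨?_, by exact_mod_cast h2⟩
  have h3 := h1.congr (g := fun x : ℝ => ((x ^ (u - 1) * (1 - x) ^ (v - 1) : ℝ) : ℂ))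
    (fun x hx => heq x (uIoc_subset_uIcc hx))
  have h4 : IntervalIntegrable (fun x : ℝ =>
      (((x ^ (u - 1) * (1 - x) ^ (v - 1) : ℝ) : ℂ)).re) volume 0 1 := by
    rw [intervalIntegrable_iff] at h3 ⊢
    exact h3.re
  simpa using h4

/-- The kernel `|1 - b e^{iθ}|²`. -/
def ker (b θ : ℝ) : ℝ := 1 + b ^ 2 - 2 * b * Real.cos θ

theorem ker_pos {b : ℝ} (hb0 : 0 < b) (hb : b < 1) (θ : ℝ) : 0 < ker b θ := by
  have h1 := Real.cos_le_one θ
  have : (1 - b) ^ 2 ≤ ker b θ := by unfold ker; nlinarith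
  have h2 : 0 < (1 - b) ^ 2 := by apply pow_pos; linarith
  linarith

theorem cpow_mul_conj_cpow {z : ℂ} (hz : z.arg ≠ Real.pi) (r : ℝ) :
    z ^ (r : ℂ) * (starRingEnd ℂ z) ^ (r : ℂ) = ((Complex.normSq z ^ r : ℝ) : ℂ) := by
  have h1 : (starRingEnd ℂ z) ^ (r : ℂ) = starRingEnd ℂ (z ^ (r : ℂ)) := by
    rw [Complex.conj_cpow _ _ hz, Complex.conj_ofReal]
  rw [h1, Complex.mul_conj, Complex.normSq_eq_norm_sq, Complex.normSq_eq_norm_sq,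
    Complex.norm_cpow_real]
  congr 1
  rw [← Real.rpow_natCast, ← Real.rpow_natCast, ← Real.rpow_mul (norm_nonneg _),
    ← Real.rpow_mul (norm_nonneg _), mul_comm]

theorem arg_ne_pi_of_re_pos {z : ℂ} (hz : 0 < z.re) : z.arg ≠ Real.pi := by
  intro h
  rw [Complex.arg_eq_pi_iff] at h
  linarith [h.1]

theorem normSq_one_sub_exp (b θ : ℝ) :
    Complex.normSq (1 - b * Complex.exp (θ * Complex.I)) = ker b θ := by
  rw [Complex.exp_mul_I, Complex.normSq_apply, ker, ← Complex.ofReal_cos, ← Complex.ofReal_sin]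
  have h := Real.sin_sq_add_cos_sq θ
  generalize Real.cos θ = c at h ⊢
  generalize Real.sin θ = d at h ⊢
  simp
  linear_combination b ^ 2 * h

theorem conj_exp_mul_I (θ : ℝ) :
    starRingEnd ℂ (Complex.exp (θ * Complex.I)) = Complex.exp (-(θ * Complex.I)) := by
  rw [← Complex.exp_conj]
  simp

theorem summable_norm_bc {s : ℝ} (hs : 0 < s) {z : ℂ} (hz : ‖z‖ < 1) :
    Summable fun j : ℕ => ‖(bc s j : ℂ) * z ^ j‖ := by
  have h3 := hasSum_bc s (z := ‖z‖) (by rwa [abs_of_nonneg (norm_nonneg _)])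
  refine h3.summable.congr fun j => ?_
  rw [norm_mul, norm_pow, Complex.norm_real, Real.norm_of_nonneg (bc_nonneg hs j)]

theorem hasSum_mul_of_norm {f g : ℕ → ℂ} {a a' : ℂ} (hf : Summable fun j => ‖f j‖)
    (hg : Summable fun j => ‖g j‖) (ha : HasSum f a) (ha' : HasSum g a') :
    HasSum (fun p : ℕ × ℕ => f p.1 * g p.2) (a * a') := by
  rw [← ha.tsum_eq, ← ha'.tsum_eq, tsum_mul_tsum_of_summable_norm hf hg]
  exact (summable_mul_of_summable_norm hf hg).hasSum

/-- The double power series of `|1 - b e^{iθ}|^(-2s)`, as the product of the binomial series of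
`(1 - b e^{iθ})^(-s)` and its conjugate. -/
theorem hasSum_ker (s : ℝ) (hs : 0 < s) {b : ℝ} (hb0 : 0 < b) (hb : b < 1) (θ : ℝ) :
    HasSum (fun p : ℕ × ℕ => (bc s p.1 : ℂ) * bc s p.2 * (b : ℂ) ^ (p.1 + p.2)
        * Complex.exp ((((p.1 : ℤ) - (p.2 : ℤ) : ℤ) : ℂ) * (θ * Complex.I)))
      ((ker b θ ^ (-s) : ℝ) : ℂ) := by
  set z : ℂ := (b : ℂ) * Complex.exp (θ * Complex.I) with hz
  have hn : ‖z‖ < 1 := by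
    rw [hz, norm_mul, Complex.norm_exp_ofReal_mul_I, mul_one, Complex.norm_real,
      Real.norm_of_nonneg hb0.le]
    exact hb
  have hzc : starRingEnd ℂ z = (b : ℂ) * Complex.exp (-(θ * Complex.I)) := by
    rw [hz, map_mul, conj_exp_mul_I, Complex.conj_ofReal]
  have hn' : ‖starRingEnd ℂ z‖ < 1 := by rwa [RCLike.norm_conj]
  have h1 := hasSum_bc_complex s hn
  have h2 := hasSum_bc_complex s hn'
  have hre : 0 < (1 - z).re := by
    have h4 := (Complex.re_le_norm z).trans_lt hn
    rw [Complex.sub_re, Complex.one_re]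
    linarith
  have hval : (1 - z) ^ (-s : ℂ) * (1 - starRingEnd ℂ z) ^ (-s : ℂ)
      = ((ker b θ ^ (-s) : ℝ) : ℂ) := by
    have h5 : 1 - starRingEnd ℂ z = starRingEnd ℂ (1 - z) := by rw [map_sub, map_one]
    rw [h5, ← Complex.ofReal_neg, cpow_mul_conj_cpow (arg_ne_pi_of_re_pos hre), hz,
      normSq_one_sub_exp]
  have h3 := hasSum_mul_of_norm (summable_norm_bc hs hn) (summable_norm_bc hs hn') h1 h2
  rw [hval, hzc, hz] at h3
  refine hasSum_of_eq h3 (fun p => ?_) rfl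
  rw [mul_pow, mul_pow, ← Complex.exp_nat_mul, ← Complex.exp_nat_mul,
    show (((p.1 : ℤ) - (p.2 : ℤ) : ℤ) : ℂ) * (θ * Complex.I)
    = (p.1 : ℂ) * (θ * Complex.I) + (p.2 : ℂ) * (-(θ * Complex.I)) by push_cast; ring,
    Complex.exp_add, pow_add]
  ring

theorem integral_exp_int (k : ℤ) :
    ∫ θ in (0 : ℝ)..(2 * Real.pi), Complex.exp (k * (θ * Complex.I))
      = if k = 0 then (2 * Real.pi : ℂ) else 0 := by
  split_ifs with hk
  · subst hk; simp
  · have hk' : (k : ℂ) * Complex.I ≠ 0 := by simp [hk]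
    have h1 : ∀ θ : ℝ, Complex.exp (k * (θ * Complex.I)) = Complex.exp ((k * Complex.I) * θ) := by
      intro θ; congr 1; ring
    simp_rw [h1]
    rw [integral_exp_mul_complex hk']
    have h2 : (k : ℂ) * Complex.I * ((2 * Real.pi : ℝ) : ℂ) = k * (2 * Real.pi * Complex.I) := by
      push_cast; ring
    rw [h2, Complex.exp_int_mul_two_pi_mul_I]
    simp

theorem summable_bc_mul (s : ℝ) (hs : 0 < s) {b : ℝ} (hb0 : 0 < b) (hb : b < 1) :
    Summable fun p : ℕ × ℕ => bc s p.1 * bc s p.2 * b ^ (p.1 + p.2) := by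
  have h := (hasSum_bc s (z := b) (by rw [abs_of_pos hb0]; exact hb)).summable
  have h1 := h.mul_of_nonneg h (fun j => mul_nonneg (bc_nonneg hs j) (by positivity))
    (fun j => mul_nonneg (bc_nonneg hs j) (by positivity))
  refine h1.congr fun p => ?_
  rw [pow_add]; ring

theorem hasSum_fourier_ker (s : ℝ) (hs : 0 < s) {b : ℝ} (hb0 : 0 < b) (hb : b < 1) (n : ℕ) :
    HasSum (fun l : ℕ => ((2 * Real.pi * (bc s (l + n) * bc s l * b ^ (2 * l + n)) : ℝ) : ℂ))
      (∫ θ in (0 : ℝ)..(2 * Real.pi),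
        ((ker b θ ^ (-s) : ℝ) : ℂ) * Complex.exp (-(n * (θ * Complex.I)))) := by
  set F : ℕ × ℕ → ℝ → ℂ := fun p θ => ((bc s p.1 : ℂ) * bc s p.2 * b ^ (p.1 + p.2)
        * Complex.exp (((p.1 : ℤ) - (p.2 : ℤ) : ℤ) * (θ * Complex.I)))
        * Complex.exp (-(n * (θ * Complex.I))) with hF
  have hFe : ∀ p θ, F p θ = ((bc s p.1 * bc s p.2 * b ^ (p.1 + p.2) : ℝ) : ℂ)
      * Complex.exp (((p.1 : ℤ) - (p.2 : ℤ) - n : ℤ) * (θ * Complex.I)) := by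
    intro p θ
    simp only [hF]
    rw [mul_assoc, ← Complex.exp_add]
    push_cast
    congr 2
    ring
  have hFn : ∀ p θ, ‖F p θ‖ = bc s p.1 * bc s p.2 * b ^ (p.1 + p.2) := by
    intro p θ
    rw [hFe, norm_mul, Complex.norm_real, ← mul_assoc, ← Complex.ofReal_intCast,
      ← Complex.ofReal_mul, Complex.norm_exp_ofReal_mul_I, mul_one, Real.norm_of_nonneg]
    have := bc_nonneg hs p.1
    have := bc_nonneg hs p.2
    positivity
  have hsum : ∀ θ, HasSum (fun p => F p θ)
      (((ker b θ ^ (-s) : ℝ) : ℂ) * Complex.exp (-(n * (θ * Complex.I)))) := fun θ =>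
    (hasSum_ker s hs hb0 hb θ).mul_right _
  have hpi := Real.pi_pos
  have h1 := hasSum_integral_of_summable_integral_norm (F := F)
    (μ := volume.restrict (Ioc 0 (2 * Real.pi))) (by
      intro p
      have : Continuous (F p) := by simp only [hF]; fun_prop
      exact (this.intervalIntegrable 0 (2 * Real.pi)).1) (by
      simp_rw [hFn]
      simp only [integral_const]
      exact (summable_bc_mul s hs hb0 hb).mul_left _)
  simp_rw [fun θ => (hsum θ).tsum_eq] at h1
  rw [← intervalIntegral.integral_of_le (by positivity)] at h1
  have h2 : ∀ p, ∫ θ in Ioc 0 (2 * Real.pi), F p θ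
      = if ((p.1 : ℤ) - (p.2 : ℤ) - n = 0) then
        ((bc s p.1 * bc s p.2 * b ^ (p.1 + p.2) : ℝ) : ℂ) * (2 * Real.pi) else 0 := by
    intro p
    rw [← intervalIntegral.integral_of_le (by positivity)]
    simp_rw [hFe]
    rw [intervalIntegral.integral_const_mul, integral_exp_int, mul_ite, mul_zero]
  simp_rw [h2] at h1
  have hinj : Function.Injective (fun l : ℕ => ((l + n, l) : ℕ × ℕ)) := fun a b h =>
    congrArg Prod.snd h
  rw [← hinj.hasSum_iff] at h1
  · refine hasSum_of_eq h1 (fun l => ?_) rfl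
    simp only [Function.comp_apply]
    rw [if_pos (by push_cast; ring)]
    push_cast
    ring
  · rintro ⟨j, l⟩ hjl
    rw [if_neg]
    intro h
    exact hjl ⟨l, by simp only [Prod.mk.injEq, and_true]; omega⟩

end Kernel

section LamSeries

variable {α : ℝ}

theorem lam_weight_integrable (hα0 : 0 < α) (hα2 : α < 2) (n : ℕ) (hn : 1 ≤ n) :
    IntervalIntegrable (fun x : ℝ => x ^ ((n : ℝ) - 1 + α / 2) * (1 - x) ^ (-(α / 2)))
      volume 0 1 := by
  have hn' : (1 : ℝ) ≤ n := by exact_mod_cast hn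
  have h := (beta_integrable (u := (n : ℝ) + α / 2) (v := 1 - α / 2)
    (by positivity) (by linarith)).1
  rw [show (n : ℝ) + α / 2 - 1 = (n : ℝ) - 1 + α / 2 by ring,
    show 1 - α / 2 - 1 = -(α / 2) by ring] at h
  exact h

theorem cAlpha_eq (hα2 : α < 2) : 2 * Real.pi * cAlpha α =
    1 / ((2 : ℝ) ^ (1 - α) * Real.Gamma (1 - α / 2) ^ 2)
      * (Real.Gamma (α / 2) * Real.Gamma (1 - α / 2)) := by
  have h1 : Real.Gamma (1 - α / 2) ≠ 0 := (Real.Gamma_pos_of_pos (by linarith)).ne'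
  have h2 : (2 : ℝ) ^ (1 - α) ≠ 0 := by positivity
  have h3 := Real.pi_ne_zero
  rw [cAlpha, show (2 - α) / 2 = 1 - α / 2 by ring]
  field_simp

theorem cAlpha_pos (hα0 : 0 < α) (hα2 : α < 2) : 0 < cAlpha α := by
  have h1 : 0 < Real.Gamma ((2 - α) / 2) := Real.Gamma_pos_of_pos (by linarith)
  have h2 : 0 < Real.Gamma (α / 2) := Real.Gamma_pos_of_pos (by linarith)
  have h3 := Real.pi_pos
  unfold cAlpha
  positivity

/-- The power series of `b Λ_n(b)`, obtained by expanding `(1 - b²x)^(-α/2)` and evaluating Beta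
integrals. Its terms agree with those of the Fourier coefficient in `hasSum_fourier_ker`. -/
theorem hasSum_Lam (hα0 : 0 < α) (hα2 : α < 2) {b : ℝ} (hb0 : 0 < b) (hb : b < 1) (n : ℕ)
    (hn : 1 ≤ n) :
    HasSum (fun l : ℕ => 2 * Real.pi * cAlpha α *
      (bc (α / 2) (l + n) * bc (α / 2) l * b ^ (2 * l + n))) (b * Lam α n b) := by
  have hs : 0 < α / 2 := by linarith
  have hn' : (1 : ℝ) ≤ n := by exact_mod_cast hn
  set w : ℝ → ℝ := fun x => x ^ ((n : ℝ) - 1 + α / 2) * (1 - x) ^ (-(α / 2)) with hw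
  set F : ℕ → ℝ → ℝ := fun l x => w x * (bc (α / 2) l * (b ^ 2 * x) ^ l) with hF
  have hint : ∀ l, IntervalIntegrable (F l) volume 0 1 := fun l =>
    (lam_weight_integrable hα0 hα2 n hn).mul_continuousOn (by fun_prop)
  have hFval : ∀ l, ∫ x in (0 : ℝ)..1, F l x = (Real.Gamma (α / 2) * Real.Gamma (1 - α / 2)) *
      (bc (α / 2) (l + n) * bc (α / 2) l * b ^ (2 * l)) := by
    intro l
    have h1 := (beta_integrable (u := ((l + n : ℕ) : ℝ) + α / 2) (v := 1 - α / 2)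
      (by positivity) (by linarith)).2
    have h2 : ∫ x in (0 : ℝ)..1, F l x = ∫ x in (0 : ℝ)..1, (bc (α / 2) l * b ^ (2 * l)) *
        (x ^ (((l + n : ℕ) : ℝ) + α / 2 - 1) * (1 - x) ^ (1 - α / 2 - 1)) := by
      refine intervalIntegral.integral_congr_ae (Eventually.of_forall fun x hx => ?_)
      rw [uIoc_of_le zero_le_one] at hx
      simp only [hF, hw]
      rw [show ((l + n : ℕ) : ℝ) + α / 2 - 1 = ((n : ℝ) - 1 + α / 2) + (l : ℕ) by push_cast; ring,
        Real.rpow_add_natCast hx.1.ne', show 1 - α / 2 - 1 = -(α / 2) by ring, mul_pow, ← pow_mul]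
      ring
    rw [h2, intervalIntegral.integral_const_mul, h1,
      show ((l + n : ℕ) : ℝ) + α / 2 + (1 - α / 2) = ((l + n : ℕ) : ℝ) + 1 by ring,
      Real.Gamma_nat_eq_factorial, Gamma_add_nat hs]
    have hf : ((l + n).factorial : ℝ) ≠ 0 := by positivity
    field_simp
  have hFnn : ∀ l, ∀ x ∈ Ioc (0 : ℝ) 1, 0 ≤ F l x := by
    intro l x hx
    have h1 := bc_nonneg hs l
    have h2 : 0 ≤ 1 - x := by linarith [hx.2]
    have h3 := hx.1
    simp only [hF, hw]
    positivity
  have hsumm : Summable fun l : ℕ => bc (α / 2) (l + n) * bc (α / 2) l * b ^ (2 * l) := by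
    have h1 := (hasSum_fourier_ker (α / 2) hs hb0 hb n).summable
    have h2 : Summable fun l : ℕ =>
        2 * Real.pi * (bc (α / 2) (l + n) * bc (α / 2) l * b ^ (2 * l + n)) := by
      exact_mod_cast h1
    have h3 := h2.mul_left (1 / (2 * Real.pi * b ^ n))
    refine h3.congr fun l => ?_
    have := Real.pi_ne_zero
    rw [pow_add]
    field_simp
  have h1 := hasSum_integral_of_summable_integral_norm (F := F)
    (μ := volume.restrict (Ioc 0 1)) (fun l => (hint l).1) (by
      have h2 : ∀ l, ∫ x in Ioc (0 : ℝ) 1, ‖F l x‖ = ∫ x in (0 : ℝ)..1, F l x := by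
        intro l
        rw [intervalIntegral.integral_of_le zero_le_one]
        refine setIntegral_congr_fun measurableSet_Ioc fun x hx => ?_
        exact Real.norm_of_nonneg (hFnn l x hx)
      simp_rw [h2, hFval]
      exact hsumm.mul_left _)
  have h3 : ∀ l, ∫ x in Ioc (0 : ℝ) 1, F l x = ∫ x in (0 : ℝ)..1, F l x := fun l =>
    (intervalIntegral.integral_of_le zero_le_one).symm
  have h4 : ∫ x in Ioc (0 : ℝ) 1, ∑' l, F l x = ∫ x in (0 : ℝ)..1,
      x ^ ((n : ℝ) - 1 + α / 2) * (1 - x) ^ (-(α / 2)) * (1 - b ^ 2 * x) ^ (-(α / 2)) := by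
    rw [intervalIntegral.integral_of_le zero_le_one]
    refine setIntegral_congr_fun measurableSet_Ioc fun x hx => ?_
    have h5 : |b ^ 2 * x| < 1 := by
      have hx0 := hx.1
      rw [abs_of_pos (by positivity)]
      have : b ^ 2 < 1 := by nlinarith
      nlinarith [hx.2]
    exact ((hasSum_bc (α / 2) h5).mul_left (w x)).tsum_eq
  simp_rw [h3, hFval] at h1
  rw [h4] at h1
  have h6 := h1.mul_left (b ^ n * (1 / ((2 : ℝ) ^ (1 - α) * Real.Gamma (1 - α / 2) ^ 2)))
  refine hasSum_of_eq h6 (fun l => ?_) ?_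
  · rw [cAlpha_eq hα2, pow_add]
    ring
  · rw [Lam]
    obtain ⟨k, rfl⟩ := Nat.exists_eq_add_of_le' hn
    rw [Nat.add_sub_cancel, pow_succ]
    ring

/-- `Λ_n(b)` is a Fourier coefficient of the mutual interaction kernel. -/
theorem mul_Lam_eq_exp (hα0 : 0 < α) (hα2 : α < 2) {b : ℝ} (hb0 : 0 < b) (hb : b < 1) (n : ℕ)
    (hn : 1 ≤ n) :
    ((b * Lam α n b : ℝ) : ℂ) = (cAlpha α : ℂ) * ∫ θ in (0 : ℝ)..(2 * Real.pi),
      ((ker b θ ^ (-(α / 2)) : ℝ) : ℂ) * Complex.exp (-(n * (θ * Complex.I))) := by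
  have h1 := hasSum_Lam hα0 hα2 hb0 hb n hn
  have h2 := (hasSum_fourier_ker (α / 2) (by linarith) hb0 hb n).mul_left (cAlpha α : ℂ)
  have h3 := (Complex.hasSum_ofReal.2 h1)
  refine h3.unique (hasSum_of_eq h2 (fun l => ?_) rfl)
  push_cast
  ring

theorem continuous_ker_rpow {b : ℝ} (hb0 : 0 < b) (hb : b < 1) (r : ℝ) :
    Continuous fun θ => ker b θ ^ r := by
  refine Continuous.rpow_const ?_ fun θ => Or.inl (ker_pos hb0 hb θ).ne'
  unfold ker
  fun_prop

theorem mul_Lam_eq (hα0 : 0 < α) (hα2 : α < 2) {b : ℝ} (hb0 : 0 < b) (hb : b < 1) (n : ℕ)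
    (hn : 1 ≤ n) :
    b * Lam α n b = cAlpha α * ∫ θ in (0 : ℝ)..(2 * Real.pi),
      Real.cos (n * θ) * ker b θ ^ (-(α / 2)) := by
  have h1 := congrArg Complex.re (mul_Lam_eq_exp hα0 hα2 hb0 hb n hn)
  rw [Complex.ofReal_re, Complex.re_ofReal_mul] at h1
  rw [h1]
  congr 1
  have hc : Continuous fun θ : ℝ =>
      ((ker b θ ^ (-(α / 2)) : ℝ) : ℂ) * Complex.exp (-(n * (θ * Complex.I))) := by
    have := continuous_ker_rpow hb0 hb (-(α / 2))
    fun_prop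
  have h2 := (hc.intervalIntegrable (μ := volume) 0 (2 * Real.pi))
  have h3 := Complex.reCLM.intervalIntegral_comp_comm h2
  simp only [Complex.reCLM_apply] at h3
  rw [← h3]
  refine intervalIntegral.integral_congr fun θ _ => ?_
  rw [Complex.re_ofReal_mul, mul_comm]
  congr 1
  rw [show -((n : ℂ) * (θ * Complex.I)) = ((-(n * θ) : ℝ) : ℂ) * Complex.I by push_cast; ring,
    Complex.exp_ofReal_mul_I_re, Real.cos_neg]

end LamSeries

/-! ### The numbers `Θ_n` as Fourier coefficients of the singular kernel -/

section ThetaFourier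

variable {α : ℝ}

/-- The singular kernel `(2 sin (θ/2))^(-α)` on `(0, 2π)`. -/
def sker (α θ : ℝ) : ℝ := (2 * Real.sin (θ / 2)) ^ (-α)

theorem sin_half_pos {θ : ℝ} (h0 : 0 < θ) (h1 : θ < 2 * Real.pi) : 0 < Real.sin (θ / 2) :=
  Real.sin_pos_of_pos_of_lt_pi (by linarith) (by linarith)

theorem sin_half_nonneg {θ : ℝ} (h0 : 0 ≤ θ) (h1 : θ ≤ 2 * Real.pi) : 0 ≤ Real.sin (θ / 2) :=
  Real.sin_nonneg_of_nonneg_of_le_pi (by linarith) (by linarith)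

theorem sker_nonneg {θ : ℝ} (h0 : 0 ≤ θ) (h1 : θ ≤ 2 * Real.pi) : 0 ≤ sker α θ :=
  Real.rpow_nonneg (by have := sin_half_nonneg h0 h1; positivity) _

theorem measurable_sker (α : ℝ) : Measurable (sker α) := by
  unfold sker
  fun_prop

theorem ker_one (θ : ℝ) : ker 1 θ = (2 * Real.sin (θ / 2)) ^ 2 := by
  have h1 := Real.cos_sq_add_sin_sq (θ / 2)
  have h2 : Real.cos θ = 2 * Real.cos (θ / 2) ^ 2 - 1 := by
    rw [← Real.cos_two_mul]; congr 1; ring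
  rw [ker, h2]
  linear_combination (-4) * h1

theorem ker_eq (b θ : ℝ) : ker b θ = (1 - b) ^ 2 + b * (2 * Real.sin (θ / 2)) ^ 2 := by
  rw [← ker_one, ker, ker]; ring

theorem ker_one_rpow {θ : ℝ} (h0 : 0 ≤ θ) (h1 : θ ≤ 2 * Real.pi) :
    ker 1 θ ^ (-(α / 2)) = sker α θ := by
  have h2 : 0 ≤ 2 * Real.sin (θ / 2) := by have := sin_half_nonneg h0 h1; positivity
  rw [ker_one, sker, ← Real.rpow_natCast, ← Real.rpow_mul h2]
  congr 1; push_cast; ring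

theorem abs_sin_nat_mul_le (n : ℕ) (x : ℝ) : |Real.sin (n * x)| ≤ n * |Real.sin x| := by
  induction n with
  | zero => simp
  | succ n ih =>
    push_cast
    rw [add_mul, one_mul, Real.sin_add]
    have h1 := Real.abs_cos_le_one (n * x)
    have h2 := Real.abs_cos_le_one x
    calc |Real.sin (n * x) * Real.cos x + Real.cos (n * x) * Real.sin x|
        ≤ |Real.sin (n * x)| * |Real.cos x| + |Real.cos (n * x)| * |Real.sin x| := by
          rw [← abs_mul, ← abs_mul]; exact abs_add_le _ _
      _ ≤ n * |Real.sin x| * 1 + 1 * |Real.sin x| := by gcongr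
      _ = ((n : ℝ) + 1) * |Real.sin x| := by ring

theorem abs_one_sub_cos_nat_le (n : ℕ) (θ : ℝ) :
    |1 - Real.cos (n * θ)| ≤ 2 * (n : ℝ) ^ 2 * Real.sin (θ / 2) ^ 2 := by
  have h1 : 1 - Real.cos (n * θ) = 2 * Real.sin (n * (θ / 2)) ^ 2 := by
    have h2 := Real.cos_sq_add_sin_sq (n * (θ / 2))
    have h3 : Real.cos (n * θ) = 2 * Real.cos (n * (θ / 2)) ^ 2 - 1 := by
      rw [← Real.cos_two_mul]; congr 1; ring
    rw [h3]; linear_combination (-2) * h2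
  rw [h1, abs_mul, abs_pow, abs_two]
  have := abs_sin_nat_mul_le n (θ / 2)
  calc 2 * |Real.sin (n * (θ / 2))| ^ 2 ≤ 2 * (n * |Real.sin (θ / 2)|) ^ 2 := by gcongr
    _ = 2 * (n : ℝ) ^ 2 * Real.sin (θ / 2) ^ 2 := by rw [mul_pow, sq_abs]; ring

theorem abs_cos_sub_cos_nat_le (n : ℕ) (θ : ℝ) :
    |Real.cos θ - Real.cos (n * θ)| ≤ (n ^ 2 + 1) * (2 * Real.sin (θ / 2)) ^ 2 := by
  have h1 := abs_one_sub_cos_nat_le n θ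
  have h2 := abs_one_sub_cos_nat_le 1 θ
  rw [Nat.cast_one, one_mul] at h2
  have h3 : Real.cos θ - Real.cos (n * θ) = (1 - Real.cos (n * θ)) - (1 - Real.cos θ) := by ring
  rw [h3]
  have h4 := abs_sub (1 - Real.cos (n * θ)) (1 - Real.cos θ)
  have h5 := sq_nonneg (Real.sin (θ / 2))
  have h6 : 0 ≤ (n : ℝ) ^ 2 * Real.sin (θ / 2) ^ 2 := by positivity
  nlinarith

/-- A product of a function vanishing to second order with the singular kernel is bounded. -/
theorem sq_mul_sker_le {θ : ℝ} (hα2 : α < 2) (h0 : 0 ≤ θ) (h1 : θ ≤ 2 * Real.pi) :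
    (2 * Real.sin (θ / 2)) ^ 2 * sker α θ ≤ 2 ^ (2 - α) := by
  have h2 : 0 ≤ 2 * Real.sin (θ / 2) := by have := sin_half_nonneg h0 h1; positivity
  have h3 : 2 * Real.sin (θ / 2) ≤ 2 := by have := Real.sin_le_one (θ / 2); linarith
  rcases h2.eq_or_lt with h | h
  · rw [← h]; simp only [ne_eq, OfNat.ofNat_ne_zero, not_false_eq_true, zero_pow, zero_mul]
    positivity
  · rw [sker, ← Real.rpow_natCast, ← Real.rpow_add h]
    push_cast
    exact Real.rpow_le_rpow h2 h3 (by linarith)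

theorem tendsto_mul_Lam_sub (hα0 : 0 < α) (hα2 : α < 2) (n : ℕ) (hn : 1 ≤ n) :
    Tendsto (fun b => b * Lam α 1 b - b * Lam α n b) (𝓝[<] 1) (𝓝 (Theta α n)) := by
  set w : ℝ → ℝ := fun x => x ^ (α / 2) * (1 - x) ^ (-(α / 2)) with hw
  have hwint : IntervalIntegrable w volume 0 1 := by
    have := lam_weight_integrable hα0 hα2 1 le_rfl
    simpa [hw] using this
  set C : ℝ := 1 / ((2 : ℝ) ^ (1 - α) * Real.Gamma (1 - α / 2) ^ 2) with hC
  have hev : ∀ᶠ b in 𝓝[<] (1 : ℝ), b ∈ Ioo (0 : ℝ) 1 := Ioo_mem_nhdsLT zero_lt_one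
  have hbx : ∀ b ∈ Ioo (0 : ℝ) 1, ∀ x ∈ Ioc (0 : ℝ) 1, 0 < 1 - b ^ 2 * x := by
    intro b hb x hx
    have h1 : b ^ 2 < 1 := by nlinarith [hb.1, hb.2]
    nlinarith [hx.1, hx.2, sq_nonneg b]
  have hintg : ∀ b ∈ Ioo (0 : ℝ) 1, ∀ k : ℕ, 1 ≤ k → IntervalIntegrable (fun x =>
      x ^ ((k : ℝ) - 1 + α / 2) * (1 - x) ^ (-(α / 2)) * (1 - b ^ 2 * x) ^ (-(α / 2)))
      volume 0 1 := by
    intro b hb k hk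
    refine (lam_weight_integrable hα0 hα2 k hk).mul_continuousOn ?_
    rw [uIcc_of_le zero_le_one]
    refine ContinuousOn.rpow_const (by fun_prop) fun x hx => Or.inl ?_
    have h1 : b ^ 2 < 1 := by nlinarith [hb.1, hb.2]
    have : 0 < 1 - b ^ 2 * x := by nlinarith [hx.1, hx.2, sq_nonneg b]
    exact this.ne'
  have hform : ∀ b ∈ Ioo (0 : ℝ) 1, b * Lam α 1 b - b * Lam α n b =
      C * ∫ x in (0 : ℝ)..1, w x * ((b - b ^ n * x ^ (n - 1)) * (1 - b ^ 2 * x) ^ (-(α / 2))) := by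
    intro b hb
    have e1 : b * Lam α 1 b = C * ∫ x in (0 : ℝ)..1, b * (x ^ (((1 : ℕ) : ℝ) - 1 + α / 2)
        * (1 - x) ^ (-(α / 2)) * (1 - b ^ 2 * x) ^ (-(α / 2))) := by
      rw [intervalIntegral.integral_const_mul, Lam, hC]
      simp only [Nat.sub_self, pow_zero]; ring
    have e2 : b * Lam α n b = C * ∫ x in (0 : ℝ)..1, b ^ n * (x ^ ((n : ℝ) - 1 + α / 2)
        * (1 - x) ^ (-(α / 2)) * (1 - b ^ 2 * x) ^ (-(α / 2))) := by
      rw [intervalIntegral.integral_const_mul, Lam, hC]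
      obtain ⟨k, rfl⟩ := Nat.exists_eq_add_of_le' hn
      rw [Nat.add_sub_cancel, pow_succ]
      ring
    rw [e1, e2, ← mul_sub, ← intervalIntegral.integral_sub ((hintg b hb 1 le_rfl).const_mul _)
      ((hintg b hb n hn).const_mul _)]
    congr 1
    refine intervalIntegral.integral_congr_ae (Eventually.of_forall fun x hx => ?_)
    rw [uIoc_of_le zero_le_one] at hx
    have h1 : x ^ ((n : ℝ) - 1 + α / 2) = x ^ (α / 2) * x ^ (n - 1) := by
      rw [← Real.rpow_add_natCast hx.1.ne']
      congr 1
      push_cast [Nat.cast_sub hn]; ring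
    simp only [hw]
    rw [h1, Nat.cast_one, sub_self, zero_add]
    ring
  have htheta : Theta α n = C * ∫ x in (0 : ℝ)..1, w x * ((1 - x ^ (n - 1)) * (1 - x) ^ (-(α / 2))) := by
    rw [Theta, hC]
    congr 1
    refine intervalIntegral.integral_congr_ae ?_
    have hne : ∀ᵐ x : ℝ, x ≠ 1 := by
      simp [ae_iff]
    filter_upwards [hne] with x hx1 hx
    rw [uIoc_of_le zero_le_one] at hx
    have hlt : 0 < 1 - x := by
      have := lt_of_le_of_ne hx.2 hx1
      linarith
    have h1 : x ^ ((n : ℝ) - 1 + α / 2) = x ^ (α / 2) * x ^ (n - 1) := by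
      rw [← Real.rpow_add_natCast hx.1.ne']
      congr 1
      push_cast [Nat.cast_sub hn]; ring
    have h2 : (1 - x) ^ (-α) = (1 - x) ^ (-(α / 2)) * (1 - x) ^ (-(α / 2)) := by
      rw [← Real.rpow_add hlt]; congr 1; ring
    simp only [hw]
    rw [h1, h2]; ring
  rw [htheta]
  have hlim : Tendsto (fun b => C * ∫ x in (0 : ℝ)..1,
      w x * ((b - b ^ n * x ^ (n - 1)) * (1 - b ^ 2 * x) ^ (-(α / 2)))) (𝓝[<] 1)
      (𝓝 (C * ∫ x in (0 : ℝ)..1, w x * ((1 - x ^ (n - 1)) * (1 - x) ^ (-(α / 2))))) := by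
    refine Tendsto.const_mul C ?_
    refine intervalIntegral.tendsto_integral_filter_of_dominated_convergence
      (fun x => w x * n) ?_ ?_ (hwint.mul_const _) ?_
    · refine Eventually.of_forall fun b => ?_
      refine Measurable.aestronglyMeasurable ?_
      simp only [hw]
      fun_prop
    · filter_upwards [hev] with b hb
      refine Eventually.of_forall fun x hx => ?_
      rw [uIoc_of_le zero_le_one] at hx
      have hw0 : 0 ≤ w x := by
        have h1 : 0 ≤ 1 - x := by linarith [hx.2]
        have h2 := hx.1
        simp only [hw]; positivity
      have hp := hbx b hb x hx
      rw [norm_mul, Real.norm_of_nonneg hw0]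
      gcongr
      have hbx0 : 0 ≤ b * x := mul_nonneg hb.1.le hx.1.le
      have hbx1 : b * x ≤ 1 := by nlinarith [hb.1, hb.2, hx.1, hx.2]
      have hpow : 1 - (n - 1 : ℕ) * (1 - b * x) ≤ (b * x) ^ (n - 1) := by
        have := one_add_mul_le_pow (a := b * x - 1) (by linarith) (n - 1)
        rw [add_sub_cancel] at this
        linarith
      have hpow1 : (b * x) ^ (n - 1) ≤ 1 := pow_le_one₀ hbx0 hbx1
      have hfac : b - b ^ n * x ^ (n - 1) = b * (1 - (b * x) ^ (n - 1)) := by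
        obtain ⟨k, rfl⟩ := Nat.exists_eq_add_of_le' hn
        rw [Nat.add_sub_cancel, pow_succ, mul_pow]; ring
      have hcast : ((n - 1 : ℕ) : ℝ) ≤ n := by exact_mod_cast Nat.sub_le n 1
      have h1 : 0 ≤ b - b ^ n * x ^ (n - 1) := by
        rw [hfac]; exact mul_nonneg hb.1.le (by linarith)
      have h2 : b - b ^ n * x ^ (n - 1) ≤ n * (1 - b ^ 2 * x) := by
        rw [hfac]
        have h3 : 1 - b * x ≤ 1 - b ^ 2 * x := by nlinarith [hb.1, hb.2, hx.1]
        calc b * (1 - (b * x) ^ (n - 1)) ≤ 1 * ((n - 1 : ℕ) * (1 - b * x)) := by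
              apply mul_le_mul hb.2.le (by linarith) (by linarith) zero_le_one
          _ ≤ n * (1 - b ^ 2 * x) := by
              rw [one_mul]
              exact mul_le_mul hcast h3 (by linarith) (by positivity)
      rw [norm_mul, Real.norm_of_nonneg h1, Real.norm_of_nonneg (Real.rpow_nonneg hp.le _)]
      calc (b - b ^ n * x ^ (n - 1)) * (1 - b ^ 2 * x) ^ (-(α / 2))
          ≤ n * (1 - b ^ 2 * x) * (1 - b ^ 2 * x) ^ (-(α / 2)) := by
            gcongr
        _ = n * (1 - b ^ 2 * x) ^ (1 - α / 2) := by
            rw [mul_assoc]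
            congr 1
            rw [sub_eq_add_neg 1 (α / 2), Real.rpow_add hp, Real.rpow_one]
        _ ≤ n * 1 := by
            gcongr
            refine Real.rpow_le_one hp.le ?_ (by linarith)
            nlinarith [sq_nonneg b, hx.1]
        _ = n := mul_one _
    · have hne : ∀ᵐ x : ℝ, x ≠ 1 := by
        simp [ae_iff]
      filter_upwards [hne] with x hx1 hx
      rw [uIoc_of_le zero_le_one] at hx
      have hlt : 0 < 1 - x := by
        have := lt_of_le_of_ne hx.2 hx1
        linarith
      have hc : ContinuousAt (fun b : ℝ => w x * ((b - b ^ n * x ^ (n - 1)) *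
          (1 - b ^ 2 * x) ^ (-(α / 2)))) 1 := by
        refine continuousAt_const.mul (ContinuousAt.mul (by fun_prop) ?_)
        refine ContinuousAt.rpow_const (by fun_prop) (Or.inl ?_)
        rw [one_pow, one_mul]; exact hlt.ne'
      have h1 := hc.tendsto
      simp only [one_pow, one_mul] at h1
      exact h1.mono_left nhdsWithin_le_nhds
  refine hlim.congr' ?_
  filter_upwards [hev] with b hb
  rw [hform b hb]

/-- `Θ_n` in terms of the singular kernel `(2 sin (θ/2))^(-α)`. -/
theorem Theta_eq (hα0 : 0 < α) (hα2 : α < 2) (n : ℕ) (hn : 1 ≤ n) :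
    Theta α n = cAlpha α * ∫ θ in (0 : ℝ)..(2 * Real.pi),
      (Real.cos θ - Real.cos (n * θ)) * sker α θ := by
  have hpi := Real.pi_pos
  have hev : ∀ᶠ b in 𝓝[<] (1 : ℝ), b ∈ Ioo (1 / 2 : ℝ) 1 := Ioo_mem_nhdsLT (by norm_num)
  have hform : ∀ b ∈ Ioo (1 / 2 : ℝ) 1, b * Lam α 1 b - b * Lam α n b =
      cAlpha α * ∫ θ in (0 : ℝ)..(2 * Real.pi),
        (Real.cos θ - Real.cos (n * θ)) * ker b θ ^ (-(α / 2)) := by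
    intro b hb
    have hb0 : 0 < b := by linarith [hb.1]
    have hc := continuous_ker_rpow hb0 hb.2 (-(α / 2))
    rw [mul_Lam_eq hα0 hα2 hb0 hb.2 1 le_rfl, mul_Lam_eq hα0 hα2 hb0 hb.2 n hn, ← mul_sub,
      ← intervalIntegral.integral_sub]
    · congr 1
      refine intervalIntegral.integral_congr fun θ _ => ?_
      simp only [Nat.cast_one, one_mul]
      ring
    · exact Continuous.intervalIntegrable (by fun_prop) _ _
    · exact Continuous.intervalIntegrable (by fun_prop) _ _
  have hlim : Tendsto (fun b => cAlpha α * ∫ θ in (0 : ℝ)..(2 * Real.pi),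
        (Real.cos θ - Real.cos (n * θ)) * ker b θ ^ (-(α / 2))) (𝓝[<] 1)
      (𝓝 (cAlpha α * ∫ θ in (0 : ℝ)..(2 * Real.pi),
        (Real.cos θ - Real.cos (n * θ)) * sker α θ)) := by
    refine Tendsto.const_mul _ ?_
    refine intervalIntegral.tendsto_integral_filter_of_dominated_convergence
      (fun _ => (n ^ 2 + 1) * 2 ^ (2 - α) * (1 / 2) ^ (-(α / 2))) ?_ ?_ (by simp) ?_
    · refine Eventually.of_forall fun b => Measurable.aestronglyMeasurable ?_
      unfold ker
      fun_prop
    · filter_upwards [hev] with b hb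
      refine Eventually.of_forall fun θ hθ => ?_
      rw [uIoc_of_le (by positivity)] at hθ
      have hb0 : 0 < b := by linarith [hb.1]
      have hk := ker_pos hb0 hb.2 θ
      rw [norm_mul, Real.norm_eq_abs, Real.norm_of_nonneg (Real.rpow_nonneg hk.le _)]
      have h1 := abs_cos_sub_cos_nat_le n θ
      rcases hθ.2.eq_or_lt with h2pi | hlt
      · have h0 : |Real.cos θ - Real.cos (n * θ)| ≤ 0 := by
          refine h1.trans (le_of_eq ?_)
          rw [h2pi, show 2 * Real.pi / 2 = Real.pi by ring, Real.sin_pi]; simp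
        calc |Real.cos θ - Real.cos (n * θ)| * ker b θ ^ (-(α / 2))
            ≤ 0 * ker b θ ^ (-(α / 2)) := by gcongr
          _ ≤ _ := by rw [zero_mul]; positivity
      · have hs := sin_half_pos hθ.1 hlt
        have h2 : 1 / 2 * (2 * Real.sin (θ / 2)) ^ 2 ≤ ker b θ := by
          rw [ker_eq]
          nlinarith [sq_nonneg (1 - b), hb.1, sq_nonneg (2 * Real.sin (θ / 2))]
        have h3 : ker b θ ^ (-(α / 2)) ≤ (1 / 2) ^ (-(α / 2)) * sker α θ := by
          rw [← ker_one_rpow hθ.1.le hθ.2, ker_one, ← Real.mul_rpow (by norm_num) (by positivity)]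
          exact Real.rpow_le_rpow_of_nonpos (by positivity) h2 (by linarith)
        have h4 := sq_mul_sker_le hα2 hθ.1.le hθ.2
        have h5 := sker_nonneg (α := α) hθ.1.le hθ.2
        calc |Real.cos θ - Real.cos (n * θ)| * ker b θ ^ (-(α / 2))
            ≤ ((n ^ 2 + 1) * (2 * Real.sin (θ / 2)) ^ 2) * ((1 / 2) ^ (-(α / 2)) * sker α θ) := by
              gcongr
          _ = (n ^ 2 + 1) * ((2 * Real.sin (θ / 2)) ^ 2 * sker α θ) * (1 / 2) ^ (-(α / 2)) := by
              ring
          _ ≤ (n ^ 2 + 1) * 2 ^ (2 - α) * (1 / 2) ^ (-(α / 2)) := by gcongr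
    · have hne : ∀ᵐ x : ℝ, x ≠ 2 * Real.pi := by
        simp [ae_iff]
      filter_upwards [hne] with θ h2pi hθ
      rw [uIoc_of_le (by positivity)] at hθ
      have hs := sin_half_pos hθ.1 (lt_of_le_of_ne hθ.2 h2pi)
      rw [← ker_one_rpow hθ.1.le hθ.2]
      have hk : ker 1 θ ≠ 0 := by rw [ker_one]; positivity
      have hc : ContinuousAt (fun b : ℝ => (Real.cos θ - Real.cos (n * θ)) *
          ker b θ ^ (-(α / 2))) 1 := by
        refine continuousAt_const.mul (ContinuousAt.rpow_const ?_ (Or.inl hk))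
        unfold ker; fun_prop
      exact hc.tendsto.mono_left nhdsWithin_le_nhds
  refine tendsto_nhds_unique (tendsto_mul_Lam_sub hα0 hα2 n hn) (hlim.congr' ?_)
  filter_upwards [hev] with b hb
  rw [hform b hb]

end ThetaFourier

/-! ### Monotonicity and size of `Θ_n` and `Λ_n` -/

section Bounds

variable {α : ℝ}

theorem lamConst_pos (hα2 : α < 2) :
    0 < 1 / ((2 : ℝ) ^ (1 - α) * Real.Gamma (1 - α / 2) ^ 2) := by
  have := Real.Gamma_pos_of_pos (s := 1 - α / 2) (by linarith)
  positivity

theorem theta_integrable (hα0 : 0 < α) (hα2 : α < 2) (n : ℕ) (hn : 1 ≤ n) :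
    IntervalIntegrable (fun x : ℝ => (x ^ (α / 2) - x ^ ((n : ℝ) - 1 + α / 2)) * (1 - x) ^ (-α))
      volume 0 1 := by
  have h0 : IntervalIntegrable (fun x : ℝ => (n : ℝ) * (1 - x) ^ (1 - α)) volume 0 1 := by
    have h1 := (intervalIntegral.intervalIntegrable_rpow' (r := 1 - α) (a := 0) (b := 1)
      (by linarith)).comp_sub_left 1
    simp only [sub_zero, sub_self] at h1
    exact h1.symm.const_mul _
  refine h0.mono_fun (Measurable.aestronglyMeasurable (by fun_prop)) ?_
  have hne : ∀ᵐ x : ℝ, x ≠ 1 := by simp [ae_iff]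
  rw [EventuallyLE, ae_restrict_iff' measurableSet_uIoc]
  filter_upwards [hne] with x hx1 hx
  rw [uIoc_of_le zero_le_one] at hx
  have hlt : 0 < 1 - x := by
    have := lt_of_le_of_ne hx.2 hx1
    linarith
  have h1 : x ^ ((n : ℝ) - 1 + α / 2) = x ^ (α / 2) * x ^ (n - 1) := by
    rw [← Real.rpow_add_natCast hx.1.ne']
    congr 1
    push_cast [Nat.cast_sub hn]; ring
  have hb := one_add_mul_le_pow (a := x - 1) (by linarith [hx.1]) (n - 1)
  rw [add_sub_cancel] at hb
  have hle1 : x ^ (n - 1) ≤ 1 := pow_le_one₀ hx.1.le hx.2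
  have hs1 : x ^ (α / 2) ≤ 1 := Real.rpow_le_one hx.1.le hx.2 (by linarith)
  have hs0 : 0 ≤ x ^ (α / 2) := Real.rpow_nonneg hx.1.le _
  have hcast : ((n - 1 : ℕ) : ℝ) ≤ n := by exact_mod_cast Nat.sub_le n 1
  rw [h1, norm_mul, norm_mul, Real.norm_of_nonneg (Real.rpow_nonneg hlt.le _),
    Real.norm_of_nonneg (Real.rpow_nonneg hlt.le _), Real.norm_of_nonneg (Nat.cast_nonneg n),
    show x ^ (α / 2) - x ^ (α / 2) * x ^ (n - 1) = x ^ (α / 2) * (1 - x ^ (n - 1)) by ring,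
    Real.norm_of_nonneg (mul_nonneg hs0 (by linarith)), sub_eq_add_neg 1 α, Real.rpow_add hlt,
    Real.rpow_one, ← mul_assoc]
  refine mul_le_mul_of_nonneg_right ?_ (Real.rpow_nonneg hlt.le _)
  calc x ^ (α / 2) * (1 - x ^ (n - 1)) ≤ 1 * ((n - 1 : ℕ) * (1 - x)) := by
        apply mul_le_mul hs1 (by linarith) (by linarith) zero_le_one
    _ ≤ n * (1 - x) := by rw [one_mul]; gcongr

theorem Theta_one (α : ℝ) : Theta α 1 = 0 := by simp [Theta]

theorem Theta_lt (hα0 : 0 < α) (hα2 : α < 2) {n k : ℕ} (hn : 1 ≤ n) (hnk : n < k) :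
    Theta α n < Theta α k := by
  have h1 := theta_integrable hα0 hα2 n hn
  have h2 := theta_integrable hα0 hα2 k (hn.trans hnk.le)
  have hpos := lamConst_pos hα2
  have hnk' : (n : ℝ) < k := by exact_mod_cast hnk
  unfold Theta
  refine mul_lt_mul_of_pos_left ?_ hpos
  rw [← sub_pos, ← intervalIntegral.integral_sub h2 h1]
  refine intervalIntegral.intervalIntegral_pos_of_pos_on (h2.sub h1) (fun x hx => ?_) zero_lt_one
  have h3 : x ^ ((k : ℝ) - 1 + α / 2) < x ^ ((n : ℝ) - 1 + α / 2) :=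
    Real.rpow_lt_rpow_of_exponent_gt hx.1 hx.2 (by linarith)
  have h4 : 0 < (1 - x) ^ (-α) := Real.rpow_pos_of_pos (by linarith [hx.2]) _
  rw [← sub_mul]
  exact mul_pos (by linarith) h4

theorem Theta_pos (hα0 : 0 < α) (hα2 : α < 2) {n : ℕ} (hn : 2 ≤ n) : 0 < Theta α n := by
  rw [← Theta_one α]
  exact Theta_lt hα0 hα2 le_rfl hn

theorem Theta_mono (hα0 : 0 < α) (hα2 : α < 2) {n k : ℕ} (hn : 1 ≤ n) (hnk : n ≤ k) :
    Theta α n ≤ Theta α k := by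
  rcases hnk.eq_or_lt with h | h
  · rw [h]
  · exact (Theta_lt hα0 hα2 hn h).le

theorem one_sub_pow_ge {y : ℝ} (h0 : 0 ≤ y) (h1 : y ≤ 1) (k : ℕ) :
    1 / 2 * min 1 (k * y) ≤ 1 - (1 - y) ^ k := by
  have hk : 0 ≤ k * y := by positivity
  have h2 : (1 - y) ^ k * (1 + k * y) ≤ 1 := by
    have h3 := one_add_mul_le_pow (a := y) (by linarith) k
    calc (1 - y) ^ k * (1 + k * y) ≤ (1 - y) ^ k * (1 + y) ^ k := by
          gcongr
      _ = (1 - y ^ 2) ^ k := by rw [← mul_pow]; ring_nf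
      _ ≤ 1 := pow_le_one₀ (by nlinarith) (by nlinarith)
  have h4 : (1 - y) ^ k ≤ 1 := pow_le_one₀ (by linarith) (by linarith)
  have h5 : 0 ≤ (1 - y) ^ k := pow_nonneg (by linarith) _
  rcases le_total 1 (k * y) with h | h
  · rw [min_eq_left h]; nlinarith
  · rw [min_eq_right h]; nlinarith

/-- A lower bound for `Θ_n` of the order of its growth as `n → ∞`. -/
theorem Theta_ge (hα0 : 0 < α) (hα2 : α < 2) (n : ℕ) (hn : 1 ≤ n) :
    IntervalIntegrable (fun y : ℝ => min 1 ((n - 1 : ℕ) * y) * y ^ (-α)) volume 0 (1 / 2) ∧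
    1 / ((2 : ℝ) ^ (1 - α) * Real.Gamma (1 - α / 2) ^ 2) * (1 / 4) *
      ∫ y in (0 : ℝ)..(1 / 2), min 1 ((n - 1 : ℕ) * y) * y ^ (-α) ≤ Theta α n := by
  have hpos := lamConst_pos hα2
  set k := n - 1 with hk
  have hint : IntervalIntegrable (fun y : ℝ => min 1 ((k : ℕ) * y) * y ^ (-α)) volume 0 (1 / 2) := by
    have h1 : IntervalIntegrable (fun y : ℝ => (k : ℝ) * y ^ (1 - α)) volume 0 (1 / 2) :=
      (intervalIntegral.intervalIntegrable_rpow' (by linarith)).const_mul _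
    refine h1.mono_fun (Measurable.aestronglyMeasurable (by fun_prop)) ?_
    rw [EventuallyLE, ae_restrict_iff' measurableSet_uIoc]
    refine Eventually.of_forall fun y hy => ?_
    rw [uIoc_of_le (by norm_num)] at hy
    have hy0 := hy.1
    rw [norm_mul, norm_mul, Real.norm_of_nonneg (Real.rpow_nonneg hy0.le _),
      Real.norm_of_nonneg (Real.rpow_nonneg hy0.le _), Real.norm_of_nonneg (by positivity),
      Real.norm_of_nonneg (by positivity), sub_eq_add_neg 1 α, Real.rpow_add hy0, Real.rpow_one,
      ← mul_assoc]
    gcongr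
    exact min_le_right _ _
  refine ⟨hint, ?_⟩
  set f : ℝ → ℝ := fun x => (x ^ (α / 2) - x ^ ((n : ℝ) - 1 + α / 2)) * (1 - x) ^ (-α) with hf
  have hfi : IntervalIntegrable f volume 0 1 := theta_integrable hα0 hα2 n hn
  have hfi' : IntervalIntegrable (fun y => f (1 - y)) volume 0 1 := by
    have := hfi.comp_sub_left 1
    simp only [sub_zero, sub_self] at this
    exact this.symm
  have hsub : ∫ y in (0 : ℝ)..1, f (1 - y) = ∫ x in (0 : ℝ)..1, f x := by
    rw [intervalIntegral.integral_comp_sub_left]; simp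
  have hpt : ∀ y ∈ Ioo (0 : ℝ) 1, f (1 - y) = (1 - y) ^ (α / 2) * (1 - (1 - y) ^ k) * y ^ (-α) := by
    intro y hy
    have h0 : 0 < 1 - y := by linarith [hy.2]
    have h1 : (1 - y) ^ ((n : ℝ) - 1 + α / 2) = (1 - y) ^ (α / 2) * (1 - y) ^ k := by
      rw [← Real.rpow_add_natCast h0.ne', hk]
      congr 1
      push_cast [Nat.cast_sub hn]; ring
    simp only [hf]
    rw [h1, sub_sub_cancel]; ring
  have hnn : ∀ y ∈ Ioo (0 : ℝ) 1, 0 ≤ f (1 - y) := by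
    intro y hy
    rw [hpt y hy]
    have h0 : 0 < 1 - y := by linarith [hy.2]
    have h1 : (1 - y) ^ k ≤ 1 := pow_le_one₀ h0.le (by linarith [hy.1])
    have h2 := hy.1
    have h3 : 0 ≤ 1 - (1 - y) ^ k := by linarith
    positivity
  have h1 : ∫ y in (0 : ℝ)..(1 / 2), 1 / 4 * (min 1 ((k : ℕ) * y) * y ^ (-α))
      ≤ ∫ y in (0 : ℝ)..(1 / 2), f (1 - y) := by
    refine intervalIntegral.integral_mono_on_of_le_Ioo (by norm_num) (hint.const_mul _)
      (hfi'.mono_set ?_) fun y hy => ?_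
    · rw [uIcc_of_le (by norm_num), uIcc_of_le zero_le_one]
      exact Icc_subset_Icc le_rfl (by norm_num)
    · rw [hpt y ⟨hy.1, by linarith [hy.2]⟩, ← mul_assoc]
      have hy0 := hy.1
      have hy2 := hy.2
      have h0 : 1 / 2 ≤ 1 - y := by linarith
      have h2 := one_sub_pow_ge hy.1.le (by linarith) k
      have h3 : 1 / 2 ≤ (1 - y) ^ (α / 2) := by
        calc (1 / 2 : ℝ) ≤ 1 - y := h0
          _ = (1 - y) ^ (1 : ℝ) := (Real.rpow_one _).symm
          _ ≤ (1 - y) ^ (α / 2) :=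
              Real.rpow_le_rpow_of_exponent_ge (by linarith) (by linarith) (by linarith)
      have h4 : 0 ≤ min 1 ((k : ℝ) * y) := by positivity
      have h5 : 0 ≤ y ^ (-α) := Real.rpow_nonneg hy0.le _
      refine mul_le_mul_of_nonneg_right ?_ h5
      calc 1 / 4 * min 1 ((k : ℝ) * y) = 1 / 2 * (1 / 2 * min 1 ((k : ℝ) * y)) := by ring
        _ ≤ _ := mul_le_mul h3 h2 (by positivity) (by linarith)
  have h2 : ∫ y in (0 : ℝ)..(1 / 2), f (1 - y) ≤ ∫ y in (0 : ℝ)..1, f (1 - y) := by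
    refine intervalIntegral.integral_mono_interval le_rfl (by norm_num) (by norm_num) ?_ hfi'
    have hne : ∀ᵐ x : ℝ, x ≠ 1 := by simp [ae_iff]
    rw [EventuallyLE, ae_restrict_iff' measurableSet_Ioc]
    filter_upwards [hne] with y hy1 hy
    exact hnn y ⟨hy.1, lt_of_le_of_ne hy.2 hy1⟩
  rw [intervalIntegral.integral_const_mul] at h1
  rw [Theta, mul_assoc]
  refine mul_le_mul_of_nonneg_left ?_ hpos.le
  exact (h1.trans h2).trans hsub.le

theorem norm_exp_sub_one_le (l : ℤ) (θ : ℝ) :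
    ‖Complex.exp (l * (θ * Complex.I)) - 1‖ ≤ 2 ∧
    ‖Complex.exp (l * (θ * Complex.I)) - 1‖ ≤ |(l : ℝ)| * |2 * Real.sin (θ / 2)| := by
  have h0 : (l : ℂ) * (θ * Complex.I) = Complex.I * ((l * θ : ℝ) : ℂ) := by push_cast; ring
  rw [h0, Complex.norm_exp_I_mul_ofReal_sub_one]
  have h1 := Real.abs_sin_le_one (l * θ / 2)
  rw [Real.norm_eq_abs, abs_mul, abs_two]
  refine ⟨by linarith, ?_⟩
  have h2 : |Real.sin (l * θ / 2)| ≤ |(l : ℝ)| * |Real.sin (θ / 2)| := by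
    have h3 := abs_sin_nat_mul_le l.natAbs (θ / 2)
    have h4 : ((l.natAbs : ℕ) : ℝ) = |(l : ℝ)| := by
      rw [Nat.cast_natAbs]; push_cast; rfl
    rw [h4] at h3
    refine le_trans (le_of_eq ?_) h3
    rcases abs_choice (l : ℝ) with h | h
    · rw [h]; congr 2; ring
    · rw [h, neg_mul, Real.sin_neg, abs_neg]; congr 2; ring
  rw [abs_mul, abs_two]
  linarith

/-- The `L¹` norm of `(e^{ilθ} - 1)` against the singular kernel is controlled by `Θ_n`, with a
constant independent of the frequency. -/
theorem exists_expDiff_bound (hα0 : 0 < α) (hα2 : α < 2) : ∃ C : ℝ, 0 < C ∧ ∀ n : ℕ, 2 ≤ n →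
    ∀ l : ℤ, |(l : ℝ)| ≤ n + 1 →
      IntervalIntegrable (fun θ : ℝ => ‖Complex.exp (l * (θ * Complex.I)) - 1‖ * sker α θ)
        volume 0 (2 * Real.pi) ∧
      ∫ θ in (0 : ℝ)..(2 * Real.pi), ‖Complex.exp (l * (θ * Complex.I)) - 1‖ * sker α θ
        ≤ C * Theta α n := by
  have hpos := lamConst_pos hα2
  have hpi := Real.pi_pos
  set c₀ := 1 / ((2 : ℝ) ^ (1 - α) * Real.Gamma (1 - α / 2) ^ 2) * (1 / 4) with hc₀
  have hc₀pos : 0 < c₀ := by positivity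
  set A : ℝ := 8 ^ (-α) * (12 * Real.pi) with hA
  have hApos : 0 < A := by positivity
  refine ⟨2 * (4 * Real.pi * A) / c₀, by positivity, fun n hn l hl => ?_⟩
  obtain ⟨hint, hge⟩ := Theta_ge hα0 hα2 n (by omega)
  set k : ℕ := n - 1 with hk
  have hk1 : (1 : ℝ) ≤ k := by exact_mod_cast (by omega : 1 ≤ k)
  have hnk : (n : ℝ) = k + 1 := by rw [hk]; push_cast [Nat.cast_sub (by omega : 1 ≤ n)]; ring
  set ψ : ℝ → ℝ := fun θ => A * (min 1 (k * (θ / (4 * Real.pi))) * (θ / (4 * Real.pi)) ^ (-α))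
    with hψ
  have hψint : IntervalIntegrable ψ volume 0 (2 * Real.pi) := by
    have h1 := (hint.comp_mul_right (c := (4 * Real.pi)⁻¹)).const_mul A
    rw [zero_div, show (1 / 2 : ℝ) / (4 * Real.pi)⁻¹ = 2 * Real.pi by field_simp; ring] at h1
    exact h1
  have hψval : ∫ θ in (0 : ℝ)..(2 * Real.pi), ψ θ = 4 * Real.pi * A *
      ∫ y in (0 : ℝ)..(1 / 2), min 1 ((k : ℕ) * y) * y ^ (-α) := by
    simp only [hψ]
    rw [intervalIntegral.integral_const_mul,
      intervalIntegral.integral_comp_div (fun y => min 1 ((k : ℕ) * y) * y ^ (-α)) (by positivity)]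
    rw [zero_div, show 2 * Real.pi / (4 * Real.pi) = 1 / 2 by field_simp; norm_num, smul_eq_mul]
    ring
  have hψnn : ∀ θ, 0 ≤ θ → 0 ≤ ψ θ := by
    intro θ hθ
    simp only [hψ]
    positivity
  -- the bound by `ψ` at the singularity `θ = 0`
  have hleft : ∀ θ ∈ Ioc (0 : ℝ) Real.pi,
      min 2 (|(l : ℝ)| * (2 * Real.sin (θ / 2))) * sker α θ ≤ ψ θ := by
    intro θ hθ
    have hθ0 := hθ.1
    have hsin : θ / Real.pi ≤ Real.sin (θ / 2) := by
      have := Real.mul_le_sin (x := θ / 2) (by linarith) (by linarith [hθ.2])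
      calc θ / Real.pi = 2 / Real.pi * (θ / 2) := by field_simp
        _ ≤ _ := this
    have hsin' : Real.sin (θ / 2) ≤ θ / 2 := Real.sin_le (by linarith)
    have hspos : 0 < Real.sin (θ / 2) := sin_half_pos hθ0 (by linarith [hθ.2])
    set y := θ / (4 * Real.pi) with hy
    have hypos : 0 < y := by positivity
    have hθy : θ = 4 * Real.pi * y := by rw [hy]; field_simp
    have h1 : sker α θ ≤ 8 ^ (-α) * y ^ (-α) := by
      rw [sker, ← Real.mul_rpow (by norm_num) hypos.le]
      refine Real.rpow_le_rpow_of_nonpos (by positivity) ?_ (by linarith)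
      calc 8 * y = 2 * (θ / Real.pi) := by rw [hθy]; field_simp; ring
        _ ≤ 2 * Real.sin (θ / 2) := by linarith
    have h2 : min 2 (|(l : ℝ)| * (2 * Real.sin (θ / 2))) ≤ 12 * Real.pi * min 1 (k * y) := by
      have hpi3 := Real.pi_gt_three
      rcases le_total 1 (k * y) with h | h
      · rw [min_eq_left h]
        exact (min_le_left _ _).trans (by linarith)
      · rw [min_eq_right h]
        refine (min_le_right _ _).trans ?_
        calc |(l : ℝ)| * (2 * Real.sin (θ / 2)) ≤ (3 * k) * θ := by
              apply mul_le_mul (by linarith) (by linarith) (by positivity) (by positivity)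
          _ = 12 * Real.pi * (k * y) := by rw [hθy]; ring
    have h3 : 0 ≤ sker α θ := sker_nonneg hθ0.le (by linarith [hθ.2])
    calc min 2 (|(l : ℝ)| * (2 * Real.sin (θ / 2))) * sker α θ
        ≤ (12 * Real.pi * min 1 (k * y)) * (8 ^ (-α) * y ^ (-α)) := by
          apply mul_le_mul h2 h1 h3 (by positivity)
      _ = ψ θ := by simp only [hψ, hA]; ring
  have hrefl : ∀ θ, Real.sin ((2 * Real.pi - θ) / 2) = Real.sin (θ / 2) := by
    intro θ
    rw [show (2 * Real.pi - θ) / 2 = Real.pi - θ / 2 by ring, Real.sin_pi_sub]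
  have hpt : ∀ θ ∈ Ioo (0 : ℝ) (2 * Real.pi),
      ‖Complex.exp (l * (θ * Complex.I)) - 1‖ * sker α θ ≤ ψ θ + ψ (2 * Real.pi - θ) := by
    intro θ hθ
    have hs := sin_half_pos hθ.1 hθ.2
    have h0 : 0 ≤ sker α θ := sker_nonneg hθ.1.le hθ.2.le
    obtain ⟨h1, h2⟩ := norm_exp_sub_one_le l θ
    rw [abs_of_pos (show 0 < 2 * Real.sin (θ / 2) by positivity)] at h2
    have h3 : ‖Complex.exp (l * (θ * Complex.I)) - 1‖ * sker α θ
        ≤ min 2 (|(l : ℝ)| * (2 * Real.sin (θ / 2))) * sker α θ := by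
      gcongr
      exact le_min h1 h2
    refine h3.trans ?_
    rcases le_total θ Real.pi with h | h
    · have := hψnn (2 * Real.pi - θ) (by linarith [hθ.2])
      linarith [hleft θ ⟨hθ.1, h⟩]
    · have h4 := hleft (2 * Real.pi - θ) ⟨by linarith [hθ.2], by linarith⟩
      have h5 : sker α (2 * Real.pi - θ) = sker α θ := by rw [sker, sker, hrefl]
      rw [hrefl, h5] at h4
      have := hψnn θ hθ.1.le
      linarith
  have hψint' : IntervalIntegrable (fun θ => ψ (2 * Real.pi - θ)) volume 0 (2 * Real.pi) := by
    have := hψint.comp_sub_left (2 * Real.pi)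
    simp only [sub_zero, sub_self] at this
    exact this.symm
  have hfin : IntervalIntegrable
      (fun θ : ℝ => ‖Complex.exp (l * (θ * Complex.I)) - 1‖ * sker α θ)
      volume 0 (2 * Real.pi) := by
    refine (hψint.add hψint').mono_fun (Measurable.aestronglyMeasurable ?_) ?_
    · have := measurable_sker α
      fun_prop
    · have hne : ∀ᵐ x : ℝ, x ≠ 2 * Real.pi := by simp [ae_iff]
      rw [EventuallyLE, ae_restrict_iff' measurableSet_uIoc]
      filter_upwards [hne] with θ hθ1 hθ
      rw [uIoc_of_le (by positivity)] at hθ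
      have h1 := hpt θ ⟨hθ.1, lt_of_le_of_ne hθ.2 hθ1⟩
      have h0 : 0 ≤ sker α θ := sker_nonneg hθ.1.le hθ.2
      rw [Real.norm_of_nonneg (by positivity)]
      exact h1.trans (le_abs_self _)
  refine ⟨hfin, ?_⟩
  have hsub : ∫ θ in (0 : ℝ)..(2 * Real.pi), ψ (2 * Real.pi - θ)
      = ∫ θ in (0 : ℝ)..(2 * Real.pi), ψ θ := by
    rw [intervalIntegral.integral_comp_sub_left]; simp
  have h1 := intervalIntegral.integral_mono_on_of_le_Ioo (by positivity) hfin (hψint.add hψint') hpt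
  rw [intervalIntegral.integral_add hψint hψint', hsub, hψval] at h1
  refine h1.trans ?_
  have h2 : ∫ y in (0 : ℝ)..(1 / 2), min 1 ((k : ℕ) * y) * y ^ (-α) ≤ Theta α n / c₀ := by
    rw [le_div_iff₀ hc₀pos, mul_comm]
    exact hge
  calc 4 * Real.pi * A * (∫ y in (0 : ℝ)..(1 / 2), min 1 ((k : ℕ) * y) * y ^ (-α))
      + 4 * Real.pi * A * (∫ y in (0 : ℝ)..(1 / 2), min 1 ((k : ℕ) * y) * y ^ (-α))
      = 2 * (4 * Real.pi * A) * (∫ y in (0 : ℝ)..(1 / 2), min 1 ((k : ℕ) * y) * y ^ (-α)) := by ring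
    _ ≤ 2 * (4 * Real.pi * A) * (Theta α n / c₀) := by gcongr
    _ = 2 * (4 * Real.pi * A) / c₀ * Theta α n := by ring

end Bounds

section LamMono

variable {α : ℝ}

theorem lam_integrable (hα0 : 0 < α) (hα2 : α < 2) {b : ℝ} (hb0 : 0 < b) (hb1 : b < 1) (n : ℕ)
    (hn : 1 ≤ n) : IntervalIntegrable (fun x =>
      x ^ ((n : ℝ) - 1 + α / 2) * (1 - x) ^ (-(α / 2)) * (1 - b ^ 2 * x) ^ (-(α / 2)))
      volume 0 1 := by
  refine (lam_weight_integrable hα0 hα2 n hn).mul_continuousOn ?_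
  rw [uIcc_of_le zero_le_one]
  refine ContinuousOn.rpow_const (by fun_prop) fun x hx => Or.inl ?_
  have h1 : b ^ 2 < 1 := by nlinarith
  have : 0 < 1 - b ^ 2 * x := by nlinarith [hx.1, hx.2, sq_nonneg b]
  exact this.ne'

theorem one_sub_sq_mul_pos {b x : ℝ} (hb0 : 0 < b) (hb1 : b < 1) (hx : x ∈ Ioo (0 : ℝ) 1) :
    0 < 1 - b ^ 2 * x := by
  have h1 : b ^ 2 < 1 := by nlinarith
  nlinarith [hx.1, hx.2, sq_nonneg b]

theorem Lam_pos (hα0 : 0 < α) (hα2 : α < 2) {b : ℝ} (hb0 : 0 < b) (hb1 : b < 1) (n : ℕ)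
    (hn : 1 ≤ n) : 0 < Lam α n b := by
  have hpos := lamConst_pos hα2
  have h2 : 0 < b ^ (n - 1) := pow_pos hb0 _
  rw [Lam, div_eq_mul_one_div]
  refine mul_pos (mul_pos h2 hpos) ?_
  refine intervalIntegral.intervalIntegral_pos_of_pos_on (lam_integrable hα0 hα2 hb0 hb1 n hn)
    (fun x hx => ?_) zero_lt_one
  have h3 := one_sub_sq_mul_pos hb0 hb1 hx
  have h4 : 0 < 1 - x := by linarith [hx.2]
  have h5 := hx.1
  positivity

theorem Lam_mono (hα0 : 0 < α) (hα2 : α < 2) (n : ℕ) (hn : 1 ≤ n) :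
    MonotoneOn (Lam α n) (Ioo 0 1) := by
  intro b hb b' hb' hbb
  have hpos := lamConst_pos hα2
  rw [Lam, Lam, div_eq_mul_one_div, div_eq_mul_one_div (b' ^ (n - 1))]
  have hb0 := hb.1
  have h1 : ∫ x in (0 : ℝ)..1,
      x ^ ((n : ℝ) - 1 + α / 2) * (1 - x) ^ (-(α / 2)) * (1 - b ^ 2 * x) ^ (-(α / 2)) ≤
      ∫ x in (0 : ℝ)..1,
      x ^ ((n : ℝ) - 1 + α / 2) * (1 - x) ^ (-(α / 2)) * (1 - b' ^ 2 * x) ^ (-(α / 2)) := by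
    refine intervalIntegral.integral_mono_on_of_le_Ioo zero_le_one
      (lam_integrable hα0 hα2 hb.1 hb.2 n hn) (lam_integrable hα0 hα2 hb'.1 hb'.2 n hn)
      fun x hx => ?_
    have h3 := one_sub_sq_mul_pos hb'.1 hb'.2 hx
    have h4 : 0 < 1 - x := by linarith [hx.2]
    have h5 := hx.1
    refine mul_le_mul_of_nonneg_left ?_ (by positivity)
    refine Real.rpow_le_rpow_of_nonpos h3 ?_ (by linarith)
    gcongr
  have h2 : 0 ≤ ∫ x in (0 : ℝ)..1,
      x ^ ((n : ℝ) - 1 + α / 2) * (1 - x) ^ (-(α / 2)) * (1 - b ^ 2 * x) ^ (-(α / 2)) := by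
    have h3 := Lam_pos hα0 hα2 hb.1 hb.2 n hn
    rw [Lam, div_eq_mul_one_div] at h3
    exact (pos_of_mul_pos_right h3 (by positivity)).le
  exact mul_le_mul (mul_le_mul_of_nonneg_right (pow_le_pow_left₀ hb0.le hbb _) hpos.le) h1 h2
    (mul_nonneg (pow_nonneg hb'.1.le _) hpos.le)

theorem Lam_anti (hα0 : 0 < α) (hα2 : α < 2) {b : ℝ} (hb0 : 0 < b) (hb1 : b < 1) {n k : ℕ}
    (hn : 1 ≤ n) (hnk : n ≤ k) : Lam α k b ≤ Lam α n b := by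
  have hpos := lamConst_pos hα2
  rw [Lam, Lam, div_eq_mul_one_div, div_eq_mul_one_div (b ^ (n - 1))]
  have hnk' : (n : ℝ) ≤ k := by exact_mod_cast hnk
  have h1 : ∫ x in (0 : ℝ)..1,
      x ^ ((k : ℝ) - 1 + α / 2) * (1 - x) ^ (-(α / 2)) * (1 - b ^ 2 * x) ^ (-(α / 2)) ≤
      ∫ x in (0 : ℝ)..1,
      x ^ ((n : ℝ) - 1 + α / 2) * (1 - x) ^ (-(α / 2)) * (1 - b ^ 2 * x) ^ (-(α / 2)) := by
    refine intervalIntegral.integral_mono_on_of_le_Ioo zero_le_one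
      (lam_integrable hα0 hα2 hb0 hb1 k (hn.trans hnk)) (lam_integrable hα0 hα2 hb0 hb1 n hn)
      fun x hx => ?_
    have h3 := one_sub_sq_mul_pos hb0 hb1 hx
    have h4 : 0 < 1 - x := by linarith [hx.2]
    have h5 := hx.1
    have h6 : x ^ ((k : ℝ) - 1 + α / 2) ≤ x ^ ((n : ℝ) - 1 + α / 2) :=
      Real.rpow_le_rpow_of_exponent_ge hx.1 hx.2.le (by linarith)
    gcongr
  have h2 : 0 ≤ ∫ x in (0 : ℝ)..1,
      x ^ ((k : ℝ) - 1 + α / 2) * (1 - x) ^ (-(α / 2)) * (1 - b ^ 2 * x) ^ (-(α / 2)) := by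
    have h3 := Lam_pos hα0 hα2 hb0 hb1 k (hn.trans hnk)
    rw [Lam, div_eq_mul_one_div] at h3
    exact (pos_of_mul_pos_right h3 (by positivity)).le
  refine mul_le_mul (mul_le_mul_of_nonneg_right ?_ hpos.le) h1 h2
    (mul_nonneg (pow_nonneg hb0.le _) hpos.le)
  exact pow_le_pow_of_le_one hb0.le hb1.le (by omega)

/-- Differences of Fourier coefficients of the kernel, normalized to the mean radius, increase
with the inner radius: this is the positivity of the first minus the `n`-th Fourier coefficient of
an even function decreasing on `(0, π)`. -/
theorem integral_cos_sub_cos_mono (hα0 : 0 < α) (n : ℕ) (hn : 1 ≤ n) {ε ε' : ℝ}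
    (hε' : 0 < ε') (hεε : ε' ≤ ε) :
    ∫ θ in (0 : ℝ)..(2 * Real.pi),
        (Real.cos θ - Real.cos (n * θ)) * (ε + 2 - 2 * Real.cos θ) ^ (-(α / 2)) ≤
    ∫ θ in (0 : ℝ)..(2 * Real.pi),
        (Real.cos θ - Real.cos (n * θ)) * (ε' + 2 - 2 * Real.cos θ) ^ (-(α / 2)) := by
  have hpi := Real.pi_pos
  have hn0 : (0 : ℝ) < n := by exact_mod_cast hn
  have hpos : ∀ e : ℝ, 0 < e → ∀ θ, 0 < e + 2 - 2 * Real.cos θ := fun e he θ => by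
    have := Real.cos_le_one θ; linarith
  have hε : 0 < ε := hε'.trans_le hεε
  have hcont : ∀ e : ℝ, 0 < e → ∀ r : ℝ, Continuous fun θ => (e + 2 - 2 * Real.cos θ) ^ r :=
    fun e he r => Continuous.rpow_const (by fun_prop) fun θ => Or.inl (hpos e he θ).ne'
  have hc1 := hcont ε hε (-(α / 2))
  have hc2 := hcont ε' hε' (-(α / 2))
  have hc3 := hcont ε hε (-(α / 2) - 1)
  have hc4 := hcont ε' hε' (-(α / 2) - 1)
  have hder : ∀ e : ℝ, 0 < e → ∀ θ, HasDerivAt (fun θ => (e + 2 - 2 * Real.cos θ) ^ (-(α / 2)))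
      (2 * Real.sin θ * (-(α / 2)) * (e + 2 - 2 * Real.cos θ) ^ (-(α / 2) - 1)) θ := by
    intro e he θ
    have h1 : HasDerivAt (fun θ => e + 2 - 2 * Real.cos θ) (2 * Real.sin θ) θ := by
      have := ((Real.hasDerivAt_cos θ).const_mul 2).const_sub (e + 2)
      exact this.congr_deriv (by ring)
    exact h1.rpow_const (Or.inl (hpos e he θ).ne')
  set u : ℝ → ℝ := fun θ => (ε' + 2 - 2 * Real.cos θ) ^ (-(α / 2))
    - (ε + 2 - 2 * Real.cos θ) ^ (-(α / 2)) with hu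
  set u' : ℝ → ℝ := fun θ => 2 * Real.sin θ * (-(α / 2)) * (ε' + 2 - 2 * Real.cos θ) ^ (-(α / 2) - 1)
    - 2 * Real.sin θ * (-(α / 2)) * (ε + 2 - 2 * Real.cos θ) ^ (-(α / 2) - 1) with hu'
  set v : ℝ → ℝ := fun θ => Real.sin θ - (n : ℝ)⁻¹ * Real.sin (n * θ) with hv
  set v' : ℝ → ℝ := fun θ => Real.cos θ - Real.cos (n * θ) with hv'
  have hud : ∀ θ ∈ uIcc 0 (2 * Real.pi), HasDerivAt u (u' θ) θ := fun θ _ =>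
    (hder ε' hε' θ).sub (hder ε hε θ)
  have hvd : ∀ θ ∈ uIcc 0 (2 * Real.pi), HasDerivAt v (v' θ) θ := by
    intro θ _
    have h1 : HasDerivAt (fun θ => Real.sin (n * θ)) (Real.cos (n * θ) * n) θ := by
      exact (((hasDerivAt_id θ).const_mul (n : ℝ)).sin).congr_deriv (by simp)
    have h2 := (Real.hasDerivAt_sin θ).sub (h1.const_mul (n : ℝ)⁻¹)
    exact h2.congr_deriv (by simp only [hv']; field_simp)
  have hparts := intervalIntegral.integral_mul_deriv_eq_deriv_mul hud hvd
    (Continuous.intervalIntegrable (by simp only [hu']; fun_prop) _ _)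
    (Continuous.intervalIntegrable (by simp only [hv']; fun_prop) _ _)
  have hv0 : v 0 = 0 := by simp [hv]
  have hv1 : v (2 * Real.pi) = 0 := by
    have : Real.sin ((n : ℝ) * (2 * Real.pi)) = 0 := by
      rw [Real.sin_eq_zero_iff]; exact ⟨2 * n, by push_cast; ring⟩
    simp [hv, this]
  rw [hv0, hv1, mul_zero, mul_zero, sub_zero, zero_sub] at hparts
  have hneg : ∫ θ in (0 : ℝ)..(2 * Real.pi), u' θ * v θ ≤ 0 := by
    rw [← neg_nonneg, ← intervalIntegral.integral_neg]
    refine intervalIntegral.integral_nonneg (by positivity) fun θ _ => ?_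
    have h1 : (ε + 2 - 2 * Real.cos θ) ^ (-(α / 2) - 1) ≤ (ε' + 2 - 2 * Real.cos θ) ^ (-(α / 2) - 1) :=
      Real.rpow_le_rpow_of_nonpos (hpos ε' hε' θ) (by linarith) (by linarith)
    have h2 : 0 ≤ Real.sin θ * v θ := by
      have h3 := abs_sin_nat_mul_le n θ
      have h4 : |(n : ℝ)⁻¹ * Real.sin (n * θ)| ≤ |Real.sin θ| := by
        rw [abs_mul, abs_of_pos (inv_pos.2 hn0), inv_mul_le_iff₀ hn0]
        exact h3
      have h5 : Real.sin θ * ((n : ℝ)⁻¹ * Real.sin (n * θ)) ≤ Real.sin θ * Real.sin θ := by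
        calc Real.sin θ * ((n : ℝ)⁻¹ * Real.sin (n * θ))
            ≤ |Real.sin θ| * |(n : ℝ)⁻¹ * Real.sin (n * θ)| := by
              rw [← abs_mul]; exact le_abs_self _
          _ ≤ |Real.sin θ| * |Real.sin θ| := by gcongr
          _ = Real.sin θ * Real.sin θ := abs_mul_abs_self _
      simp only [hv]
      linarith [mul_sub (Real.sin θ) (Real.sin θ) ((n : ℝ)⁻¹ * Real.sin (n * θ))]
    have h6 : u' θ * v θ = -(α * (Real.sin θ * v θ) * ((ε' + 2 - 2 * Real.cos θ) ^ (-(α / 2) - 1)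
      - (ε + 2 - 2 * Real.cos θ) ^ (-(α / 2) - 1))) := by
      simp only [hu']; ring
    rw [h6, neg_neg]
    exact mul_nonneg (mul_nonneg hα0.le h2) (by linarith)
  have hsub : ∫ θ in (0 : ℝ)..(2 * Real.pi), u θ * v' θ =
      (∫ θ in (0 : ℝ)..(2 * Real.pi),
        (Real.cos θ - Real.cos (n * θ)) * (ε' + 2 - 2 * Real.cos θ) ^ (-(α / 2))) -
      ∫ θ in (0 : ℝ)..(2 * Real.pi),
        (Real.cos θ - Real.cos (n * θ)) * (ε + 2 - 2 * Real.cos θ) ^ (-(α / 2)) := by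
    rw [← intervalIntegral.integral_sub]
    · refine intervalIntegral.integral_congr fun θ _ => ?_
      simp only [hu, hv']; ring
    · exact Continuous.intervalIntegrable (by fun_prop) _ _
    · exact Continuous.intervalIntegrable (by fun_prop) _ _
  rw [hsub] at hparts
  linarith

theorem rpow_mul_Lam_sub_eq (hα0 : 0 < α) (hα2 : α < 2) {b : ℝ} (hb0 : 0 < b) (hb1 : b < 1) (n : ℕ)
    (hn : 1 ≤ n) : b ^ (α / 2) * (b * Lam α 1 b - b * Lam α n b) =
    cAlpha α * ∫ θ in (0 : ℝ)..(2 * Real.pi),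
      (Real.cos θ - Real.cos (n * θ)) * ((1 - b) ^ 2 / b + 2 - 2 * Real.cos θ) ^ (-(α / 2)) := by
  have hc := continuous_ker_rpow hb0 hb1 (-(α / 2))
  rw [mul_Lam_eq hα0 hα2 hb0 hb1 1 le_rfl, mul_Lam_eq hα0 hα2 hb0 hb1 n hn, ← mul_sub,
      ← intervalIntegral.integral_sub, mul_left_comm, ← intervalIntegral.integral_const_mul]
  · congr 1
    refine intervalIntegral.integral_congr fun θ _ => ?_
    have h1 : (1 - b) ^ 2 / b + 2 - 2 * Real.cos θ = ker b θ / b := by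
      rw [ker]; field_simp; ring
    simp only [Nat.cast_one, one_mul]
    rw [h1, Real.div_rpow (ker_pos hb0 hb1 θ).le hb0.le, Real.rpow_neg hb0.le]
    have : b ^ (α / 2) ≠ 0 := (Real.rpow_pos_of_pos hb0 _).ne'
    field_simp
  · exact Continuous.intervalIntegrable (by fun_prop) _ _
  · exact Continuous.intervalIntegrable (by fun_prop) _ _

theorem tendsto_rpow_mul_Lam_sub (hα0 : 0 < α) (hα2 : α < 2) (n : ℕ) (hn : 1 ≤ n) :
    Tendsto (fun b : ℝ => b ^ (α / 2) * (b * Lam α 1 b - b * Lam α n b)) (𝓝[<] 1)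
      (𝓝 (Theta α n)) := by
  have h1 : Tendsto (fun b : ℝ => b ^ (α / 2)) (𝓝[<] 1) (𝓝 1) := by
    have h2 : ContinuousAt (fun b : ℝ => b ^ (α / 2)) 1 :=
      Real.continuousAt_rpow_const _ _ (Or.inl one_ne_zero)
    have h3 := h2.tendsto
    rw [Real.one_rpow] at h3
    exact h3.mono_left nhdsWithin_le_nhds
  have := h1.mul (tendsto_mul_Lam_sub hα0 hα2 n hn)
  rwa [one_mul] at this

/-- By monotonicity in `b`, the normalized difference of `Λ_1` and `Λ_n` is bounded by its limit `Θ_n`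
as `b → 1`. -/
theorem rpow_mul_Lam_sub_le (hα0 : 0 < α) (hα2 : α < 2) {b : ℝ} (hb0 : 0 < b) (hb1 : b < 1) (n : ℕ)
    (hn : 1 ≤ n) : b ^ (α / 2) * (b * Lam α 1 b - b * Lam α n b) ≤ Theta α n := by
  refine ge_of_tendsto (tendsto_rpow_mul_Lam_sub hα0 hα2 n hn) ?_
  have hev : ∀ᶠ b' in 𝓝[<] (1 : ℝ), b' ∈ Ioo b 1 := Ioo_mem_nhdsLT hb1
  filter_upwards [hev] with b' hb'
  have hb'0 : 0 < b' := hb0.trans hb'.1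
  rw [rpow_mul_Lam_sub_eq hα0 hα2 hb0 hb1 n hn, rpow_mul_Lam_sub_eq hα0 hα2 hb'0 hb'.2 n hn]
  refine mul_le_mul_of_nonneg_left (integral_cos_sub_cos_mono hα0 n hn ?_ ?_)
    (cAlpha_pos hα0 hα2).le
  · have : 0 < 1 - b' := by linarith [hb'.2]
    positivity
  · have h1 : 1 - b' ≤ 1 - b := by linarith [hb'.1]
    have h2 : 0 ≤ 1 - b' := by linarith [hb'.2]
    have h3 := hb'.1.le
    gcongr

theorem hasDerivAt_Lam (hα0 : 0 < α) (hα2 : α < 2) {b : ℝ} (hb0 : 0 < b) (hb1 : b < 1) (n : ℕ)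
    (hn : 1 ≤ n) : ∃ L', 0 ≤ L' ∧ HasDerivAt (Lam α n) L' b := by
  have hpi := Real.pi_pos
  set F : ℝ → ℝ → ℝ := fun b θ => Real.cos (n * θ) * ker b θ ^ (-(α / 2)) with hF
  set F' : ℝ → ℝ → ℝ := fun b θ =>
    Real.cos (n * θ) * ((2 * b - 2 * Real.cos θ) * (-(α / 2)) * ker b θ ^ (-(α / 2) - 1)) with hF'
  set ρ : ℝ := (1 - b) / 2 with hρ
  have hρ0 : 0 < ρ := by rw [hρ]; linarith
  set s : Set ℝ := Ioo 0 (1 - ρ) with hs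
  have hs_nhds : s ∈ 𝓝 b := Ioo_mem_nhds hb0 (by rw [hρ]; linarith)
  have hker : ∀ x ∈ s, ∀ θ, ρ ^ 2 ≤ ker x θ := by
    intro x hx θ
    rw [ker_eq]
    have h1 : ρ ≤ 1 - x := by linarith [hx.2]
    have h2 : ρ ^ 2 ≤ (1 - x) ^ 2 := by gcongr
    have h3 := mul_nonneg hx.1.le (sq_nonneg (2 * Real.sin (θ / 2)))
    linarith
  have hs1 : ∀ x ∈ s, 0 < x ∧ x < 1 := fun x hx => ⟨hx.1, by linarith [hx.2]⟩
  have hcont : ∀ x, 0 < x → x < 1 → Continuous (F x) := by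
    intro x h0 h1
    have := continuous_ker_rpow h0 h1 (-(α / 2))
    simp only [hF]; fun_prop
  have h := intervalIntegral.hasDerivAt_integral_of_dominated_loc_of_deriv_le (F := F) (F' := F')
    (x₀ := b) (a := 0) (b := 2 * Real.pi) (μ := volume)
    (bound := fun _ => 4 * (α / 2) * (ρ ^ 2) ^ (-(α / 2) - 1)) hs_nhds
    (by
      filter_upwards [hs_nhds] with x hx
      exact (hcont x (hs1 x hx).1 (hs1 x hx).2).aestronglyMeasurable)
    ((hcont b hb0 hb1).intervalIntegrable _ _)
    (by
      have := continuous_ker_rpow hb0 hb1 (-(α / 2) - 1)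
      have hc : Continuous (F' b) := by simp only [hF']; fun_prop
      exact hc.aestronglyMeasurable)
    (by
      refine Eventually.of_forall fun θ _ x hx => ?_
      have hk := hker x hx θ
      have hk0 : 0 < ker x θ := lt_of_lt_of_le (by positivity) hk
      have h1 := Real.abs_cos_le_one (n * θ)
      have h2 := Real.abs_cos_le_one θ
      have h3 : |2 * x - 2 * Real.cos θ| ≤ 4 := by
        rw [abs_le] at h2 ⊢
        constructor <;> linarith [(hs1 x hx).1, (hs1 x hx).2]
      have h4 : ker x θ ^ (-(α / 2) - 1) ≤ (ρ ^ 2) ^ (-(α / 2) - 1) :=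
        Real.rpow_le_rpow_of_nonpos (by positivity) hk (by linarith)
      have h5 : 0 ≤ ker x θ ^ (-(α / 2) - 1) := Real.rpow_nonneg hk0.le _
      simp only [hF']
      rw [Real.norm_eq_abs, abs_mul, abs_mul, abs_mul, abs_of_nonneg h5, abs_neg,
        abs_of_pos (show 0 < α / 2 by linarith)]
      calc |Real.cos (n * θ)| * (|2 * x - 2 * Real.cos θ| * (α / 2) * ker x θ ^ (-(α / 2) - 1))
          ≤ 1 * (4 * (α / 2) * (ρ ^ 2) ^ (-(α / 2) - 1)) := by gcongr
        _ = _ := one_mul _)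
    (by simp)
    (by
      refine Eventually.of_forall fun θ _ x hx => ?_
      have hk0 := ker_pos (hs1 x hx).1 (hs1 x hx).2 θ
      have h1 : HasDerivAt (fun x => ker x θ) (2 * x - 2 * Real.cos θ) x := by
        have h2 := (((hasDerivAt_id x).pow 2).const_add 1).sub
          (((hasDerivAt_id x).const_mul 2).mul_const (Real.cos θ))
        exact h2.congr_deriv (by simp)
      exact (h1.rpow_const (Or.inl hk0.ne')).const_mul _)
  have h1 : HasDerivAt (fun x => x⁻¹ * (cAlpha α * ∫ θ in (0 : ℝ)..(2 * Real.pi), F x θ)) _ b :=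
    (hasDerivAt_inv hb0.ne').mul (h.2.const_mul (cAlpha α))
  have h2 : HasDerivAt (Lam α n) _ b := h1.congr_of_eventuallyEq (by
    filter_upwards [hs_nhds] with x hx
    simp only [hF]
    rw [← mul_Lam_eq hα0 hα2 (hs1 x hx).1 (hs1 x hx).2 n hn, inv_mul_cancel_left₀ (hs1 x hx).1.ne'])
  refine ⟨_, ?_, h2⟩
  have h3 := (Lam_mono hα0 hα2 n hn).derivWithin_nonneg (x := b)
  rwa [derivWithin_of_isOpen isOpen_Ioo ⟨hb0, hb1⟩, h2.deriv] at h3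

end LamMono

/-! ### Roots of the determinant -/

section Det
variable {α : ℝ}

/-- The first diagonal entry of the symmetrized matrix, which has `Θ_n` as an eigenvalue exactly when
`Δ_n(b) = 0`. -/
def outerShear (α b : ℝ) : ℝ := b ^ 2 * Lam α 1 b

/-- The second diagonal entry of the symmetrized matrix. -/
def innerShear (α b : ℝ) : ℝ := b ^ α * Lam α 1 b

/-- The off-diagonal entry of the symmetrized matrix. -/
def coupling (α : ℝ) (n : ℕ) (b : ℝ) : ℝ := b ^ (1 + α / 2) * Lam α n b

/-- The determinant of `Θ_n` minus the symmetrized matrix. -/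
def symmDet (α : ℝ) (n : ℕ) (b : ℝ) : ℝ :=
  (Theta α n - outerShear α b) * (Theta α n - innerShear α b) - coupling α n b ^ 2

theorem Delta_eq {b : ℝ} (hb0 : 0 < b) (n : ℕ) :
    Delta α n b = -(b ^ (1 - α) * symmDet α n b) := by
  have h1 : b ^ (1 - α) * b ^ α = b := by
    rw [← Real.rpow_add hb0]; simp
  have h2 : (b ^ (1 + α / 2)) ^ 2 = b ^ 2 * b ^ α := by
    rw [← Real.rpow_natCast b 2, ← Real.rpow_natCast (b ^ (1 + α / 2)) 2, ← Real.rpow_mul hb0.le,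
      ← Real.rpow_add hb0]
    congr 1; push_cast; ring
  rw [Delta, M, Matrix.det_fin_two_of, symmDet, coupling, mul_pow, h2, outerShear, innerShear]
  linear_combination (-(Theta α n - b ^ 2 * Lam α 1 b) * Lam α 1 b - b ^ 2 * Lam α n b ^ 2) * h1

/-- The roots of `Δ_n` are the radii for which `Θ_n` is an eigenvalue of the symmetrized matrix. -/
theorem Delta_eq_zero_iff {b : ℝ} (hb0 : 0 < b) (n : ℕ) : Delta α n b = 0 ↔ symmDet α n b = 0 := by
  rw [Delta_eq hb0, neg_eq_zero, mul_eq_zero]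
  exact or_iff_right (Real.rpow_pos_of_pos hb0 _).ne'

/-- The quadratic form of `Θ_n` minus the symmetrized matrix is positive at `(1, -b^(1-α/2))`: the
smaller eigenvalue of the symmetrized matrix is always less than `Θ_n`. -/
theorem quadForm_test_pos (hα0 : 0 < α) (hα2 : α < 2) {b : ℝ} (hb0 : 0 < b) (hb1 : b < 1) {n : ℕ}
    (hn : 2 ≤ n) :
    0 < (Theta α n - outerShear α b) + (b ^ (1 - α / 2)) ^ 2 * (Theta α n - innerShear α b)
      + 2 * b ^ (1 - α / 2) * coupling α n b := by
  have h1 : (b ^ (1 - α / 2)) ^ 2 * b ^ α = b ^ 2 := by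
    rw [← Real.rpow_natCast b 2, ← Real.rpow_natCast (b ^ (1 - α / 2)) 2, ← Real.rpow_mul hb0.le,
      ← Real.rpow_add hb0]
    congr 1; push_cast; ring
  have h2 : b ^ (1 - α / 2) * b ^ (1 + α / 2) = b ^ 2 := by
    rw [← Real.rpow_natCast b 2, ← Real.rpow_add hb0]
    congr 1; push_cast; ring
  have h3 : b ^ (1 + α / 2) = b ^ (α / 2) * b := by
    rw [add_comm, Real.rpow_add hb0, Real.rpow_one]
  have h4 := rpow_mul_Lam_sub_le hα0 hα2 hb0 hb1 n (by omega)
  have h5 : b ^ (1 - α / 2) < 1 := Real.rpow_lt_one hb0.le hb1 (by linarith)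
  have h6 : 0 < b ^ (1 - α / 2) := Real.rpow_pos_of_pos hb0 _
  have h7 := Theta_pos hα0 hα2 hn
  rw [outerShear, innerShear, coupling]
  set t := b ^ (1 - α / 2)
  have h8 : (Theta α n - b ^ 2 * Lam α 1 b) + t ^ 2 * (Theta α n - b ^ α * Lam α 1 b)
      + 2 * t * (b ^ (1 + α / 2) * Lam α n b) =
      (1 + t ^ 2) * Theta α n - 2 * t * (b ^ (α / 2) * (b * Lam α 1 b - b * Lam α n b)) := by
    linear_combination (-Lam α 1 b) * h1 + 2 * Lam α 1 b * h2 - 2 * t * Lam α 1 b * h3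
      + 2 * t * Lam α n b * h3
  rw [h8]
  have h9 := mul_le_mul_of_nonneg_left h4 (show 0 ≤ 2 * t by linarith)
  have h10 : 0 < (1 - t) ^ 2 * Theta α n := mul_pos (pow_pos (by linarith) 2) h7
  linarith

theorem coupling_pos (hα0 : 0 < α) (hα2 : α < 2) {b : ℝ} (hb0 : 0 < b) (hb1 : b < 1) {n : ℕ}
    (hn : 1 ≤ n) : 0 < coupling α n b :=
  mul_pos (Real.rpow_pos_of_pos hb0 _) (Lam_pos hα0 hα2 hb0 hb1 n hn)

/-- If the symmetrized determinant is nonnegative, then `Θ_n` minus the symmetrized matrix is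
positive semidefinite. -/
theorem diag_pos_of_symmDet_nonneg (hα0 : 0 < α) (hα2 : α < 2) {b : ℝ} (hb0 : 0 < b) (hb1 : b < 1)
    {n : ℕ} (hn : 2 ≤ n) (h : 0 ≤ symmDet α n b) :
    0 < Theta α n - outerShear α b ∧ 0 < Theta α n - innerShear α b := by
  have h1 := quadForm_test_pos hα0 hα2 hb0 hb1 hn
  have h2 := coupling_pos hα0 hα2 hb0 hb1 (n := n) (by omega)
  have h3 : 0 < b ^ (1 - α / 2) := Real.rpow_pos_of_pos hb0 _
  rw [symmDet] at h
  set a := Theta α n - outerShear α b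
  set c := Theta α n - innerShear α b
  set r := coupling α n b
  set t := b ^ (1 - α / 2)
  have hac : 0 < a * c := by nlinarith [sq_nonneg r, pow_pos h2 2]
  rcases mul_pos_iff.1 hac with h4 | h4
  · exact h4
  · exfalso
    -- the arithmetic-geometric mean inequality for `-a` and `-t²c`
    have h5 : (2 * t * r) ^ 2 ≤ (-a - t ^ 2 * c) ^ 2 := by
      nlinarith [sq_nonneg (a - t ^ 2 * c), mul_nonneg (sq_nonneg t) h]
    have h6 : 0 ≤ -a - t ^ 2 * c := by nlinarith [mul_pos (pow_pos h3 2) (neg_pos.2 h4.2)]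
    have h7 := abs_le_of_sq_le_sq h5 h6
    linarith [(abs_le.1 h7).2]

theorem outerShear_strictMonoOn (hα0 : 0 < α) (hα2 : α < 2) :
    StrictMonoOn (outerShear α) (Ioo 0 1) := by
  intro b hb b' hb' h
  have h1 := Lam_mono hα0 hα2 1 le_rfl hb hb' h.le
  have h2 := Lam_pos hα0 hα2 hb.1 hb.2 1 le_rfl
  exact mul_lt_mul (pow_lt_pow_left₀ h hb.1.le two_ne_zero) h1 h2 (by positivity)

theorem innerShear_strictMonoOn (hα0 : 0 < α) (hα2 : α < 2) :
    StrictMonoOn (innerShear α) (Ioo 0 1) := by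
  intro b hb b' hb' h
  have h1 := Lam_mono hα0 hα2 1 le_rfl hb hb' h.le
  have h2 := Lam_pos hα0 hα2 hb.1 hb.2 1 le_rfl
  exact mul_lt_mul (Real.rpow_lt_rpow hb.1.le h hα0) h1 h2 (Real.rpow_nonneg hb'.1.le _)

theorem coupling_monotoneOn (hα0 : 0 < α) (hα2 : α < 2) {n : ℕ} (hn : 1 ≤ n) :
    MonotoneOn (coupling α n) (Ioo 0 1) := by
  intro b hb b' hb' h
  have h1 := Lam_mono hα0 hα2 n hn hb hb' h
  have h2 := Lam_pos hα0 hα2 hb.1 hb.2 n hn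
  exact mul_le_mul (Real.rpow_le_rpow hb.1.le h (by linarith)) h1 h2.le (Real.rpow_nonneg hb'.1.le _)

/-- The determinant is positive to the left of a root: there `Θ_n` is the larger eigenvalue of the
symmetrized matrix, whose entries increase with `b`. -/
theorem symmDet_pos_of_lt_root (hα0 : 0 < α) (hα2 : α < 2) {n : ℕ} (hn : 2 ≤ n) {b b' : ℝ}
    (hb : b ∈ Ioo (0 : ℝ) 1) (hb' : b' ∈ Ioo (0 : ℝ) 1) (hbb : b < b')
    (h' : symmDet α n b' = 0) : 0 < symmDet α n b := by
  obtain ⟨h3, h4⟩ := diag_pos_of_symmDet_nonneg hα0 hα2 hb'.1 hb'.2 hn h'.ge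
  have h5 := outerShear_strictMonoOn hα0 hα2 hb hb' hbb
  have h6 := innerShear_strictMonoOn hα0 hα2 hb hb' hbb
  have h7 := coupling_monotoneOn hα0 hα2 (show 1 ≤ n by omega) hb hb' hbb.le
  have h8 := coupling_pos hα0 hα2 hb.1 hb.2 (show 1 ≤ n by omega)
  have h9 : coupling α n b ^ 2 ≤ coupling α n b' ^ 2 := pow_le_pow_left₀ h8.le h7 2
  have h10 : (Theta α n - outerShear α b') * (Theta α n - innerShear α b') <
      (Theta α n - outerShear α b) * (Theta α n - innerShear α b) :=
    mul_lt_mul'' (by linarith) (by linarith) h3.le h4.le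
  rw [symmDet] at h' ⊢
  linarith

theorem hasDerivAt_outerShear (hα0 : 0 < α) (hα2 : α < 2) {b : ℝ} (hb0 : 0 < b) (hb1 : b < 1) :
    ∃ d, 0 < d ∧ HasDerivAt (outerShear α) d b := by
  obtain ⟨L', hL0, hL⟩ := hasDerivAt_Lam hα0 hα2 hb0 hb1 1 le_rfl
  have h2 := Lam_pos hα0 hα2 hb0 hb1 1 le_rfl
  exact ⟨_, by positivity, (hasDerivAt_pow 2 b).mul hL⟩

theorem hasDerivAt_innerShear (hα0 : 0 < α) (hα2 : α < 2) {b : ℝ} (hb0 : 0 < b) (hb1 : b < 1) :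
    ∃ d, 0 < d ∧ HasDerivAt (innerShear α) d b := by
  obtain ⟨L', hL0, hL⟩ := hasDerivAt_Lam hα0 hα2 hb0 hb1 1 le_rfl
  have h2 := Lam_pos hα0 hα2 hb0 hb1 1 le_rfl
  exact ⟨_, by positivity, (Real.hasDerivAt_rpow_const (p := α) (Or.inl hb0.ne')).mul hL⟩

theorem hasDerivAt_coupling (hα0 : 0 < α) (hα2 : α < 2) {b : ℝ} (hb0 : 0 < b) (hb1 : b < 1) {n : ℕ}
    (hn : 1 ≤ n) : ∃ d, 0 < d ∧ HasDerivAt (coupling α n) d b := by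
  obtain ⟨L', hL0, hL⟩ := hasDerivAt_Lam hα0 hα2 hb0 hb1 n hn
  have h2 := Lam_pos hα0 hα2 hb0 hb1 n hn
  exact ⟨_, by positivity, (Real.hasDerivAt_rpow_const (p := 1 + α / 2) (Or.inl hb0.ne')).mul hL⟩

theorem continuousOn_symmDet (hα0 : 0 < α) (hα2 : α < 2) {n : ℕ} (hn : 1 ≤ n) :
    ContinuousOn (symmDet α n) (Ioo 0 1) := by
  intro b hb
  obtain ⟨d1, -, h1⟩ := hasDerivAt_outerShear hα0 hα2 hb.1 hb.2
  obtain ⟨d2, -, h2⟩ := hasDerivAt_innerShear hα0 hα2 hb.1 hb.2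
  obtain ⟨d3, -, h3⟩ := hasDerivAt_coupling hα0 hα2 hb.1 hb.2 hn
  exact (((h1.const_sub _).mul (h2.const_sub _)).sub (h3.pow 2)).continuousAt.continuousWithinAt

/-- The determinant has a nonzero derivative at its root. -/
theorem hasDerivAt_Delta (hα0 : 0 < α) (hα2 : α < 2) {b : ℝ} (hb0 : 0 < b) (hb1 : b < 1) {n : ℕ}
    (hn : 2 ≤ n) (h : Delta α n b = 0) : ∃ d, d ≠ 0 ∧ HasDerivAt (Delta α n) d b := by
  rw [Delta_eq_zero_iff hb0] at h
  obtain ⟨h3, h4⟩ := diag_pos_of_symmDet_nonneg hα0 hα2 hb0 hb1 hn h.ge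
  have hc := coupling_pos hα0 hα2 hb0 hb1 (show 1 ≤ n by omega)
  obtain ⟨d1, hd1, h5⟩ := hasDerivAt_outerShear hα0 hα2 hb0 hb1
  obtain ⟨d2, hd2, h6⟩ := hasDerivAt_innerShear hα0 hα2 hb0 hb1
  obtain ⟨d3, hd3, h7⟩ := hasDerivAt_coupling hα0 hα2 hb0 hb1 (show 1 ≤ n by omega)
  have h8 := ((h5.const_sub (Theta α n)).mul (h6.const_sub (Theta α n))).sub (h7.pow 2)
  have h9 : HasDerivAt (symmDet α n)
      (-(d1 * (Theta α n - innerShear α b) + d2 * (Theta α n - outerShear α b)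
        + 2 * coupling α n b * d3)) b := h8.congr_deriv (by push_cast; ring)
  have h10 := ((Real.hasDerivAt_rpow_const (p := 1 - α) (Or.inl hb0.ne')).mul h9).neg
  refine ⟨_, ?_, h10.congr_of_eventuallyEq ?_⟩
  · rw [h, mul_zero, zero_add, mul_neg, neg_neg]
    have := Real.rpow_pos_of_pos hb0 (1 - α)
    positivity
  · filter_upwards [Ioi_mem_nhds hb0] with x hx
    exact Delta_eq hx n

/-- For small `b` the symmetrized matrix is small compared with `Θ_n`. -/
theorem exists_symmDet_pos (hα0 : 0 < α) (hα2 : α < 2) {n : ℕ} (hn : 2 ≤ n) :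
    ∃ b ∈ Ioo (0 : ℝ) (1 / 2), 0 < symmDet α n b := by
  have hT := Theta_pos hα0 hα2 hn
  have hlim : ∀ s : ℝ, 0 < s → Tendsto (fun b : ℝ => b ^ s * Lam α 1 (1 / 2)) (𝓝[>] 0) (𝓝 0) := by
    intro s hs
    have h1 : ContinuousAt (fun b : ℝ => b ^ s * Lam α 1 (1 / 2)) 0 :=
      (Real.continuousAt_rpow_const _ _ (Or.inr hs.le)).mul continuousAt_const
    have h2 := h1.tendsto
    simp only [Real.zero_rpow hs.ne', zero_mul] at h2
    exact h2.mono_left nhdsWithin_le_nhds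
  have hlim2 : Tendsto (fun b : ℝ => b ^ 2 * Lam α 1 (1 / 2)) (𝓝[>] 0) (𝓝 0) := by
    have := hlim 2 two_pos
    simpa using this
  have e1 := hlim2.eventually_lt_const (show (0 : ℝ) < Theta α n / 2 by positivity)
  have e2 := (hlim α hα0).eventually_lt_const (show (0 : ℝ) < Theta α n / 2 by positivity)
  have e3 := (hlim (1 + α / 2) (by linarith)).eventually_lt_const
    (show (0 : ℝ) < Theta α n / 2 by positivity)
  have e4 : ∀ᶠ b in 𝓝[>] (0 : ℝ), b ∈ Ioo (0 : ℝ) (1 / 2) := Ioo_mem_nhdsGT (by norm_num)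
  obtain ⟨b, h1, h2, h3, hb⟩ := (e1.and (e2.and (e3.and e4))).exists
  refine ⟨b, hb, ?_⟩
  have hb' : b ∈ Ioo (0 : ℝ) 1 := ⟨hb.1, by linarith [hb.2]⟩
  have h0 : (1 / 2 : ℝ) ∈ Ioo (0 : ℝ) 1 := by norm_num
  have h4 := Lam_mono hα0 hα2 1 le_rfl hb' h0 hb.2.le
  have h5 := (Lam_anti hα0 hα2 hb'.1 hb'.2 le_rfl (show 1 ≤ n by omega)).trans h4
  have h6 : outerShear α b < Theta α n / 2 :=
    (mul_le_mul_of_nonneg_left h4 (by positivity)).trans_lt h1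
  have h7 : innerShear α b < Theta α n / 2 :=
    (mul_le_mul_of_nonneg_left h4 (Real.rpow_nonneg hb.1.le _)).trans_lt h2
  have h8 : coupling α n b < Theta α n / 2 :=
    (mul_le_mul_of_nonneg_left h5 (Real.rpow_nonneg hb.1.le _)).trans_lt h3
  have h9 := coupling_pos hα0 hα2 hb'.1 hb'.2 (show 1 ≤ n by omega)
  rw [symmDet]
  nlinarith

/-- For `b` close to `1` the larger eigenvalue of the symmetrized matrix is at least
`Θ_n`. -/
theorem exists_symmDet_nonpos (hα0 : 0 < α) (hα2 : α < 2) {n : ℕ} (hn : 2 ≤ n) :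
    ∃ b ∈ Ioo (1 / 2 : ℝ) 1, symmDet α n b ≤ 0 := by
  by_contra! hcon
  have hT := Theta_pos hα0 hα2 hn
  have h0 : (1 / 2 : ℝ) ∈ Ioo (0 : ℝ) 1 := by norm_num
  have hN := Lam_pos hα0 hα2 h0.1 h0.2 n (by omega)
  have hev : ∀ᶠ b in 𝓝[<] (1 : ℝ), b ∈ Ioo (1 / 2 : ℝ) 1 := Ioo_mem_nhdsLT (by norm_num)
  have hlim1 : Tendsto (fun b : ℝ => b ^ (1 - α / 2)) (𝓝[<] 1) (𝓝 1) := by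
    have h2 : ContinuousAt (fun b : ℝ => b ^ (1 - α / 2)) 1 :=
      Real.continuousAt_rpow_const _ _ (Or.inl one_ne_zero)
    have h3 := h2.tendsto
    rw [Real.one_rpow] at h3
    exact h3.mono_left nhdsWithin_le_nhds
  have hlim2 : Tendsto (fun b : ℝ => b) (𝓝[<] 1) (𝓝 1) := tendsto_id.mono_left nhdsWithin_le_nhds
  have hlimL : Tendsto (fun b : ℝ => 2 * b ^ (1 - α / 2) *
      (b ^ (α / 2) * (b * Lam α 1 b - b * Lam α n b)) + 4 * b ^ 2 * Lam α n (1 / 2)) (𝓝[<] 1)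
      (𝓝 (2 * 1 * Theta α n + 4 * 1 ^ 2 * Lam α n (1 / 2))) :=
    ((hlim1.const_mul 2).mul (tendsto_rpow_mul_Lam_sub hα0 hα2 n (by omega))).add
      (((hlim2.pow 2).const_mul 4).mul_const _)
  have hlimR : Tendsto (fun b : ℝ => (1 + (b ^ (1 - α / 2)) ^ 2) * Theta α n) (𝓝[<] 1)
      (𝓝 ((1 + 1 ^ 2) * Theta α n)) := ((hlim1.pow 2).const_add 1).mul_const _
  have := le_of_tendsto_of_tendsto hlimL hlimR (by
    filter_upwards [hev] with b hb
    have hb0 : 0 < b := by linarith [hb.1]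
    have h1 := hcon b hb
    obtain ⟨h3, h4⟩ := diag_pos_of_symmDet_nonneg hα0 hα2 hb0 hb.2 hn h1.le
    have hc := coupling_pos hα0 hα2 hb0 hb.2 (show 1 ≤ n by omega)
    have h5 := Lam_mono hα0 hα2 n (by omega) h0 ⟨hb0, hb.2⟩ hb.1.le
    have k1 : (b ^ (1 - α / 2)) ^ 2 * b ^ α = b ^ 2 := by
      rw [← Real.rpow_natCast b 2, ← Real.rpow_natCast (b ^ (1 - α / 2)) 2, ← Real.rpow_mul hb0.le,
        ← Real.rpow_add hb0]
      congr 1; push_cast; ring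
    have k2 : b ^ (1 - α / 2) * b ^ (1 + α / 2) = b ^ 2 := by
      rw [← Real.rpow_natCast b 2, ← Real.rpow_add hb0]
      congr 1; push_cast; ring
    have k3 : b ^ (1 + α / 2) = b ^ (α / 2) * b := by
      rw [add_comm, Real.rpow_add hb0, Real.rpow_one]
    have ht : 0 < b ^ (1 - α / 2) := Real.rpow_pos_of_pos hb0 _
    rw [symmDet] at h1
    -- the arithmetic-geometric mean inequality for the two diagonal entries
    have h6 : 2 * b ^ (1 - α / 2) * coupling α n b ≤ (Theta α n - outerShear α b)
        + (b ^ (1 - α / 2)) ^ 2 * (Theta α n - innerShear α b) := by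
      have h6 : 0 ≤ (Theta α n - outerShear α b)
        + (b ^ (1 - α / 2)) ^ 2 * (Theta α n - innerShear α b) := by positivity
      refine (abs_le.1 (abs_le_of_sq_le_sq ?_ h6)).2
      set a := Theta α n - outerShear α b
      set c := Theta α n - innerShear α b
      set r := coupling α n b
      set t := b ^ (1 - α / 2)
      nlinarith [sq_nonneg (a - t ^ 2 * c), mul_nonneg (sq_nonneg t) h1.le]
    rw [outerShear, innerShear, coupling] at h6
    set t := b ^ (1 - α / 2)
    have h7 : (Theta α n - b ^ 2 * Lam α 1 b) + t ^ 2 * (Theta α n - b ^ α * Lam α 1 b)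
        - 2 * t * (b ^ (1 + α / 2) * Lam α n b) =
        (1 + t ^ 2) * Theta α n - (2 * t * (b ^ (α / 2) * (b * Lam α 1 b - b * Lam α n b))
          + 4 * b ^ 2 * Lam α n b) := by
      linear_combination (-Lam α 1 b) * k1 + 2 * Lam α 1 b * k2 - 2 * t * Lam α 1 b * k3
        + 2 * t * Lam α n b * k3 - 4 * Lam α n b * k2
    have h8 : 4 * b ^ 2 * Lam α n (1 / 2) ≤ 4 * b ^ 2 * Lam α n b :=
      mul_le_mul_of_nonneg_left h5 (by positivity)
    linarith)
  linarith

/-- The determinant of the linearization has exactly one root in `(0, 1)`. -/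
theorem existsUnique_Delta_eq_zero (hα0 : 0 < α) (hα2 : α < 2) {n : ℕ} (hn : 2 ≤ n) :
    ∃ b : ℝ, (0 < b ∧ b < 1) ∧ Delta α n b = 0 ∧
      ∀ b' : ℝ, 0 < b' → b' < 1 → Delta α n b' = 0 → b' = b := by
  obtain ⟨b₁, hb₁, h₁⟩ := exists_symmDet_pos hα0 hα2 hn
  obtain ⟨b₂, hb₂, h₂⟩ := exists_symmDet_nonpos hα0 hα2 hn
  have hsub : Icc b₁ b₂ ⊆ Ioo (0 : ℝ) 1 := fun x hx =>
    ⟨hb₁.1.trans_le hx.1, hx.2.trans_lt hb₂.2⟩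
  obtain ⟨b, hb, hb'⟩ := intermediate_value_Icc' (hb₁.2.le.trans hb₂.1.le)
    ((continuousOn_symmDet hα0 hα2 (show 1 ≤ n by omega)).mono hsub) ⟨h₂, h₁.le⟩
  have hbI := hsub hb
  refine ⟨b, hbI, (Delta_eq_zero_iff hbI.1 n).2 hb', fun b' h0 h1 h => ?_⟩
  rw [Delta_eq_zero_iff h0] at h
  rcases lt_trichotomy b' b with h2 | h2 | h2
  · exact absurd h (symmDet_pos_of_lt_root hα0 hα2 hn ⟨h0, h1⟩ hbI h2 hb').ne'
  · exact h2
  · exact absurd hb' (symmDet_pos_of_lt_root hα0 hα2 hn hbI ⟨h0, h1⟩ h2 h).ne'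

/-- At a root of `Δ_m`, the determinants of the higher modes are bounded below like `Θ_n²`. -/
theorem exists_Delta_bound (hα0 : 0 < α) (hα2 : α < 2) {b : ℝ} (hb0 : 0 < b) (hb1 : b < 1) {m : ℕ}
    (hm : 2 ≤ m) (h : Delta α m b = 0) :
    ∃ δ : ℝ, 0 < δ ∧ ∀ n : ℕ, 2 * m ≤ n → δ * Theta α n ^ 2 ≤ |Delta α n b| := by
  rw [Delta_eq_zero_iff hb0] at h
  obtain ⟨h3, h4⟩ := diag_pos_of_symmDet_nonneg hα0 hα2 hb0 hb1 hm h.ge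
  have hTm := Theta_pos hα0 hα2 hm
  have hT2 := Theta_lt hα0 hα2 (show 1 ≤ m by omega) (show m < 2 * m by omega)
  have hq : Theta α m / Theta α (2 * m) < 1 := (div_lt_one (hTm.trans hT2)).2 hT2
  have hb := Real.rpow_pos_of_pos hb0 (1 - α)
  refine ⟨b ^ (1 - α) * (1 - Theta α m / Theta α (2 * m)) ^ 2,
    mul_pos hb (pow_pos (by linarith) 2), fun n hn => ?_⟩
  have h5 := Theta_mono hα0 hα2 (show 1 ≤ 2 * m by omega) hn
  have h6 := coupling_pos hα0 hα2 hb0 hb1 (show 1 ≤ n by omega)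
  have h7 : coupling α n b ≤ coupling α m b :=
    mul_le_mul_of_nonneg_left (Lam_anti hα0 hα2 hb0 hb1 (show 1 ≤ m by omega) (by omega))
      (Real.rpow_nonneg hb0.le _)
  have h8 : (1 - Theta α m / Theta α (2 * m)) * Theta α n ≤ Theta α n - Theta α m := by
    have h9 : Theta α m ≤ Theta α m / Theta α (2 * m) * Theta α n := by
      rw [div_mul_eq_mul_div, le_div_iff₀ (hTm.trans hT2)]
      exact mul_le_mul_of_nonneg_left h5 hTm.le
    linarith
  have h10 : 0 ≤ (1 - Theta α m / Theta α (2 * m)) * Theta α n :=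
    mul_nonneg (by linarith) (by linarith)
  have h11 : ((1 - Theta α m / Theta α (2 * m)) * Theta α n) ^ 2 ≤ symmDet α n b := by
    refine (pow_le_pow_left₀ h10 h8 2).trans ?_
    have h12 : coupling α n b ^ 2 ≤ coupling α m b ^ 2 := pow_le_pow_left₀ h6.le h7 2
    rw [symmDet] at h ⊢
    nlinarith [mul_nonneg (h10.trans h8) (add_pos h3 h4).le]
  rw [Delta_eq hb0, abs_neg, abs_mul, abs_of_pos hb, mul_assoc, ← mul_pow]
  exact mul_le_mul_of_nonneg_left (h11.trans (le_abs_self _)) hb.le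

/-- The entries of the linearization grow at most like `Θ_n`. -/
theorem exists_M_bound (hα0 : 0 < α) (hα2 : α < 2) {b : ℝ} (hb0 : 0 < b) (hb1 : b < 1) :
    ∃ C : ℝ, 0 < C ∧ ∀ n : ℕ, 2 ≤ n → ∀ i j, |M α n b i j| ≤ C * Theta α n := by
  have hT := Theta_pos hα0 hα2 (le_refl 2)
  have hL := Lam_pos hα0 hα2 hb0 hb1 1 le_rfl
  have hb := Real.rpow_pos_of_pos hb0 (1 - α)
  refine ⟨1 + b ^ (1 - α) + Lam α 1 b / Theta α 2, by positivity, fun n hn => ?_⟩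
  have h1 := Theta_mono hα0 hα2 (show 1 ≤ 2 by omega) hn
  have h2 := Lam_anti hα0 hα2 hb0 hb1 le_rfl (show 1 ≤ n by omega)
  have h3 := Lam_pos hα0 hα2 hb0 hb1 n (show 1 ≤ n by omega)
  have h4 : Lam α 1 b ≤ Lam α 1 b / Theta α 2 * Theta α n := by
    rw [div_mul_eq_mul_div, le_div_iff₀ hT]
    exact mul_le_mul_of_nonneg_left h1 hL.le
  have hTn : 0 < Theta α n := hT.trans_le h1
  have hb2 : b ^ 2 ≤ 1 := pow_le_one₀ hb0.le hb1.le
  have h5 : 0 < b ^ (1 - α) * Theta α n := by positivity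
  have key : ∀ x : ℝ, |x| ≤ (1 + b ^ (1 - α)) * Theta α n + Lam α 1 b →
      |x| ≤ (1 + b ^ (1 - α) + Lam α 1 b / Theta α 2) * Theta α n := fun x hx => by
    linarith
  have b1 : b ^ 2 * Lam α 1 b ≤ Lam α 1 b := mul_le_of_le_one_left hL.le hb2
  have b2 : b ^ 2 * Lam α n b ≤ Lam α 1 b := (mul_le_of_le_one_left h3.le hb2).trans h2
  have b3 : b * Lam α 1 b ≤ Lam α 1 b := mul_le_of_le_one_left hL.le hb1.le
  have b4 : b * Lam α n b ≤ Lam α 1 b := (mul_le_of_le_one_left h3.le hb1.le).trans h2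
  have c1 : 0 < b ^ 2 * Lam α 1 b := by positivity
  have c2 : 0 < b ^ 2 * Lam α n b := by positivity
  have c3 : 0 < b * Lam α 1 b := by positivity
  have c4 : 0 < b * Lam α n b := by positivity
  intro i j
  refine key _ (abs_le.2 ⟨?_, ?_⟩) <;> fin_cases i <;> fin_cases j <;> simp [M] <;> linarith

/-- The first entry of the matrix does not vanish at a root, so that the kernel vector
`(-M_{01}, M_{00})` is nonzero. -/
theorem M_zero_neg (hα0 : 0 < α) (hα2 : α < 2) {b : ℝ} (hb0 : 0 < b) (hb1 : b < 1) {m : ℕ}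
    (hm : 2 ≤ m) (h : Delta α m b = 0) : M α m b 0 0 < 0 := by
  rw [Delta_eq_zero_iff hb0] at h
  have h3 := (diag_pos_of_symmDet_nonneg hα0 hα2 hb0 hb1 hm h.ge).1
  rw [outerShear] at h3
  simp [M]
  linarith

theorem differentiableAt_M (hα0 : 0 < α) (hα2 : α < 2) {b : ℝ} (hb0 : 0 < b) (hb1 : b < 1) {n : ℕ}
    (hn : 1 ≤ n) (i j : Fin 2) : DifferentiableAt ℝ (fun b => M α n b i j) b := by
  obtain ⟨L1, -, h1⟩ := hasDerivAt_Lam hα0 hα2 hb0 hb1 1 le_rfl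
  obtain ⟨L2, -, h2⟩ := hasDerivAt_Lam hα0 hα2 hb0 hb1 n hn
  have h3 := h1.differentiableAt
  have h4 := h2.differentiableAt
  have h5 : DifferentiableAt ℝ (fun b : ℝ => b ^ (1 - α)) b :=
    (Real.hasDerivAt_rpow_const (Or.inl hb0.ne')).differentiableAt
  fin_cases i <;> fin_cases j <;> simp [M] <;> fun_prop

end Det

/-! ### Weighted Fourier multipliers -/

/-- The standing assumptions on the parameters, as a class, so that they are found by instance
search. -/
class Admissible (α : ℝ) (m : ℕ) : Prop where
  pos : 0 < α
  lt_two : α < 2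
  two_le : 2 ≤ m

section Multipliers

/-- Bounds on the unit vectors give bounds for an operator on `ℓ¹`. -/
theorem Ell.norm_apply_le_of_basis {ι E : Type*} [DecidableEq ι] [NormedAddCommGroup E]
    [NormedSpace ℝ E] [CompleteSpace E] {T : Ell ι →L[ℝ] E} {C : ℝ}
    (h : ∀ i, ‖T (Ell.basis i)‖ ≤ C) (x : Ell ι) : ‖T x‖ ≤ C * ‖x‖ := by
  have hT : T = Ell.lift fun i => T (Ell.basis i) :=
    Ell.ext_basis fun i => (Ell.lift_basis h i).symm
  rw [hT]
  exact Ell.norm_lift_apply_le h x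

variable (α : ℝ) (m : ℕ)

/-- The weight of the `n`-th frequency in the space of perturbations, apart from `2^|n|`. It is
chosen so that the linearization at the annulus becomes bounded with bounded inverse. -/
def omega (n : ℤ) : ℝ := if n = 0 then 1 else |(n : ℝ)| * Theta α (m * n.natAbs)

/-- A bound for the multipliers of order one on the weighted space. -/
def coefBound : ℝ := 1 + (m + 1) / Theta α m

theorem omega_zero : omega α m 0 = 1 := if_pos rfl

theorem one_le_abs_of_ne {n : ℤ} (hn : n ≠ 0) : (1 : ℝ) ≤ |(n : ℝ)| := by
  rw [← Int.cast_abs]; exact_mod_cast Int.one_le_abs hn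

variable [hp : Admissible α m]

theorem Theta_m_pos : 0 < Theta α m := Theta_pos hp.pos hp.lt_two hp.two_le

theorem le_omega {n : ℤ} (hn : n ≠ 0) : |(n : ℝ)| * Theta α m ≤ omega α m n := by
  rw [omega, if_neg hn]
  have h1 : 1 ≤ n.natAbs := Int.natAbs_pos.2 hn
  have h2 := hp.two_le
  exact mul_le_mul_of_nonneg_left (Theta_mono hp.pos hp.lt_two (by omega)
    (Nat.le_mul_of_pos_right m h1)) (abs_nonneg _)

theorem omega_pos (n : ℤ) : 0 < omega α m n := by
  by_cases hn : n = 0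
  · rw [hn, omega_zero]; exact one_pos
  · exact lt_of_lt_of_le (mul_pos (by linarith [one_le_abs_of_ne hn]) (Theta_m_pos α m))
      (le_omega α m hn)

theorem coefBound_pos : 0 < coefBound α m := by
  have := Theta_m_pos α m
  unfold coefBound; positivity

/-- Multipliers of order one are bounded on the weighted space, since `ω_n ≥ |n| Θ_m`. -/
theorem inv_omega_mul_le (n : ℤ) {c : ℝ} (hc : |c| ≤ 1 + m * |(n : ℝ)|) :
    |(omega α m n)⁻¹ * c| ≤ coefBound α m := by
  have hT := Theta_m_pos α m
  have ho := omega_pos α m n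
  rw [abs_mul, abs_of_pos (inv_pos.2 ho), inv_mul_le_iff₀ ho, coefBound]
  by_cases hn : n = 0
  · subst hn
    rw [omega_zero]
    have : 0 ≤ (m + 1) / Theta α m := by positivity
    simp at hc
    linarith
  · have h1 := one_le_abs_of_ne hn
    have h2 := le_omega α m hn
    have h3 : |(n : ℝ)| * Theta α m * ((m + 1) / Theta α m) = |(n : ℝ)| * (m + 1) := by
      field_simp
    have h4 : |(n : ℝ)| * Theta α m * ((m + 1) / Theta α m) ≤
        omega α m n * ((m + 1) / Theta α m) :=
      mul_le_mul_of_nonneg_right h2 (by positivity)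
    nlinarith

/-- The operator sending the frequency `n` with coefficient `1` to `c n e^{inmx} e^{i (j n) θ}`. -/
def coefMap (c : ℤ → ℝ) (j : ℤ → ℤ) : Ell ℤ →L[ℝ] Four :=
  Ell.lift fun n => ((omega α m n)⁻¹ * c n) • Four.e (n, j n)

variable {c : ℤ → ℝ}

theorem norm_coef_smul_e_le (hc : ∀ n : ℤ, |c n| ≤ 1 + m * |(n : ℝ)|) (j : ℤ → ℤ) (n : ℤ) :
    ‖((omega α m n)⁻¹ * c n) • Four.e (n, j n)‖ ≤ coefBound α m := by
  rw [norm_smul, Four.norm_e, mul_one]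
  exact inv_omega_mul_le α m n (hc n)

theorem coefMap_basis (hc : ∀ n : ℤ, |c n| ≤ 1 + m * |(n : ℝ)|) (j : ℤ → ℤ) (n : ℤ) :
    coefMap α m c j (Ell.basis n) = ((omega α m n)⁻¹ * c n) • Four.e (n, j n) :=
  Ell.lift_basis (norm_coef_smul_e_le α m hc j) n

omit hp in
theorem abs_one_le (n : ℤ) : |(1 : ℝ)| ≤ 1 + m * |(n : ℝ)| := by
  rw [abs_one]
  have : 0 ≤ (m : ℝ) * |(n : ℝ)| := by positivity
  linarith

/-- The frequency `s - mn` of `e^{isθ} e^{-inmθ}`, for a sign `s`. -/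
def freq (s n : ℤ) : ℤ := s - m * n

omit hp in
theorem abs_freq_le {s : ℤ} (hs : |s| = 1) (n : ℤ) : |(freq m s n : ℝ)| ≤ 1 + m * |(n : ℝ)| := by
  have hs' : |(s : ℝ)| = 1 := by exact_mod_cast hs
  have h := abs_sub (s : ℝ) (m * n)
  rw [hs', abs_mul, Nat.abs_cast] at h
  simpa [freq] using h

/-! ### Divided differences -/

/-- The Laurent polynomial `(1 - e^{ilsθ}) / (1 - e^{isθ})`, for a sign `s`. -/
def geo (s l : ℤ) : Four :=
  if 0 ≤ l then ∑ i ∈ Finset.range l.natAbs, Four.t (s * i)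
  else -∑ i ∈ Finset.range l.natAbs, Four.t (s * (-1 - i))

theorem norm_geo_le (s l : ℤ) : ‖geo s l‖ ≤ |(l : ℝ)| := by
  have h : (l.natAbs : ℝ) = |(l : ℝ)| := by rw [Nat.cast_natAbs, Int.cast_abs]
  rw [geo]
  split_ifs
  · refine (norm_sum_le _ _).trans ?_
    simp [Four.norm_t, h]
  · rw [norm_neg]
    refine (norm_sum_le _ _).trans ?_
    simp [Four.norm_t, h]

/-- The geometric sum identity, in a form without division. -/
theorem eval_geo (s l : ℤ) (m : ℕ) (x θ : ℝ) :
    eval m x θ (geo s l) * (1 - Complex.exp (s * (θ * Complex.I))) =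
      1 - Complex.exp (l * (s * (θ * Complex.I))) := by
  have ht : ∀ j : ℤ, eval m x θ (Four.t (s * j)) = Complex.exp (s * (θ * Complex.I)) ^ j := by
    intro j
    rw [eval_t, ← Complex.exp_int_mul]
    congr 1; push_cast; ring
  have hz : Complex.exp (s * (θ * Complex.I)) ≠ 0 := Complex.exp_ne_zero _
  rw [Complex.exp_int_mul _ l]
  set z := Complex.exp (s * (θ * Complex.I))
  rw [geo]
  split_ifs with hl
  · obtain ⟨k, rfl⟩ := Int.eq_ofNat_of_zero_le hl
    rw [map_sum]
    simp_rw [ht]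
    simp only [zpow_natCast, Int.natAbs_natCast]
    exact geom_sum_mul_neg z k
  · obtain ⟨k, rfl⟩ : ∃ k : ℕ, l = -k := ⟨l.natAbs, by omega⟩
    rw [map_neg, map_sum]
    simp_rw [ht]
    have h1 : ∀ i : ℕ, z ^ (-1 - (i : ℤ)) = z⁻¹ * z⁻¹ ^ i := by
      intro i
      rw [zpow_sub₀ hz, zpow_neg_one, zpow_natCast, inv_pow]; rfl
    simp_rw [h1]
    rw [Int.natAbs_neg, Int.natAbs_natCast, ← Finset.mul_sum, zpow_neg, zpow_natCast]
    have h2 := geom_sum_mul_neg z⁻¹ k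
    rw [inv_pow] at h2
    rw [← h2]
    field_simp
    ring

/-- The divided difference `u ↦ (u(x) - e^{isθ} u(x - θ)) / (1 - e^{isθ})`, for a sign `s`. -/
def divDiff (s : ℤ) : Ell ℤ →L[ℝ] Four :=
  Ell.lift fun n => (omega α m n)⁻¹ • (Four.e (n, 0) * geo s (1 - s * (m * n)))

theorem norm_divDiff_le {s : ℤ} (hs : |s| = 1) (n : ℤ) :
    ‖(omega α m n)⁻¹ • (Four.e (n, 0) * geo s (1 - s * (m * n)))‖ ≤ coefBound α m := by
  have h1 : |((1 - s * (m * n) : ℤ) : ℝ)| ≤ 1 + m * |(n : ℝ)| := by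
    have hs' : |(s : ℝ)| = 1 := by exact_mod_cast hs
    have h := abs_sub (1 : ℝ) (s * (m * n))
    rw [abs_one, abs_mul, abs_mul, hs', Nat.abs_cast, one_mul] at h
    push_cast
    exact h
  refine le_trans ?_ (inv_omega_mul_le α m n h1)
  rw [norm_smul, abs_mul, Real.norm_eq_abs]
  refine mul_le_mul_of_nonneg_left ?_ (abs_nonneg _)
  refine (norm_mul_le _ _).trans ?_
  rw [Four.norm_e, one_mul]
  exact norm_geo_le _ _

theorem divDiff_basis {s : ℤ} (hs : |s| = 1) (n : ℤ) : divDiff α m s (Ell.basis n) =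
    (omega α m n)⁻¹ • (Four.e (n, 0) * geo s (1 - s * (m * n))) :=
  Ell.lift_basis (norm_divDiff_le α m hs) n

omit hp in
theorem eval_e_eq (x θ : ℝ) (n j : ℤ) : eval m x θ (Four.e (n, j)) =
    ((wt n)⁻¹ : ℝ) * Complex.exp ((n * m * x : ℝ) * Complex.I) *
      Complex.exp (j * (θ * Complex.I)) := by
  rw [eval_e, monoVal, mul_assoc (((wt n)⁻¹ : ℝ) : ℂ), ← Complex.exp_add]
  congr 2
  push_cast; ring

/-- The value of the divided difference, in a form without division. -/
theorem eval_divDiff {s : ℤ} (hs : |s| = 1) (x θ : ℝ) (u : Ell ℤ) :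
    eval m x θ (divDiff α m s u) * (1 - Complex.exp (s * (θ * Complex.I))) =
      eval m x θ (coefMap α m (fun _ => 1) (fun _ => 0) u) -
      eval m x θ (coefMap α m (fun _ => 1) (freq m s) u) := by
  let T₁ : Ell ℤ →L[ℝ] ℂ := (ContinuousLinearMap.mul ℝ ℂ).flip
    (1 - Complex.exp (s * (θ * Complex.I))) ∘L (eval m x θ ∘L divDiff α m s)
  let T₂ : Ell ℤ →L[ℝ] ℂ := eval m x θ ∘L (coefMap α m (fun _ => 1) (fun _ => 0)
    - coefMap α m (fun _ => 1) (freq m s))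
  have h : T₁ = T₂ := by
    refine Ell.ext_basis fun n => ?_
    change eval m x θ (divDiff α m s (Ell.basis n)) * (1 - Complex.exp (s * (θ * Complex.I))) =
      eval m x θ (coefMap α m (fun _ => 1) (fun _ => 0) (Ell.basis n) -
        coefMap α m (fun _ => 1) (freq m s) (Ell.basis n))
    rw [divDiff_basis α m hs, coefMap_basis α m (abs_one_le m), coefMap_basis α m (abs_one_le m),
      map_sub, map_smul, map_smul, map_smul, eval_mul, smul_mul_assoc, mul_assoc, eval_geo,
      eval_e_eq, eval_e_eq, mul_one, ← smul_sub]
    congr 1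
    have h1 : ((1 - s * (m * n) : ℤ) : ℂ) * (s * (θ * Complex.I)) =
        (freq m s n : ℂ) * (θ * Complex.I) := by
      have hs' : s * s = 1 := by
        rw [← abs_mul_abs_self, hs, one_mul]
      have hs2 : (s : ℂ) * s = 1 := by exact_mod_cast hs'
      rw [freq]
      push_cast
      linear_combination (-(m * n * (θ * Complex.I)) : ℂ) * hs2
    rw [h1]
    simp
    ring
  have h2 := congrArg (fun T : Ell ℤ →L[ℝ] ℂ => T u) h
  rw [← map_sub]
  exact h2

end Multipliers

/-! ### Averages in `θ`, as sine series in `x` -/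

section Smear

/-- The sine of the frequency `n`, as an element of the space of sine series. -/
def sinVal (n : ℤ) : Ell ℕ := (n.sign : ℝ) • Ell.basis (n.natAbs - 1)

theorem norm_sinVal_le (n : ℤ) : ‖sinVal n‖ ≤ 1 := by
  rw [sinVal, norm_smul, Ell.norm_basis, mul_one, Real.norm_eq_abs]
  rcases lt_trichotomy n 0 with h | h | h
  · simp [Int.sign_eq_neg_one_of_neg h]
  · simp [h]
  · simp [Int.sign_eq_one_of_pos h]

/-- The value at `x` of the sine series `∑ y_k 2^(-(k+1)) sin((k+1)mx)`. -/
def sinEval (m : ℕ) (x : ℝ) : Ell ℕ →L[ℝ] ℝ :=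
  Ell.lift fun k => Real.sin ((k + 1 : ℕ) * m * x) / wt (k + 1 : ℕ)

theorem norm_sin_div_wt_le (m : ℕ) (x : ℝ) (k : ℕ) :
    ‖Real.sin ((k + 1 : ℕ) * m * x) / wt (k + 1 : ℕ)‖ ≤ 1 := by
  have h := one_le_wt (k + 1 : ℕ)
  rw [norm_div, Real.norm_eq_abs, Real.norm_of_nonneg (wt_pos _).le, div_le_one (wt_pos _)]
  exact (Real.abs_sin_le_one _).trans h

theorem sinEval_basis (m : ℕ) (x : ℝ) (k : ℕ) :
    sinEval m x (Ell.basis k) = Real.sin ((k + 1 : ℕ) * m * x) / wt (k + 1 : ℕ) :=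
  Ell.lift_basis (norm_sin_div_wt_le m x) k

theorem wt_neg (n : ℤ) : wt (-n) = wt n := by rw [wt, wt, Int.natAbs_neg]

theorem sinEval_sinVal (m : ℕ) (x : ℝ) (n : ℤ) :
    sinEval m x (sinVal n) = Real.sin (n * m * x) / wt n := by
  rw [sinVal, map_smul, sinEval_basis, smul_eq_mul]
  rcases lt_trichotomy n 0 with h | h | h
  · obtain ⟨k, rfl⟩ : ∃ k : ℕ, n = -((k + 1 : ℕ) : ℤ) := ⟨n.natAbs - 1, by omega⟩
    rw [Int.sign_eq_neg_one_of_neg h, wt_neg]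
    have h1 : (-((k + 1 : ℕ) : ℤ)).natAbs - 1 = k := by omega
    have h2 : ((-((k + 1 : ℕ) : ℤ) : ℤ) : ℝ) * m * x = -((k + 1 : ℕ) * m * x) := by
      push_cast; ring
    rw [h1, h2, Real.sin_neg]
    push_cast; ring
  · simp [h]
  · obtain ⟨k, rfl⟩ : ∃ k : ℕ, n = ((k + 1 : ℕ) : ℤ) := ⟨n.natAbs - 1, by omega⟩
    rw [Int.sign_eq_one_of_pos h]
    have h1 : (((k + 1 : ℕ) : ℤ)).natAbs - 1 = k := by omega
    rw [h1]
    push_cast; ring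

/-- Integrable functions on `[0, 2π]` with the symmetry `φ(2π - θ) = conj φ(θ)`, which makes their
Fourier coefficients real. -/
structure IsRealWeight (φ : ℝ → ℂ) : Prop where
  integrable : IntervalIntegrable φ volume 0 (2 * Real.pi)
  symm : ∀ θ, φ (2 * Real.pi - θ) = starRingEnd ℂ (φ θ)

theorem exp_int_two_pi_sub (l : ℤ) (θ : ℝ) :
    Complex.exp (l * (((2 * Real.pi - θ : ℝ) : ℂ) * Complex.I)) =
      starRingEnd ℂ (Complex.exp (l * (θ * Complex.I))) := by
  rw [← Complex.exp_conj]
  have h1 : (l : ℂ) * (((2 * Real.pi - θ : ℝ) : ℂ) * Complex.I) =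
      l * (2 * Real.pi * Complex.I) + starRingEnd ℂ (l * (θ * Complex.I)) := by
    simp only [map_mul, Complex.conj_I, Complex.conj_ofReal, map_intCast]
    push_cast; ring
  rw [h1, Complex.exp_add, Complex.exp_int_mul_two_pi_mul_I, one_mul]

theorem norm_exp_int (l : ℤ) (θ : ℝ) : ‖Complex.exp (l * (θ * Complex.I))‖ = 1 := by
  have : (l : ℂ) * (θ * Complex.I) = ((l * θ : ℝ) : ℂ) * Complex.I := by push_cast; ring
  rw [this, Complex.norm_exp_ofReal_mul_I]

variable {φ : ℝ → ℂ}

/-- The symmetry `θ ↦ 2π - θ` makes the moments real. -/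
theorem IsRealWeight.im_moment (hφ : IsRealWeight φ) (j : ℤ) :
    (∫ θ in (0 : ℝ)..(2 * Real.pi), φ θ * Complex.exp (j * (θ * Complex.I))).im = 0 := by
  have hpi : 0 ≤ 2 * Real.pi := by have := Real.pi_pos; linarith
  rw [← Complex.conj_eq_iff_im]
  have h1 := intervalIntegral.integral_comp_sub_left (a := 0) (b := 2 * Real.pi)
    (fun θ : ℝ => φ θ * Complex.exp (j * (θ * Complex.I))) (2 * Real.pi)
  rw [sub_self, sub_zero] at h1
  simp_rw [hφ.symm, exp_int_two_pi_sub, ← map_mul] at h1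
  rw [intervalIntegral.integral_of_le hpi, intervalIntegral.integral_of_le hpi,
    integral_conj] at h1
  rw [intervalIntegral.integral_of_le hpi, h1]

theorem IsRealWeight.integrable_mul (hφ : IsRealWeight φ) {g : ℝ → ℂ} (hg : Continuous g) :
    IntervalIntegrable (fun θ => φ θ * g θ) volume 0 (2 * Real.pi) :=
  hφ.integrable.mul_continuousOn hg.continuousOn

variable (φ)

/-- The imaginary part of the `θ`-average of a double Fourier series against `φ`, as a sine series in
`x`. Only the real parts of the moments of `φ` enter, so this is the average if they are real. -/
def smear : Four →L[ℝ] Ell ℕ := Four.lift fun i =>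
  (∫ θ in (0 : ℝ)..(2 * Real.pi), φ θ * Complex.exp (i.2 * (θ * Complex.I))).re • sinVal i.1

theorem norm_smear_value_le (i : ℤ × ℤ) :
    ‖(∫ θ in (0 : ℝ)..(2 * Real.pi), φ θ * Complex.exp (i.2 * (θ * Complex.I))).re • sinVal i.1‖ ≤
      ∫ θ in (0 : ℝ)..(2 * Real.pi), ‖φ θ‖ := by
  rw [norm_smul]
  refine (mul_le_of_le_one_right (norm_nonneg _) (norm_sinVal_le _)).trans ?_
  refine (Complex.abs_re_le_norm _).trans ?_
  refine (intervalIntegral.norm_integral_le_integral_norm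
    (by have := Real.pi_pos; linarith)).trans (le_of_eq ?_)
  refine intervalIntegral.integral_congr fun θ _ => ?_
  simp only [norm_mul, norm_exp_int, mul_one]

theorem norm_smear_le : ‖smear φ‖ ≤ ∫ θ in (0 : ℝ)..(2 * Real.pi), ‖φ θ‖ :=
  Four.norm_lift_le (intervalIntegral.integral_nonneg (by have := Real.pi_pos; linarith)
    fun _ _ => norm_nonneg _) (norm_smear_value_le φ)

variable {φ}

/-- For weights with real moments, `smear` computes the imaginary part of the average. -/
theorem sinEval_smear (hφ : IsRealWeight φ) (m : ℕ) (x : ℝ) (h : Four) :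
    sinEval m x (smear φ h) = (∫ θ in (0 : ℝ)..(2 * Real.pi), φ θ * eval m x θ h).im := by
  have hint : ∀ h : Four, IntervalIntegrable (fun θ => φ θ * eval m x θ h) volume 0 (2 * Real.pi) :=
    fun h => hφ.integrable_mul (continuous_eval m x h)
  have hpi := Real.pi_pos
  let T : Four →ₗ[ℝ] ℝ :=
    { toFun := fun h => (∫ θ in (0 : ℝ)..(2 * Real.pi), φ θ * eval m x θ h).im
      map_add' := fun f g => by
        rw [← Complex.add_im, ← intervalIntegral.integral_add (hint f) (hint g)]
        simp_rw [map_add, mul_add]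
      map_smul' := fun r f => by
        rw [RingHom.id_apply, ← Complex.smul_im, ← intervalIntegral.integral_smul]
        simp_rw [map_smul, mul_smul_comm] }
  let T' : Four →L[ℝ] ℝ := T.mkContinuous (∫ θ in (0 : ℝ)..(2 * Real.pi), ‖φ θ‖) (fun f => by
    refine (Complex.abs_im_le_norm _).trans ?_
    refine (intervalIntegral.norm_integral_le_integral_norm (by linarith)).trans ?_
    rw [← intervalIntegral.integral_mul_const]
    refine intervalIntegral.integral_mono_on (by linarith) (hint f).norm
      (hφ.integrable.norm.mul_const _) fun θ _ => ?_
    rw [norm_mul]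
    exact mul_le_mul_of_nonneg_left (norm_eval_le m x θ f) (norm_nonneg _))
  have hT : sinEval m x ∘L smear φ = T' := by
    refine Four.ext_e fun i => ?_
    change sinEval m x (smear φ (Four.e i)) =
      (∫ θ in (0 : ℝ)..(2 * Real.pi), φ θ * eval m x θ (Four.e i)).im
    obtain ⟨n, j⟩ := i
    rw [smear, Four.lift_e (norm_smear_value_le φ), map_smul, sinEval_sinVal, smul_eq_mul]
    simp_rw [eval_e_eq]
    have h1 : ∀ θ : ℝ, φ θ * (((wt n)⁻¹ : ℝ) * Complex.exp ((n * m * x : ℝ) * Complex.I) *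
        Complex.exp (j * (θ * Complex.I))) = (((wt n)⁻¹ : ℝ) *
        Complex.exp ((n * m * x : ℝ) * Complex.I)) * (φ θ * Complex.exp (j * (θ * Complex.I))) :=
      fun θ => by ring
    simp_rw [h1]
    rw [intervalIntegral.integral_const_mul, Complex.mul_im, hφ.im_moment j, mul_zero, zero_add,
      Complex.im_ofReal_mul, Complex.exp_ofReal_mul_I_im]
    ring
  exact congrArg (fun T : Four →L[ℝ] ℝ => T h) hT

end Smear

/-! ### The singular pairing -/

section SingPair
open Complex in
theorem norm_exp_sub_one_eq {θ : ℝ} (h0 : 0 ≤ θ) (h1 : θ ≤ 2 * Real.pi) :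
    ‖Complex.exp ((1 : ℤ) * (θ * Complex.I)) - 1‖ = 2 * Real.sin (θ / 2) := by
  have h2 : ((1 : ℤ) : ℂ) * (θ * Complex.I) = Complex.I * (θ : ℝ) := by push_cast; ring
  have h3 := sin_half_nonneg h0 h1
  rw [h2, Complex.norm_exp_I_mul_ofReal_sub_one, Real.norm_of_nonneg (by positivity)]

theorem sker_two_pi_sub (α θ : ℝ) : sker α (2 * Real.pi - θ) = sker α θ := by
  rw [sker, sker]
  have : (2 * Real.pi - θ) / 2 = Real.pi - θ / 2 := by ring
  rw [this, Real.sin_pi_sub]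

variable (α : ℝ) (m : ℕ) [hp : Admissible α m]

omit hp in
theorem sker_weight_integrable (hα0 : 0 < α) (hα2 : α < 2) (l : ℤ) : IntervalIntegrable
    (fun θ : ℝ => ((sker α θ : ℝ) : ℂ) * (Complex.exp (l * (θ * Complex.I)) - 1)) volume 0
      (2 * Real.pi) := by
  obtain ⟨C, -, hC⟩ := exists_expDiff_bound hα0 hα2
  have h1 := (hC (l.natAbs + 2) (by omega) l (by
    have hN : (l.natAbs : ℝ) = |(l : ℝ)| := by rw [Nat.cast_natAbs, Int.cast_abs]
    push_cast [hN]; linarith)).1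
  refine h1.mono_fun' ?_ ?_
  · exact ((Complex.measurable_ofReal.comp (measurable_sker α)).mul
      (by fun_prop)).aestronglyMeasurable
  · rw [Filter.EventuallyLE, ae_restrict_iff' measurableSet_uIoc]
    refine Eventually.of_forall fun θ hθ => ?_
    rw [uIoc_of_le (by have := Real.pi_pos; linarith)] at hθ
    have h3 := sker_nonneg (α := α) hθ.1.le hθ.2
    rw [norm_mul, Complex.norm_real, Real.norm_of_nonneg h3, mul_comm]

omit hp in
theorem sin_mul_sker_integrable (hα0 : 0 < α) (hα2 : α < 2) : IntervalIntegrable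
    (fun θ : ℝ => 2 * Real.sin (θ / 2) * sker α θ) volume 0 (2 * Real.pi) := by
  have hpi := Real.pi_pos
  obtain ⟨C, -, hC⟩ := exists_expDiff_bound hα0 hα2
  refine (hC 2 le_rfl 1 (by norm_num)).1.congr fun θ hθ => ?_
  rw [uIoc_of_le (by linarith)] at hθ
  rw [norm_exp_sub_one_eq hθ.1.le hθ.2]

/-- The weight `ω_n⁻¹ l (e^{ilθ} - 1) |2 sin (θ/2)|^(-α)` for `l = s - mn`. -/
def singWeight (s n : ℤ) (θ : ℝ) : ℂ :=
  (((omega α m n)⁻¹ * freq m s n : ℝ) : ℂ) *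
    (((sker α θ : ℝ) : ℂ) * (Complex.exp (freq m s n * (θ * Complex.I)) - 1))

omit hp in
theorem isRealWeight_singWeight (hα0 : 0 < α) (hα2 : α < 2) (s n : ℤ) :
    IsRealWeight (singWeight α m s n) where
  integrable := (sker_weight_integrable α hα0 hα2 _).const_mul _
  symm := fun θ => by
    simp only [singWeight, sker_two_pi_sub, exp_int_two_pi_sub, map_mul, map_sub, map_one,
      Complex.conj_ofReal]

/-- The weights are bounded in `L¹` uniformly in the frequency: the factor `l` and the integral of
`|e^{ilθ} - 1|` against the singular kernel are of order `n` and `Θ_n`, and are compensated by `ω_n`. -/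
theorem exists_singWeight_bound : ∃ C : ℝ, 0 < C ∧ ∀ s : ℤ, |s| = 1 → ∀ n : ℤ,
    ∫ θ in (0 : ℝ)..(2 * Real.pi), ‖singWeight α m s n θ‖ ≤ C := by
  have hpi := Real.pi_pos
  obtain ⟨C, hC0, hC⟩ := exists_expDiff_bound hp.pos hp.lt_two
  have hT := Theta_pos hp.pos hp.lt_two le_rfl
  refine ⟨C * (m + 1 + Theta α 2), by positivity, fun s hs n => ?_⟩
  have hf := abs_freq_le m hs n
  have ho := omega_pos α m n
  have h1 : ∫ θ in (0 : ℝ)..(2 * Real.pi), ‖singWeight α m s n θ‖ =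
      |(omega α m n)⁻¹ * freq m s n| * ∫ θ in (0 : ℝ)..(2 * Real.pi),
        ‖Complex.exp (freq m s n * (θ * Complex.I)) - 1‖ * sker α θ := by
    rw [← intervalIntegral.integral_const_mul]
    refine intervalIntegral.integral_congr fun θ hθ => ?_
    rw [uIcc_of_le (by linarith)] at hθ
    have h3 := sker_nonneg (α := α) hθ.1 hθ.2
    simp only [singWeight]
    rw [norm_mul, norm_mul, Complex.norm_real, Complex.norm_real, Real.norm_eq_abs,
      Real.norm_of_nonneg h3, mul_comm (sker α θ)]
  rw [h1, abs_mul, abs_of_pos (inv_pos.2 ho)]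
  by_cases hn : n = 0
  · subst hn
    have h2 := (hC 2 le_rfl (freq m s 0) (by simp at hf; norm_num; linarith)).2
    rw [omega_zero, inv_one, one_mul]
    have h3 : |(freq m s 0 : ℝ)| ≤ 1 := by simpa using hf
    have h4 : C * Theta α 2 ≤ C * (m + 1 + Theta α 2) := by
      have : 0 ≤ (m : ℝ) := Nat.cast_nonneg m
      exact mul_le_mul_of_nonneg_left (by linarith) hC0.le
    calc |(freq m s 0 : ℝ)| * _ ≤ 1 * (C * Theta α 2) :=
          mul_le_mul h3 h2 (intervalIntegral.integral_nonneg (by linarith) fun θ hθ =>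
            mul_nonneg (norm_nonneg _) (sker_nonneg hθ.1 hθ.2)) zero_le_one
      _ ≤ _ := by rw [one_mul]; exact h4
  · have hn1 := one_le_abs_of_ne hn
    have hN : (n.natAbs : ℝ) = |(n : ℝ)| := by rw [Nat.cast_natAbs, Int.cast_abs]
    have h1n : 1 ≤ n.natAbs := Int.natAbs_pos.2 hn
    have h2 := (hC (m * n.natAbs) (by have := hp.two_le; nlinarith) (freq m s n) (by
      push_cast [hN]; linarith)).2
    have h3 : |(freq m s n : ℝ)| ≤ (m + 1) * |(n : ℝ)| := by linarith
    rw [mul_assoc, inv_mul_le_iff₀ ho]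
    calc |(freq m s n : ℝ)| * _ ≤ ((m + 1) * |(n : ℝ)|) * (C * Theta α (m * n.natAbs)) :=
          mul_le_mul h3 h2 (intervalIntegral.integral_nonneg (by linarith) fun θ hθ =>
            mul_nonneg (norm_nonneg _) (sker_nonneg hθ.1 hθ.2)) (by positivity)
      _ = omega α m n * (C * (m + 1)) := by rw [omega, if_neg hn]; ring
      _ ≤ omega α m n * (C * (m + 1 + Theta α 2)) := by gcongr _ * (_ * ?_); linarith

/-- The operators sending the frequency `n` with coefficient `1` to `l e^{inmx} e^{ilθ}` and to
`l e^{inmx}`, where `l = s - mn`, respectively; the difference vanishes at `θ = 0`. -/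
def shiftDiff (s : ℤ) : Ell ℤ →L[ℝ] Four :=
  coefMap α m (fun n => freq m s n) (freq m s) - coefMap α m (fun n => freq m s n) fun _ => 0

theorem eval_shiftDiff_basis {s : ℤ} (hs : |s| = 1) (x θ : ℝ) (n : ℤ) :
    eval m x θ (shiftDiff α m s (Ell.basis n)) = (((omega α m n)⁻¹ * freq m s n : ℝ) : ℂ) *
      (Complex.exp (freq m s n * (θ * Complex.I)) - 1) * eval m x θ (Four.e (n, 0)) := by
  rw [shiftDiff, sub_apply, coefMap_basis α m (abs_freq_le m hs),
    coefMap_basis α m (abs_freq_le m hs), map_sub, map_smul, map_smul, Complex.real_smul,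
    Complex.real_smul, eval_e_eq, eval_e_eq]
  simp only [Int.cast_zero, zero_mul, Complex.exp_zero]
  ring

/-- The values of `shiftDiff` vanish at `θ = 0` at the rate of `|2 sin (θ/2)|`. -/
theorem norm_eval_shiftDiff_le {s : ℤ} (hs : |s| = 1) (x θ : ℝ) (u : Ell ℤ) :
    ‖eval m x θ (shiftDiff α m s u)‖ ≤
      coefBound α m * (1 + m) * |2 * Real.sin (θ / 2)| * ‖u‖ := by
  refine Ell.norm_apply_le_of_basis (T := eval m x θ ∘L shiftDiff α m s) (fun n => ?_) u
  change ‖eval m x θ (shiftDiff α m s (Ell.basis n))‖ ≤ _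
  have hf := abs_freq_le m hs n
  have h1 := inv_omega_mul_le α m n hf
  have h2 := (norm_exp_sub_one_le (freq m s n) θ).2
  have h3 : ‖eval m x θ (Four.e (n, 0))‖ = (wt n)⁻¹ := by rw [eval_e, norm_monoVal]
  have hB := coefBound_pos α m
  have hw := wt_pos n
  have h4 : |(freq m s n : ℝ)| * (wt n)⁻¹ ≤ 1 + m := by
    rw [← div_eq_mul_inv, div_le_iff₀ hw]
    have h5 := one_le_wt n
    have h6 : |(n : ℝ)| ≤ wt n := by
      have hN : (n.natAbs : ℝ) = |(n : ℝ)| := by rw [Nat.cast_natAbs, Int.cast_abs]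
      rw [← hN, wt]
      exact_mod_cast (Nat.lt_two_pow_self (n := n.natAbs)).le
    have h7 : (0 : ℝ) ≤ m := Nat.cast_nonneg m
    nlinarith
  rw [eval_shiftDiff_basis α m hs, norm_mul, norm_mul, h3, Complex.norm_real, Real.norm_eq_abs]
  calc |(omega α m n)⁻¹ * (freq m s n : ℝ)| *
        ‖Complex.exp (freq m s n * (θ * Complex.I)) - 1‖ * (wt n)⁻¹
      ≤ coefBound α m * (|(freq m s n : ℝ)| * |2 * Real.sin (θ / 2)|) * (wt n)⁻¹ := by gcongr
    _ = coefBound α m * |2 * Real.sin (θ / 2)| * (|(freq m s n : ℝ)| * (wt n)⁻¹) := by ring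
    _ ≤ coefBound α m * |2 * Real.sin (θ / 2)| * (1 + m) := by gcongr
    _ = _ := by ring

/-- The singular average of the product of `shiftDiff s u` and `h` against `|2 sin (θ/2)|^(-α)`,
as a bounded bilinear operator. -/
def singPair (s : ℤ) : Ell ℤ →L[ℝ] Four →L[ℝ] Ell ℕ :=
  Ell.lift fun n => smear (singWeight α m s n) ∘L Four.mulB (Four.e (n, 0))

theorem exists_norm_singPair_le : ∃ C : ℝ, 0 < C ∧ ∀ s : ℤ, |s| = 1 → ∀ n : ℤ,
    ‖smear (singWeight α m s n) ∘L Four.mulB (Four.e (n, 0))‖ ≤ C := by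
  obtain ⟨C, hC0, hC⟩ := exists_singWeight_bound α m
  refine ⟨C, hC0, fun s hs n => ?_⟩
  refine (ContinuousLinearMap.opNorm_comp_le _ _).trans ?_
  have h1 : ‖Four.mulB (Four.e (n, 0))‖ ≤ 1 := by
    refine (Four.mulB.le_opNorm _).trans ?_
    rw [Four.norm_e, mul_one]
    exact Four.norm_mulB_le
  exact (mul_le_of_le_one_right (norm_nonneg _) h1).trans ((norm_smear_le _).trans (hC s hs n))

theorem singPair_basis {s : ℤ} (hs : |s| = 1) (n : ℤ) (h : Four) :
    singPair α m s (Ell.basis n) h = smear (singWeight α m s n) (Four.e (n, 0) * h) := by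
  obtain ⟨C, -, hC⟩ := exists_norm_singPair_le α m
  rw [singPair, Ell.lift_basis (hC s hs)]
  rfl

theorem shiftDiff_mul_integrable {s : ℤ} (hs : |s| = 1) (x : ℝ) (u : Ell ℤ) (h : Four) :
    IntervalIntegrable (fun θ => ((sker α θ : ℝ) : ℂ) * eval m x θ (shiftDiff α m s u * h)) volume
      0 (2 * Real.pi) ∧
    ∀ θ ∈ Icc 0 (2 * Real.pi), ‖((sker α θ : ℝ) : ℂ) * eval m x θ (shiftDiff α m s u * h)‖ ≤
      2 * Real.sin (θ / 2) * sker α θ * (coefBound α m * (1 + m) * ‖u‖ * ‖h‖) := by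
  have hpi := Real.pi_pos
  have hb : ∀ θ ∈ Icc 0 (2 * Real.pi),
      ‖((sker α θ : ℝ) : ℂ) * eval m x θ (shiftDiff α m s u * h)‖ ≤
      2 * Real.sin (θ / 2) * sker α θ * (coefBound α m * (1 + m) * ‖u‖ * ‖h‖) := by
    intro θ hθ
    have h1 := sin_half_nonneg hθ.1 hθ.2
    have h3 := sker_nonneg (α := α) hθ.1 hθ.2
    have h4 := norm_eval_shiftDiff_le α m hs x θ u
    rw [abs_of_nonneg (by positivity)] at h4
    rw [norm_mul, Complex.norm_real, Real.norm_of_nonneg h3, eval_mul, norm_mul]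
    calc sker α θ * (‖eval m x θ (shiftDiff α m s u)‖ * ‖eval m x θ h‖)
        ≤ sker α θ * (coefBound α m * (1 + m) * (2 * Real.sin (θ / 2)) * ‖u‖ * ‖h‖) := by
          refine mul_le_mul_of_nonneg_left ?_ h3
          exact mul_le_mul h4 (norm_eval_le m x θ h) (norm_nonneg _) ((norm_nonneg _).trans h4)
      _ = _ := by ring
  refine ⟨?_, hb⟩
  refine ((sin_mul_sker_integrable α hp.pos hp.lt_two).mul_const
    (coefBound α m * (1 + m) * ‖u‖ * ‖h‖)).mono_fun' ?_ ?_
  · exact ((Complex.measurable_ofReal.comp (measurable_sker α)).mul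
      (continuous_eval m x _).measurable).aestronglyMeasurable
  · rw [Filter.EventuallyLE, ae_restrict_iff' measurableSet_uIoc]
    refine Eventually.of_forall fun θ hθ => ?_
    rw [uIoc_of_le (by linarith)] at hθ
    exact hb θ ⟨hθ.1.le, hθ.2⟩

/-- `singPair` represents the integral of the product against the singular kernel. -/
theorem sinEval_singPair {s : ℤ} (hs : |s| = 1) (x : ℝ) (u : Ell ℤ) (h : Four) :
    sinEval m x (singPair α m s u h) = (∫ θ in (0 : ℝ)..(2 * Real.pi),
      ((sker α θ : ℝ) : ℂ) * eval m x θ (shiftDiff α m s u * h)).im := by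
  have hpi := Real.pi_pos
  have hint := fun u => (shiftDiff_mul_integrable α m hs x u h).1
  have hB := coefBound_pos α m
  let T : Ell ℤ →ₗ[ℝ] ℝ :=
    { toFun := fun u => (∫ θ in (0 : ℝ)..(2 * Real.pi),
        ((sker α θ : ℝ) : ℂ) * eval m x θ (shiftDiff α m s u * h)).im
      map_add' := fun f g => by
        rw [← Complex.add_im, ← intervalIntegral.integral_add (hint f) (hint g)]
        simp_rw [map_add, add_mul, map_add, mul_add]
      map_smul' := fun r f => by
        rw [RingHom.id_apply, ← Complex.smul_im, ← intervalIntegral.integral_smul]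
        simp_rw [map_smul, smul_mul_assoc, map_smul, mul_smul_comm] }
  let T' : Ell ℤ →L[ℝ] ℝ := T.mkContinuous ((∫ θ in (0 : ℝ)..(2 * Real.pi),
      2 * Real.sin (θ / 2) * sker α θ) * (coefBound α m * (1 + m) * ‖h‖)) (fun f => by
    refine (Complex.abs_im_le_norm _).trans ?_
    refine (intervalIntegral.norm_integral_le_integral_norm (by linarith)).trans ?_
    rw [mul_assoc, ← intervalIntegral.integral_mul_const]
    refine intervalIntegral.integral_mono_on (by linarith) (hint f).norm
      ((sin_mul_sker_integrable α hp.pos hp.lt_two).mul_const _) fun θ hθ => ?_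
    refine ((shiftDiff_mul_integrable α m hs x f h).2 θ hθ).trans (le_of_eq ?_)
    ring)
  let G : Ell ℤ →L[ℝ] ℝ := sinEval m x ∘L (singPair α m s).flip h
  have hT : G = T' := by
    refine Ell.ext_basis fun n => ?_
    change sinEval m x (singPair α m s (Ell.basis n) h) = (∫ θ in (0 : ℝ)..(2 * Real.pi),
        ((sker α θ : ℝ) : ℂ) * eval m x θ (shiftDiff α m s (Ell.basis n) * h)).im
    rw [singPair_basis α m hs, sinEval_smear (isRealWeight_singWeight α m hp.pos hp.lt_two s n)]
    congr 1
    refine intervalIntegral.integral_congr fun θ _ => ?_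
    rw [eval_mul, eval_mul, eval_shiftDiff_basis α m hs, singWeight]
    ring
  exact congrArg (fun T : Ell ℤ →L[ℝ] ℝ => T u) hT

end SingPair

/-! ### Even real profiles -/

section Profiles

variable (α : ℝ) (m : ℕ)

/-- The coefficient of `cos((k+1)mx)` in the `k`-th unit vector of the space of perturbations. -/
def cosCoef (k : ℕ) : ℝ := (omega α m (k + 1 : ℕ))⁻¹ * (wt (k + 1 : ℕ))⁻¹

/-- The inclusion of cosine series into Fourier series. -/
def emb : Ell ℕ →L[ℝ] Ell ℤ := Ell.lift fun k =>
  (1 / 2 : ℝ) • (Ell.basis ((k + 1 : ℕ) : ℤ) + Ell.basis (-((k + 1 : ℕ) : ℤ)))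

theorem norm_emb_value_le (k : ℕ) :
    ‖(1 / 2 : ℝ) • ((Ell.basis ((k + 1 : ℕ) : ℤ) : Ell ℤ) + Ell.basis (-((k + 1 : ℕ) : ℤ)))‖ ≤ 1 := by
  rw [norm_smul]
  have h := norm_add_le (Ell.basis ((k + 1 : ℕ) : ℤ) : Ell ℤ) (Ell.basis (-((k + 1 : ℕ) : ℤ)))
  rw [Ell.norm_basis, Ell.norm_basis] at h
  rw [Real.norm_of_nonneg (by norm_num)]
  linarith

theorem emb_basis (k : ℕ) : emb (Ell.basis k) =
    (1 / 2 : ℝ) • (Ell.basis ((k + 1 : ℕ) : ℤ) + Ell.basis (-((k + 1 : ℕ) : ℤ))) :=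
  Ell.lift_basis norm_emb_value_le k

/-- The Fourier series of the radius function `a + d`. -/
def prof (a : ℝ) (d : Ell ℕ) : Ell ℤ := a • Ell.basis 0 + emb d

/-- The value of a cosine series at `x`. -/
def cosEval (x : ℝ) : Ell ℕ →L[ℝ] ℝ :=
  Ell.lift fun k => cosCoef α m k * Real.cos ((k + 1 : ℕ) * m * x)

/-- The derivative of a cosine series at `x`. -/
def dcosEval (x : ℝ) : Ell ℕ →L[ℝ] ℝ :=
  Ell.lift fun k => -(cosCoef α m k * ((k + 1 : ℕ) * m) * Real.sin ((k + 1 : ℕ) * m * x))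

variable [hp : Admissible α m]

theorem cosCoef_pos (k : ℕ) : 0 < cosCoef α m k :=
  mul_pos (inv_pos.2 (omega_pos α m _)) (inv_pos.2 (wt_pos _))

theorem cosCoef_mul_wt_mul_le (k : ℕ) :
    cosCoef α m k * wt (k + 1 : ℕ) * (1 + m * (k + 1 : ℕ)) ≤ coefBound α m := by
  have h1 := inv_omega_mul_le α m (k + 1 : ℕ) (c := 1 + m * (k + 1 : ℕ)) (by
    rw [abs_of_nonneg (by positivity)]
    push_cast
    rw [abs_of_nonneg (by positivity)])
  refine le_trans (le_of_eq ?_) ((le_abs_self _).trans h1)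
  have := (wt_pos (k + 1 : ℕ)).ne'
  rw [cosCoef]
  field_simp

theorem cosCoef_mul_wt_le (k : ℕ) : cosCoef α m k * wt (k + 1 : ℕ) ≤ coefBound α m := by
  refine le_trans ?_ (cosCoef_mul_wt_mul_le α m k)
  refine le_mul_of_one_le_right (mul_pos (cosCoef_pos α m k) (wt_pos _)).le ?_
  have : (0 : ℝ) ≤ m * (k + 1 : ℕ) := by positivity
  linarith

theorem cosCoef_le (k : ℕ) : cosCoef α m k ≤ coefBound α m :=
  (le_mul_of_one_le_right (cosCoef_pos α m k).le (one_le_wt _)).trans (cosCoef_mul_wt_le α m k)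

theorem cosCoef_mul_le (k : ℕ) : cosCoef α m k * ((k + 1 : ℕ) * m) ≤ coefBound α m := by
  refine le_trans ?_ (cosCoef_mul_wt_mul_le α m k)
  have h1 := one_le_wt (k + 1 : ℕ)
  have h2 := cosCoef_pos α m k
  rw [mul_assoc]
  refine mul_le_mul_of_nonneg_left ?_ h2.le
  have : (0 : ℝ) ≤ m * (k + 1 : ℕ) := by positivity
  nlinarith

theorem norm_cosEval_value_le (x : ℝ) (k : ℕ) :
    ‖cosCoef α m k * Real.cos ((k + 1 : ℕ) * m * x)‖ ≤ coefBound α m := by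
  rw [norm_mul, Real.norm_of_nonneg (cosCoef_pos α m k).le]
  exact (mul_le_of_le_one_right (cosCoef_pos α m k).le (Real.abs_cos_le_one _)).trans
    (cosCoef_le α m k)

theorem norm_dcosEval_value_le (x : ℝ) (k : ℕ) :
    ‖-(cosCoef α m k * ((k + 1 : ℕ) * m) * Real.sin ((k + 1 : ℕ) * m * x))‖ ≤ coefBound α m := by
  have h1 : 0 ≤ cosCoef α m k * ((k + 1 : ℕ) * m) :=
    mul_nonneg (cosCoef_pos α m k).le (by positivity)
  rw [norm_neg, norm_mul, Real.norm_of_nonneg h1]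
  exact (mul_le_of_le_one_right h1 (Real.abs_sin_le_one _)).trans (cosCoef_mul_le α m k)

theorem cosEval_basis (x : ℝ) (k : ℕ) :
    cosEval α m x (Ell.basis k) = cosCoef α m k * Real.cos ((k + 1 : ℕ) * m * x) :=
  Ell.lift_basis (norm_cosEval_value_le α m x) k

theorem dcosEval_basis (x : ℝ) (k : ℕ) : dcosEval α m x (Ell.basis k) =
    -(cosCoef α m k * ((k + 1 : ℕ) * m) * Real.sin ((k + 1 : ℕ) * m * x)) :=
  Ell.lift_basis (norm_dcosEval_value_le α m x) k

omit hp in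
theorem omega_neg (n : ℤ) : omega α m (-n) = omega α m n := by
  simp [omega]

omit hp in
/-- The Fourier monomials of frequencies `±(k+1)` at `(x, θ)`, when the shift `j` is affine in the
frequency. -/
theorem eval_e_shift {j : ℤ → ℤ} {p q : ℤ} (hj : ∀ n, j n = p - q * (m * n)) (x θ : ℝ) (n : ℤ) :
    eval m x θ (Four.e (n, j n)) = ((wt n)⁻¹ : ℝ) * (Complex.exp (p * (θ * Complex.I)) *
      (Real.cos (n * m * (x - q * θ)) + Real.sin (n * m * (x - q * θ)) * Complex.I)) := by
  have h : Complex.exp ((n * m * (x - q * θ) : ℝ) * Complex.I) =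
      Real.cos (n * m * (x - q * θ)) + Real.sin (n * m * (x - q * θ)) * Complex.I := by
    rw [Complex.exp_mul_I, Complex.ofReal_cos, Complex.ofReal_sin]
  rw [eval_e_eq, hj, ← h, mul_assoc, ← Complex.exp_add, ← Complex.exp_add]
  congr 2
  push_cast; ring

/-- With multiplier `1` the value of `coefMap` is the profile itself, translated by `qθ`. -/
theorem eval_coefMap_one_prof {j : ℤ → ℤ} {p q : ℤ} (hj : ∀ n, j n = p - q * (m * n)) (x θ a : ℝ)
    (d : Ell ℕ) : eval m x θ (coefMap α m (fun _ => 1) j (prof a d)) =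
      Complex.exp (p * (θ * Complex.I)) * (a + cosEval α m (x - q * θ) d : ℝ) := by
  let T₁ : Ell ℕ →L[ℝ] ℂ := eval m x θ ∘L coefMap α m (fun _ => 1) j ∘L emb
  let T₂ : Ell ℕ →L[ℝ] ℂ := ContinuousLinearMap.mul ℝ ℂ (Complex.exp (p * (θ * Complex.I))) ∘L
    Complex.ofRealCLM ∘L cosEval α m (x - q * θ)
  have hT : T₁ = T₂ := by
    refine Ell.ext_basis fun k => ?_
    change eval m x θ (coefMap α m (fun _ => 1) j (emb (Ell.basis k))) =
      Complex.exp (p * (θ * Complex.I)) * (cosEval α m (x - q * θ) (Ell.basis k) : ℝ)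
    rw [emb_basis, map_smul, map_add, coefMap_basis α m (abs_one_le m),
      coefMap_basis α m (abs_one_le m), map_smul, map_add, map_smul, map_smul, cosEval_basis,
      eval_e_shift m hj, eval_e_shift m hj, omega_neg, wt_neg, cosCoef, Complex.real_smul,
      Complex.real_smul, Complex.real_smul]
    have h2 : ((-((k + 1 : ℕ) : ℤ) : ℤ) : ℝ) * m * (x - q * θ) =
      -(((k + 1 : ℕ) : ℤ) * m * (x - q * θ)) := by push_cast; ring
    rw [h2, Real.cos_neg, Real.sin_neg]
    push_cast
    ring
  have h0 : eval m x θ (coefMap α m (fun _ => 1) j (Ell.basis 0)) =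
      Complex.exp (p * (θ * Complex.I)) := by
    rw [coefMap_basis α m (abs_one_le m), map_smul, eval_e_shift m hj, omega_zero]
    simp [wt]
  have h1 := congrArg (fun T : Ell ℕ →L[ℝ] ℂ => T d) hT
  change eval m x θ (coefMap α m (fun _ => 1) j (emb d)) =
      Complex.exp (p * (θ * Complex.I)) * (cosEval α m (x - q * θ) d : ℝ) at h1
  rw [prof, map_add, map_add, map_smul, map_smul, h0, h1, Complex.real_smul]
  push_cast; ring

/-- With multiplier `s - mn` the value of `coefMap` combines the profile and its derivative. -/
theorem eval_coefMap_freq_prof {s : ℤ} (hs : |s| = 1) {j : ℤ → ℤ} {p q : ℤ}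
    (hj : ∀ n, j n = p - q * (m * n)) (x θ a : ℝ)
    (d : Ell ℕ) : eval m x θ (coefMap α m (fun n => freq m s n) j (prof a d)) =
      Complex.exp (p * (θ * Complex.I)) * (s * (a + cosEval α m (x - q * θ) d : ℝ) +
        (dcosEval α m (x - q * θ) d : ℝ) * Complex.I) := by
  let T₁ : Ell ℕ →L[ℝ] ℂ := eval m x θ ∘L coefMap α m (fun n => freq m s n) j ∘L emb
  let T₂ : Ell ℕ →L[ℝ] ℂ := ContinuousLinearMap.mul ℝ ℂ (Complex.exp (p * (θ * Complex.I))) ∘L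
    (ContinuousLinearMap.mul ℝ ℂ (s : ℂ) ∘L Complex.ofRealCLM ∘L cosEval α m (x - q * θ) +
      (ContinuousLinearMap.mul ℝ ℂ).flip Complex.I ∘L Complex.ofRealCLM ∘L
        dcosEval α m (x - q * θ))
  have hT : T₁ = T₂ := by
    refine Ell.ext_basis fun k => ?_
    change eval m x θ (coefMap α m (fun n => freq m s n) j (emb (Ell.basis k))) =
      Complex.exp (p * (θ * Complex.I)) * (s * (cosEval α m (x - q * θ) (Ell.basis k) : ℝ) +
        (dcosEval α m (x - q * θ) (Ell.basis k) : ℝ) * Complex.I)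
    rw [emb_basis, map_smul, map_add, coefMap_basis α m (abs_freq_le m hs),
      coefMap_basis α m (abs_freq_le m hs), map_smul, map_add, map_smul, map_smul, cosEval_basis,
      dcosEval_basis,
      eval_e_shift m hj, eval_e_shift m hj, omega_neg, wt_neg, cosCoef, Complex.real_smul,
      Complex.real_smul, Complex.real_smul]
    have h2 : ((-((k + 1 : ℕ) : ℤ) : ℤ) : ℝ) * m * (x - q * θ) =
      -(((k + 1 : ℕ) : ℤ) * m * (x - q * θ)) := by push_cast; ring
    rw [h2, Real.cos_neg, Real.sin_neg, freq, freq]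
    push_cast
    ring_nf
  have h0 : eval m x θ (coefMap α m (fun n => freq m s n) j (Ell.basis 0)) =
      Complex.exp (p * (θ * Complex.I)) * s := by
    rw [coefMap_basis α m (abs_freq_le m hs), map_smul, eval_e_shift m hj, omega_zero]
    simp [wt, freq, mul_comm]
  have h1 := congrArg (fun T : Ell ℕ →L[ℝ] ℂ => T d) hT
  change eval m x θ (coefMap α m (fun n => freq m s n) j (emb d)) =
      Complex.exp (p * (θ * Complex.I)) * (s * (cosEval α m (x - q * θ) d : ℝ) +
        (dcosEval α m (x - q * θ) d : ℝ) * Complex.I) at h1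
  rw [prof, map_add, map_add, map_smul, map_smul, h0, h1, Complex.real_smul]
  push_cast; ring

end Profiles

/-! ### The numerator and the kernels -/

section Kernels

variable (α : ℝ) (m : ℕ)

/-- The numerator of the velocity integral, as a bilinear expression in the profile `f` at `x` and
the profile `g` at `x - θ`, multiplied by `2i`. -/
def numer (f g : Ell ℤ) : Four :=
  coefMap α m (fun n => freq m 1 n) (fun _ => 0) f *
      coefMap α m (fun n => freq m (-1) n) (freq m (-1)) g -
    coefMap α m (fun n => freq m (-1) n) (fun _ => 0) f *
      coefMap α m (fun n => freq m 1 n) (freq m 1) g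

/-- The difference `f(x) - e^{isθ} g(x - θ)`, for a sign `s`. -/
def gapOut (s : ℤ) (f g : Ell ℤ) : Four :=
  coefMap α m (fun _ => 1) (fun _ => 0) f - coefMap α m (fun _ => 1) (freq m s) g

/-- The difference `g(x - θ) - e^{isθ} f(x)`, for a sign `s`. -/
def gapIn (s : ℤ) (f g : Ell ℤ) : Four :=
  coefMap α m (fun _ => 1) (freq m 0) g - coefMap α m (fun _ => 1) (fun _ => s) f

/-- The kernel `|f(x) - e^{iθ} g(x - θ)|^(-α)` near constants `f = 1`, `|g| < 1`. -/
def kerOut (f g : Ell ℤ) : Four :=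
  pw (-(α / 2)) (gapOut α m 1 f g - 1) * pw (-(α / 2)) (gapOut α m (-1) f g - 1)

/-- The kernel `|g(x - θ) - e^{iθ} f(x)|^(-α)` near constants `g = 1`, `|f| < 1`. -/
def kerIn (f g : Ell ℤ) : Four :=
  pw (-(α / 2)) (gapIn α m 1 f g - 1) * pw (-(α / 2)) (gapIn α m (-1) f g - 1)

/-- The kernel `|(u(x) - e^{iθ} u(x - θ)) / (1 - e^{iθ})|^(-α)` near the constant `u = a`. -/
def kerSelf (a : ℝ) (u : Ell ℤ) : Four :=
  a ^ (-α) • (pw (-(α / 2)) (a⁻¹ • divDiff α m 1 u - 1) *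
    pw (-(α / 2)) (a⁻¹ • divDiff α m (-1) u - 1))

variable [hp : Admissible α m]

/-- The numerator of the velocity integral for real profiles with values `f`, `g` and derivatives
`f'`, `g'`. -/
def realNumer (θ f f' g g' : ℝ) : ℝ :=
  Real.cos θ * (f * g' - f' * g) + Real.sin θ * (f * g + f' * g')

omit hp in
theorem exp_one_mul_I (θ : ℝ) : Complex.exp ((1 : ℤ) * (θ * Complex.I)) =
    Real.cos θ + Real.sin θ * Complex.I := by
  rw [Int.cast_one, one_mul, Complex.exp_mul_I, Complex.ofReal_cos, Complex.ofReal_sin]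

omit hp in
theorem exp_neg_one_mul_I (θ : ℝ) : Complex.exp ((-1 : ℤ) * (θ * Complex.I)) =
    Real.cos θ - Real.sin θ * Complex.I := by
  have : ((-1 : ℤ) : ℂ) * (θ * Complex.I) = ((-θ : ℝ) : ℂ) * Complex.I := by push_cast; ring
  rw [this, Complex.exp_mul_I, ← Complex.ofReal_cos, ← Complex.ofReal_sin, Real.cos_neg,
    Real.sin_neg]
  push_cast; ring

/-- For real profiles the algebraic numerator is `2i` times the real one. -/
theorem eval_numer (x θ a b : ℝ) (d e : Ell ℕ) :
    eval m x θ (numer α m (prof a d) (prof b e)) = ((2 * realNumer θ (a + cosEval α m x d)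
      (dcosEval α m x d) (b + cosEval α m (x - θ) e) (dcosEval α m (x - θ) e) : ℝ) : ℂ) *
        Complex.I := by
  have h0 : ∀ n : ℤ, (0 : ℤ) = 0 - 0 * (m * n) := fun n => by ring
  have h1 : ∀ s n : ℤ, freq m s n = s - 1 * (m * n) := fun s n => by rw [freq]; ring
  have hs : |(-1 : ℤ)| = 1 := by norm_num
  have hs' : |(1 : ℤ)| = 1 := by norm_num
  rw [numer, map_sub, eval_mul, eval_mul, eval_coefMap_freq_prof α m hs' h0,
    eval_coefMap_freq_prof α m hs (h1 _), eval_coefMap_freq_prof α m hs h0,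
    eval_coefMap_freq_prof α m hs' (h1 _), exp_one_mul_I, exp_neg_one_mul_I, realNumer]
  simp only [Int.cast_zero, zero_mul, Complex.exp_zero, sub_zero, Int.cast_one, one_mul,
    Int.cast_neg]
  push_cast
  ring_nf
  simp only [Complex.I_pow_three]
  ring

/-- The product of the powers of two conjugate numbers is the power of their absolute square. The
binomial series gives the principal branch, because both numbers lie in the right half-plane. -/
theorem eval_pw_mul_pw {z₁ z₂ : Four} (h₁ : ‖z₁‖ < 1) (h₂ : ‖z₂‖ < 1) (r : ℝ) (x θ : ℝ) {ζ : ℂ}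
    (hζ₁ : 1 + eval m x θ z₁ = ζ) (hζ₂ : 1 + eval m x θ z₂ = starRingEnd ℂ ζ) :
    0 < Complex.normSq ζ ∧
    eval m x θ (pw r z₁ * pw r z₂) = ((Complex.normSq ζ ^ r : ℝ) : ℂ) := by
  have hre : 0 < ζ.re := by
    have h3 := (abs_le.1 ((Complex.abs_re_le_norm _).trans (norm_eval_le m x θ z₁))).1
    rw [← hζ₁]
    simp only [Complex.add_re, Complex.one_re]
    linarith
  refine ⟨Complex.normSq_pos.2 fun h => by simp [h] at hre, ?_⟩
  have harg := arg_ne_pi_of_re_pos hre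
  rw [eval_mul, eval_pw r h₁, eval_pw r h₂, hζ₁, hζ₂, ← cpow_mul_conj_cpow harg r,
    Complex.conj_cpow _ _ harg, Complex.conj_ofReal]

end Kernels

section KernelValues

variable (α : ℝ) (m : ℕ)

theorem freq_eq (s n : ℤ) : freq m s n = s - 1 * (m * n) := by rw [freq]; ring

theorem normSq_gap (f g θ : ℝ) : Complex.normSq (f - (Real.cos θ + Real.sin θ * Complex.I) * g) =
    f ^ 2 + g ^ 2 - 2 * f * g * Real.cos θ := by
  have h : (f : ℂ) - (Real.cos θ + Real.sin θ * Complex.I) * g =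
      ((f - Real.cos θ * g : ℝ) : ℂ) + ((-(Real.sin θ * g) : ℝ) : ℂ) * Complex.I := by
    push_cast; ring
  rw [h, Complex.normSq_add_mul_I]
  linear_combination g ^ 2 * Real.sin_sq_add_cos_sq θ

theorem conj_gap (f g θ : ℝ) :
    starRingEnd ℂ (f - (Real.cos θ + Real.sin θ * Complex.I) * g) =
      f - (Real.cos θ - Real.sin θ * Complex.I) * g := by
  simp only [map_sub, map_mul, map_add, Complex.conj_ofReal, Complex.conj_I]
  ring

/-- The velocity density for real profiles with values `f`, `g` and derivatives `f'`, `g'`. -/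
def velKer (θ f f' g g' : ℝ) : ℝ :=
  realNumer θ f f' g g' * (f ^ 2 + g ^ 2 - 2 * f * g * Real.cos θ) ^ (-(α / 2))

/-- The velocity density at the angle `x` of the curve `a + d`, induced by the point at the angle
`x - θ` of the curve `b + e`. -/
def velDensity (a : ℝ) (d : Ell ℕ) (b : ℝ) (e : Ell ℕ) (x θ : ℝ) : ℝ :=
  velKer α θ (a + cosEval α m x d) (dcosEval α m x d)
    (b + cosEval α m (x - θ) e) (dcosEval α m (x - θ) e)

/-- The self-interaction, near the constant `a`. -/
def selfTerm (a : ℝ) (u : Ell ℤ) : Ell ℕ :=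
  singPair α m (-1) u (coefMap α m (fun n => freq m 1 n) (fun _ => 0) u * kerSelf α m a u) -
    singPair α m 1 u (coefMap α m (fun n => freq m (-1) n) (fun _ => 0) u * kerSelf α m a u)

/-- The velocity on the outer curve `f` induced by the inner curve `g`. -/
def outTerm (f g : Ell ℤ) : Ell ℕ := smear (fun _ => 1) (numer α m f g * kerOut α m f g)

/-- The velocity on the inner curve `f` induced by the outer curve `g`. -/
def inTerm (f g : Ell ℤ) : Ell ℕ := smear (fun _ => 1) (numer α m f g * kerIn α m f g)

theorem isRealWeight_one : IsRealWeight fun _ => (1 : ℂ) where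
  integrable := intervalIntegrable_const
  symm := fun _ => by simp

variable [hp : Admissible α m]

theorem eval_gapOut_prof (x θ a b : ℝ) (d e : Ell ℕ) :
    eval m x θ (gapOut α m 1 (prof a d) (prof b e)) = ((a + cosEval α m x d : ℝ) : ℂ) -
      (Real.cos θ + Real.sin θ * Complex.I) * ((b + cosEval α m (x - θ) e : ℝ) : ℂ) ∧
    eval m x θ (gapOut α m (-1) (prof a d) (prof b e)) = ((a + cosEval α m x d : ℝ) : ℂ) -
      (Real.cos θ - Real.sin θ * Complex.I) * ((b + cosEval α m (x - θ) e : ℝ) : ℂ) := by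
  have h0 : ∀ n : ℤ, (0 : ℤ) = 0 - 0 * (m * n) := fun n => by ring
  rw [gapOut, gapOut, map_sub, map_sub, eval_coefMap_one_prof α m h0,
    eval_coefMap_one_prof α m (freq_eq m _), eval_coefMap_one_prof α m (freq_eq m _),
    exp_one_mul_I, exp_neg_one_mul_I]
  simp

theorem eval_gapIn_prof (x θ a b : ℝ) (d e : Ell ℕ) :
    eval m x θ (gapIn α m 1 (prof a d) (prof b e)) = ((b + cosEval α m (x - θ) e : ℝ) : ℂ) -
      (Real.cos θ + Real.sin θ * Complex.I) * ((a + cosEval α m x d : ℝ) : ℂ) ∧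
    eval m x θ (gapIn α m (-1) (prof a d) (prof b e)) = ((b + cosEval α m (x - θ) e : ℝ) : ℂ) -
      (Real.cos θ - Real.sin θ * Complex.I) * ((a + cosEval α m x d : ℝ) : ℂ) := by
  have h0 : ∀ s n : ℤ, s = s - 0 * (m * n) := fun s n => by ring
  rw [gapIn, gapIn, map_sub, map_sub, eval_coefMap_one_prof α m (h0 _),
    eval_coefMap_one_prof α m (h0 _), eval_coefMap_one_prof α m (freq_eq m _),
    exp_one_mul_I, exp_neg_one_mul_I]
  simp

theorem eval_numer_mul_kerOut {a b : ℝ} {d e : Ell ℕ}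
    (h : ∀ s : ℤ, |s| = 1 → ‖gapOut α m s (prof a d) (prof b e) - 1‖ < 1) (x θ : ℝ) :
    eval m x θ (numer α m (prof a d) (prof b e) * kerOut α m (prof a d) (prof b e)) =
      ((2 * velDensity α m a d b e x θ : ℝ) : ℂ) * Complex.I := by
  obtain ⟨h1, h2⟩ := eval_gapOut_prof α m x θ a b d e
  have h3 := (eval_pw_mul_pw m (h 1 (by norm_num)) (h (-1) (by norm_num)) (-(α / 2)) x θ
    (ζ := eval m x θ (gapOut α m 1 (prof a d) (prof b e)))
    (by rw [map_sub, eval_one]; ring)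
    (by rw [map_sub, eval_one, h1, h2, conj_gap]; ring)).2
  rw [eval_mul, eval_numer, kerOut, h3, h1, normSq_gap, velDensity, velKer]
  push_cast; ring

theorem eval_numer_mul_kerIn {a b : ℝ} {d e : Ell ℕ}
    (h : ∀ s : ℤ, |s| = 1 → ‖gapIn α m s (prof a d) (prof b e) - 1‖ < 1) (x θ : ℝ) :
    eval m x θ (numer α m (prof a d) (prof b e) * kerIn α m (prof a d) (prof b e)) =
      ((2 * velDensity α m a d b e x θ : ℝ) : ℂ) * Complex.I := by
  obtain ⟨h1, h2⟩ := eval_gapIn_prof α m x θ a b d e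
  have h3 := (eval_pw_mul_pw m (h 1 (by norm_num)) (h (-1) (by norm_num)) (-(α / 2)) x θ
    (ζ := eval m x θ (gapIn α m 1 (prof a d) (prof b e)))
    (by rw [map_sub, eval_one]; ring)
    (by rw [map_sub, eval_one, h1, h2, conj_gap]; ring)).2
  rw [eval_mul, eval_numer, kerIn, h3, h1, normSq_gap, velDensity, velKer]
  have h4 : ∀ f g : ℝ, f ^ 2 + g ^ 2 - 2 * f * g * Real.cos θ =
    g ^ 2 + f ^ 2 - 2 * g * f * Real.cos θ := fun f g => by ring
  rw [h4]
  push_cast; ring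

/-- The singular kernel times the power of the divided difference is the kernel of the
self-interaction. -/
theorem sker_mul_eval_kerSelf {a b : ℝ} (ha : 0 < a) {d : Ell ℕ}
    (h : ∀ s : ℤ, |s| = 1 → ‖a⁻¹ • divDiff α m s (prof b d) - 1‖ < 1) (x : ℝ) {θ : ℝ}
    (h0 : 0 < θ) (h2π : θ < 2 * Real.pi) :
    ((sker α θ : ℝ) : ℂ) * eval m x θ (kerSelf α m a (prof b d)) =
      (((b + cosEval α m x d) ^ 2 + (b + cosEval α m (x - θ) d) ^ 2 -
        2 * (b + cosEval α m x d) * (b + cosEval α m (x - θ) d) * Real.cos θ) ^ (-(α / 2)) : ℝ) := by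
  have hz0 : ∀ n : ℤ, (0 : ℤ) = 0 - 0 * (m * n) := fun n => by ring
  have hs := sin_half_pos h0 h2π
  set f : ℝ := b + cosEval α m x d with hf
  set g : ℝ := b + cosEval α m (x - θ) d with hg
  set E : ℂ := Real.cos θ + Real.sin θ * Complex.I with hE
  have hE1 : 1 - E ≠ 0 := by
    rw [hE, ← exp_one_mul_I, ← norm_ne_zero_iff, norm_sub_rev, norm_exp_sub_one_eq h0.le h2π.le]
    positivity
  have hconjE : starRingEnd ℂ E = Real.cos θ - Real.sin θ * Complex.I := by
    rw [hE]; simp only [map_mul, map_add, Complex.conj_ofReal, Complex.conj_I]; ring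
  have h1 : eval m x θ (divDiff α m 1 (prof b d)) * (1 - E) = f - E * g := by
    have := eval_divDiff α m (s := 1) (by norm_num) x θ (prof b d)
    rw [eval_coefMap_one_prof α m hz0, eval_coefMap_one_prof α m (freq_eq m _),
      exp_one_mul_I] at this
    rw [this]
    simp [hf, hg, hE]
  have h2 : eval m x θ (divDiff α m (-1) (prof b d)) * (1 - starRingEnd ℂ E) =
      f - starRingEnd ℂ E * g := by
    have := eval_divDiff α m (s := -1) (by norm_num) x θ (prof b d)
    rw [eval_coefMap_one_prof α m hz0, eval_coefMap_one_prof α m (freq_eq m _),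
      exp_neg_one_mul_I, ← hconjE] at this
    rw [this]
    simp [hf, hg]
  have h3 : eval m x θ (divDiff α m (-1) (prof b d)) =
      starRingEnd ℂ (eval m x θ (divDiff α m 1 (prof b d))) := by
    have h4 : (1 : ℂ) - starRingEnd ℂ E ≠ 0 := by
      intro h5
      apply hE1
      have := congrArg (starRingEnd ℂ) h5
      simpa using this
    apply mul_right_cancel₀ h4
    rw [h2]
    have := congrArg (starRingEnd ℂ) h1
    simp only [map_mul, map_sub, map_one, Complex.conj_ofReal] at this
    rw [this]
  have h5 := eval_pw_mul_pw m (h 1 (by norm_num)) (h (-1) (by norm_num)) (-(α / 2)) x θ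
    (ζ := a⁻¹ • eval m x θ (divDiff α m 1 (prof b d)))
    (by rw [map_sub, eval_one, map_smul]; ring)
    (by rw [map_sub, eval_one, map_smul, h3, Complex.real_smul, Complex.real_smul, map_mul,
          Complex.conj_ofReal]; ring)
  set z := eval m x θ (divDiff α m 1 (prof b d)) with hz
  have h6 : Complex.normSq (f - E * g) = Complex.normSq (a⁻¹ • z) * (a * (2 * Real.sin (θ / 2))) ^ 2 := by
    have h7 : Complex.normSq (1 - E) = (2 * Real.sin (θ / 2)) ^ 2 := by
      rw [Complex.normSq_eq_norm_sq, norm_sub_rev, hE, ← exp_one_mul_I,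
        norm_exp_sub_one_eq h0.le h2π.le]
    rw [← h1, map_mul, h7, Complex.real_smul, map_mul, Complex.normSq_ofReal]
    field_simp
  have h8 : Complex.normSq (f - E * g) = f ^ 2 + g ^ 2 - 2 * f * g * Real.cos θ := normSq_gap f g θ
  rw [← h8, h6, kerSelf, map_smul, h5.2, Complex.real_smul, Real.mul_rpow h5.1.le (by positivity),
    ← Real.rpow_natCast (a * (2 * Real.sin (θ / 2))), ← Real.rpow_mul (by positivity),
    Real.mul_rpow ha.le (by positivity), sker]
  have h9 : ((2 : ℕ) : ℝ) * (-(α / 2)) = -α := by push_cast; ring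
  rw [h9]
  push_cast; ring

omit hp in
theorem im_integral_two_mul_I {g : ℝ → ℝ} (c₁ c₂ : ℝ) :
    (∫ θ in c₁..c₂, ((2 * g θ : ℝ) : ℂ) * Complex.I).im = 2 * ∫ θ in c₁..c₂, g θ := by
  rw [intervalIntegral.integral_mul_const, intervalIntegral.integral_ofReal,
    intervalIntegral.integral_const_mul]
  simp

theorem sinEval_outTerm {a b : ℝ} {d e : Ell ℕ}
    (h : ∀ s : ℤ, |s| = 1 → ‖gapOut α m s (prof a d) (prof b e) - 1‖ < 1) (x : ℝ) :
    sinEval m x (outTerm α m (prof a d) (prof b e)) =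
      2 * ∫ θ in (0 : ℝ)..(2 * Real.pi), velDensity α m a d b e x θ := by
  rw [outTerm, sinEval_smear isRealWeight_one]
  simp_rw [one_mul, eval_numer_mul_kerOut α m h]
  exact im_integral_two_mul_I 0 _

theorem sinEval_inTerm {a b : ℝ} {d e : Ell ℕ}
    (h : ∀ s : ℤ, |s| = 1 → ‖gapIn α m s (prof a d) (prof b e) - 1‖ < 1) (x : ℝ) :
    sinEval m x (inTerm α m (prof a d) (prof b e)) =
      2 * ∫ θ in (0 : ℝ)..(2 * Real.pi), velDensity α m a d b e x θ := by
  rw [inTerm, sinEval_smear isRealWeight_one]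
  simp_rw [one_mul, eval_numer_mul_kerIn α m h]
  exact im_integral_two_mul_I 0 _

omit hp in
theorem continuous_of_eval {g : ℝ → ℝ} {x : ℝ} {h : Four}
    (hg : ∀ θ, eval m x θ h = ((2 * g θ : ℝ) : ℂ) * Complex.I) : Continuous g := by
  have h1 : g = fun θ => (1 / 2) * (eval m x θ h).im := by
    funext θ
    rw [hg]
    simp
  rw [h1]
  exact (Complex.continuous_im.comp (continuous_eval m x h)).const_mul _

theorem velDensity_integrable_out {a b : ℝ} {d e : Ell ℕ}
    (h : ∀ s : ℤ, |s| = 1 → ‖gapOut α m s (prof a d) (prof b e) - 1‖ < 1) (x : ℝ) :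
    IntervalIntegrable (velDensity α m a d b e x) volume 0 (2 * Real.pi) :=
  (continuous_of_eval m (eval_numer_mul_kerOut α m h x)).intervalIntegrable _ _

theorem velDensity_integrable_in {a b : ℝ} {d e : Ell ℕ}
    (h : ∀ s : ℤ, |s| = 1 → ‖gapIn α m s (prof a d) (prof b e) - 1‖ < 1) (x : ℝ) :
    IntervalIntegrable (velDensity α m a d b e x) volume 0 (2 * Real.pi) :=
  (continuous_of_eval m (eval_numer_mul_kerIn α m h x)).intervalIntegrable _ _

omit hp in
/-- The cancellation in the singular numerator: its two products can be replaced by products with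
differences that vanish at `θ = 0`. -/
theorem numer_self (u : Ell ℤ) : numer α m u u =
    shiftDiff α m (-1) u * coefMap α m (fun n => freq m 1 n) (fun _ => 0) u -
      shiftDiff α m 1 u * coefMap α m (fun n => freq m (-1) n) (fun _ => 0) u := by
  rw [numer, shiftDiff, shiftDiff, sub_apply, sub_apply]
  ring

/-- The singular density of the self-interaction, as a double Fourier series times the singular
kernel. -/
def selfDensity (a : ℝ) (u : Ell ℤ) (x θ : ℝ) : ℂ :=
  ((sker α θ : ℝ) : ℂ) * eval m x θ (numer α m u u * kerSelf α m a u)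

theorem selfDensity_integrable (a : ℝ) (u : Ell ℤ) (x : ℝ) :
    IntervalIntegrable (selfDensity α m a u x) volume 0 (2 * Real.pi) := by
  have h1 := (shiftDiff_mul_integrable α m (s := -1) (by norm_num) x u
    (coefMap α m (fun n => freq m 1 n) (fun _ => 0) u * kerSelf α m a u)).1
  have h2 := (shiftDiff_mul_integrable α m (s := 1) (by norm_num) x u
    (coefMap α m (fun n => freq m (-1) n) (fun _ => 0) u * kerSelf α m a u)).1
  refine (h1.sub h2).congr fun θ _ => ?_
  rw [selfDensity, numer_self, ← mul_sub, ← map_sub]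
  congr 2
  ring

/-- Thanks to `numer_self`, the two singular pairings add up to the integral of the singular density. -/
theorem sinEval_selfTerm (a : ℝ) (u : Ell ℤ) (x : ℝ) : sinEval m x (selfTerm α m a u) =
    (∫ θ in (0 : ℝ)..(2 * Real.pi), selfDensity α m a u x θ).im := by
  have h1 := (shiftDiff_mul_integrable α m (s := -1) (by norm_num) x u
    (coefMap α m (fun n => freq m 1 n) (fun _ => 0) u * kerSelf α m a u)).1
  have h2 := (shiftDiff_mul_integrable α m (s := 1) (by norm_num) x u
    (coefMap α m (fun n => freq m (-1) n) (fun _ => 0) u * kerSelf α m a u)).1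
  rw [selfTerm, map_sub, sinEval_singPair α m (by norm_num), sinEval_singPair α m (by norm_num),
    ← Complex.sub_im, ← intervalIntegral.integral_sub h1 h2]
  congr 1
  refine intervalIntegral.integral_congr fun θ _ => ?_
  rw [selfDensity, numer_self, ← mul_sub, ← map_sub]
  congr 2
  ring

theorem selfDensity_eq {a b : ℝ} (ha : 0 < a) {d : Ell ℕ}
    (h : ∀ s : ℤ, |s| = 1 → ‖a⁻¹ • divDiff α m s (prof b d) - 1‖ < 1) (x : ℝ) {θ : ℝ}
    (h0 : 0 < θ) (h2π : θ < 2 * Real.pi) : selfDensity α m a (prof b d) x θ =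
      ((2 * velDensity α m b d b d x θ : ℝ) : ℂ) * Complex.I := by
  rw [selfDensity, eval_mul, mul_left_comm, sker_mul_eval_kerSelf α m ha h x h0 h2π, eval_numer,
    velDensity, velKer]
  push_cast; ring

theorem velDensity_integrable_self {a b : ℝ} (ha : 0 < a) {d : Ell ℕ}
    (h : ∀ s : ℤ, |s| = 1 → ‖a⁻¹ • divDiff α m s (prof b d) - 1‖ < 1) (x : ℝ) :
    IntervalIntegrable (velDensity α m b d b d x) volume 0 (2 * Real.pi) := by
  have hpi := Real.pi_pos
  have h1 := selfDensity_integrable α m a (prof b d) x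
  rw [intervalIntegrable_iff_integrableOn_Ioo_of_le (by linarith)] at h1 ⊢
  refine (h1.im.const_mul (1 / 2)).congr ?_
  rw [Filter.EventuallyEq, ae_restrict_iff' measurableSet_Ioo]
  refine Eventually.of_forall fun θ hθ => ?_
  rw [selfDensity_eq α m ha h x hθ.1 hθ.2]
  simp

theorem sinEval_selfTerm_prof {a b : ℝ} (ha : 0 < a) {d : Ell ℕ}
    (h : ∀ s : ℤ, |s| = 1 → ‖a⁻¹ • divDiff α m s (prof b d) - 1‖ < 1) (x : ℝ) :
    sinEval m x (selfTerm α m a (prof b d)) =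
      2 * ∫ θ in (0 : ℝ)..(2 * Real.pi), velDensity α m b d b d x θ := by
  have hpi := Real.pi_pos
  rw [sinEval_selfTerm, ← im_integral_two_mul_I]
  congr 1
  rw [intervalIntegral.integral_of_le (by linarith), intervalIntegral.integral_of_le (by linarith),
    integral_Ioc_eq_integral_Ioo, integral_Ioc_eq_integral_Ioo]
  exact setIntegral_congr_fun measurableSet_Ioo fun θ hθ => selfDensity_eq α m ha h x hθ.1 hθ.2

end KernelValues

/-! ### The functional and the contour equations -/

section Link

variable (α : ℝ) (m : ℕ)

/-- The cosine series `∑ d_k c_k cos((k+1)mz)` with complex argument. -/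
def profile (d : Ell ℕ) (z : ℂ) : ℂ :=
  ∑' k : ℕ, ((d k * cosCoef α m k : ℝ) : ℂ) * Complex.cos (((k + 1 : ℕ) : ℂ) * m * z)

/-- For constant radii the density is odd about `θ = π`. -/
theorem velKer_swap_sign (θ f g : ℝ) : velKer α (2 * Real.pi - θ) f 0 g 0 = -velKer α θ f 0 g 0 := by
  simp only [velKer, realNumer, Real.cos_two_pi_sub, Real.sin_two_pi_sub]
  ring

theorem integral_velKer_const (f g : ℝ) :
    ∫ θ in (0 : ℝ)..(2 * Real.pi), velKer α θ f 0 g 0 = 0 := by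
  have h1 := intervalIntegral.integral_comp_sub_left (a := 0) (b := 2 * Real.pi)
    (fun θ : ℝ => velKer α θ f 0 g 0) (2 * Real.pi)
  simp_rw [velKer_swap_sign] at h1
  rw [sub_self, sub_zero, intervalIntegral.integral_neg] at h1
  linarith

theorem velKer_base_nonneg (f g θ : ℝ) : 0 ≤ f ^ 2 + g ^ 2 - 2 * f * g * Real.cos θ := by
  rw [← normSq_gap]
  exact Complex.normSq_nonneg _

theorem t1Integrand_eq (u : ℝ → ℝ) (x y : ℝ) :
    t1Integrand α u x y = velKer α (x - y) (u x) (deriv u x) (u y) (deriv u y) := by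
  rw [t1Integrand, velKer, Real.rpow_neg (velKer_base_nonneg _ _ _), realNumer, div_eq_mul_inv]
  congr 1
  ring

theorem t2Integrand_eq (p q : ℝ → ℝ) (x y : ℝ) :
    t2Integrand α p q x y = -velKer α (x - y) (q x) (deriv q x) (p y) (deriv p y) := by
  rw [t2Integrand, velKer, Real.rpow_neg (velKer_base_nonneg _ _ _), realNumer, div_eq_mul_inv]
  rw [← neg_mul]
  congr 1
  ring

variable [hp : Admissible α m]

theorem cosEval_eq_tsum (x : ℝ) (d : Ell ℕ) : cosEval α m x d =
    ∑' k : ℕ, d k * (cosCoef α m k * Real.cos ((k + 1 : ℕ) * m * x)) :=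
  Ell.lift_apply (norm_cosEval_value_le α m x) d

theorem profile_ofReal (d : Ell ℕ) (x : ℝ) : profile α m d x = (cosEval α m x d : ℝ) := by
  rw [profile, cosEval_eq_tsum, Complex.ofReal_tsum]
  refine tsum_congr fun k => ?_
  push_cast
  ring

theorem hasDerivAt_cosEval (d : Ell ℕ) (x : ℝ) :
    HasDerivAt (fun x => cosEval α m x d) (dcosEval α m x d) x := by
  have hsum : Summable fun k => |d k| * coefBound α m := (Ell.hasSum_norm d).summable.mul_right _
  have h := hasDerivAt_tsum (g := fun (k : ℕ) (x : ℝ) =>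
      d k * (cosCoef α m k * Real.cos ((k + 1 : ℕ) * m * x)))
    (g' := fun (k : ℕ) (x : ℝ) =>
      d k * -(cosCoef α m k * ((k + 1 : ℕ) * m) * Real.sin ((k + 1 : ℕ) * m * x)))
    (u := fun k => |d k| * coefBound α m) (y₀ := 0) hsum ?_ ?_ ?_ x
  · have h2 : dcosEval α m x d = ∑' k : ℕ,
        d k * -(cosCoef α m k * ((k + 1 : ℕ) * m) * Real.sin ((k + 1 : ℕ) * m * x)) :=
      Ell.lift_apply (norm_dcosEval_value_le α m x) d
    rw [h2, funext fun x => cosEval_eq_tsum α m x d]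
    exact h
  · intro k x
    have h1 : HasDerivAt (fun x : ℝ => ((k + 1 : ℕ) : ℝ) * m * x) (((k + 1 : ℕ) : ℝ) * m) x := by
      simpa using (hasDerivAt_id x).const_mul (((k + 1 : ℕ) : ℝ) * m)
    exact ((h1.cos.const_mul (cosCoef α m k)).const_mul (d k)).congr_deriv (by ring)
  · intro k x
    rw [norm_mul, Real.norm_eq_abs (d k)]
    exact mul_le_mul_of_nonneg_left (norm_dcosEval_value_le α m x k) (abs_nonneg _)
  · exact Ell.summable_smul (norm_cosEval_value_le α m 0) d

omit hp in
theorem cosEval_periodic (d : Ell ℕ) : Function.Periodic (fun x => cosEval α m x d) (2 * Real.pi) := by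
  intro x
  have h : cosEval α m (x + 2 * Real.pi) = cosEval α m x := by
    rw [cosEval, cosEval]
    congr 1
    funext k
    have : ((k + 1 : ℕ) : ℝ) * m * (x + 2 * Real.pi) =
        ((k + 1 : ℕ) : ℝ) * m * x + ((k + 1) * m : ℕ) * (2 * Real.pi) := by push_cast; ring
    rw [this, Real.cos_add_nat_mul_two_pi]
  exact congrArg (fun T : Ell ℕ →L[ℝ] ℝ => T d) h

omit hp in
theorem dcosEval_periodic (d : Ell ℕ) :
    Function.Periodic (fun x => dcosEval α m x d) (2 * Real.pi) := by
  intro x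
  have h : dcosEval α m (x + 2 * Real.pi) = dcosEval α m x := by
    rw [dcosEval, dcosEval]
    congr 1
    funext k
    have : ((k + 1 : ℕ) : ℝ) * m * (x + 2 * Real.pi) =
        ((k + 1 : ℕ) : ℝ) * m * x + ((k + 1) * m : ℕ) * (2 * Real.pi) := by push_cast; ring
    rw [this, Real.sin_add_nat_mul_two_pi]
  exact congrArg (fun T : Ell ℕ →L[ℝ] ℝ => T d) h

theorem radius_profile (a : ℝ) (d : Ell ℕ) (x : ℝ) :
    radius a (profile α m d) x = a + cosEval α m x d := by
  rw [radius, profile_ofReal, Complex.ofReal_re]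

theorem deriv_radius_profile (a : ℝ) (d : Ell ℕ) (x : ℝ) :
    deriv (radius a (profile α m d)) x = dcosEval α m x d := by
  rw [funext fun x => radius_profile α m a d x]
  exact ((hasDerivAt_cosEval α m d x).const_add a).deriv

/-- The velocity density in the original variable `y = x - θ`. -/
theorem integral_velKer_eq {a b : ℝ} {d e : Ell ℕ} {x : ℝ}
    (h : IntervalIntegrable (velDensity α m a d b e x) volume 0 (2 * Real.pi)) :
    IntervalIntegrable (fun y => velKer α (x - y) (radius a (profile α m d) x)
      (deriv (radius a (profile α m d)) x) (radius b (profile α m e) y)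
      (deriv (radius b (profile α m e)) y)) volume 0 (2 * Real.pi) ∧
    ∫ y in (0 : ℝ)..(2 * Real.pi), velKer α (x - y) (radius a (profile α m d) x)
      (deriv (radius a (profile α m d)) x) (radius b (profile α m e) y)
      (deriv (radius b (profile α m e)) y) =
    ∫ θ in (0 : ℝ)..(2 * Real.pi), velDensity α m a d b e x θ := by
  have hpi := Real.pi_pos
  simp_rw [radius_profile, deriv_radius_profile]
  set g : ℝ → ℝ := fun y => velKer α (x - y) (a + cosEval α m x d) (dcosEval α m x d)
    (b + cosEval α m y e) (dcosEval α m y e) with hg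
  have hper : Function.Periodic g (2 * Real.pi) := by
    intro y
    have h1 : x - (y + 2 * Real.pi) = x - y - 2 * Real.pi := by ring
    have h2 := cosEval_periodic α m e y
    have h3 := dcosEval_periodic α m e y
    simp only at h2 h3
    simp only [hg, h1, h2, h3, velKer, realNumer, Real.cos_sub_two_pi, Real.sin_sub_two_pi]
  have h1 : velDensity α m a d b e x = fun θ => g (x - θ) := by
    funext θ
    simp only [velDensity, hg, sub_sub_cancel]
  have h2 := h.comp_sub_left x
  have h3 : (fun y => velDensity α m a d b e x (x - y)) = g := by
    funext y
    simp only [h1, sub_sub_cancel]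
  rw [h3, sub_zero] at h2
  constructor
  · have h4 : IntervalIntegrable g volume (x - 2 * Real.pi) (x - 2 * Real.pi + 2 * Real.pi) := by
      rw [sub_add_cancel]; exact h2.symm
    exact hper.intervalIntegrable (by positivity) h4 0 (2 * Real.pi)
  · rw [h1, intervalIntegral.integral_comp_sub_left (fun y => g y) x, sub_zero]
    have h5 := hper.intervalIntegral_add_eq (x - 2 * Real.pi) 0
    rw [sub_add_cancel, zero_add] at h5
    exact h5.symm

/-- The functional whose zeros are the stationary patches; `b₀` only enters in the normalization of
the powers. -/
def patchMap (b₀ : ℝ) (q : ℝ × (Ell ℕ × Ell ℕ)) : Ell ℕ × Ell ℕ :=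
  (selfTerm α m 1 (prof 1 q.2.1) - outTerm α m (prof 1 q.2.1) (prof q.1 q.2.2),
   inTerm α m (prof q.1 q.2.2) (prof 1 q.2.1) - selfTerm α m b₀ (prof q.1 q.2.2))

/-- The neighborhood of the annulus on which all powers are given by the binomial series and the two
curves are ordered. -/
structure IsNear (b₀ : ℝ) (q : ℝ × (Ell ℕ × Ell ℕ)) : Prop where
  pos : 0 < q.1
  lt_one : q.1 < 1
  small : coefBound α m * ‖q.2.2‖ < q.1
  gapOut : ∀ s : ℤ, |s| = 1 → ‖gapOut α m s (prof 1 q.2.1) (prof q.1 q.2.2) - 1‖ < 1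
  gapIn : ∀ s : ℤ, |s| = 1 → ‖gapIn α m s (prof q.1 q.2.2) (prof 1 q.2.1) - 1‖ < 1
  outer : ∀ s : ℤ, |s| = 1 → ‖(1 : ℝ)⁻¹ • divDiff α m s (prof 1 q.2.1) - 1‖ < 1
  inner : ∀ s : ℤ, |s| = 1 → ‖b₀⁻¹ • divDiff α m s (prof q.1 q.2.2) - 1‖ < 1

variable {b₀ : ℝ} {q : ℝ × (Ell ℕ × Ell ℕ)}

/-- The functional is `2 / c_α` times the left-hand side of the contour equations; on the outer curve
this is the following identity. -/
theorem sinEval_patchMap_fst (h : IsNear α m b₀ q) (x : ℝ) :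
    sinEval m x (patchMap α m b₀ q).1 =
      2 * (∫ θ in (0 : ℝ)..(2 * Real.pi), velDensity α m 1 q.2.1 1 q.2.1 x θ) -
      2 * ∫ θ in (0 : ℝ)..(2 * Real.pi), velDensity α m 1 q.2.1 q.1 q.2.2 x θ := by
  rw [patchMap, map_sub, sinEval_selfTerm_prof α m one_pos h.outer, sinEval_outTerm α m h.gapOut]

theorem sinEval_patchMap_snd (hb₀ : 0 < b₀) (h : IsNear α m b₀ q) (x : ℝ) :
    sinEval m x (patchMap α m b₀ q).2 =
      2 * (∫ θ in (0 : ℝ)..(2 * Real.pi), velDensity α m q.1 q.2.2 1 q.2.1 x θ) -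
      2 * ∫ θ in (0 : ℝ)..(2 * Real.pi), velDensity α m q.1 q.2.2 q.1 q.2.2 x θ := by
  rw [patchMap, map_sub, sinEval_selfTerm_prof α m hb₀ h.inner, sinEval_inTerm α m h.gapIn]

theorem abs_cosEval_le (x : ℝ) (d : Ell ℕ) : |cosEval α m x d| ≤ coefBound α m * ‖d‖ :=
  Ell.norm_lift_apply_le (norm_cosEval_value_le α m x) d

/-- Zeros of the functional near an annulus solve the contour equations. -/
theorem isStationaryPatch_of_patchMap_eq_zero (hb₀ : 0 < b₀) (h : IsNear α m b₀ q)
    (hq : patchMap α m b₀ q = 0) :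
    IsStationaryPatch α q.1 (profile α m q.2.1) (profile α m q.2.2) := by
  have i11 := fun x => integral_velKer_eq α m (velDensity_integrable_self α m one_pos h.outer x)
  have i12 := fun x => integral_velKer_eq α m (velDensity_integrable_out α m h.gapOut x)
  have i21 := fun x => integral_velKer_eq α m (velDensity_integrable_in α m h.gapIn x)
  have i22 := fun x => integral_velKer_eq α m (velDensity_integrable_self α m hb₀ h.inner x)
  have e1 : ∀ x, t1Integrand α (radius 1 (profile α m q.2.1)) x = _ := fun x =>
    funext fun y => t1Integrand_eq α _ x y
  have e2 : ∀ x, t2Integrand α (radius q.1 (profile α m q.2.2)) (radius 1 (profile α m q.2.1)) x = _ :=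
    fun x => funext fun y => t2Integrand_eq α _ _ x y
  have e3 : ∀ x, t2Integrand α (radius 1 (profile α m q.2.1)) (radius q.1 (profile α m q.2.2)) x = _ :=
    fun x => funext fun y => t2Integrand_eq α _ _ x y
  have e4 : ∀ x, t1Integrand α (radius q.1 (profile α m q.2.2)) x = _ := fun x =>
    funext fun y => t1Integrand_eq α _ x y
  refine ⟨fun x => ?_, fun x => ?_, fun x => ⟨?_, ?_⟩, fun x => ⟨?_, ?_⟩, fun x => ?_, fun x => ?_⟩
  · rw [radius_profile]
    have h1 := (abs_le.1 (abs_cosEval_le α m x q.2.2)).1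
    linarith [h.small]
  · rw [radius_profile, radius_profile]
    have h1 := (norm_eval_le m x 0 _).trans_lt (h.gapOut 1 (by norm_num))
    rw [map_sub, eval_one, (eval_gapOut_prof α m x 0 _ _ _ _).1] at h1
    have h2 := (abs_lt.1 ((Complex.abs_re_le_norm _).trans_lt h1)).1
    simp at h2
    linarith
  · rw [e1]; exact (i11 x).1
  · rw [e2]; exact (i12 x).1.neg
  · rw [e3]; exact (i21 x).1.neg
  · rw [e4]; exact (i22 x).1
  · have h1 := sinEval_patchMap_fst α m h x
    rw [hq, Prod.fst_zero, map_zero] at h1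
    rw [F1, T1, T2, e1, e2, intervalIntegral.integral_neg, (i11 x).2, (i12 x).2]
    linear_combination (-(cAlpha α / 2)) * h1
  · have h1 := sinEval_patchMap_snd α m hb₀ h x
    rw [hq, Prod.snd_zero, map_zero] at h1
    rw [F2, T1, T2, e3, e4, intervalIntegral.integral_neg, (i21 x).2, (i22 x).2]
    linear_combination (-(cAlpha α / 2)) * h1

/-! ### Injectivity of the sine transform -/

omit hp in
theorem integral_cos_int {k : ℤ} (hk : k ≠ 0) :
    ∫ θ in (0 : ℝ)..(2 * Real.pi), Real.cos (k * θ) = 0 := by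
  have hk' : (k : ℝ) ≠ 0 := by exact_mod_cast hk
  rw [intervalIntegral.integral_comp_mul_left (fun θ => Real.cos θ) hk', integral_cos]
  have : Real.sin (k * (2 * Real.pi)) = 0 := by
    rw [Real.sin_eq_zero_iff]
    exact ⟨2 * k, by push_cast; ring⟩
  simp [this]

omit hp in
theorem integral_sin_mul_sin_nat {p q : ℕ} (hp : 1 ≤ p) :
    ∫ θ in (0 : ℝ)..(2 * Real.pi), Real.sin (p * θ) * Real.sin (q * θ) =
      if q = p then Real.pi else 0 := by
  have h1 : ∀ θ : ℝ, Real.sin (p * θ) * Real.sin (q * θ) =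
      (1 / 2) * Real.cos (((p - q : ℤ) : ℝ) * θ) - (1 / 2) * Real.cos (((p + q : ℤ) : ℝ) * θ) := by
    intro θ
    have e1 : (((p : ℤ) - q : ℤ) : ℝ) * θ = p * θ - q * θ := by push_cast; ring
    have e2 : (((p : ℤ) + q : ℤ) : ℝ) * θ = p * θ + q * θ := by push_cast; ring
    rw [e1, e2, Real.cos_sub, Real.cos_add]
    ring
  simp_rw [h1]
  rw [intervalIntegral.integral_sub (Continuous.intervalIntegrable (by fun_prop) _ _)
    (Continuous.intervalIntegrable (by fun_prop) _ _), intervalIntegral.integral_const_mul,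
    intervalIntegral.integral_const_mul, integral_cos_int (show (p + q : ℤ) ≠ 0 by omega)]
  split_ifs with h
  · subst h
    simp
  · rw [integral_cos_int (show (p - q : ℤ) ≠ 0 by omega)]
    simp

omit hp in
/-- The coefficients of an absolutely convergent sine series are determined by its values. -/
theorem eq_zero_of_sinEval (hm : 0 < m) {y : Ell ℕ} (h : ∀ x, sinEval m x y = 0) : y = 0 := by
  have hm' : (m : ℝ) ≠ 0 := by positivity
  suffices key : ∀ j, y j = 0 by
    ext j
    rw [key j]; rfl
  intro j
  have hval := norm_sin_div_wt_le m
  have h1 := intervalIntegral.hasSum_integral_of_dominated_convergence (μ := volume) (a := 0)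
    (b := 2 * Real.pi)
    (F := fun (k : ℕ) (ξ : ℝ) => Real.sin ((j + 1 : ℕ) * ξ) *
      (y k • (Real.sin ((k + 1 : ℕ) * m * (ξ / m)) / wt (k + 1 : ℕ))))
    (f := fun _ => 0) (fun k _ => |y k|)
    (fun k => Continuous.aestronglyMeasurable (by fun_prop))
    (fun k => Eventually.of_forall fun ξ _ => by
      rw [norm_mul, norm_smul]
      have e1 := hval (ξ / m) k
      have e2 := Real.abs_sin_le_one ((j + 1 : ℕ) * ξ)
      calc ‖Real.sin ((j + 1 : ℕ) * ξ)‖ *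
            (‖y k‖ * ‖Real.sin ((k + 1 : ℕ) * m * (ξ / m)) / wt (k + 1 : ℕ)‖)
          ≤ 1 * (‖y k‖ * 1) := by gcongr; exact e2
        _ = |y k| := by rw [one_mul, mul_one, Real.norm_eq_abs])
    (Eventually.of_forall fun ξ _ => (Ell.hasSum_norm y).summable)
    intervalIntegrable_const
    (Eventually.of_forall fun ξ _ => by
      have e := (Ell.hasSum_lift (hval (ξ / m)) y).mul_left (Real.sin ((j + 1 : ℕ) * ξ))
      refine hasSum_of_eq e (fun _ => rfl) ?_
      have h3 := h (ξ / m)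
      rw [sinEval] at h3
      rw [h3, mul_zero])
  have h2 : ∀ k : ℕ, ∫ ξ in (0 : ℝ)..(2 * Real.pi), Real.sin ((j + 1 : ℕ) * ξ) *
      (y k • (Real.sin ((k + 1 : ℕ) * m * (ξ / m)) / wt (k + 1 : ℕ))) =
      if k = j then Real.pi * (y k / wt (k + 1 : ℕ)) else 0 := by
    intro k
    have e : ∀ ξ : ℝ, Real.sin ((j + 1 : ℕ) * ξ) *
        (y k • (Real.sin ((k + 1 : ℕ) * m * (ξ / m)) / wt (k + 1 : ℕ))) =
        Real.sin ((j + 1 : ℕ) * ξ) * Real.sin ((k + 1 : ℕ) * ξ) * (y k / wt (k + 1 : ℕ)) := by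
      intro ξ
      have : ((k + 1 : ℕ) : ℝ) * m * (ξ / m) = (k + 1 : ℕ) * ξ := by field_simp
      rw [this, smul_eq_mul]; ring
    simp_rw [e]
    rw [intervalIntegral.integral_mul_const, integral_sin_mul_sin_nat (by omega)]
    by_cases hkj : k = j
    · simp [hkj]
    · simp [hkj]
  rw [intervalIntegral.integral_zero, funext h2] at h1
  have h3 : Real.pi * (y j / wt (j + 1 : ℕ)) = 0 := by
    have h4 := hasSum_single (f := fun k : ℕ => if k = j then Real.pi * (y k / wt (k + 1 : ℕ)) else 0)
      j (fun k hk => if_neg hk)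
    have h5 := h4.unique h1
    simpa using h5
  have h4 := (wt_pos (j + 1 : ℕ)).ne'
  rcases mul_eq_zero.1 h3 with h5 | h5
  · exact absurd h5 Real.pi_ne_zero
  · exact (div_eq_zero_iff.1 h5).resolve_right h4

/-- All annuli are stationary: the velocity densities are odd about `θ = π`. -/
theorem patchMap_annulus (hb₀ : 0 < b₀) {b : ℝ} (h : IsNear α m b₀ (b, 0)) :
    patchMap α m b₀ (b, 0) = 0 := by
  have hd : ∀ a c x θ : ℝ, velDensity α m a 0 c 0 x θ = velKer α θ a 0 c 0 := by
    intro a c x θ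
    simp [velDensity]
  have hm : 0 < m := by have := hp.two_le; omega
  refine Prod.ext (eq_zero_of_sinEval m hm fun x => ?_) (eq_zero_of_sinEval m hm fun x => ?_)
  · rw [sinEval_patchMap_fst α m h]
    simp only [Prod.fst_zero, Prod.snd_zero, hd, integral_velKer_const]
    simp
  · rw [sinEval_patchMap_snd α m hb₀ h]
    simp only [Prod.fst_zero, Prod.snd_zero, hd, integral_velKer_const]
    simp

end Link

/-! ### Smoothness of the functional near the annulus -/

section Smooth

variable (α : ℝ) (m : ℕ) [hp : Admissible α m]

theorem coefMap_prof_zero {c : ℤ → ℝ} (hc : ∀ n : ℤ, |c n| ≤ 1 + m * |(n : ℝ)|) (j : ℤ → ℤ) (a : ℝ) :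
    coefMap α m c j (prof a 0) = (a * c 0) • Four.t (j 0) := by
  rw [prof, map_zero, add_zero, map_smul, coefMap_basis α m hc, omega_zero, inv_one, one_mul,
    smul_smul]
  rfl

omit hp in
theorem freq_zero (s : ℤ) : freq m s 0 = s := by simp [freq]

omit hp in
theorem t_zero : Four.t 0 = 1 := rfl

theorem gapOut_annulus (s : ℤ) (b : ℝ) :
    gapOut α m s (prof 1 0) (prof b 0) - 1 = -(b • Four.t s) := by
  rw [gapOut, coefMap_prof_zero α m (abs_one_le m), coefMap_prof_zero α m (abs_one_le m), freq_zero,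
    t_zero, one_mul, one_smul, mul_one]
  abel

theorem gapIn_annulus (s : ℤ) (b : ℝ) :
    gapIn α m s (prof b 0) (prof 1 0) - 1 = -(b • Four.t s) := by
  rw [gapIn, coefMap_prof_zero α m (abs_one_le m), coefMap_prof_zero α m (abs_one_le m), freq_zero,
    t_zero, one_mul, one_smul, mul_one]
  abel

theorem divDiff_annulus {s : ℤ} (hs : |s| = 1) {a : ℝ} (ha : a ≠ 0) :
    a⁻¹ • divDiff α m s (prof a 0) - 1 = 0 := by
  have h1 : geo s (1 - s * (m * 0)) = 1 := by
    simp [geo, t_zero]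
  rw [prof, map_zero, add_zero, map_smul, divDiff_basis α m hs, smul_smul, inv_mul_cancel₀ ha,
    one_smul, omega_zero, inv_one, one_smul, h1, mul_one]
  exact sub_self _

omit hp in
theorem contDiff_prof_outer {n : WithTop ℕ∞} :
    ContDiff ℝ n fun q : ℝ × (Ell ℕ × Ell ℕ) => prof 1 q.2.1 := by
  unfold prof
  exact contDiff_const.add (emb.contDiff.comp (contDiff_fst.comp contDiff_snd))

omit hp in
theorem contDiff_prof_inner {n : WithTop ℕ∞} :
    ContDiff ℝ n fun q : ℝ × (Ell ℕ × Ell ℕ) => prof q.1 q.2.2 := by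
  unfold prof
  exact (contDiff_fst.smul contDiff_const).add (emb.contDiff.comp (contDiff_snd.comp contDiff_snd))

variable {E : Type*} [NormedAddCommGroup E] [NormedSpace ℝ E] {n : WithTop ℕ∞} {f g : E → Ell ℤ}
  {q : E}

omit hp in
theorem _root_.ContDiffAt.gapOut (hf : ContDiffAt ℝ n f q) (hg : ContDiffAt ℝ n g q) (s : ℤ) :
    ContDiffAt ℝ n (fun q => gapOut α m s (f q) (g q) - 1) q :=
  (((coefMap α m _ _).contDiff.contDiffAt.comp q hf).sub
    ((coefMap α m _ _).contDiff.contDiffAt.comp q hg)).sub contDiffAt_const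

omit hp in
theorem _root_.ContDiffAt.gapIn (hf : ContDiffAt ℝ n f q) (hg : ContDiffAt ℝ n g q) (s : ℤ) :
    ContDiffAt ℝ n (fun q => gapIn α m s (f q) (g q) - 1) q :=
  (((coefMap α m _ _).contDiff.contDiffAt.comp q hg).sub
    ((coefMap α m _ _).contDiff.contDiffAt.comp q hf)).sub contDiffAt_const

omit hp in
theorem _root_.ContDiffAt.divDiff (hf : ContDiffAt ℝ n f q) (a : ℝ) (s : ℤ) :
    ContDiffAt ℝ n (fun q => a⁻¹ • GSQG.divDiff α m s (f q) - 1) q :=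
  (((GSQG.divDiff α m s).contDiff.contDiffAt.comp q hf).const_smul a⁻¹).sub contDiffAt_const

omit hp in
theorem _root_.ContDiffAt.pw {z : E → Four} (hz : ContDiffAt ℝ n z q) (h : ‖z q‖ < 1) (r : ℝ) :
    ContDiffAt ℝ n (fun q => pw r (z q)) q :=
  (contDiffAt_pw r h).comp q hz

omit hp in
theorem _root_.ContDiffAt.numer (hf : ContDiffAt ℝ n f q) (hg : ContDiffAt ℝ n g q) :
    ContDiffAt ℝ n (fun q => numer α m (f q) (g q)) q := by
  unfold GSQG.numer
  exact (((coefMap α m _ _).contDiff.contDiffAt.comp q hf).mul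
    ((coefMap α m _ _).contDiff.contDiffAt.comp q hg)).sub
    (((coefMap α m _ _).contDiff.contDiffAt.comp q hf).mul
    ((coefMap α m _ _).contDiff.contDiffAt.comp q hg))

omit hp in
theorem contDiffAt_numer_mul_kerOut (hf : ContDiffAt ℝ n f q) (hg : ContDiffAt ℝ n g q)
    (h : ∀ s : ℤ, |s| = 1 → ‖gapOut α m s (f q) (g q) - 1‖ < 1) :
    ContDiffAt ℝ n (fun q => numer α m (f q) (g q) * kerOut α m (f q) (g q)) q := by
  unfold GSQG.kerOut
  exact (hf.numer α m hg).mul (((hf.gapOut α m hg 1).pw (h 1 (by norm_num)) _).mul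
    ((hf.gapOut α m hg (-1)).pw (h (-1) (by norm_num)) _))

omit hp in
theorem contDiffAt_numer_mul_kerIn (hf : ContDiffAt ℝ n f q) (hg : ContDiffAt ℝ n g q)
    (h : ∀ s : ℤ, |s| = 1 → ‖gapIn α m s (f q) (g q) - 1‖ < 1) :
    ContDiffAt ℝ n (fun q => numer α m (f q) (g q) * kerIn α m (f q) (g q)) q := by
  unfold GSQG.kerIn
  exact (hf.numer α m hg).mul (((hf.gapIn α m hg 1).pw (h 1 (by norm_num)) _).mul
    ((hf.gapIn α m hg (-1)).pw (h (-1) (by norm_num)) _))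

omit hp in
theorem contDiffAt_kerSelf (hf : ContDiffAt ℝ n f q) {a : ℝ}
    (h : ∀ s : ℤ, |s| = 1 → ‖a⁻¹ • divDiff α m s (f q) - 1‖ < 1) :
    ContDiffAt ℝ n (fun q => kerSelf α m a (f q)) q := by
  unfold GSQG.kerSelf
  exact ContDiffAt.const_smul _ (((hf.divDiff α m a 1).pw (h 1 (by norm_num)) _).mul
    ((hf.divDiff α m a (-1)).pw (h (-1) (by norm_num)) _))

omit hp in
theorem contDiffAt_selfTerm (hf : ContDiffAt ℝ n f q) {a : ℝ}
    (h : ∀ s : ℤ, |s| = 1 → ‖a⁻¹ • divDiff α m s (f q) - 1‖ < 1) :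
    ContDiffAt ℝ n (fun q => selfTerm α m a (f q)) q := by
  unfold GSQG.selfTerm
  have hk := contDiffAt_kerSelf α m hf h
  exact (((singPair α m (-1)).contDiff.contDiffAt.comp q hf).clm_apply
    (((coefMap α m _ _).contDiff.contDiffAt.comp q hf).mul hk)).sub
    (((singPair α m 1).contDiff.contDiffAt.comp q hf).clm_apply
    (((coefMap α m _ _).contDiff.contDiffAt.comp q hf).mul hk))

omit hp in
/-- Smoothness of the functional: it is composed of bounded multilinear maps and binomial powers. -/
theorem contDiffAt_patchMap {b₀ : ℝ} {q : ℝ × (Ell ℕ × Ell ℕ)} (h : IsNear α m b₀ q) :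
    ContDiffAt ℝ n (patchMap α m b₀) q := by
  have h1 : ContDiffAt ℝ n (fun q : ℝ × (Ell ℕ × Ell ℕ) => prof 1 q.2.1) q :=
    contDiff_prof_outer.contDiffAt
  have h2 : ContDiffAt ℝ n (fun q : ℝ × (Ell ℕ × Ell ℕ) => prof q.1 q.2.2) q :=
    contDiff_prof_inner.contDiffAt
  unfold patchMap
  refine ((contDiffAt_selfTerm α m h1 h.outer).sub ?_).prodMk
    (ContDiffAt.sub ?_ (contDiffAt_selfTerm α m h2 h.inner))
  · exact (smear fun _ => 1).contDiff.contDiffAt.comp q (contDiffAt_numer_mul_kerOut α m h1 h2 h.gapOut)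
  · exact (smear fun _ => 1).contDiff.contDiffAt.comp q (contDiffAt_numer_mul_kerIn α m h2 h1 h.gapIn)

omit hp in
theorem abs_eq_one_iff (s : ℤ) : |s| = 1 ↔ s = 1 ∨ s = -1 := by
  rw [abs_eq (by norm_num)]

/-- Near the annulus all smallness conditions hold, because they are open and hold at the annulus, where
the arguments of the powers are `1 - b₀ e^{±iθ}` or `1`. -/
theorem eventually_isNear {b₀ : ℝ} (h0 : 0 < b₀) (h1 : b₀ < 1) :
    ∀ᶠ q in 𝓝 ((b₀, 0) : ℝ × (Ell ℕ × Ell ℕ)), IsNear α m b₀ q := by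
  have c1 : ContDiff ℝ 0 (fun q : ℝ × (Ell ℕ × Ell ℕ) => prof 1 q.2.1) := contDiff_prof_outer
  have c2 : ContDiff ℝ 0 (fun q : ℝ × (Ell ℕ × Ell ℕ) => prof q.1 q.2.2) := contDiff_prof_inner
  have e1 : ∀ s : ℤ, ∀ᶠ q in 𝓝 ((b₀, 0) : ℝ × (Ell ℕ × Ell ℕ)),
      ‖gapOut α m s (prof 1 q.2.1) (prof q.1 q.2.2) - 1‖ < 1 := fun s =>
    (c1.contDiffAt.gapOut α m c2.contDiffAt s).continuousAt.norm.eventually_lt_const (by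
      simp only [Prod.fst_zero, Prod.snd_zero]
      rw [gapOut_annulus, norm_neg, norm_smul, Four.norm_t, mul_one, Real.norm_of_nonneg h0.le]
      exact h1)
  have e2 : ∀ s : ℤ, ∀ᶠ q in 𝓝 ((b₀, 0) : ℝ × (Ell ℕ × Ell ℕ)),
      ‖gapIn α m s (prof q.1 q.2.2) (prof 1 q.2.1) - 1‖ < 1 := fun s =>
    (c2.contDiffAt.gapIn α m c1.contDiffAt s).continuousAt.norm.eventually_lt_const (by
      simp only [Prod.fst_zero, Prod.snd_zero]
      rw [gapIn_annulus, norm_neg, norm_smul, Four.norm_t, mul_one, Real.norm_of_nonneg h0.le]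
      exact h1)
  have e3 : ∀ s : ℤ, |s| = 1 → ∀ᶠ q in 𝓝 ((b₀, 0) : ℝ × (Ell ℕ × Ell ℕ)),
      ‖(1 : ℝ)⁻¹ • divDiff α m s (prof 1 q.2.1) - 1‖ < 1 := fun s hs =>
    (c1.contDiffAt.divDiff α m 1 s).continuousAt.norm.eventually_lt_const (by
      simp only [Prod.fst_zero]
      rw [divDiff_annulus α m hs one_ne_zero, norm_zero]
      exact one_pos)
  have e4 : ∀ s : ℤ, |s| = 1 → ∀ᶠ q in 𝓝 ((b₀, 0) : ℝ × (Ell ℕ × Ell ℕ)),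
      ‖b₀⁻¹ • divDiff α m s (prof q.1 q.2.2) - 1‖ < 1 := fun s hs =>
    (c2.contDiffAt.divDiff α m b₀ s).continuousAt.norm.eventually_lt_const (by
      simp only [Prod.snd_zero]
      rw [divDiff_annulus α m hs h0.ne', norm_zero]
      exact one_pos)
  have cf : ContinuousAt (fun q : ℝ × (Ell ℕ × Ell ℕ) => q.1) (b₀, 0) := continuousAt_fst
  have cs : ContinuousAt (fun q : ℝ × (Ell ℕ × Ell ℕ) => coefBound α m * ‖q.2.2‖) (b₀, 0) := by
    fun_prop
  have e5 := cf.eventually_const_lt (show 0 < ((b₀, 0) : ℝ × (Ell ℕ × Ell ℕ)).1 from h0)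
  have e6 := cf.eventually_lt_const (show ((b₀, 0) : ℝ × (Ell ℕ × Ell ℕ)).1 < 1 from h1)
  have e7 := cs.eventually_lt cf (by simpa using h0)
  filter_upwards [e1 1, e1 (-1), e2 1, e2 (-1), e3 1 (by norm_num), e3 (-1) (by norm_num),
    e4 1 (by norm_num), e4 (-1) (by norm_num), e5, e6, e7] with q a1 a2 b1 b2 c1 c2 d1 d2 p1 p2 p3
  refine ⟨p1, p2, p3, fun s hs => ?_, fun s hs => ?_, fun s hs => ?_, fun s hs => ?_⟩ <;>
  · rcases (abs_eq_one_iff s).1 hs with rfl | rfl <;> assumption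

end Smooth

/-! ### The linearized velocity integrals -/

section LinearIntegrals

variable (α : ℝ)

/-- The derivative of `velKer` at constant profiles `f₀`, `g₀`, in the direction of profiles with
values `φ`, `ψ` and derivatives `φ'`, `ψ'`. -/
def linKer (θ f₀ g₀ φ φ' ψ ψ' : ℝ) : ℝ :=
  (Real.cos θ * (f₀ * ψ' - φ' * g₀) + Real.sin θ * (φ * g₀ + f₀ * ψ)) *
      (f₀ ^ 2 + g₀ ^ 2 - 2 * f₀ * g₀ * Real.cos θ) ^ (-(α / 2)) +
    Real.sin θ * (f₀ * g₀) * ((2 * f₀ * φ + 2 * g₀ * ψ - 2 * (φ * g₀ + f₀ * ψ) * Real.cos θ) *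
      (-(α / 2)) * (f₀ ^ 2 + g₀ ^ 2 - 2 * f₀ * g₀ * Real.cos θ) ^ (-(α / 2) - 1))

theorem hasDerivAt_velKer {θ f₀ g₀ : ℝ} (h : f₀ ^ 2 + g₀ ^ 2 - 2 * f₀ * g₀ * Real.cos θ ≠ 0)
    (φ φ' ψ ψ' : ℝ) : HasDerivAt
      (fun s : ℝ => velKer α θ (f₀ + s * φ) (s * φ') (g₀ + s * ψ) (s * ψ'))
      (linKer α θ f₀ g₀ φ φ' ψ ψ') 0 := by
  have hl : ∀ a c : ℝ, HasDerivAt (fun s : ℝ => a + s * c) c 0 := fun a c => by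
    simpa using ((hasDerivAt_id (0 : ℝ)).mul_const c).const_add a
  have hl' : ∀ c : ℝ, HasDerivAt (fun s : ℝ => s * c) c 0 := fun c => by
    simpa using (hasDerivAt_id (0 : ℝ)).mul_const c
  have hf := hl f₀ φ
  have hg := hl g₀ ψ
  have hf' := hl' φ'
  have hg' := hl' ψ'
  have h1 := (((hf.mul hg').sub (hf'.mul hg)).const_mul (Real.cos θ)).add
    (((hf.mul hg).add (hf'.mul hg')).const_mul (Real.sin θ))
  have h2 := ((hf.pow 2).add (hg.pow 2)).sub (((hf.const_mul 2).mul hg).mul_const (Real.cos θ))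
  have h3 := h2.rpow_const (p := -(α / 2)) (Or.inl (by simpa using h))
  refine (h1.mul h3).congr_deriv ?_
  simp only [linKer, Pi.add_apply, Pi.sub_apply, Pi.mul_apply, Pi.pow_apply, zero_mul, add_zero,
    mul_zero, zero_add, pow_one, Nat.cast_ofNat, Nat.add_one_sub_one]
  ring

theorem abs_sin_nat_le (n : ℕ) {θ : ℝ} (h0 : 0 ≤ θ) (h1 : θ ≤ 2 * Real.pi) :
    |Real.sin (n * θ)| ≤ n * (2 * Real.sin (θ / 2)) ∧
    |1 - Real.cos (n * θ)| ≤ n * (2 * Real.sin (θ / 2)) := by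
  have h2 := (norm_exp_sub_one_le n θ).2
  have h3 := sin_half_nonneg h0 h1
  simp only [Int.cast_natCast, Nat.abs_cast] at h2
  rw [abs_of_nonneg (show 0 ≤ 2 * Real.sin (θ / 2) by positivity)] at h2
  have h4 : ((n : ℂ) * (θ * Complex.I)) = ((n * θ : ℝ) : ℂ) * Complex.I := by push_cast; ring
  rw [h4] at h2
  constructor
  · refine le_trans ?_ ((Complex.abs_im_le_norm _).trans h2)
    rw [Complex.sub_im, Complex.exp_ofReal_mul_I_im, Complex.one_im, sub_zero]
  · refine le_trans ?_ ((Complex.abs_re_le_norm _).trans h2)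
    rw [Complex.sub_re, Complex.exp_ofReal_mul_I_re, Complex.one_re, abs_sub_comm]

variable {α}

theorem integrable_mul_sker (hα0 : 0 < α) (hα2 : α < 2) {g : ℝ → ℝ} (hg : Continuous g) {C : ℝ}
    (h : ∀ θ ∈ Icc 0 (2 * Real.pi), |g θ| ≤ C * (2 * Real.sin (θ / 2))) :
    IntervalIntegrable (fun θ => g θ * sker α θ) volume 0 (2 * Real.pi) := by
  have hpi := Real.pi_pos
  refine ((sin_mul_sker_integrable α hα0 hα2).const_mul C).mono_fun' ?_ ?_
  · exact (hg.measurable.mul (measurable_sker α)).aestronglyMeasurable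
  · rw [Filter.EventuallyLE, ae_restrict_iff' measurableSet_uIoc]
    refine Eventually.of_forall fun θ hθ => ?_
    rw [uIoc_of_le (by linarith)] at hθ
    have h3 := sker_nonneg (α := α) hθ.1.le hθ.2
    rw [norm_mul, Real.norm_of_nonneg h3, Real.norm_eq_abs, ← mul_assoc]
    exact mul_le_mul_of_nonneg_right (h θ ⟨hθ.1.le, hθ.2⟩) h3

theorem integral_eq_zero_of_odd {g : ℝ → ℝ} (h : ∀ θ, g (2 * Real.pi - θ) = -g θ) :
    ∫ θ in (0 : ℝ)..(2 * Real.pi), g θ = 0 := by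
  have h1 := intervalIntegral.integral_comp_sub_left (a := 0) (b := 2 * Real.pi) g (2 * Real.pi)
  simp_rw [h] at h1
  rw [sub_self, sub_zero, intervalIntegral.integral_neg] at h1
  linarith

theorem cos_nat_two_pi_sub (n : ℕ) (θ : ℝ) :
    Real.cos (n * (2 * Real.pi - θ)) = Real.cos (n * θ) := by
  have : (n : ℝ) * (2 * Real.pi - θ) = n * (2 * Real.pi) - n * θ := by ring
  rw [this, Real.cos_nat_mul_two_pi_sub]

theorem sin_nat_two_pi_sub (n : ℕ) (θ : ℝ) :
    Real.sin (n * (2 * Real.pi - θ)) = -Real.sin (n * θ) := by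
  have : (n : ℝ) * (2 * Real.pi - θ) = n * (2 * Real.pi) - n * θ := by ring
  rw [this, Real.sin_nat_mul_two_pi_sub]

/-- The moment identity behind the linearization of the self-interaction, obtained by integrating the
derivative of `(2 sin (θ/2))^(2-α) sin(nθ)`. -/
theorem integral_self_moment (hα0 : 0 < α) (hα2 : α < 2) {n : ℕ} (hn : 1 ≤ n) :
    IntervalIntegrable (fun θ => (n * (Real.cos θ * (1 - Real.cos (n * θ))) +
        (1 - α / 2) * (Real.sin θ * Real.sin (n * θ))) * sker α θ) volume 0 (2 * Real.pi) ∧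
    cAlpha α * ∫ θ in (0 : ℝ)..(2 * Real.pi), (n * (Real.cos θ * (1 - Real.cos (n * θ))) +
      (1 - α / 2) * (Real.sin θ * Real.sin (n * θ))) * sker α θ = n * Theta α n := by
  have hpi := Real.pi_pos
  have i1 : IntervalIntegrable (fun θ => (n * (Real.cos θ * (1 - Real.cos (n * θ))) +
      (1 - α / 2) * (Real.sin θ * Real.sin (n * θ))) * sker α θ) volume 0 (2 * Real.pi) := by
    refine integrable_mul_sker hα0 hα2 (by fun_prop) (C := n * n + n) fun θ hθ => ?_
    obtain ⟨h1, h2⟩ := abs_sin_nat_le n hθ.1 hθ.2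
    have h3 := Real.abs_cos_le_one θ
    have h4 := Real.abs_sin_le_one θ
    have h5 := sin_half_nonneg hθ.1 hθ.2
    refine (abs_add_le _ _).trans ?_
    rw [abs_mul, abs_mul, abs_mul, abs_mul, Nat.abs_cast, abs_of_pos (show 0 < 1 - α / 2 by linarith)]
    calc (n : ℝ) * (|Real.cos θ| * |1 - Real.cos (n * θ)|) +
          (1 - α / 2) * (|Real.sin θ| * |Real.sin (n * θ)|)
        ≤ n * (1 * (n * (2 * Real.sin (θ / 2)))) + 1 * (1 * (n * (2 * Real.sin (θ / 2)))) := by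
          gcongr; linarith
      _ = _ := by ring
  have i2 : IntervalIntegrable (fun θ => (n * (Real.cos θ - Real.cos (n * θ))) * sker α θ) volume 0
      (2 * Real.pi) := by
    refine integrable_mul_sker hα0 hα2 (by fun_prop) (C := n * (1 + n)) fun θ hθ => ?_
    have h1 := (abs_sin_nat_le n hθ.1 hθ.2).2
    have h2 := (abs_sin_nat_le 1 hθ.1 hθ.2).2
    simp only [Nat.cast_one, one_mul] at h2
    have h3 : Real.cos θ - Real.cos (n * θ) = (1 - Real.cos (n * θ)) - (1 - Real.cos θ) := by ring
    rw [abs_mul, Nat.abs_cast, h3, mul_assoc]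
    refine mul_le_mul_of_nonneg_left ((abs_sub _ _).trans ?_) (Nat.cast_nonneg n)
    linarith
  refine ⟨i1, ?_⟩
  have hQ : ∫ θ in (0 : ℝ)..(2 * Real.pi), ((n * (Real.cos θ * (1 - Real.cos (n * θ))) +
      (1 - α / 2) * (Real.sin θ * Real.sin (n * θ))) * sker α θ -
        (n * (Real.cos θ - Real.cos (n * θ))) * sker α θ) = 0 := by
    have h := intervalIntegral.integral_eq_sub_of_hasDerivAt_of_le
      (a := 0) (b := 2 * Real.pi) (by linarith)
      (f := fun θ => 1 / 2 * ((2 * Real.sin (θ / 2)) ^ (2 - α) * Real.sin (n * θ)))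
      (f' := fun θ => ((n * (Real.cos θ * (1 - Real.cos (n * θ))) +
        (1 - α / 2) * (Real.sin θ * Real.sin (n * θ))) * sker α θ -
        (n * (Real.cos θ - Real.cos (n * θ))) * sker α θ)) ?_ ?_ (i1.sub i2)
    · rw [h]
      have h1 : Real.sin (n * (2 * Real.pi)) = 0 := by
        rw [Real.sin_eq_zero_iff]; exact ⟨2 * n, by push_cast; ring⟩
      rw [h1]
      simp
    · refine Continuous.continuousOn ?_
      have h1 : Continuous fun θ : ℝ => (2 * Real.sin (θ / 2)) ^ (2 - α) :=
        Continuous.rpow_const (by fun_prop) fun θ => Or.inr (by linarith)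
      fun_prop
    · intro θ hθ
      have hs := sin_half_pos hθ.1 hθ.2
      have e1 : HasDerivAt (fun θ : ℝ => 2 * Real.sin (θ / 2)) (Real.cos (θ / 2)) θ :=
        ((((hasDerivAt_id θ).div_const 2).sin).const_mul 2).congr_deriv (by simp; ring)
      have e2 := e1.rpow_const (p := 2 - α) (Or.inl (by positivity))
      have e3 : HasDerivAt (fun θ : ℝ => Real.sin (n * θ)) (Real.cos (n * θ) * n) θ :=
        (((hasDerivAt_id θ).const_mul (n : ℝ)).sin).congr_deriv (by simp)
      refine ((e2.mul e3).const_mul (1 / 2)).congr_deriv ?_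
      have p1 : (2 * Real.sin (θ / 2)) ^ (2 - α - 1) = 2 * Real.sin (θ / 2) * sker α θ := by
        have : 2 - α - 1 = 1 + -α := by ring
        rw [sker, this, Real.rpow_add (by positivity), Real.rpow_one]
      have p2 : (2 * Real.sin (θ / 2)) ^ (2 - α) = (2 * Real.sin (θ / 2)) ^ 2 * sker α θ := by
        rw [sker, ← Real.rpow_natCast, ← Real.rpow_add (by positivity)]
        congr 1
      have t1 : Real.sin θ = 2 * Real.sin (θ / 2) * Real.cos (θ / 2) := by
        rw [← Real.sin_two_mul]; congr 1; ring
      have t2 : Real.cos θ = 1 - 2 * Real.sin (θ / 2) ^ 2 := by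
        have h := Real.cos_two_mul (θ / 2)
        have h2 := Real.sin_sq_add_cos_sq (θ / 2)
        have h3 : 2 * (θ / 2) = θ := by ring
        rw [h3] at h
        linarith
      rw [p1, p2, t1, t2]
      ring
  rw [intervalIntegral.integral_sub i1 i2, sub_eq_zero] at hQ
  rw [hQ, Theta_eq hα0 hα2 n hn]
  simp_rw [mul_assoc]
  rw [intervalIntegral.integral_const_mul]
  ring

/-- The linearization of the self-interaction at the circle of radius `a`, on the `n`-th mode. -/
theorem integral_linKer_self (hα0 : 0 < α) (hα2 : α < 2) {n : ℕ} (hn : 1 ≤ n) {a : ℝ} (ha : 0 < a)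
    (C x : ℝ) :
    cAlpha α * ∫ θ in (0 : ℝ)..(2 * Real.pi), linKer α θ a a (C * Real.cos (n * x))
      (-(C * n * Real.sin (n * x))) (C * Real.cos (n * (x - θ))) (-(C * n * Real.sin (n * (x - θ)))) =
      a ^ (1 - α) * (n * Theta α n) * (C * Real.sin (n * x)) := by
  have hpi := Real.pi_pos
  obtain ⟨i1, h1⟩ := integral_self_moment hα0 hα2 hn
  have i2 : IntervalIntegrable (fun θ => (n * (Real.cos θ * Real.sin (n * θ)) +
      (1 - α / 2) * (Real.sin θ * (1 + Real.cos (n * θ)))) * sker α θ) volume 0 (2 * Real.pi) := by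
    refine integrable_mul_sker hα0 hα2 (by fun_prop) (C := n * n + 2) fun θ hθ => ?_
    have h1 := (abs_sin_nat_le n hθ.1 hθ.2).1
    have h2 := (abs_sin_nat_le 1 hθ.1 hθ.2).1
    simp only [Nat.cast_one, one_mul] at h2
    have h3 := Real.abs_cos_le_one θ
    have h4 : |1 + Real.cos (n * θ)| ≤ 2 := by
      refine (abs_add_le _ _).trans ?_
      rw [abs_one]
      linarith [Real.abs_cos_le_one (n * θ)]
    have h5 := sin_half_nonneg hθ.1 hθ.2
    refine (abs_add_le _ _).trans ?_
    rw [abs_mul, abs_mul, abs_mul, abs_mul, Nat.abs_cast, abs_of_pos (show 0 < 1 - α / 2 by linarith)]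
    calc (n : ℝ) * (|Real.cos θ| * |Real.sin (n * θ)|) +
          (1 - α / 2) * (|Real.sin θ| * |1 + Real.cos (n * θ)|)
        ≤ n * (1 * (n * (2 * Real.sin (θ / 2)))) + 1 * (2 * Real.sin (θ / 2) * 2) := by
          gcongr; linarith
      _ = _ := by ring
  have h2 : ∫ θ in (0 : ℝ)..(2 * Real.pi), (n * (Real.cos θ * Real.sin (n * θ)) +
      (1 - α / 2) * (Real.sin θ * (1 + Real.cos (n * θ)))) * sker α θ = 0 := by
    refine integral_eq_zero_of_odd fun θ => ?_
    rw [cos_nat_two_pi_sub, sin_nat_two_pi_sub, Real.cos_two_pi_sub, Real.sin_two_pi_sub,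
      sker_two_pi_sub]
    ring
  have h3 : ∫ θ in (0 : ℝ)..(2 * Real.pi), linKer α θ a a (C * Real.cos (n * x))
      (-(C * n * Real.sin (n * x))) (C * Real.cos (n * (x - θ))) (-(C * n * Real.sin (n * (x - θ)))) =
      ∫ θ in (0 : ℝ)..(2 * Real.pi), (a ^ (1 - α) * (C * Real.sin (n * x)) *
        ((n * (Real.cos θ * (1 - Real.cos (n * θ))) +
          (1 - α / 2) * (Real.sin θ * Real.sin (n * θ))) * sker α θ) +
        a ^ (1 - α) * (C * Real.cos (n * x)) * ((n * (Real.cos θ * Real.sin (n * θ)) +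
          (1 - α / 2) * (Real.sin θ * (1 + Real.cos (n * θ)))) * sker α θ)) := by
    rw [intervalIntegral.integral_of_le (by linarith), intervalIntegral.integral_of_le (by linarith),
      integral_Ioc_eq_integral_Ioo, integral_Ioc_eq_integral_Ioo]
    refine setIntegral_congr_fun measurableSet_Ioo fun θ hθ => ?_
    have hs := sin_half_pos hθ.1 hθ.2
    have t2 : Real.cos θ = 1 - 2 * Real.sin (θ / 2) ^ 2 := by
      have h := Real.cos_two_mul (θ / 2)
      have h2 := Real.sin_sq_add_cos_sq (θ / 2)
      have h3 : 2 * (θ / 2) = θ := by ring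
      rw [h3] at h
      linarith
    have k0 : a ^ 2 + a ^ 2 - 2 * a * a * Real.cos θ = (a * (2 * Real.sin (θ / 2))) ^ 2 := by
      rw [t2]; ring
    have hpos : 0 < a * (2 * Real.sin (θ / 2)) := by positivity
    have k1 : (a ^ 2 + a ^ 2 - 2 * a * a * Real.cos θ) ^ (-(α / 2)) = a ^ (-α) * sker α θ := by
      rw [k0, ← Real.rpow_natCast, ← Real.rpow_mul hpos.le, Real.mul_rpow ha.le (by positivity), sker]
      have : ((2 : ℕ) : ℝ) * (-(α / 2)) = -α := by push_cast; ring
      rw [this]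
    have k2 : (a ^ 2 + a ^ 2 - 2 * a * a * Real.cos θ) ^ (-(α / 2) - 1) =
        a ^ (-α) * sker α θ / (a * (2 * Real.sin (θ / 2))) ^ 2 := by
      rw [Real.rpow_sub_one (by rw [k0]; positivity), k1, k0]
    have k3 : a ^ (1 - α) = a * a ^ (-α) := by
      rw [sub_eq_add_neg, Real.rpow_add ha, Real.rpow_one]
    have k4 : Real.cos (n * (x - θ)) = Real.cos (n * x) * Real.cos (n * θ) +
        Real.sin (n * x) * Real.sin (n * θ) := by rw [mul_sub, Real.cos_sub]
    have k5 : Real.sin (n * (x - θ)) = Real.sin (n * x) * Real.cos (n * θ) -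
        Real.cos (n * x) * Real.sin (n * θ) := by rw [mul_sub, Real.sin_sub]
    rw [linKer, k1, k2, k3, k4, k5]
    have k6 : ∀ φ ψ : ℝ, (2 * a * φ + 2 * a * ψ - 2 * (φ * a + a * ψ) * Real.cos θ) =
        a * (φ + ψ) * (2 * Real.sin (θ / 2)) ^ 2 := fun φ ψ => by rw [t2]; ring
    rw [k6]
    field_simp
    ring
  rw [h3, intervalIntegral.integral_add (i1.const_mul _) (i2.const_mul _),
    intervalIntegral.integral_const_mul, intervalIntegral.integral_const_mul, h2]
  linear_combination (a ^ (1 - α) * (C * Real.sin (n * x))) * h1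

variable {f₀ g₀ b : ℝ}

/-- The linearization of the mutual interaction of two concentric circles, in the direction of the
curve on which the velocity is taken. -/
theorem integral_linKer_left (hα0 : 0 < α) (hα2 : α < 2) (hb0 : 0 < b) (hb1 : b < 1)
    (hfg : ∀ θ, f₀ ^ 2 + g₀ ^ 2 - 2 * f₀ * g₀ * Real.cos θ = ker b θ) (φ φ' : ℝ) :
    cAlpha α * ∫ θ in (0 : ℝ)..(2 * Real.pi), linKer α θ f₀ g₀ φ φ' 0 0 =
      -(g₀ * φ' * (b * Lam α 1 b)) := by
  have c1 := continuous_ker_rpow hb0 hb1 (-(α / 2))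
  have c2 := continuous_ker_rpow hb0 hb1 (-(α / 2) - 1)
  have h1 : ∀ θ, linKer α θ f₀ g₀ φ φ' 0 0 =
      -(g₀ * φ') * (Real.cos ((1 : ℕ) * θ) * ker b θ ^ (-(α / 2))) +
      Real.sin θ * (φ * g₀ * ker b θ ^ (-(α / 2)) + f₀ * g₀ * ((2 * f₀ * φ - 2 * φ * g₀ * Real.cos θ) *
        (-(α / 2)) * ker b θ ^ (-(α / 2) - 1))) := by
    intro θ
    rw [linKer, hfg, Nat.cast_one, one_mul]; ring
  have h2 : ∫ θ in (0 : ℝ)..(2 * Real.pi), Real.sin θ * (φ * g₀ * ker b θ ^ (-(α / 2)) +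
      f₀ * g₀ * ((2 * f₀ * φ - 2 * φ * g₀ * Real.cos θ) *
        (-(α / 2)) * ker b θ ^ (-(α / 2) - 1))) = 0 := by
    refine integral_eq_zero_of_odd fun θ => ?_
    rw [ker, ker, Real.cos_two_pi_sub, Real.sin_two_pi_sub]; ring
  simp_rw [h1]
  rw [intervalIntegral.integral_add (Continuous.intervalIntegrable (by fun_prop) _ _)
    (Continuous.intervalIntegrable (by fun_prop) _ _), h2, intervalIntegral.integral_const_mul,
    mul_Lam_eq hα0 hα2 hb0 hb1 1 le_rfl]
  ring

/-- The linearization of the mutual interaction of two concentric circles, in the direction of the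
curve that induces the velocity. -/
theorem integral_linKer_right (hα0 : 0 < α) (hα2 : α < 2) (hb0 : 0 < b) (hb1 : b < 1)
    (hfg : ∀ θ, f₀ ^ 2 + g₀ ^ 2 - 2 * f₀ * g₀ * Real.cos θ = ker b θ) (hfgb : f₀ * g₀ = b) {n : ℕ}
    (hn : 1 ≤ n) (C x : ℝ) :
    cAlpha α * ∫ θ in (0 : ℝ)..(2 * Real.pi), linKer α θ f₀ g₀ 0 0 (C * Real.cos (n * (x - θ)))
      (-(C * n * Real.sin (n * (x - θ)))) = -(g₀ * n * (b * Lam α n b) * (C * Real.sin (n * x))) := by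
  have hpi := Real.pi_pos
  have c1 := continuous_ker_rpow hb0 hb1 (-(α / 2))
  have c2 := continuous_ker_rpow hb0 hb1 (-(α / 2) - 1)
  -- the total derivative obtained from integration by parts
  set P : ℝ → ℝ := fun θ => ker b θ ^ (-(α / 2)) * ((g₀ - f₀ * Real.cos θ) *
    (C * Real.cos (n * (x - θ)))) with hP
  set P' : ℝ → ℝ := fun θ => 2 * b * Real.sin θ * (-(α / 2)) * ker b θ ^ (-(α / 2) - 1) *
      ((g₀ - f₀ * Real.cos θ) * (C * Real.cos (n * (x - θ)))) +
      ker b θ ^ (-(α / 2)) * (f₀ * Real.sin θ * (C * Real.cos (n * (x - θ))) +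
        (g₀ - f₀ * Real.cos θ) * (C * n * Real.sin (n * (x - θ)))) with hP'
  have hd : ∀ θ, HasDerivAt P (P' θ) θ := by
    intro θ
    have e1 : HasDerivAt (fun θ => ker b θ) (2 * b * Real.sin θ) θ :=
      (((Real.hasDerivAt_cos θ).const_mul (2 * b)).const_sub (1 + b ^ 2)).congr_deriv (by ring)
    have e2 := e1.rpow_const (p := -(α / 2)) (Or.inl (ker_pos hb0 hb1 θ).ne')
    have e3 : HasDerivAt (fun θ => g₀ - f₀ * Real.cos θ) (f₀ * Real.sin θ) θ :=
      (((Real.hasDerivAt_cos θ).const_mul f₀).const_sub g₀).congr_deriv (by ring)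
    have e4 : HasDerivAt (fun θ : ℝ => C * Real.cos (n * (x - θ))) (C * n * Real.sin (n * (x - θ))) θ :=
      (((((hasDerivAt_id θ).const_sub x).const_mul (n : ℝ)).cos).const_mul C).congr_deriv (by
        simp; ring)
    exact e2.mul (e3.mul e4)
  have hcP' : Continuous P' := by simp only [hP']; fun_prop
  have h0 : ∫ θ in (0 : ℝ)..(2 * Real.pi), P' θ = 0 := by
    rw [intervalIntegral.integral_eq_sub_of_hasDerivAt (fun θ _ => hd θ)
      (hcP'.intervalIntegrable _ _)]
    have k1 : Real.cos (n * (x - 2 * Real.pi)) = Real.cos (n * x) := by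
      rw [mul_sub, Real.cos_sub_nat_mul_two_pi]
    simp only [hP, ker, Real.cos_two_pi, Real.cos_zero, k1, sub_zero, sub_self]
  have h1 : ∀ θ, linKer α θ f₀ g₀ 0 0 (C * Real.cos (n * (x - θ)))
      (-(C * n * Real.sin (n * (x - θ)))) = P' θ +
      (-(g₀ * n * (C * Real.sin (n * x))) * (Real.cos (n * θ) * ker b θ ^ (-(α / 2))) +
      g₀ * n * (C * Real.cos (n * x)) * (Real.sin (n * θ) * ker b θ ^ (-(α / 2)))) := by
    intro θ
    have k5 : Real.sin (n * (x - θ)) = Real.sin (n * x) * Real.cos (n * θ) -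
        Real.cos (n * x) * Real.sin (n * θ) := by rw [mul_sub, Real.sin_sub]
    simp only [linKer, hfg, hP']
    rw [hfgb, k5]
    ring
  have h2 : ∫ θ in (0 : ℝ)..(2 * Real.pi), Real.sin (n * θ) * ker b θ ^ (-(α / 2)) = 0 := by
    refine integral_eq_zero_of_odd fun θ => ?_
    rw [ker, ker, Real.cos_two_pi_sub, sin_nat_two_pi_sub]; ring
  simp_rw [h1]
  rw [intervalIntegral.integral_add (hcP'.intervalIntegrable _ _)
    (Continuous.intervalIntegrable (by fun_prop) _ _), h0,
    intervalIntegral.integral_add (Continuous.intervalIntegrable (by fun_prop) _ _)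
    (Continuous.intervalIntegrable (by fun_prop) _ _), intervalIntegral.integral_const_mul,
    intervalIntegral.integral_const_mul, h2, mul_Lam_eq hα0 hα2 hb0 hb1 n hn]
  ring

end LinearIntegrals

/-! ### The linearization at the annulus -/

section Linearization

variable (α : ℝ) (m : ℕ) [hp : Admissible α m]

/-- The linearized density at concentric circles of radii `a`, `c`. -/
def linDensity (a : ℝ) (d : Ell ℕ) (c : ℝ) (e : Ell ℕ) (x θ : ℝ) : ℝ :=
  linKer α θ a c (cosEval α m x d) (dcosEval α m x d) (cosEval α m (x - θ) e)
    (dcosEval α m (x - θ) e)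

omit hp in
theorem hasDerivAt_velDensity {a c θ : ℝ} (h : a ^ 2 + c ^ 2 - 2 * a * c * Real.cos θ ≠ 0)
    (d e : Ell ℕ) (x : ℝ) :
    HasDerivAt (fun s : ℝ => ((2 * velDensity α m a (s • d) c (s • e) x θ : ℝ) : ℂ) * Complex.I)
      (((2 * linDensity α m a d c e x θ : ℝ) : ℂ) * Complex.I) 0 := by
  have h1 := hasDerivAt_velKer α h (cosEval α m x d) (dcosEval α m x d) (cosEval α m (x - θ) e)
    (dcosEval α m (x - θ) e)
  have h2 := (h1.const_mul 2).ofReal_comp.mul_const Complex.I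
  refine h2.congr_of_eventuallyEq (Eventually.of_forall fun s => ?_)
  simp only [velDensity, map_smul, smul_eq_mul]

omit hp in
theorem hasDerivAt_prof (a : ℝ) (d : Ell ℕ) :
    HasDerivAt (fun s : ℝ => prof a (s • d)) (emb d) 0 := by
  simp only [prof, map_smul]
  have := ((hasDerivAt_id (0 : ℝ)).smul_const (emb d)).const_add (a • Ell.basis 0 : Ell ℤ)
  simpa using this

omit hp in
/-- Values of a derivative in the algebra can be computed pointwise. -/
theorem eval_deriv_eq {H : ℝ → Four} {H' : Four} (hH : HasDerivAt H H' 0) {v : ℝ → ℂ} {v' : ℂ}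
    (x θ : ℝ) (h : ∀ᶠ s in 𝓝 (0 : ℝ), eval m x θ (H s) = v s) (hv : HasDerivAt v v' 0) :
    eval m x θ H' = v' :=
  (((eval m x θ).hasFDerivAt.comp_hasDerivAt (0 : ℝ) hH).congr_of_eventuallyEq
    (h.mono fun _ hs => hs.symm)).unique hv

omit hp in
theorem contDiffAt_prof (a : ℝ) (d : Ell ℕ) {n : WithTop ℕ∞} :
    ContDiffAt ℝ n (fun s : ℝ => prof a (s • d)) 0 := by
  unfold prof
  exact contDiffAt_const.add (emb.contDiff.contDiffAt.comp (0 : ℝ)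
    (contDiffAt_id.smul contDiffAt_const))

omit hp in
/-- The derivative of the mutual interaction exists in the sine space, and its values are obtained by
differentiating under the integral sign. -/
theorem exists_hasDerivAt_outTerm [Admissible α m] {a c : ℝ} (d e : Ell ℕ)
    (h : ∀ s : ℤ, |s| = 1 → ‖gapOut α m s (prof a 0) (prof c 0) - 1‖ < 1)
    (hk : ∀ θ, a ^ 2 + c ^ 2 - 2 * a * c * Real.cos θ ≠ 0) :
    ∃ T, HasDerivAt (fun s : ℝ => outTerm α m (prof a (s • d)) (prof c (s • e))) T 0 ∧
      ∀ x, sinEval m x T = 2 * ∫ θ in (0 : ℝ)..(2 * Real.pi), linDensity α m a d c e x θ := by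
  have c1 : ContDiffAt ℝ 1 (fun s : ℝ => prof a (s • d)) 0 := contDiffAt_prof a d
  have c2 : ContDiffAt ℝ 1 (fun s : ℝ => prof c (s • e)) 0 := contDiffAt_prof c e
  have h0 : ∀ s : ℤ, |s| = 1 →
      ‖gapOut α m s (prof a ((0 : ℝ) • d)) (prof c ((0 : ℝ) • e)) - 1‖ < 1 := by
    simpa using h
  have hH := ((contDiffAt_numer_mul_kerOut α m c1 c2 h0).differentiableAt one_ne_zero).hasDerivAt
  have hev : ∀ s : ℤ, |s| = 1 → ∀ᶠ r in 𝓝 (0 : ℝ),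
      ‖gapOut α m s (prof a (r • d)) (prof c (r • e)) - 1‖ < 1 := fun s hs =>
    (c1.gapOut α m c2 s).continuousAt.norm.eventually_lt_const (h0 s hs)
  refine ⟨_, (smear fun _ => 1).hasFDerivAt.comp_hasDerivAt (0 : ℝ) hH, fun x => ?_⟩
  rw [sinEval_smear isRealWeight_one, ← im_integral_two_mul_I]
  congr 1
  refine intervalIntegral.integral_congr fun θ _ => ?_
  simp only [one_mul]
  refine eval_deriv_eq m hH x θ ?_ (hasDerivAt_velDensity α m (hk θ) d e x)
  filter_upwards [hev 1 (by norm_num), hev (-1) (by norm_num)] with r h1 h2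
  refine eval_numer_mul_kerOut α m (fun s hs => ?_) x θ
  rcases (abs_eq_one_iff s).1 hs with rfl | rfl <;> assumption

omit hp in
theorem exists_hasDerivAt_inTerm [Admissible α m] {a c : ℝ} (d e : Ell ℕ)
    (h : ∀ s : ℤ, |s| = 1 → ‖gapIn α m s (prof a 0) (prof c 0) - 1‖ < 1)
    (hk : ∀ θ, a ^ 2 + c ^ 2 - 2 * a * c * Real.cos θ ≠ 0) :
    ∃ T, HasDerivAt (fun s : ℝ => inTerm α m (prof a (s • d)) (prof c (s • e))) T 0 ∧
      ∀ x, sinEval m x T = 2 * ∫ θ in (0 : ℝ)..(2 * Real.pi), linDensity α m a d c e x θ := by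
  have c1 : ContDiffAt ℝ 1 (fun s : ℝ => prof a (s • d)) 0 := contDiffAt_prof a d
  have c2 : ContDiffAt ℝ 1 (fun s : ℝ => prof c (s • e)) 0 := contDiffAt_prof c e
  have h0 : ∀ s : ℤ, |s| = 1 →
      ‖gapIn α m s (prof a ((0 : ℝ) • d)) (prof c ((0 : ℝ) • e)) - 1‖ < 1 := by
    simpa using h
  have hH := ((contDiffAt_numer_mul_kerIn α m c1 c2 h0).differentiableAt one_ne_zero).hasDerivAt
  have hev : ∀ s : ℤ, |s| = 1 → ∀ᶠ r in 𝓝 (0 : ℝ),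
      ‖gapIn α m s (prof a (r • d)) (prof c (r • e)) - 1‖ < 1 := fun s hs =>
    (c1.gapIn α m c2 s).continuousAt.norm.eventually_lt_const (h0 s hs)
  refine ⟨_, (smear fun _ => 1).hasFDerivAt.comp_hasDerivAt (0 : ℝ) hH, fun x => ?_⟩
  rw [sinEval_smear isRealWeight_one, ← im_integral_two_mul_I]
  congr 1
  refine intervalIntegral.integral_congr fun θ _ => ?_
  simp only [one_mul]
  refine eval_deriv_eq m hH x θ ?_ (hasDerivAt_velDensity α m (hk θ) d e x)
  filter_upwards [hev 1 (by norm_num), hev (-1) (by norm_num)] with r h1 h2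
  refine eval_numer_mul_kerIn α m (fun s hs => ?_) x θ
  rcases (abs_eq_one_iff s).1 hs with rfl | rfl <;> assumption

/-- The derivative of the self-interaction. The singular kernel does not allow pointwise differentiation
under the integral; the product rule for the two pairings is evaluated instead. -/
theorem exists_hasDerivAt_selfTerm {a c : ℝ} (ha : 0 < a) (hc : 0 < c) (d : Ell ℕ)
    (h : ∀ s : ℤ, |s| = 1 → ‖a⁻¹ • divDiff α m s (prof c 0) - 1‖ < 1) :
    ∃ T, HasDerivAt (fun s : ℝ => selfTerm α m a (prof c (s • d))) T 0 ∧
      ∀ x, sinEval m x T = 2 * ∫ θ in (0 : ℝ)..(2 * Real.pi), linDensity α m c d c d x θ := by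
  have hpi := Real.pi_pos
  have c1 : ContDiffAt ℝ 1 (fun s : ℝ => prof c (s • d)) 0 := contDiffAt_prof c d
  have h0 : ∀ s : ℤ, |s| = 1 → ‖a⁻¹ • divDiff α m s (prof c ((0 : ℝ) • d)) - 1‖ < 1 := by
    simpa using h
  have hev : ∀ s : ℤ, |s| = 1 → ∀ᶠ r in 𝓝 (0 : ℝ),
      ‖a⁻¹ • divDiff α m s (prof c (r • d)) - 1‖ < 1 := fun s hs =>
    (c1.divDiff α m a s).continuousAt.norm.eventually_lt_const (h0 s hs)
  have hu := hasDerivAt_prof c d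
  have hV := ((contDiffAt_kerSelf α m c1 h0).differentiableAt one_ne_zero).hasDerivAt
  -- the derivatives of the second factors of the two pairings
  have hA : ∀ s : ℤ, ∃ h', HasDerivAt (fun r : ℝ => coefMap α m (fun n => freq m s n) (fun _ => 0)
      (prof c (r • d)) * kerSelf α m a (prof c (r • d))) h' 0 := fun s =>
    ⟨_, ((coefMap α m (fun n => freq m s n) (fun _ => 0)).hasFDerivAt.comp_hasDerivAt
      (0 : ℝ) hu).mul hV⟩
  choose h' hA using hA
  have hS : ∀ s t : ℤ, HasDerivAt (fun r : ℝ => singPair α m s (prof c (r • d))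
      (coefMap α m (fun n => freq m t n) (fun _ => 0) (prof c (r • d)) *
        kerSelf α m a (prof c (r • d))))
      (singPair α m s (emb d) (coefMap α m (fun n => freq m t n) (fun _ => 0) (prof c ((0 : ℝ) • d)) *
        kerSelf α m a (prof c ((0 : ℝ) • d))) + singPair α m s (prof c ((0 : ℝ) • d)) (h' t)) 0 :=
    fun s t => ((singPair α m s).hasFDerivAt.comp_hasDerivAt (0 : ℝ) hu).clm_apply (hA t)
  have hD : ∀ s t : ℤ, HasDerivAt (fun r : ℝ => shiftDiff α m s (prof c (r • d)) *
      (coefMap α m (fun n => freq m t n) (fun _ => 0) (prof c (r • d)) *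
        kerSelf α m a (prof c (r • d))))
      (shiftDiff α m s (emb d) * (coefMap α m (fun n => freq m t n) (fun _ => 0)
        (prof c ((0 : ℝ) • d)) * kerSelf α m a (prof c ((0 : ℝ) • d))) +
        shiftDiff α m s (prof c ((0 : ℝ) • d)) * h' t) 0 :=
    fun s t => ((shiftDiff α m s).hasFDerivAt.comp_hasDerivAt (0 : ℝ) hu).mul (hA t)
  have hZ := (hD (-1) 1).sub (hD 1 (-1))
  refine ⟨_, (hS (-1) 1).sub (hS 1 (-1)), fun x => ?_⟩
  have hs1 : |(1 : ℤ)| = 1 := by norm_num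
  have hs2 : |(-1 : ℤ)| = 1 := by norm_num
  have hint := fun (s : ℤ) (hs : |s| = 1) (u : Ell ℤ) (h : Four) =>
    (shiftDiff_mul_integrable α m hs x u h).1
  rw [map_sub, map_add, map_add, sinEval_singPair α m hs2, sinEval_singPair α m hs2,
    sinEval_singPair α m hs1, sinEval_singPair α m hs1, ← Complex.add_im, ← Complex.add_im,
    ← Complex.sub_im, ← intervalIntegral.integral_add (hint _ hs2 _ _) (hint _ hs2 _ _),
    ← intervalIntegral.integral_add (hint _ hs1 _ _) (hint _ hs1 _ _),
    ← intervalIntegral.integral_sub ((hint _ hs2 _ _).add (hint _ hs2 _ _))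
      ((hint _ hs1 _ _).add (hint _ hs1 _ _)), ← im_integral_two_mul_I]
  congr 1
  rw [intervalIntegral.integral_of_le (by linarith), intervalIntegral.integral_of_le (by linarith),
    integral_Ioc_eq_integral_Ioo, integral_Ioc_eq_integral_Ioo]
  refine setIntegral_congr_fun measurableSet_Ioo fun θ hθ => ?_
  have hs := sin_half_pos hθ.1 hθ.2
  have hk : c ^ 2 + c ^ 2 - 2 * c * c * Real.cos θ ≠ 0 := by
    have t2 : Real.cos θ = 1 - 2 * Real.sin (θ / 2) ^ 2 := by
      have h := Real.cos_two_mul (θ / 2)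
      have h2 := Real.sin_sq_add_cos_sq (θ / 2)
      have h3 : 2 * (θ / 2) = θ := by ring
      rw [h3] at h
      linarith
    have : c ^ 2 + c ^ 2 - 2 * c * c * Real.cos θ = 4 * c ^ 2 * Real.sin (θ / 2) ^ 2 := by
      rw [t2]; ring
    rw [this]; positivity
  have hv := hasDerivAt_velDensity α m hk d d x
  have hkey := ((((eval m x θ).hasFDerivAt.comp_hasDerivAt (0 : ℝ) hZ).const_mul
    ((sker α θ : ℝ) : ℂ)).congr_of_eventuallyEq (f₁ := fun s : ℝ =>
      ((2 * velDensity α m c (s • d) c (s • d) x θ : ℝ) : ℂ) * Complex.I) ?_).unique hv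
  · rw [← hkey]
    simp only [map_sub, map_add]
    ring
  · filter_upwards [hev 1 hs1, hev (-1) hs2] with r h1 h2
    rw [← selfDensity_eq α m ha (fun s hs => by
      rcases (abs_eq_one_iff s).1 hs with rfl | rfl <;> assumption) x hθ.1 hθ.2, selfDensity,
      numer_self]
    simp only [Function.comp_apply, Pi.sub_apply, sub_mul, mul_assoc]

theorem sinEval_fderiv_patchMap {b₀ b : ℝ} (hb₀ : 0 < b₀) (h : IsNear α m b₀ (b, 0)) (d e : Ell ℕ)
    (x : ℝ) :
    sinEval m x (fderiv ℝ (patchMap α m b₀) (b, 0) (0, (d, e))).1 =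
      2 * (∫ θ in (0 : ℝ)..(2 * Real.pi), linDensity α m 1 d 1 d x θ) -
      2 * (∫ θ in (0 : ℝ)..(2 * Real.pi), linDensity α m 1 d b e x θ) ∧
    sinEval m x (fderiv ℝ (patchMap α m b₀) (b, 0) (0, (d, e))).2 =
      2 * (∫ θ in (0 : ℝ)..(2 * Real.pi), linDensity α m b e 1 d x θ) -
      2 * (∫ θ in (0 : ℝ)..(2 * Real.pi), linDensity α m b e b e x θ) := by
  have hb0 : 0 < b := h.pos
  have hb1 : b < 1 := h.lt_one
  have hk1 : ∀ θ, (1 : ℝ) ^ 2 + b ^ 2 - 2 * 1 * b * Real.cos θ ≠ 0 := fun θ => by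
    have h1 : (1 : ℝ) ^ 2 + b ^ 2 - 2 * 1 * b * Real.cos θ = ker b θ := by rw [ker]; ring
    rw [h1]
    exact (ker_pos hb0 hb1 θ).ne'
  have hk2 : ∀ θ, b ^ 2 + (1 : ℝ) ^ 2 - 2 * b * 1 * Real.cos θ ≠ 0 := fun θ => by
    have := hk1 θ
    intro h; apply this; linarith
  obtain ⟨T1, hT1, e1⟩ := exists_hasDerivAt_selfTerm α m one_pos one_pos d h.outer
  obtain ⟨T2, hT2, e2⟩ := exists_hasDerivAt_outTerm α m d e h.gapOut hk1
  obtain ⟨T3, hT3, e3⟩ := exists_hasDerivAt_inTerm α m e d h.gapIn hk2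
  obtain ⟨T4, hT4, e4⟩ := exists_hasDerivAt_selfTerm α m hb₀ hb0 e h.inner
  have hc : HasDerivAt (fun s : ℝ => (b, s • ((d, e) : Ell ℕ × Ell ℕ))) (0, (d, e)) 0 := by
    have := (hasDerivAt_const (0 : ℝ) b).prodMk
      ((hasDerivAt_id (0 : ℝ)).smul_const ((d, e) : Ell ℕ × Ell ℕ))
    simpa using this
  have hF : HasFDerivAt (patchMap α m b₀) (fderiv ℝ (patchMap α m b₀) (b, 0))
      (b, (0 : ℝ) • ((d, e) : Ell ℕ × Ell ℕ)) := by
    rw [zero_smul]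
    exact ((contDiffAt_patchMap α m (n := 1) h).differentiableAt one_ne_zero).hasFDerivAt
  have h1 := hF.comp_hasDerivAt (0 : ℝ) hc
  have h2 := (hT1.sub hT2).prodMk (hT3.sub hT4)
  have h3 : fderiv ℝ (patchMap α m b₀) (b, 0) (0, (d, e)) = (T1 - T2, T3 - T4) := h1.unique h2
  rw [h3]
  simp only [map_sub, e1, e2, e3, e4]
  exact ⟨trivial, trivial⟩

end Linearization

section Modes

variable (α : ℝ) (m : ℕ)

/-- The factor between the matrix `M_n(b)`, `n = m(k+1)`, and the linearization on the `k`-th mode. -/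
def modeFactor (k : ℕ) : ℝ := -(2 * m / (cAlpha α * Theta α (m * (k + 1))))

variable [hp : Admissible α m]

theorem Theta_mode_pos (k : ℕ) : 0 < Theta α (m * (k + 1)) :=
  Theta_pos hp.pos hp.lt_two (hp.two_le.trans (Nat.le_mul_of_pos_right m (Nat.succ_pos k)))

theorem modeFactor_neg (k : ℕ) : modeFactor α m k < 0 := by
  have h1 := Theta_mode_pos α m k
  have h2 := cAlpha_pos hp.pos hp.lt_two
  have h3 : (0 : ℝ) < m := by have := hp.two_le; positivity
  rw [modeFactor, neg_lt_zero]
  positivity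

/-- The values of a multiple of the `k`-th unit vector, in terms of the frequency `n = m(k+1)`. -/
theorem cosEval_mode (x : ℝ) (k : ℕ) :
    cosEval α m x (Ell.basis k) = cosCoef α m k * Real.cos ((m * (k + 1) : ℕ) * x) ∧
    dcosEval α m x (Ell.basis k) =
      -(cosCoef α m k * (m * (k + 1) : ℕ) * Real.sin ((m * (k + 1) : ℕ) * x)) := by
  have h : ((m * (k + 1) : ℕ) : ℝ) = ((k + 1 : ℕ) : ℝ) * m := by push_cast; ring
  rw [cosEval_basis, dcosEval_basis, h]
  exact ⟨rfl, rfl⟩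

theorem modeFactor_mul_sin (x : ℝ) (k : ℕ) :
    2 / cAlpha α * ((m * (k + 1) : ℕ) * (cosCoef α m k * Real.sin ((m * (k + 1) : ℕ) * x))) =
      -modeFactor α m k * sinEval m x (Ell.basis k) := by
  have h1 := (Theta_mode_pos α m k).ne'
  have h2 := (cAlpha_pos hp.pos hp.lt_two).ne'
  have h3 : ((m * (k + 1) : ℕ) : ℝ) = ((k + 1 : ℕ) : ℝ) * m := by push_cast; ring
  have h4 : omega α m (k + 1 : ℕ) = (k + 1 : ℕ) * Theta α (m * (k + 1)) := by
    rw [omega, if_neg (by omega), Int.natAbs_natCast, Int.cast_natCast, Nat.abs_cast]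
  have h5 := (wt_pos (k + 1 : ℕ)).ne'
  have h6 : ((k + 1 : ℕ) : ℝ) ≠ 0 := by positivity
  rw [sinEval_basis, modeFactor, cosCoef, h4, h3]
  field_simp

variable {b₀ b : ℝ}

/-- The linearization at an annulus in the direction of a mode of the outer curve. -/
theorem fderiv_patchMap_outer (hb₀ : 0 < b₀) (h : IsNear α m b₀ (b, 0)) (k : ℕ) :
    fderiv ℝ (patchMap α m b₀) (b, 0) (0, (Ell.basis k, 0)) =
      ((modeFactor α m k * M α (m * (k + 1)) b 0 0) • Ell.basis k,
       (modeFactor α m k * M α (m * (k + 1)) b 1 0) • Ell.basis k) := by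
  have hb0 : 0 < b := h.pos
  have hb1 : b < 1 := h.lt_one
  have hm : 0 < m := by have := hp.two_le; omega
  have hc := (cAlpha_pos hp.pos hp.lt_two).ne'
  have hn : 1 ≤ m * (k + 1) := Nat.mul_pos hm (Nat.succ_pos k)
  have hker : ∀ θ, (1 : ℝ) ^ 2 + b ^ 2 - 2 * 1 * b * Real.cos θ = ker b θ := fun θ => by
    rw [ker]; ring
  have hker' : ∀ θ, b ^ 2 + (1 : ℝ) ^ 2 - 2 * b * 1 * Real.cos θ = ker b θ := fun θ => by
    rw [ker]; ring
  refine Prod.ext (sub_eq_zero.1 (eq_zero_of_sinEval m hm fun x => ?_))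
    (sub_eq_zero.1 (eq_zero_of_sinEval m hm fun x => ?_))
  · have e1 := integral_linKer_self hp.pos hp.lt_two hn one_pos (cosCoef α m k) x
    have e2 := integral_linKer_left hp.pos hp.lt_two hb0 hb1 hker
      (cosCoef α m k * Real.cos ((m * (k + 1) : ℕ) * x))
      (-(cosCoef α m k * (m * (k + 1) : ℕ) * Real.sin ((m * (k + 1) : ℕ) * x)))
    have e3 := modeFactor_mul_sin α m x k
    rw [map_sub, (sinEval_fderiv_patchMap α m hb₀ h _ _ x).1, map_smul, smul_eq_mul]
    simp only [linDensity, cosEval_mode, map_zero]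
    rw [Real.one_rpow, one_mul] at e1
    replace e1 := eq_div_of_mul_eq hc ((mul_comm _ _).trans e1)
    replace e2 := eq_div_of_mul_eq hc ((mul_comm _ _).trans e2)
    rw [e1, e2]
    simp only [M, Matrix.of_apply, Matrix.cons_val_zero, Matrix.cons_val', Matrix.cons_val_fin_one]
    linear_combination (Theta α (m * (k + 1)) - b ^ 2 * Lam α 1 b) * e3
  · have e2 := integral_linKer_right hp.pos hp.lt_two hb0 hb1 hker' (mul_one b) hn (cosCoef α m k) x
    have e3 := modeFactor_mul_sin α m x k
    rw [map_sub, (sinEval_fderiv_patchMap α m hb₀ h _ _ x).2, map_smul, smul_eq_mul]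
    simp only [linDensity, cosEval_mode, map_zero]
    have e0 : ∀ θ, linKer α θ b b 0 0 0 0 = 0 := fun θ => by rw [linKer]; ring
    replace e2 := eq_div_of_mul_eq hc ((mul_comm _ _).trans e2)
    rw [e2]
    simp only [e0, intervalIntegral.integral_zero]
    simp only [M, Matrix.of_apply, Matrix.cons_val_zero, Matrix.cons_val_one, Matrix.cons_val',
      Matrix.cons_val_fin_one]
    linear_combination (-(b * Lam α (m * (k + 1)) b)) * e3

/-- The linearization at an annulus in the direction of a mode of the inner curve. -/
theorem fderiv_patchMap_inner (hb₀ : 0 < b₀) (h : IsNear α m b₀ (b, 0)) (k : ℕ) :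
    fderiv ℝ (patchMap α m b₀) (b, 0) (0, (0, Ell.basis k)) =
      ((modeFactor α m k * M α (m * (k + 1)) b 0 1) • Ell.basis k,
       (modeFactor α m k * M α (m * (k + 1)) b 1 1) • Ell.basis k) := by
  have hb0 : 0 < b := h.pos
  have hb1 : b < 1 := h.lt_one
  have hm : 0 < m := by have := hp.two_le; omega
  have hc := (cAlpha_pos hp.pos hp.lt_two).ne'
  have hn : 1 ≤ m * (k + 1) := Nat.mul_pos hm (Nat.succ_pos k)
  have hker : ∀ θ, (1 : ℝ) ^ 2 + b ^ 2 - 2 * 1 * b * Real.cos θ = ker b θ := fun θ => by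
    rw [ker]; ring
  have hker' : ∀ θ, b ^ 2 + (1 : ℝ) ^ 2 - 2 * b * 1 * Real.cos θ = ker b θ := fun θ => by
    rw [ker]; ring
  refine Prod.ext (sub_eq_zero.1 (eq_zero_of_sinEval m hm fun x => ?_))
    (sub_eq_zero.1 (eq_zero_of_sinEval m hm fun x => ?_))
  · have e2 := integral_linKer_right hp.pos hp.lt_two hb0 hb1 hker (one_mul b) hn (cosCoef α m k) x
    have e3 := modeFactor_mul_sin α m x k
    rw [map_sub, (sinEval_fderiv_patchMap α m hb₀ h _ _ x).1, map_smul, smul_eq_mul]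
    simp only [linDensity, cosEval_mode, map_zero]
    have e0 : ∀ θ, linKer α θ 1 1 0 0 0 0 = 0 := fun θ => by rw [linKer]; ring
    replace e2 := eq_div_of_mul_eq hc ((mul_comm _ _).trans e2)
    rw [e2]
    simp only [e0, intervalIntegral.integral_zero]
    simp only [M, Matrix.of_apply, Matrix.cons_val_zero, Matrix.cons_val_one, Matrix.cons_val',
      Matrix.cons_val_fin_one]
    linear_combination (b ^ 2 * Lam α (m * (k + 1)) b) * e3
  · have e1 := integral_linKer_self hp.pos hp.lt_two hn hb0 (cosCoef α m k) x
    have e2 := integral_linKer_left hp.pos hp.lt_two hb0 hb1 hker'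
      (cosCoef α m k * Real.cos ((m * (k + 1) : ℕ) * x))
      (-(cosCoef α m k * (m * (k + 1) : ℕ) * Real.sin ((m * (k + 1) : ℕ) * x)))
    have e3 := modeFactor_mul_sin α m x k
    rw [map_sub, (sinEval_fderiv_patchMap α m hb₀ h _ _ x).2, map_smul, smul_eq_mul]
    simp only [linDensity, cosEval_mode, map_zero]
    replace e1 := eq_div_of_mul_eq hc ((mul_comm _ _).trans e1)
    replace e2 := eq_div_of_mul_eq hc ((mul_comm _ _).trans e2)
    rw [e1, e2]
    simp only [M, Matrix.of_apply, Matrix.cons_val_one, Matrix.cons_val', Matrix.cons_val_fin_one]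
    linear_combination (b * Lam α 1 b - b ^ (1 - α) * Theta α (m * (k + 1))) * e3

/-- The `k`-th coordinate as a continuous linear functional. -/
def coord (k : ℕ) : Ell ℕ →L[ℝ] ℝ := Ell.lift fun i => if i = k then 1 else 0

omit hp in
theorem coord_apply (k : ℕ) (d : Ell ℕ) : coord k d = d k := by
  have h : ∀ i, ‖(if i = k then (1 : ℝ) else 0)‖ ≤ 1 := fun i => by split_ifs <;> simp
  rw [coord, Ell.lift_apply h, tsum_eq_single k (fun i hi => by simp [hi])]
  simp

omit hp in
/-- An operator which multiplies the unit vectors by scalars acts diagonally. -/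
theorem apply_of_forall_basis {T : Ell ℕ →L[ℝ] Ell ℕ} {c : ℕ → ℝ}
    (hT : ∀ i, T (Ell.basis i) = c i • Ell.basis i) (d : Ell ℕ) (k : ℕ) : T d k = c k * d k := by
  have h1 : coord k ∘L T = c k • coord k := by
    refine Ell.ext_basis fun i => ?_
    change coord k (T (Ell.basis i)) = c k * coord k (Ell.basis i)
    rw [hT, map_smul, coord_apply, Ell.basis_apply, smul_eq_mul]
    split_ifs with hi
    · rw [hi]
    · simp
  have h2 := congrArg (fun S : Ell ℕ →L[ℝ] ℝ => S d) h1
  change coord k (T d) = c k * coord k d at h2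
  rwa [coord_apply, coord_apply] at h2

/-- The linearization is block diagonal. -/
theorem fderiv_patchMap_coord (hb₀ : 0 < b₀) (h : IsNear α m b₀ (b, 0)) (d e : Ell ℕ) (k : ℕ) :
    (fderiv ℝ (patchMap α m b₀) (b, 0) (0, (d, e))).1 k = modeFactor α m k *
      (M α (m * (k + 1)) b 0 0 * d k + M α (m * (k + 1)) b 0 1 * e k) ∧
    (fderiv ℝ (patchMap α m b₀) (b, 0) (0, (d, e))).2 k = modeFactor α m k *
      (M α (m * (k + 1)) b 1 0 * d k + M α (m * (k + 1)) b 1 1 * e k) := by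
  set A := fderiv ℝ (patchMap α m b₀) (b, 0) with hA
  let ι₁ : Ell ℕ →L[ℝ] ℝ × (Ell ℕ × Ell ℕ) :=
    (ContinuousLinearMap.inr ℝ ℝ (Ell ℕ × Ell ℕ)) ∘L (ContinuousLinearMap.inl ℝ (Ell ℕ) (Ell ℕ))
  let ι₂ : Ell ℕ →L[ℝ] ℝ × (Ell ℕ × Ell ℕ) :=
    (ContinuousLinearMap.inr ℝ ℝ (Ell ℕ × Ell ℕ)) ∘L (ContinuousLinearMap.inr ℝ (Ell ℕ) (Ell ℕ))
  have h11 := apply_of_forall_basis (T := ContinuousLinearMap.fst ℝ _ _ ∘L A ∘L ι₁)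
    (fun i => congrArg Prod.fst (fderiv_patchMap_outer α m hb₀ h i)) d k
  have h21 := apply_of_forall_basis (T := ContinuousLinearMap.snd ℝ _ _ ∘L A ∘L ι₁)
    (fun i => congrArg Prod.snd (fderiv_patchMap_outer α m hb₀ h i)) d k
  have h12 := apply_of_forall_basis (T := ContinuousLinearMap.fst ℝ _ _ ∘L A ∘L ι₂)
    (fun i => congrArg Prod.fst (fderiv_patchMap_inner α m hb₀ h i)) e k
  have h22 := apply_of_forall_basis (T := ContinuousLinearMap.snd ℝ _ _ ∘L A ∘L ι₂)
    (fun i => congrArg Prod.snd (fderiv_patchMap_inner α m hb₀ h i)) e k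
  change (A (0, (d, 0))).1 k = _ at h11
  change (A (0, (d, 0))).2 k = _ at h21
  change (A (0, (0, e))).1 k = _ at h12
  change (A (0, (0, e))).2 k = _ at h22
  have hsplit : ((0 : ℝ), (d, e)) = ((0 : ℝ), (d, (0 : Ell ℕ))) + ((0 : ℝ), ((0 : Ell ℕ), e)) := by
    simp
  rw [hsplit, map_add]
  constructor
  · rw [Prod.fst_add, lp.coeFn_add, Pi.add_apply, h11, h12]; ring
  · rw [Prod.snd_add, lp.coeFn_add, Pi.add_apply, h21, h22]; ring

end Modes

/-! ### The bifurcation condition -/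

section Bifurcation

variable (α : ℝ) (m : ℕ)

theorem Delta_eq_mul_sub_mul (n : ℕ) (b : ℝ) :
    Delta α n b = M α n b 0 0 * M α n b 1 1 - M α n b 0 1 * M α n b 1 0 := by
  rw [Delta, Matrix.det_fin_two]

/-- A vector in the kernel of the linearization at a zero `b` of `Δ_m`, concentrated on the first
mode. -/
def kernelVec (b : ℝ) : Ell ℕ × Ell ℕ :=
  ((-M α m b 0 1) • Ell.basis 0, (M α m b 0 0) • Ell.basis 0)

/-- The functional that pairs the first mode with `kernelVec`; it serves to normalize the
complement of the kernel. -/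
def kernelFunctional (b : ℝ) : (Ell ℕ × Ell ℕ) →L[ℝ] ℝ :=
  (-M α m b 0 1) • (coord 0 ∘L ContinuousLinearMap.fst ℝ _ _) +
    (M α m b 0 0) • (coord 0 ∘L ContinuousLinearMap.snd ℝ _ _)

theorem kernelFunctional_apply (b : ℝ) (w : Ell ℕ × Ell ℕ) :
    kernelFunctional α m b w = -M α m b 0 1 * w.1 0 + M α m b 0 0 * w.2 0 := by
  rw [← coord_apply 0 w.1, ← coord_apply 0 w.2]
  rfl

theorem kernelFunctional_kernelVec (b : ℝ) :
    kernelFunctional α m b (kernelVec α m b) = M α m b 0 1 ^ 2 + M α m b 0 0 ^ 2 := by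
  rw [kernelFunctional_apply, kernelVec]
  simp only [lp.coeFn_smul, Pi.smul_apply, Ell.basis_apply, if_true, smul_eq_mul, mul_one]
  ring

/-- The derivative in `b` of the linearization applied to `kernelVec`. -/
def transVec (b : ℝ) : Ell ℕ × Ell ℕ :=
  ((modeFactor α m 0 * (deriv (fun t => M α m t 0 0) b * -M α m b 0 1 +
      deriv (fun t => M α m t 0 1) b * M α m b 0 0)) • Ell.basis 0,
   (modeFactor α m 0 * (deriv (fun t => M α m t 1 0) b * -M α m b 0 1 +
      deriv (fun t => M α m t 1 1) b * M α m b 0 0)) • Ell.basis 0)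

variable [hp : Admissible α m] {b₀ b : ℝ}

theorem fderiv_patchMap_mode (hb₀ : 0 < b₀) (h : IsNear α m b₀ (b, 0)) (k : ℕ) (x y : ℝ) :
    fderiv ℝ (patchMap α m b₀) (b, 0) (0, (x • Ell.basis k, y • Ell.basis k)) =
      ((modeFactor α m k * (M α (m * (k + 1)) b 0 0 * x + M α (m * (k + 1)) b 0 1 * y)) •
          Ell.basis k,
       (modeFactor α m k * (M α (m * (k + 1)) b 1 0 * x + M α (m * (k + 1)) b 1 1 * y)) •
          Ell.basis k) := by
  have hsplit : ((0 : ℝ), (x • (Ell.basis k : Ell ℕ), y • (Ell.basis k : Ell ℕ))) =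
      x • ((0 : ℝ), ((Ell.basis k : Ell ℕ), (0 : Ell ℕ))) +
      y • ((0 : ℝ), ((0 : Ell ℕ), (Ell.basis k : Ell ℕ))) := by
    simp
  rw [hsplit, map_add, map_smul, map_smul, fderiv_patchMap_outer α m hb₀ h,
    fderiv_patchMap_inner α m hb₀ h]
  refine Prod.ext ?_ ?_
  · simp only [Prod.fst_add, Prod.smul_fst, smul_smul, ← add_smul]
    congr 1; ring
  · simp only [Prod.snd_add, Prod.smul_snd, smul_smul, ← add_smul]
    congr 1; ring

theorem fderiv_patchMap_kernelVec (hb₀ : 0 < b₀) (h : IsNear α m b₀ (b, 0))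
    (hΔ : Delta α m b = 0) :
    fderiv ℝ (patchMap α m b₀) (b, 0) (0, kernelVec α m b) = 0 := by
  rw [Delta_eq_mul_sub_mul] at hΔ
  rw [kernelVec, fderiv_patchMap_mode α m hb₀ h]
  simp only [zero_add, mul_one]
  refine Prod.ext ?_ ?_
  · simp only [Prod.fst_zero]
    rw [show M α m b 0 0 * -M α m b 0 1 + M α m b 0 1 * M α m b 0 0 = 0 by ring, mul_zero, zero_smul]
  · simp only [Prod.snd_zero]
    rw [show M α m b 1 0 * -M α m b 0 1 + M α m b 1 1 * M α m b 0 0 = 0 by linarith, mul_zero,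
      zero_smul]

/-- `transVec` is the mixed derivative of the functional in `b` and `kernelVec`. -/
theorem hasDerivAt_fderiv_patchMap_kernelVec (hb0 : 0 < b) (hb1 : b < 1) :
    HasDerivAt (fun t => fderiv ℝ (patchMap α m b) (t, 0) (0, kernelVec α m b))
      (transVec α m b) b := by
  have hm : 1 ≤ m := by have := hp.two_le; omega
  have hd : ∀ i j, HasDerivAt (fun t => M α m t i j) (deriv (fun t => M α m t i j) b) b :=
    fun i j => (differentiableAt_M hp.pos hp.lt_two hb0 hb1 hm i j).hasDerivAt
  have hcont : Tendsto (fun t : ℝ => (t, (0 : Ell ℕ × Ell ℕ))) (𝓝 b) (𝓝 (b, 0)) :=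
    (Continuous.prodMk_left (0 : Ell ℕ × Ell ℕ)).tendsto b
  have hev := hcont.eventually (eventually_isNear α m hb0 hb1)
  have h1 := ((((hd 0 0).mul_const (-M α m b 0 1)).add ((hd 0 1).mul_const (M α m b 0 0))).const_mul
    (modeFactor α m 0)).smul_const (Ell.basis 0 : Ell ℕ)
  have h2 := ((((hd 1 0).mul_const (-M α m b 0 1)).add ((hd 1 1).mul_const (M α m b 0 0))).const_mul
    (modeFactor α m 0)).smul_const (Ell.basis 0 : Ell ℕ)
  refine HasDerivAt.congr_of_eventuallyEq (h1.prodMk h2) ?_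
  filter_upwards [hev] with t ht
  rw [kernelVec, fderiv_patchMap_mode α m hb0 ht]
  simp only [zero_add, mul_one, Pi.add_apply]

/-- The transversality condition: the left kernel of the linearization does not annihilate
`transVec`, because `Δ_m` has a simple zero. -/
theorem transVec_pairing (hb0 : 0 < b) (hb1 : b < 1) (hΔ : Delta α m b = 0) :
    M α m b 1 0 * (transVec α m b).1 0 - M α m b 0 0 * (transVec α m b).2 0 ≠ 0 := by
  have hm : 1 ≤ m := by have := hp.two_le; omega
  have hd : ∀ i j, HasDerivAt (fun t => M α m t i j) (deriv (fun t => M α m t i j) b) b :=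
    fun i j => (differentiableAt_M hp.pos hp.lt_two hb0 hb1 hm i j).hasDerivAt
  obtain ⟨d, hd0, hdd⟩ := hasDerivAt_Delta hp.pos hp.lt_two hb0 hb1 hp.two_le hΔ
  have h1 := ((hd 0 0).mul (hd 1 1)).sub ((hd 0 1).mul (hd 1 0))
  have h2 := hdd.unique (h1.congr_of_eventuallyEq
    (Eventually.of_forall fun t => Delta_eq_mul_sub_mul α m t))
  have h3 : M α m b 0 0 ≠ 0 := (M_zero_neg hp.pos hp.lt_two hb0 hb1 hp.two_le hΔ).ne
  rw [Delta_eq_mul_sub_mul] at hΔ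
  have h4 : M α m b 1 0 * (transVec α m b).1 0 - M α m b 0 0 * (transVec α m b).2 0 =
      -(modeFactor α m 0 * M α m b 0 0 * d) := by
    rw [transVec, h2]
    simp only [lp.coeFn_smul, Pi.smul_apply, Ell.basis_apply, if_true, smul_eq_mul, mul_one]
    linear_combination (modeFactor α m 0 * deriv (fun t => M α m t 0 0) b) * hΔ
  rw [h4]
  exact neg_ne_zero.2 (mul_ne_zero (mul_ne_zero (modeFactor_neg α m 0).ne h3) hd0)

/-- The modes `k ≥ 1` of the inverse of the linearization are uniformly bounded. -/
theorem exists_inverse_bound (hb0 : 0 < b) (hb1 : b < 1) (hΔ : Delta α m b = 0) :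
    ∃ K, 0 < K ∧ ∀ k, 1 ≤ k → Delta α (m * (k + 1)) b ≠ 0 ∧
      ∀ i j, |M α (m * (k + 1)) b i j / (modeFactor α m k * Delta α (m * (k + 1)) b)| ≤ K := by
  have hm := hp.two_le
  have hm0 : (0 : ℝ) < m := by positivity
  have hc := cAlpha_pos hp.pos hp.lt_two
  obtain ⟨δ, hδ, h1⟩ := exists_Delta_bound hp.pos hp.lt_two hb0 hb1 hp.two_le hΔ
  obtain ⟨C, hC, h2⟩ := exists_M_bound (α := α) hp.pos hp.lt_two hb0 hb1
  refine ⟨C * cAlpha α / (2 * m * δ), by positivity, fun k hk => ?_⟩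
  have hT := Theta_mode_pos α m k
  have hn : 2 * m ≤ m * (k + 1) := by nlinarith
  have h3 := h1 _ hn
  have h4 : 0 < |Delta α (m * (k + 1)) b| := lt_of_lt_of_le (by positivity) h3
  refine ⟨abs_pos.1 h4, fun i j => ?_⟩
  have h5 := h2 (m * (k + 1)) (by nlinarith) i j
  have h6 : |modeFactor α m k| = 2 * m / (cAlpha α * Theta α (m * (k + 1))) := by
    rw [modeFactor, abs_neg, abs_of_pos (by positivity)]
  rw [abs_div, abs_mul, h6, div_le_iff₀ (by positivity)]
  calc |M α (m * (k + 1)) b i j| ≤ C * Theta α (m * (k + 1)) := h5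
    _ = C * cAlpha α / (2 * m * δ) * (2 * m / (cAlpha α * Theta α (m * (k + 1))) *
        (δ * Theta α (m * (k + 1)) ^ 2)) := by field_simp
    _ ≤ _ := by gcongr

/-- The linearization of the patch equations, bordered by `transVec` and `kernelFunctional`. -/
def borderedMap (b : ℝ) : (ℝ × (Ell ℕ × Ell ℕ)) →L[ℝ] ((Ell ℕ × Ell ℕ) × ℝ) :=
  ((ContinuousLinearMap.fst ℝ ℝ (Ell ℕ × Ell ℕ)).smulRight (transVec α m b) +
    (fderiv ℝ (patchMap α m b) (b, 0) ∘L ContinuousLinearMap.inr ℝ ℝ (Ell ℕ × Ell ℕ)) ∘L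
      ContinuousLinearMap.snd ℝ ℝ (Ell ℕ × Ell ℕ)).prod
    (kernelFunctional α m b ∘L ContinuousLinearMap.snd ℝ ℝ (Ell ℕ × Ell ℕ))

omit hp in
theorem borderedMap_apply (β : ℝ) (w : Ell ℕ × Ell ℕ) :
    borderedMap α m b (β, w) = (β • transVec α m b + fderiv ℝ (patchMap α m b) (b, 0) (0, w),
      kernelFunctional α m b w) := rfl

omit hp in
theorem transVec_apply_of_ne (b : ℝ) {k : ℕ} (hk : k ≠ 0) :
    (transVec α m b).1 k = 0 ∧ (transVec α m b).2 k = 0 := by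
  simp [transVec, Ell.basis_apply, hk]

/-- The bordered linearization in coordinates. -/
theorem borderedMap_eq_iff (hb0 : 0 < b) (hb1 : b < 1) (β t : ℝ) (d e p q : Ell ℕ) :
    borderedMap α m b (β, (d, e)) = ((p, q), t) ↔
      (∀ k, β * (transVec α m b).1 k + modeFactor α m k *
          (M α (m * (k + 1)) b 0 0 * d k + M α (m * (k + 1)) b 0 1 * e k) = p k) ∧
      (∀ k, β * (transVec α m b).2 k + modeFactor α m k *
          (M α (m * (k + 1)) b 1 0 * d k + M α (m * (k + 1)) b 1 1 * e k) = q k) ∧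
      -M α m b 0 1 * d 0 + M α m b 0 0 * e 0 = t := by
  have hnear := (eventually_isNear α m hb0 hb1).self_of_nhds
  have hco := fderiv_patchMap_coord α m hb0 hnear d e
  have h1 : ∀ k, (β • transVec α m b + fderiv ℝ (patchMap α m b) (b, 0) (0, (d, e))).1 k =
      β * (transVec α m b).1 k + modeFactor α m k *
          (M α (m * (k + 1)) b 0 0 * d k + M α (m * (k + 1)) b 0 1 * e k) := fun k => by
    rw [← (hco k).1]; rfl
  have h2 : ∀ k, (β • transVec α m b + fderiv ℝ (patchMap α m b) (b, 0) (0, (d, e))).2 k =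
      β * (transVec α m b).2 k + modeFactor α m k *
          (M α (m * (k + 1)) b 1 0 * d k + M α (m * (k + 1)) b 1 1 * e k) := fun k => by
    rw [← (hco k).2]; rfl
  rw [borderedMap_apply, Prod.ext_iff, Prod.ext_iff, and_assoc, kernelFunctional_apply]
  refine and_congr ?_ (and_congr ?_ Iff.rfl)
  · simp only [← h1]
    exact ⟨fun h k => by rw [h], fun h => lp.ext (funext h)⟩
  · simp only [← h2]
    exact ⟨fun h k => by rw [h], fun h => lp.ext (funext h)⟩

/-- On the first mode injectivity follows from transversality and the normalization, on the others from
`Δ_n ≠ 0`. -/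
theorem borderedMap_injective (hb0 : 0 < b) (hb1 : b < 1) (hΔ : Delta α m b = 0) :
    Function.Injective (borderedMap α m b) := by
  have htrans := transVec_pairing α m hb0 hb1 hΔ
  have hneg := M_zero_neg hp.pos hp.lt_two hb0 hb1 hp.two_le hΔ
  obtain ⟨K, -, hK⟩ := exists_inverse_bound α m hb0 hb1 hΔ
  rw [injective_iff_map_eq_zero]
  rintro ⟨β, d, e⟩ h
  rw [show (0 : (Ell ℕ × Ell ℕ) × ℝ) = ((0, 0), 0) from rfl, borderedMap_eq_iff α m hb0 hb1] at h
  obtain ⟨h1, h2, h3⟩ := h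
  rw [Delta_eq_mul_sub_mul] at hΔ
  have hf := (modeFactor_neg α m 0).ne
  have h10 := h1 0
  have h20 := h2 0
  simp only [zero_add, mul_one, lp.coeFn_zero, Pi.zero_apply] at h10 h20
  have hβ : β = 0 := by
    refine (mul_eq_zero.1 ?_).resolve_right htrans
    linear_combination M α m b 1 0 * h10 - M α m b 0 0 * h20 +
      modeFactor α m 0 * e 0 * hΔ
  rw [hβ, zero_mul, zero_add] at h10
  have h10' := (mul_eq_zero.1 h10).resolve_left hf
  have hD : 0 < M α m b 0 0 ^ 2 + M α m b 0 1 ^ 2 := by nlinarith [sq_nonneg (M α m b 0 1)]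
  have hd0 : d 0 = 0 := by
    refine (mul_eq_zero.1 ?_).resolve_left hD.ne'
    linear_combination M α m b 0 0 * h10' - M α m b 0 1 * h3
  have he0 : e 0 = 0 := by
    refine (mul_eq_zero.1 ?_).resolve_left hD.ne'
    linear_combination M α m b 0 1 * h10' + M α m b 0 0 * h3
  have hk : ∀ k, d k = 0 ∧ e k = 0 := by
    intro k
    rcases Nat.eq_zero_or_pos k with rfl | hk
    · exact ⟨hd0, he0⟩
    · have hdet := (hK k hk).1
      have e1 := h1 k
      have e2 := h2 k
      rw [hβ, zero_mul, zero_add] at e1 e2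
      have hf := (modeFactor_neg α m k).ne
      have e1' := (mul_eq_zero.1 e1).resolve_left hf
      have e2' := (mul_eq_zero.1 e2).resolve_left hf
      rw [Delta_eq_mul_sub_mul] at hdet
      constructor
      · refine (mul_eq_zero.1 ?_).resolve_left hdet
        linear_combination M α (m * (k + 1)) b 1 1 * e1' - M α (m * (k + 1)) b 0 1 * e2'
      · refine (mul_eq_zero.1 ?_).resolve_left hdet
        linear_combination -M α (m * (k + 1)) b 1 0 * e1' + M α (m * (k + 1)) b 0 0 * e2'
  have hd : d = 0 := lp.ext (funext fun k => (hk k).1)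
  have he : e = 0 := lp.ext (funext fun k => (hk k).2)
  rw [hβ, hd, he]; rfl

/-- The preimage is written down mode by mode with Cramer's rule; it is summable by
`exists_inverse_bound`. -/
theorem borderedMap_surjective (hb0 : 0 < b) (hb1 : b < 1) (hΔ : Delta α m b = 0) :
    Function.Surjective (borderedMap α m b) := by
  have htrans := transVec_pairing α m hb0 hb1 hΔ
  have hneg := M_zero_neg hp.pos hp.lt_two hb0 hb1 hp.two_le hΔ
  obtain ⟨K, hK0, hK⟩ := exists_inverse_bound α m hb0 hb1 hΔ
  rintro ⟨⟨p, q⟩, t⟩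
  set D := M α m b 1 0 * (transVec α m b).1 0 - M α m b 0 0 * (transVec α m b).2 0 with hDdef
  -- `β` makes the first mode of the right-hand side solvable
  set β := (M α m b 1 0 * p 0 - M α m b 0 0 * q 0) / D with hβ
  set s := (p 0 - β * (transVec α m b).1 0) / modeFactor α m 0 with hs
  set N := M α m b 0 0 ^ 2 + M α m b 0 1 ^ 2 with hN
  clear_value s β D
  have hN0 : 0 < N := by rw [hN]; nlinarith [sq_nonneg (M α m b 0 1)]
  have hsum : ∀ (x : ℝ) (i j i' j' : Fin 2) (σ σ' : ℝ), |σ| = 1 → |σ'| = 1 → Summable fun k =>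
      |if k = 0 then x else
        σ * (M α (m * (k + 1)) b i j / (modeFactor α m k * Delta α (m * (k + 1)) b)) * p k +
        σ' * (M α (m * (k + 1)) b i' j' / (modeFactor α m k * Delta α (m * (k + 1)) b)) * q k| := by
    intro x i j i' j' σ σ' hσ hσ'
    rw [← summable_nat_add_iff 1]
    have hb : Summable fun k => K * |p (k + 1)| + K * |q (k + 1)| :=
      (((summable_nat_add_iff 1).2 (Ell.hasSum_norm p).summable).mul_left K).add
        (((summable_nat_add_iff 1).2 (Ell.hasSum_norm q).summable).mul_left K)
    refine Summable.of_nonneg_of_le (fun k => abs_nonneg _) (fun k => ?_) hb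
    rw [if_neg (Nat.succ_ne_zero k)]
    have h := (hK (k + 1) (Nat.le_add_left 1 k)).2
    refine (abs_add_le _ _).trans (add_le_add ?_ ?_)
    · rw [abs_mul, abs_mul, hσ, one_mul]
      exact mul_le_mul_of_nonneg_right (h i j) (abs_nonneg _)
    · rw [abs_mul, abs_mul, hσ', one_mul]
      exact mul_le_mul_of_nonneg_right (h i' j') (abs_nonneg _)
  have s1 := hsum ((M α m b 0 0 * s - M α m b 0 1 * t) / N) 1 1 0 1 1 (-1) (by simp) (by simp)
  have s2 := hsum ((M α m b 0 1 * s + M α m b 0 0 * t) / N) 1 0 0 0 (-1) 1 (by simp) (by simp)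
  refine ⟨(β, (Ell.mk _ s1, Ell.mk _ s2)), ?_⟩
  have hf := (modeFactor_neg α m 0).ne
  have hβ' : β * D = M α m b 1 0 * p 0 - M α m b 0 0 * q 0 := by rw [hβ]; field_simp
  have hs' : modeFactor α m 0 * s = p 0 - β * (transVec α m b).1 0 := by rw [hs]; field_simp
  have hd0 : M α m b 0 0 * ((M α m b 0 0 * s - M α m b 0 1 * t) / N) +
      M α m b 0 1 * ((M α m b 0 1 * s + M α m b 0 0 * t) / N) = s := by
    rw [mul_div_assoc', mul_div_assoc', ← add_div, div_eq_iff hN0.ne', hN]; ring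
  have hd1 : -M α m b 0 1 * ((M α m b 0 0 * s - M α m b 0 1 * t) / N) +
      M α m b 0 0 * ((M α m b 0 1 * s + M α m b 0 0 * t) / N) = t := by
    rw [mul_div_assoc', mul_div_assoc', ← add_div, div_eq_iff hN0.ne', hN]; ring
  rw [Delta_eq_mul_sub_mul] at hΔ
  rw [borderedMap_eq_iff α m hb0 hb1]
  simp only [Ell.mk_apply]
  refine ⟨fun k => ?_, fun k => ?_, ?_⟩
  · rcases Nat.eq_zero_or_pos k with rfl | hk
    · simp only [if_true, zero_add, mul_one]
      rw [hd0, hs']; ring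
    · have hdet := (hK k hk).1
      have hf := (modeFactor_neg α m k).ne
      rw [if_neg hk.ne', if_neg hk.ne', (transVec_apply_of_ne α m b hk.ne').1]
      field_simp
      rw [Delta_eq_mul_sub_mul]; ring
  · rcases Nat.eq_zero_or_pos k with rfl | hk
    · simp only [if_true, zero_add, mul_one]
      refine mul_left_cancel₀ hneg.ne ?_
      linear_combination (modeFactor α m 0 * ((M α m b 0 1 * s + M α m b 0 0 * t) / N)) * hΔ +
        (M α m b 1 0 * modeFactor α m 0) * hd0 + M α m b 1 0 * hs' - hβ' + β * hDdef
    · have hdet := (hK k hk).1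
      have hf := (modeFactor_neg α m k).ne
      rw [if_neg hk.ne', if_neg hk.ne', (transVec_apply_of_ne α m b hk.ne').2]
      field_simp
      rw [Delta_eq_mul_sub_mul]; ring
  · simp only [if_true]
    exact hd1

/-- A curve of zeros of the patch equations bifurcates from the annulus at a zero of `Δ_m`. -/
theorem exists_patch_branch (hb0 : 0 < b) (hb1 : b < 1) (hΔ : Delta α m b = 0) {ρ : ℝ}
    (hρ : 0 < ρ) :
    ∃ ε > 0, ∃ z : ℝ → ℝ × (Ell ℕ × Ell ℕ), z 0 = (b, 0) ∧ ContinuousOn z (Ioo (-ε) ε) ∧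
      ∀ s ∈ Ioo (-ε) ε, ‖z s - (b, 0)‖ ≤ ρ ∧
        patchMap α m b ((z s).1, s • (kernelVec α m b + (z s).2)) = 0 ∧
        kernelFunctional α m b (z s).2 = 0 := by
  have hnear := (eventually_isNear α m hb0 hb1)
  have hcont : Tendsto (fun t : ℝ => (t, (0 : Ell ℕ × Ell ℕ))) (𝓝 b) (𝓝 (b, 0)) :=
    (Continuous.prodMk_left (0 : Ell ℕ × Ell ℕ)).tendsto b
  refine exists_bifurcation_branch (patchMap α m b) b (kernelVec α m b) (kernelFunctional α m b)
    (transVec α m b) (contDiffAt_patchMap α m hnear.self_of_nhds) ?_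
    (fderiv_patchMap_kernelVec α m hb0 hnear.self_of_nhds hΔ)
    (hasDerivAt_fderiv_patchMap_kernelVec α m hb0 hb1)
    (ContinuousLinearEquiv.ofBijective (borderedMap α m b)
      (LinearMap.ker_eq_bot.2 (borderedMap_injective α m hb0 hb1 hΔ))
      (LinearMap.range_eq_top.2 (borderedMap_surjective α m hb0 hb1 hΔ)))
    (fun β w => ?_) ρ hρ
  · filter_upwards [hcont.eventually hnear] with t ht
    exact patchMap_annulus α m hb0 ht
  · rw [ContinuousLinearEquiv.coeFn_ofBijective, borderedMap_apply]

end Bifurcation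

/-! ### Bounded holomorphic functions on a strip -/

theorem isOpen_strip (c : ℝ) : IsOpen (strip c) :=
  isOpen_lt (continuous_abs.comp Complex.continuous_im) continuous_const

theorem convex_strip (c : ℝ) : Convex ℝ (strip c) := by
  have h : strip c = Complex.imLm ⁻¹' (Metric.ball 0 c) := by
    ext z
    simp [strip]
  rw [h]
  exact (convex_ball 0 c).linear_preimage Complex.imLm

/-- Cauchy's estimate on a strip of half the width. -/
theorem norm_iteratedDeriv_le_of_strip {c B : ℝ} (hc : 0 < c) {f : ℂ → ℂ}
    (hf : DifferentiableOn ℂ f (strip (2 * c))) (hB : ∀ z ∈ strip (2 * c), ‖f z‖ ≤ B) (n : ℕ)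
    {z : ℂ} (hz : z ∈ strip c) : ‖iteratedDeriv n f z‖ ≤ n.factorial * B / (c / 2) ^ n := by
  have hsub : ∀ w, dist w z ≤ c / 2 → w ∈ strip (2 * c) := by
    intro w hw
    have h1 : |w.im - z.im| ≤ c / 2 := by
      rw [← Complex.sub_im]
      exact (Complex.abs_im_le_norm _).trans (by rwa [dist_eq_norm] at hw)
    have h2 : |z.im| < c := hz
    have h3 : |w.im| ≤ |w.im - z.im| + |z.im| := by
      simpa using abs_add_le (w.im - z.im) z.im
    change |w.im| < 2 * c
    linarith
  refine Complex.norm_iteratedDeriv_le_of_forall_mem_sphere_norm_le n (by positivity) ?_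
    fun w hw => hB w (hsub w (Metric.mem_sphere.1 hw).le)
  refine DifferentiableOn.diffContOnCl (hf.mono fun w hw => ?_)
  exact hsub w (Metric.mem_closedBall.1 (Metric.closure_ball_subset_closedBall hw))

theorem intervalIntegrable_abs_rpow_neg {β : ℝ} (hβ : β < 1) (a b : ℝ) :
    IntervalIntegrable (fun y : ℝ => |y| ^ (-β)) volume a b := by
  refine intervalIntegrable_of_even (fun x => by rw [abs_neg]) (fun x hx => ?_)
  refine (intervalIntegral.intervalIntegrable_rpow' (a := 0) (b := x) (r := -β) (by linarith)).congr ?_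
  intro y hy
  rw [uIoc_of_le hx.le] at hy
  simp only [abs_of_pos hy.1]

/-- The Lipschitz bound for the numerator makes the integrand of `singularOp` integrable. -/
theorem norm_singularOp_le {c B : ℝ} (hc : 0 < c) {f : ℂ → ℂ}
    (hf : DifferentiableOn ℂ f (strip (2 * c))) (hB : ∀ z ∈ strip (2 * c), ‖f z‖ ≤ B) (n : ℕ)
    {β : ℝ} (hβ0 : 0 ≤ β) (hβ1 : β < 1) {z : ℂ} (hz : z ∈ strip c) :
    ‖singularOp n β f z‖ ≤ (n + 1).factorial * B / (c / 2) ^ (n + 1) *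
      (Real.pi ^ (1 + β) * ∫ y in (-Real.pi)..Real.pi, |y| ^ (-β)) := by
  have hpi := Real.pi_pos
  set K := (n + 1).factorial * B / (c / 2) ^ (n + 1) with hK
  have han : AnalyticOnNhd ℂ (iteratedDeriv n f) (strip (2 * c)) := by
    rw [iteratedDeriv_eq_iterate]
    exact (hf.analyticOnNhd (isOpen_strip _)).iterated_deriv n
  have hsub : strip c ⊆ strip (2 * c) := fun w (hw : |w.im| < c) => by
    change |w.im| < 2 * c
    linarith
  have hK0 : 0 ≤ K := (norm_nonneg _).trans (norm_iteratedDeriv_le_of_strip hc hf hB (n + 1) hz)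
  have hlip : ∀ y : ℝ, ‖iteratedDeriv n f (z - y) - iteratedDeriv n f z‖ ≤ K * |y| := by
    intro y
    have hy : z - y ∈ strip c := by
      have h1 : (z - y).im = z.im := by simp
      change |(z - y).im| < c
      rw [h1]
      exact hz
    have h := (convex_strip c).norm_image_sub_le_of_norm_deriv_le (𝕜 := ℂ)
      (f := iteratedDeriv n f) (C := K) (fun w hw => (han w (hsub hw)).differentiableAt)
      (fun w hw => by
        rw [← iteratedDeriv_succ]
        exact norm_iteratedDeriv_le_of_strip hc hf hB (n + 1) hw) hz hy
    simpa using h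
  have hint := (intervalIntegrable_abs_rpow_neg hβ1 (-Real.pi) Real.pi).const_mul
    (K * Real.pi ^ (1 + β))
  have h := intervalIntegral.norm_integral_le_of_norm_le (μ := volume)
    (f := fun y : ℝ => (iteratedDeriv n f (z - y) - iteratedDeriv n f z) /
      ((|Real.sin (y / 2)| ^ (1 + β) : ℝ) : ℂ)) (by linarith : -Real.pi ≤ Real.pi)
    (Eventually.of_forall fun y hy => ?_) hint
  · rw [intervalIntegral.integral_const_mul, mul_assoc] at h
    exact h
  · rw [norm_div, Complex.norm_real, Real.norm_of_nonneg (by positivity)]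
    rcases eq_or_ne y 0 with rfl | hy0
    · have h0 : ‖iteratedDeriv n f (z - (0 : ℝ)) - iteratedDeriv n f z‖ = 0 := by simp
      rw [h0, zero_div]
      positivity
    have hy' : 0 < |y| := abs_pos.2 hy0
    have h1 : |y| / Real.pi ≤ |Real.sin (y / 2)| := by
      have h2 : |y / 2| ≤ Real.pi / 2 := by
        rw [abs_div, abs_two]
        have := abs_le.2 ⟨hy.1.le, hy.2⟩
        linarith
      refine le_trans (le_of_eq ?_) (Real.mul_abs_le_abs_sin h2)
      rw [abs_div, abs_two]
      field_simp
    have h3 : (|y| / Real.pi) ^ (1 + β) ≤ |Real.sin (y / 2)| ^ (1 + β) :=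
      Real.rpow_le_rpow (by positivity) h1 (by linarith)
    have h4 : 0 < (|y| / Real.pi) ^ (1 + β) := by positivity
    calc _ ≤ K * |y| / (|y| / Real.pi) ^ (1 + β) :=
          div_le_div₀ (by positivity) (hlip y) h4 h3
      _ = K * Real.pi ^ (1 + β) * |y| ^ (-β) := by
        rw [Real.div_rpow hy'.le hpi.le, Real.rpow_add hy', Real.rpow_one, Real.rpow_neg hy'.le]
        have h5 : |y| ^ β ≠ 0 := by positivity
        field_simp

theorem lineL2_le {g : ℂ → ℂ} {c A s : ℝ} (hA : ∀ z ∈ strip c, ‖g z‖ ≤ A) (hs : |s| < c) :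
    lineL2 g s ≤ ENNReal.ofReal (3 * A) := by
  have hpi := Real.pi_pos
  have hmem : ∀ x : ℝ, (x : ℂ) + (s : ℂ) * Complex.I ∈ strip c := fun x => by
    change |((x : ℂ) + (s : ℂ) * Complex.I).im| < c
    simpa using hs
  have h0 : 0 ≤ A := (norm_nonneg _).trans (hA _ (hmem 0))
  have h := eLpNorm_le_of_ae_bound (p := 2) (μ := volume.restrict (Ioc 0 (2 * Real.pi)))
    (f := fun x : ℝ => g ((x : ℂ) + (s : ℂ) * Complex.I)) (C := A)
    (Eventually.of_forall fun x => hA _ (hmem x))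
  refine h.trans ?_
  rw [Measure.restrict_apply_univ, Real.volume_Ioc, sub_zero,
    ENNReal.ofReal_rpow_of_pos (by positivity), ← ENNReal.ofReal_mul (by positivity)]
  refine ENNReal.ofReal_le_ofReal (mul_le_mul_of_nonneg_right ?_ h0)
  have h1 : (2 * Real.pi) ≤ 3 ^ (2 : ℝ) := by
    have := Real.pi_lt_d2
    norm_num
    linarith
  calc (2 * Real.pi) ^ ((2 : ℝ≥0∞).toReal⁻¹) ≤ ((3 : ℝ) ^ (2 : ℝ)) ^ ((2 : ℝ≥0∞).toReal⁻¹) :=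
        Real.rpow_le_rpow (by positivity) h1 (by positivity)
    _ = 3 := by
      rw [← Real.rpow_mul (by norm_num)]
      norm_num

theorem xNorm_le {c A : ℝ} (k : ℕ) {f : ℂ → ℂ} (hA0 : ∀ z ∈ strip c, ‖f z‖ ≤ A)
    (hA1 : ∀ z ∈ strip c, ‖iteratedDeriv k f z‖ ≤ A) : xNorm c k f ≤ ENNReal.ofReal (6 * A) := by
  have hle : (⨆ s ∈ Ico 0 c, (lineL2 f s ^ 2 + lineL2 f (-s) ^ 2 +
      (lineL2 (iteratedDeriv k f) s ^ 2 + lineL2 (iteratedDeriv k f) (-s) ^ 2))) ≤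
      (2 * ENNReal.ofReal (3 * A)) ^ 2 := by
    refine iSup₂_le fun s hs => ?_
    have h1 : |s| < c := by rw [abs_of_nonneg hs.1]; exact hs.2
    have h2 : |-s| < c := by rwa [abs_neg]
    have e1 := pow_le_pow_left' (lineL2_le hA0 h1) 2
    have e2 := pow_le_pow_left' (lineL2_le hA0 h2) 2
    have e3 := pow_le_pow_left' (lineL2_le hA1 h1) 2
    have e4 := pow_le_pow_left' (lineL2_le hA1 h2) 2
    refine (add_le_add (add_le_add e1 e2) (add_le_add e3 e4)).trans (le_of_eq ?_)
    ring
  rw [xNorm]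
  refine (ENNReal.rpow_le_rpow hle (by norm_num)).trans (le_of_eq ?_)
  rw [← ENNReal.rpow_natCast, ← ENNReal.rpow_mul]
  rw [show ((2 : ℕ) : ℝ) * (1 / 2) = 1 by norm_num, ENNReal.rpow_one,
    show (2 : ℝ≥0∞) = ENNReal.ofReal 2 by simp, ← ENNReal.ofReal_mul (by norm_num)]
  congr 1
  ring

theorem singularNorm_le {c A : ℝ} (k : ℕ) (β : ℝ) {f : ℂ → ℂ}
    (hA : ∀ z ∈ strip c, ‖singularOp k β f z‖ ≤ A) :
    singularNorm c k β f ≤ ENNReal.ofReal (3 * A) + ENNReal.ofReal (3 * A) := by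
  refine iSup₂_le fun s hs => ?_
  have h1 : |s| < c := by rw [abs_of_nonneg hs.1]; exact hs.2
  have h2 : |-s| < c := by rwa [abs_neg]
  exact add_le_add (lineL2_le hA h1) (lineL2_le hA h2)

/-- The norm of the perturbation space of half-width `c` is controlled by the supremum on the strip
of half-width `2c`. -/
theorem exists_patchNorm_le {α : ℝ} (hα2 : α < 2) {c : ℝ} (hc : 0 < c) (k : ℕ) :
    ∃ C : ℝ, 0 ≤ C ∧ ∀ (f : ℂ → ℂ) (B : ℝ), DifferentiableOn ℂ f (strip (2 * c)) →
      (∀ z ∈ strip (2 * c), ‖f z‖ ≤ B) → patchNorm α c k f ≤ ENNReal.ofReal (C * B) := by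
  have hpi := Real.pi_pos
  set C₁ : ℝ := 1 + (k + 1).factorial / (c / 2) ^ (k + 1) with hC₁
  have hC₁0 : 0 ≤ C₁ := by positivity
  have hx : ∀ (f : ℂ → ℂ) (B : ℝ), DifferentiableOn ℂ f (strip (2 * c)) →
      (∀ z ∈ strip (2 * c), ‖f z‖ ≤ B) → 0 ≤ B ∧
        xNorm c (k + 1) f ≤ ENNReal.ofReal (6 * (C₁ * B)) := by
    intro f B hf hB
    have h0 : (0 : ℂ) ∈ strip (2 * c) := by
      change |(0 : ℂ).im| < 2 * c
      simpa using hc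
    have hB0 : 0 ≤ B := (norm_nonneg _).trans (hB 0 h0)
    have hsub : strip c ⊆ strip (2 * c) := fun w (hw : |w.im| < c) => by
      change |w.im| < 2 * c
      linarith
    refine ⟨hB0, xNorm_le (k + 1) (fun z hz => (hB z (hsub hz)).trans ?_) fun z hz =>
      (norm_iteratedDeriv_le_of_strip hc hf hB (k + 1) hz).trans ?_⟩
    · rw [hC₁, add_mul, one_mul]
      exact le_add_of_nonneg_right (by positivity)
    · rw [hC₁, add_mul, one_mul, div_mul_eq_mul_div]
      exact le_add_of_nonneg_left hB0
  have hs : ∀ β : ℝ, 0 ≤ β → β < 1 → ∃ C₂ : ℝ, 0 ≤ C₂ ∧ ∀ (f : ℂ → ℂ) (B : ℝ),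
      DifferentiableOn ℂ f (strip (2 * c)) → (∀ z ∈ strip (2 * c), ‖f z‖ ≤ B) →
        xNorm c (k + 1) f + singularNorm c (k + 1) β f ≤ ENNReal.ofReal (C₂ * B) := by
    intro β hβ0 hβ1
    set J : ℝ := ((k + 1 + 1).factorial / (c / 2) ^ (k + 1 + 1)) *
      (Real.pi ^ (1 + β) * ∫ y in (-Real.pi)..Real.pi, |y| ^ (-β)) with hJ
    have hJ0 : 0 ≤ J := by
      have : 0 ≤ ∫ y in (-Real.pi)..Real.pi, |y| ^ (-β) :=
        intervalIntegral.integral_nonneg (by linarith) fun y _ => by positivity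
      positivity
    refine ⟨6 * C₁ + 6 * J, by positivity, fun f B hf hB => ?_⟩
    obtain ⟨hB0, hxB⟩ := hx f B hf hB
    have h1 := singularNorm_le (k + 1) β (A := J * B) fun z hz =>
      (norm_singularOp_le hc hf hB (k + 1) hβ0 hβ1 hz).trans (le_of_eq (by rw [hJ]; ring))
    refine (add_le_add hxB h1).trans (le_of_eq ?_)
    rw [← ENNReal.ofReal_add (by positivity) (by positivity),
      ← ENNReal.ofReal_add (by positivity) (by positivity)]
    congr 1
    ring
  rcases lt_trichotomy α 1 with h | h | h
  · refine ⟨6 * C₁, by positivity, fun f B hf hB => ?_⟩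
    rw [patchNorm, if_pos h, mul_assoc]
    exact (hx f B hf hB).2
  · obtain ⟨C₂, h0, h2⟩ := hs 0 le_rfl one_pos
    refine ⟨C₂, h0, fun f B hf hB => ?_⟩
    rw [patchNorm, if_neg h.not_lt, if_pos h]
    exact h2 f B hf hB
  · obtain ⟨C₂, h0, h2⟩ := hs (α - 1) (by linarith) (by linarith)
    refine ⟨C₂, h0, fun f B hf hB => ?_⟩
    rw [patchNorm, if_neg h.le.not_gt, if_neg h.ne']
    exact h2 f B hf hB

/-! ### Analyticity of the boundary curves -/

theorem norm_cos_le_exp (w : ℂ) : ‖Complex.cos w‖ ≤ Real.exp |w.im| := by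
  have h1 : ‖Complex.exp (w * Complex.I)‖ ≤ Real.exp |w.im| := by
    rw [Complex.norm_exp]
    refine Real.exp_le_exp.2 ?_
    simpa using neg_le_abs w.im
  have h2 : ‖Complex.exp (-w * Complex.I)‖ ≤ Real.exp |w.im| := by
    rw [Complex.norm_exp]
    refine Real.exp_le_exp.2 ?_
    simpa using le_abs_self w.im
  rw [Complex.cos, norm_div, Complex.norm_two]
  have := norm_add_le (Complex.exp (w * Complex.I)) (Complex.exp (-w * Complex.I))
  linarith

section Profile

variable (α : ℝ) (m : ℕ) [hp : Admissible α m]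

/-- Half the half-width of the strip on which the weights `2^k` give analyticity. -/
def stripWidth (m : ℕ) : ℝ := Real.log 2 / (2 * m)

omit hp in
theorem stripWidth_pos (hm : 0 < m) : 0 < stripWidth m := by
  have : 0 < Real.log 2 := Real.log_pos (by norm_num)
  unfold stripWidth
  positivity

theorem norm_profile_term_le (d : Ell ℕ) (k : ℕ) {z : ℂ} (hz : z ∈ strip (2 * stripWidth m)) :
    ‖((d k * cosCoef α m k : ℝ) : ℂ) * Complex.cos (((k + 1 : ℕ) : ℂ) * m * z)‖ ≤
      |d k| * coefBound α m := by
  have hm : (0 : ℝ) < m := by have := hp.two_le; positivity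
  have h1 : ‖Complex.cos (((k + 1 : ℕ) : ℂ) * m * z)‖ ≤ wt (k + 1 : ℕ) := by
    refine (norm_cos_le_exp _).trans ?_
    have hz' : |z.im| ≤ Real.log 2 / m := by
      have : |z.im| < 2 * stripWidth m := hz
      refine this.le.trans (le_of_eq ?_)
      rw [stripWidth]; field_simp
    have h2 : (((k + 1 : ℕ) : ℂ) * m * z).im = (k + 1 : ℕ) * m * z.im := by
      rw [show ((k + 1 : ℕ) : ℂ) * m * z = (((k + 1 : ℕ) * m : ℝ) : ℂ) * z by push_cast; ring,
        Complex.im_ofReal_mul]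
    have h3 : |(((k + 1 : ℕ) : ℂ) * m * z).im| ≤ (k + 1 : ℕ) * Real.log 2 := by
      rw [h2, abs_mul, abs_of_nonneg (by positivity)]
      calc ((k + 1 : ℕ) : ℝ) * m * |z.im| ≤ (k + 1 : ℕ) * m * (Real.log 2 / m) := by gcongr
        _ = _ := by field_simp
    refine (Real.exp_le_exp.2 h3).trans (le_of_eq ?_)
    rw [wt, Int.natAbs_natCast, Real.exp_nat_mul, Real.exp_log (by norm_num)]
  have h2 := cosCoef_pos α m k
  rw [norm_mul, Complex.norm_real, norm_mul, Real.norm_eq_abs, Real.norm_of_nonneg h2.le, mul_assoc]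
  refine mul_le_mul_of_nonneg_left ?_ (abs_nonneg _)
  exact (mul_le_mul_of_nonneg_left h1 h2.le).trans (cosCoef_mul_wt_le α m k)

theorem hasSum_profile (d : Ell ℕ) {z : ℂ} (hz : z ∈ strip (2 * stripWidth m)) :
    HasSum (fun k : ℕ => ((d k * cosCoef α m k : ℝ) : ℂ) * Complex.cos (((k + 1 : ℕ) : ℂ) * m * z))
      (profile α m d z) :=
  (Summable.of_norm_bounded ((Ell.hasSum_norm d).summable.mul_right (coefBound α m))
    fun k => norm_profile_term_le α m d k hz).hasSum

theorem norm_profile_le (d : Ell ℕ) {z : ℂ} (hz : z ∈ strip (2 * stripWidth m)) :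
    ‖profile α m d z‖ ≤ coefBound α m * ‖d‖ := by
  refine (tsum_of_norm_bounded ((Ell.hasSum_norm d).mul_right (coefBound α m))
    fun k => norm_profile_term_le α m d k hz).trans (le_of_eq (mul_comm _ _))

theorem differentiableOn_profile (d : Ell ℕ) :
    DifferentiableOn ℂ (profile α m d) (strip (2 * stripWidth m)) := by
  refine Complex.differentiableOn_tsum_of_summable_norm
    ((Ell.hasSum_norm d).summable.mul_right (coefBound α m)) (fun k => ?_) (isOpen_strip _)
    fun k z hz => norm_profile_term_le α m d k hz
  fun_prop

theorem profile_sub_apply (d e : Ell ℕ) {z : ℂ} (hz : z ∈ strip (2 * stripWidth m)) :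
    (profile α m d - profile α m e) z = profile α m (d - e) z := by
  refine ((hasSum_profile α m d hz).sub (hasSum_profile α m e hz)).unique ?_
  refine hasSum_of_eq (hasSum_profile α m (d - e) hz) (fun k => ?_) rfl
  rw [lp.coeFn_sub, Pi.sub_apply]
  push_cast
  ring

omit hp in
theorem profile_zero : profile α m 0 = 0 := by
  funext z
  simp [profile]

theorem isStripCosine_profile (d : Ell ℕ) : IsStripCosine (stripWidth m) m (profile α m d) := by
  have h0 := stripWidth_pos m (by have := hp.two_le; omega)
  have hsub : strip (stripWidth m) ⊆ strip (2 * stripWidth m) :=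
    fun w (hw : |w.im| < stripWidth m) => by
      change |w.im| < 2 * stripWidth m
      linarith
  refine ⟨((differentiableOn_profile α m d).mono hsub).analyticOnNhd (isOpen_strip _),
    fun j => d (j - 1) * cosCoef α m (j - 1), fun z hz => ?_⟩
  exact hasSum_profile α m d (hsub hz)

/-- The parametrization of the boundary curves is Lipschitz for the norm of the perturbation
space. -/
theorem exists_patchNorm_profile_le (k : ℕ) : ∃ C : ℝ, ∀ d e : Ell ℕ,
    patchNorm α (stripWidth m) k (profile α m d) ≤ ENNReal.ofReal (C * ‖d‖) ∧
    patchNorm α (stripWidth m) k (profile α m d - profile α m e) ≤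
      ENNReal.ofReal (C * ‖d - e‖) := by
  have h0 := stripWidth_pos m (by have := hp.two_le; omega)
  obtain ⟨C, -, hC⟩ := exists_patchNorm_le hp.lt_two h0 k
  refine ⟨C * coefBound α m, fun d e => ⟨?_, ?_⟩⟩
  · rw [mul_assoc]
    exact hC _ _ (differentiableOn_profile α m d) fun z hz => norm_profile_le α m d hz
  · rw [mul_assoc]
    refine hC _ _ ((differentiableOn_profile α m d).sub (differentiableOn_profile α m e))
      fun z hz => ?_
    rw [profile_sub_apply α m d e hz]
    exact norm_profile_le α m _ hz

theorem memPatchSpace_profile (k : ℕ) (d : Ell ℕ) :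
    MemPatchSpace α (stripWidth m) k m (profile α m d) := by
  obtain ⟨C, hC⟩ := exists_patchNorm_profile_le α m k
  exact ⟨isStripCosine_profile α m d, (hC d 0).1.trans_lt ENNReal.ofReal_lt_top⟩

theorem tendsto_patchNorm_profile_sub (k : ℕ) {g : ℝ → Ell ℕ} {s : ℝ} (hg : ContinuousAt g s) :
    Tendsto (fun t => patchNorm α (stripWidth m) k (profile α m (g t) - profile α m (g s)))
      (𝓝 s) (𝓝 0) := by
  obtain ⟨C, hC⟩ := exists_patchNorm_profile_le α m k
  have h1 : Tendsto (fun t => C * ‖g t - g s‖) (𝓝 s) (𝓝 0) := by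
    have h2 : ContinuousAt (fun t => C * ‖g t - g s‖) s :=
      continuousAt_const.mul (hg.sub continuousAt_const).norm
    simpa [ContinuousAt] using h2
  have h3 := ENNReal.tendsto_ofReal h1
  rw [ENNReal.ofReal_zero] at h3
  exact tendsto_of_tendsto_of_tendsto_of_le_of_le tendsto_const_nhds h3 (fun _ => zero_le)
    fun t => (hC (g t) (g s)).2

/-- A nonzero sequence of coefficients gives a boundary curve other than a circle. -/
theorem exists_profile_ne_zero {d : Ell ℕ} (hd : d ≠ 0) : ∃ x : ℝ, profile α m d x ≠ 0 := by
  by_contra! h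
  have hm : 0 < m := by have := hp.two_le; omega
  have hm' : (0 : ℝ) < m := by positivity
  have hcos : ∀ x, cosEval α m x d = 0 := fun x => by
    have := h x
    rw [profile_ofReal] at this
    exact_mod_cast this
  have hdcos : ∀ x, dcosEval α m x d = 0 := fun x => by
    have h1 := hasDerivAt_cosEval α m d x
    rw [funext hcos] at h1
    exact h1.unique (hasDerivAt_const x 0)
  -- the derivative is a sine series with nonzero multiples of the same coefficients
  have hv : ∀ k : ℕ, ‖(cosCoef α m k * ((k + 1 : ℕ) * m) * wt (k + 1 : ℕ)) •
      (Ell.basis k : Ell ℕ)‖ ≤ coefBound α m := by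
    intro k
    have h1 := cosCoef_pos α m k
    have h2 := wt_pos (k + 1 : ℕ)
    rw [norm_smul, Ell.norm_basis, mul_one, Real.norm_of_nonneg (by positivity)]
    refine le_trans ?_ (cosCoef_mul_wt_mul_le α m k)
    have h3 : 0 < cosCoef α m k * wt (k + 1 : ℕ) := by positivity
    nlinarith
  set T : Ell ℕ →L[ℝ] Ell ℕ := Ell.lift fun k =>
    (cosCoef α m k * ((k + 1 : ℕ) * m) * wt (k + 1 : ℕ)) • (Ell.basis k : Ell ℕ) with hT
  have hcomp : ∀ x, sinEval m x ∘L T = -dcosEval α m x := fun x => by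
    refine Ell.ext_basis fun k => ?_
    have h2 := (wt_pos (k + 1 : ℕ)).ne'
    change sinEval m x (T (Ell.basis k)) = -(dcosEval α m x (Ell.basis k))
    rw [hT, Ell.lift_basis hv, map_smul, sinEval_basis, dcosEval_basis, smul_eq_mul]
    field_simp
  have hTd : T d = 0 := eq_zero_of_sinEval m hm fun x => by
    have h1 := congrArg (fun S : Ell ℕ →L[ℝ] ℝ => S d) (hcomp x)
    change sinEval m x (T d) = -(dcosEval α m x d) at h1
    rw [h1, hdcos, neg_zero]
  refine hd (lp.ext (funext fun k => ?_))
  have h4 := apply_of_forall_basis (fun i => Ell.lift_basis hv i) d k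
  rw [← hT, hTd] at h4
  have h5 : cosCoef α m k * ((k + 1 : ℕ) * m) * wt (k + 1 : ℕ) ≠ 0 := by
    have h1 := cosCoef_pos α m k
    have h2 := wt_pos (k + 1 : ℕ)
    positivity
  exact (mul_eq_zero.1 h4.symm).resolve_left h5

end Profile

end GSQG

end

theorem theorem1 (α : ℝ) (hα0 : 0 < α) (hα2 : α < 2) (k m : ℕ) (hk : 3 ≤ k) (hm : 2 ≤ m) :
    ∃ bStar : ℝ, (0 < bStar ∧ bStar < 1) ∧ GSQG.Delta α m bStar = 0 ∧
      (∀ b : ℝ, 0 < b → b < 1 → GSQG.Delta α m b = 0 → b = bStar) ∧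
      ∃ c : ℝ, 0 < c ∧ ∃ ε : ℝ, 0 < ε ∧ ∃ (b : ℝ → ℝ) (R r : ℝ → ℂ → ℂ),
        -- the family starts at the annulus with radii 1 and bStar
        b 0 = bStar ∧ R 0 = 0 ∧ r 0 = 0 ∧
        -- it is continuous, in the norm of the perturbation space
        ContinuousOn b (Ioo (-ε) ε) ∧
        (∀ s ∈ Ioo (-ε) ε,
          Tendsto (fun t => GSQG.patchNorm α c k (R t - R s)) (𝓝 s) (𝓝 0) ∧
          Tendsto (fun t => GSQG.patchNorm α c k (r t - r s)) (𝓝 s) (𝓝 0)) ∧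
        -- it consists of stationary doubly-connected patches with m-fold analytic boundaries
        (∀ s ∈ Ioo (-ε) ε,
          0 < b s ∧ b s < 1 ∧
          GSQG.MemPatchSpace α c k m (R s) ∧ GSQG.MemPatchSpace α c k m (r s) ∧
          GSQG.IsStationaryPatch α (b s) (R s) (r s)) ∧
        -- and it is not an annulus except at the start
        (∀ s ∈ Ioo (-ε) ε, s ≠ 0 → ∃ x : ℝ, R s (x : ℂ) ≠ 0 ∨ r s (x : ℂ) ≠ 0) := by
  have hp : GSQG.Admissible α m := ⟨hα0, hα2, hm⟩
  obtain ⟨b, ⟨hb0, hb1⟩, hΔ, huniq⟩ := GSQG.existsUnique_Delta_eq_zero hα0 hα2 hm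
  refine ⟨b, ⟨hb0, hb1⟩, hΔ, huniq, GSQG.stripWidth m, GSQG.stripWidth_pos m (by omega), ?_⟩
  obtain ⟨ε₁, hε₁, z, hz0, hzc, hz⟩ := GSQG.exists_patch_branch α m hb0 hb1 hΔ one_pos
  set u : ℝ → GSQG.Ell ℕ × GSQG.Ell ℕ := fun s => s • (GSQG.kernelVec α m b + (z s).2) with hu
  have hzat : ∀ s ∈ Ioo (-ε₁) ε₁, ContinuousAt z s := fun s hs =>
    hzc.continuousAt (isOpen_Ioo.mem_nhds hs)
  have huat : ∀ s ∈ Ioo (-ε₁) ε₁, ContinuousAt u s := fun s hs =>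
    continuousAt_id.smul (continuousAt_const.add (hzat s hs).snd)
  have hu0 : u 0 = 0 := by rw [hu]; exact zero_smul ℝ _
  have h0mem : (0 : ℝ) ∈ Ioo (-ε₁) ε₁ := ⟨by linarith, hε₁⟩
  have hnear : ∀ᶠ s in 𝓝 (0 : ℝ), GSQG.IsNear α m b ((z s).1, u s) := by
    have h1 : Tendsto (fun s => ((z s).1, u s)) (𝓝 0) (𝓝 (b, 0)) := by
      have h2 := ((hzat 0 h0mem).fst.prodMk (huat 0 h0mem)).tendsto
      rwa [hz0, hu0] at h2
    exact h1.eventually (GSQG.eventually_isNear α m hb0 hb1)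
  obtain ⟨ε₂, hε₂, hball⟩ := Metric.eventually_nhds_iff.1 hnear
  have hsub : ∀ s ∈ Ioo (-min ε₁ ε₂) (min ε₁ ε₂),
      s ∈ Ioo (-ε₁) ε₁ ∧ GSQG.IsNear α m b ((z s).1, u s) := by
    intro s hs
    have h1 : |s| < min ε₁ ε₂ := abs_lt.2 hs
    refine ⟨abs_lt.1 (h1.trans_le (min_le_left _ _)), hball ?_⟩
    rw [Real.dist_eq, sub_zero]
    exact h1.trans_le (min_le_right _ _)
  refine ⟨min ε₁ ε₂, lt_min hε₁ hε₂, fun s => (z s).1, fun s => GSQG.profile α m (u s).1,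
    fun s => GSQG.profile α m (u s).2, congrArg Prod.fst hz0, ?_, ?_, ?_, ?_, ?_, ?_⟩
  · change GSQG.profile α m (u 0).1 = 0
    rw [hu0]; exact GSQG.profile_zero α m
  · change GSQG.profile α m (u 0).2 = 0
    rw [hu0]; exact GSQG.profile_zero α m
  · exact fun s hs => (hzat s (hsub s hs).1).fst.continuousWithinAt
  · exact fun s hs => ⟨GSQG.tendsto_patchNorm_profile_sub α m k (huat s (hsub s hs).1).fst,
      GSQG.tendsto_patchNorm_profile_sub α m k (huat s (hsub s hs).1).snd⟩
  · intro s hs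
    obtain ⟨hs1, hs2⟩ := hsub s hs
    exact ⟨hs2.pos, hs2.lt_one, GSQG.memPatchSpace_profile α m k _,
      GSQG.memPatchSpace_profile α m k _,
      GSQG.isStationaryPatch_of_patchMap_eq_zero α m hb0 hs2 (hz s hs1).2.1⟩
  · intro s hs hs0
    by_contra! hcon
    have hu1 : u s = 0 := by
      refine Prod.ext ?_ ?_
      · by_contra hne
        obtain ⟨x, hx⟩ := GSQG.exists_profile_ne_zero α m hne
        exact hx (hcon x).1
      · by_contra hne
        obtain ⟨x, hx⟩ := GSQG.exists_profile_ne_zero α m hne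
        exact hx (hcon x).2
    have h1 : GSQG.kernelVec α m b + (z s).2 = 0 := (smul_eq_zero.1 hu1).resolve_left hs0
    -- the correction is annihilated by the functional, the kernel vector is not
    have h2 := congrArg (GSQG.kernelFunctional α m b) h1
    rw [map_add, (hz s (hsub s hs).1).2.2, add_zero, map_zero,
      GSQG.kernelFunctional_kernelVec] at h2
    have h3 := GSQG.M_zero_neg hα0 hα2 hb0 hb1 hm hΔ
    nlinarith [sq_nonneg (GSQG.M α m b 0 1)]
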